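/- Let $\mathbb T^n=\mathbb R^n/\mathbb Z^n$, let $\mathcal P(\mathbb T^n)$ be the set of Borel probability measures on $\mathbb T^n$ with the weak topology, and let $\sigma,\sigma',T>0$ and $\rho_0\in\mathcal P(\mathbb T^n)$. Let $C:\mathbb R\times\mathbb T^n\times\mathbb R^n\to\mathbb R$ and $F,G:\mathbb R\times\mathbb T^n\times\mathcal P(\mathbb T^n)\to\mathbb R$ be such that: * $F$ and $G$ are continuous, and $|F(s,x,\rho)|+|G(s,x,\rho)|\le Ke^{k|s|}$ for some constants $K,k$ and all $(s,x,\rho)$; * $C$ is measurable in $s$ and continuous in $(x,\alpha)$; for every $\alpha$ there are constants $K,k$ with $|C(s,x,\alpha)|\le Ke^{k|s|}$ for all $(s,x)$; and $\alpha\mapsto C(s,x,\alpha)$ is strongly convex, uniformly in $(s,x)$; * $\alpha\mapsto C(s,x,\alpha)$ is differentiable with a Lipschitz gradient, with a Lipschitz constant uniform in $(s,x)$ (so that the Hamiltonian $H$ below is strongly convex in $p$, uniformly in $(t,z,x)$); * (Lasry–Lions monotonicity, state by state) for every $s\in\mathbb R$ and all $\rho^1\ne\rho^2$ in $\mathcal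 P(\mathbb T^n)$, $$\int_{\mathbb T^n}\big(F(s,x,\rho^1)-F(s,x,\rho^2)\big)\,(\rho^1-\rho^2)(dx)\ge0,\qquad \int_{\mathbb T^n}\big(G(s,x,\rho^1)-G(s,x,\rho^2)\big)\,(\rho^1-\rho^2)(dx)\ge0 .$$ Put $r_t(z)=\frac{z}{t+\sigma^2}$, $\sigma_t^2=\frac{\sigma^2}{\sigma^2+t}$, let $\varphi_{\mu,v}$ be the density of the normal law $\mathcal N(\mu,v)$, and set $$\tilde C(t,z,x,\alpha)=\int_{\mathbb R}\varphi_{r_t(z),\sigma_t^2}(s)\,C(s,x,\alpha)\,ds,\qquad H(t,z,x,p)=\sup_{\alpha\in\mathbb R^n}\{-\alpha\cdot p-\tilde C(t,z,x,\alpha)\}.$$ For $m:\mathbb R\times(0,T]\times\mathbb R\times\mathbb T^n\to[0,\infty)$, $(s,t,z,x)\mapsto m(s,t,z,x)$, such that each $m(s,t,\cdot,\cdot)$ is a probability density on $\mathbb R\times\mathbb T^n$, let $\rho^m_{s,t}(dx)=\big(\int_{\mathbb R}m(s,t,z,x)\,dz\big)dx$ be the law of positions, and set $$\tilde F(t,z,x,m)=\int_{\mathbb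 R}\varphi_{r_t(z),\sigma_t^2}(s)\,F(s,x,\rho^m_{s,t})\,ds,\qquad \tilde G(z,x,m)=\int_{\mathbb R}\varphi_{r_T(z),\sigma_T^2}(s)\,G(s,x,\rho^m_{s,T})\,ds .$$ A classical solution of the mean field game system is a pair $(u,m)$ with the following properties. * $u(t,z,x)$ is continuous on $[0,T]\times\mathbb R\times\mathbb T^n$ and $C^{1,2}$ on $(0,T)\times\mathbb R\times\mathbb T^n$ (once continuously differentiable in $t$, twice in $(z,x)$); $u$, $D_zu$ and $D_xu$ are bounded by $Ke^{k|z|}$ for some constants $K,k$, uniformly in $(t,x)$; and $$-D_tu+H(t,z,x,D_xu)-r_t(z)D_zu-\tfrac{\sigma^2}{2}\Delta_zu-\tfrac{\sigma'^2}{2}\Delta_xu=\tilde F(t,z,x,m)\ \text{ on }(0,T)\times\mathbb R\times\mathbb T^n,\qquad u(T,z,x)=\tilde G(z,x,m).$$ * For every $s\in\mathbb R$, $m(s,t,\cdot,\cdot)$ is a probability density on $\mathbb R\times\mathbb T^n$ for every $t\in(0,T]$; $m(s,\cdot,\cdot,\cdot)$ is continuous on $(0,T]\times\mathbb R\times\mathbb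 T^n$ and $C^{1,2}$ on $(0,T)\times\mathbb R\times\mathbb T^n$; the field $m\,D_pH(t,z,x,D_xu)$ is differentiable in $x$; and $$\partial_tm+\mathrm{div}_x\big(-D_pH(t,z,x,D_xu)\,m\big)+s\,D_zm-\tfrac{\sigma^2}{2}\Delta_zm-\tfrac{\sigma'^2}{2}\Delta_xm=0\ \text{ on }(0,T)\times\mathbb R\times\mathbb T^n,$$ with the initial condition $m(s,0,\cdot,\cdot)=\delta_0(dz)\otimes\rho_0(dx)$, in the sense that $m(s,t,z,x)\,dz\,dx\to\delta_0(dz)\otimes\rho_0(dx)$ weakly as $t\to0^+$. Then, if $(u^1,m_1)$ and $(u^2,m_2)$ are two classical solutions, $u^1=u^2$ on $[0,T]\times\mathbb R\times\mathbb T^n$, and for almost every $(s,t)\in\mathbb R\times[0,T]$ one has $m_1(s,t,z,x)=m_2(s,t,z,x)$ for all $(z,x)\in\mathbb R\times\mathbb T^n$. -/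

import Mathlib

open MeasureTheory ProbabilityTheory Filter Topology
open scoped NNReal ENNReal Laplacian BoundedContinuousFunction

noncomputable section

/-- The flat torus `ℝⁿ / ℤⁿ`, of total volume one. -/
abbrev Torus (n : ℕ) : Type := UnitAddTorus (Fin n)

/-- Controls, momenta and points of the universal cover of the torus: `ℝⁿ` with its Euclidean
norm. -/
abbrev Vec (n : ℕ) : Type := EuclideanSpace ℝ (Fin n)

/-- The covering map `ℝⁿ → ℝⁿ / ℤⁿ`. Spatial derivatives of functions on the torus are those of
their pull-backs along this map. -/
def toTorus {n : ℕ} (y : Vec n) : Torus n := fun i => (y i : UnitAddCircle)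

/-- The primitive data of the game: signal noise `σ`, position noise `σ'`, horizon `T`, running
cost `C(s,x,α)`, interaction costs `F(s,x,ρ)` and `G(s,x,ρ)`, initial law `ρ₀` of the positions. -/
structure MFGData (n : ℕ) where
  σ : ℝ
  σ' : ℝ
  T : ℝ
  C : ℝ → Torus n → Vec n → ℝ
  F : ℝ → Torus n → ProbabilityMeasure (Torus n) → ℝ
  G : ℝ → Torus n → ProbabilityMeasure (Torus n) → ℝ
  ρ₀ : ProbabilityMeasure (Torus n)

namespace MFGData

variable {n : ℕ}

/-! ### Hypotheses on the data -/

/-- Nondegenerate noises and a positive horizon. -/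
structure Nondegenerate (d : MFGData n) : Prop where
  σ_pos : 0 < d.σ
  σ'_pos : 0 < d.σ'
  T_pos : 0 < d.T

/-- An interaction cost is jointly continuous (for the weak topology on probability measures) and
grows at most exponentially in the state, uniformly in the position and the distribution. -/
structure RegularInteraction (F : ℝ → Torus n → ProbabilityMeasure (Torus n) → ℝ) : Prop where
  continuous : Continuous fun q : ℝ × Torus n × ProbabilityMeasure (Torus n) => F q.1 q.2.1 q.2.2
  growth : ∃ K k : ℝ, ∀ s x ρ, |F s x ρ| ≤ K * Real.exp (k * |s|)

/-- The running cost is measurable in the state, continuous in position and control, at most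
exponentially growing in the state, and strongly convex in the control, uniformly in `(s,x)`. -/
structure RegularRunningCost (C : ℝ → Torus n → Vec n → ℝ) : Prop where
  measurable : ∀ x α, Measurable fun s => C s x α
  continuous : ∀ s, Continuous fun q : Torus n × Vec n => C s q.1 q.2
  growth : ∀ α, ∃ K k : ℝ, ∀ s x, |C s x α| ≤ K * Real.exp (k * |s|)
  strongConvex : ∃ c : ℝ, 0 < c ∧ ∀ s x, StrongConvexOn Set.univ c (C s x)

/-- `α ↦ C(s,x,α)` is differentiable with a Lipschitz gradient, with a constant uniform in
`(s,x)`. -/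
def LipschitzGradient (C : ℝ → Torus n → Vec n → ℝ) : Prop :=
  ∃ L : ℝ≥0, ∀ s x, Differentiable ℝ (C s x) ∧ LipschitzWith L (gradient (C s x))

/-- The Lasry–Lions monotonicity condition, for each state separately. -/
def StatewiseMonotone (F : ℝ → Torus n → ProbabilityMeasure (Torus n) → ℝ) : Prop :=
  ∀ (s : ℝ) (ρ₁ ρ₂ : ProbabilityMeasure (Torus n)), ρ₁ ≠ ρ₂ →
    0 ≤ (∫ x, (F s x ρ₁ - F s x ρ₂) ∂(ρ₁ : Measure (Torus n)))
      - ∫ x, (F s x ρ₁ - F s x ρ₂) ∂(ρ₂ : Measure (Torus n))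

/-! ### Beliefs, averaged costs and the Hamiltonian -/

/-- The posterior mean `r_t(z) = z / (t + σ²)` of the state. -/
def postMean (d : MFGData n) (t z : ℝ) : ℝ := z / (t + d.σ ^ 2)

/-- The posterior variance `σ_t² = σ² / (σ² + t)` of the state. -/
def postVar (d : MFGData n) (t : ℝ) : ℝ≥0 := (d.σ ^ 2 / (d.σ ^ 2 + t)).toNNReal

/-- The posterior law `𝒩(r_t(z), σ_t²)` of the state given the signal `z` at time `t`. -/
def belief (d : MFGData n) (t z : ℝ) : Measure ℝ := gaussianReal (d.postMean t z) (d.postVar t)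

/-- `F̃(t,z,x,ρ)`, where `ρ s t` is the law of the positions at time `t` in state `s`. -/
def avgF (d : MFGData n) (t z : ℝ) (x : Torus n) (ρ : ℝ → ℝ → ProbabilityMeasure (Torus n)) : ℝ :=
  ∫ s, d.F s x (ρ s t) ∂(d.belief t z)

/-- `C̃(t,z,x,α)`. -/
def avgC (d : MFGData n) (t z : ℝ) (x : Torus n) (α : Vec n) : ℝ :=
  ∫ s, d.C s x α ∂(d.belief t z)

/-- `G̃(z,x,ρ)`. -/
def avgG (d : MFGData n) (z : ℝ) (x : Torus n) (ρ : ℝ → ℝ → ProbabilityMeasure (Torus n)) : ℝ :=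
  ∫ s, d.G s x (ρ s d.T) ∂(d.belief d.T z)

/-- `H(t,z,x,p) = sup_α (-α · p - C̃(t,z,x,α))`. -/
def ham (d : MFGData n) (t z : ℝ) (x : Torus n) (p : Vec n) : ℝ :=
  ⨆ α : Vec n, (-(inner ℝ α p) - d.avgC t z x α)

/-- `D_p H(t,z,x,p)`. -/
def hamGrad (d : MFGData n) (t z : ℝ) (x : Torus n) (p : Vec n) : Vec n :=
  gradient (fun q => d.ham t z x q) p

end MFGData

/-! ### Differential operators -/

section Operators

variable {n : ℕ}

/-- `D_x w` at the point of the torus below `y`. -/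
def gradX (w : Torus n → ℝ) (y : Vec n) : Vec n := gradient (fun y' => w (toTorus y')) y

/-- `Δ_x w` at the point of the torus below `y`. -/
def lapX (w : Torus n → ℝ) (y : Vec n) : ℝ := (Δ fun y' : Vec n => w (toTorus y')) y

/-- The divergence of a vector field on `ℝⁿ`. -/
def divX (V : Vec n → Vec n) (y : Vec n) : ℝ :=
  ∑ i : Fin n, (fderiv ℝ V y (EuclideanSpace.single i 1)) i

/-- `w(t,z,x)` is of class `C^{1,2}` on `(0,T) × ℝ × 𝕋ⁿ`: once continuously differentiable in `t`
and twice in `(z,x)`, all derivatives being jointly continuous in `(t,z,x)`. -/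
structure IsC12 (T : ℝ) (w : ℝ → ℝ → Torus n → ℝ) : Prop where
  time_diff : ∀ t ∈ Set.Ioo 0 T, ∀ z x, DifferentiableAt ℝ (fun t' => w t' z x) t
  space_diff : ∀ t ∈ Set.Ioo 0 T, ContDiff ℝ 2 fun q : ℝ × Vec n => w t q.1 (toTorus q.2)
  continuousOn : ContinuousOn (fun p : ℝ × ℝ × Torus n => w p.1 p.2.1 p.2.2)
    (Set.Ioo 0 T ×ˢ Set.univ)
  continuousOn_time : ContinuousOn
    (fun p : ℝ × ℝ × Torus n => deriv (fun t' => w t' p.2.1 p.2.2) p.1)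
    (Set.Ioo 0 T ×ˢ Set.univ)
  continuousOn_space₁ : ContinuousOn
    (fun p : ℝ × ℝ × Vec n => fderiv ℝ (fun q : ℝ × Vec n => w p.1 q.1 (toTorus q.2)) p.2)
    (Set.Ioo 0 T ×ˢ Set.univ)
  continuousOn_space₂ : ContinuousOn
    (fun p : ℝ × ℝ × Vec n =>
      fderiv ℝ (fderiv ℝ (fun q : ℝ × Vec n => w p.1 q.1 (toTorus q.2))) p.2)
    (Set.Ioo 0 T ×ˢ Set.univ)

/-! ### Game distributions -/

/-- `f` is a probability density on `ℝ × 𝕋ⁿ`. -/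
def IsProbDensity (f : ℝ → Torus n → ℝ) : Prop :=
  (∀ z x, 0 ≤ f z x) ∧ Measurable (fun q : ℝ × Torus n => f q.1 q.2) ∧
    ∫⁻ q : ℝ × Torus n, ENNReal.ofReal (f q.1 q.2) = 1

/-- The marginal over positions of the measure with density `f` on `ℝ × 𝕋ⁿ`. -/
def posMarginal (f : ℝ → Torus n → ℝ) : Measure (Torus n) :=
  volume.withDensity fun x => ∫⁻ z, ENNReal.ofReal (f z x)

open Classical in
/-- The law of the positions at time `t` in state `s`, a probability measure as soon as `m s t` is
a probability density (and an irrelevant default otherwise). -/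
def posLaw (m : ℝ → ℝ → ℝ → Torus n → ℝ) (s t : ℝ) : ProbabilityMeasure (Torus n) :=
  if h : IsProbabilityMeasure (posMarginal (m s t)) then ⟨posMarginal (m s t), h⟩ else default

end Operators

namespace MFGData

variable {n : ℕ}

/-- `u(t,z,x)` is a classical solution of the Hamilton–Jacobi–Bellman equation with terminal
condition, where `ρ s t` is the law of the positions at time `t` in state `s`; `u`, `D_z u` and
`D_x u` grow at most exponentially in the signal. -/
structure SolvesHJB (d : MFGData n) (ρ : ℝ → ℝ → ProbabilityMeasure (Torus n))
    (u : ℝ → ℝ → Torus n → ℝ) : Prop where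
  isC12 : IsC12 d.T u
  continuousOn : ContinuousOn (fun p : ℝ × ℝ × Torus n => u p.1 p.2.1 p.2.2)
    (Set.Icc 0 d.T ×ˢ Set.univ)
  growth : ∃ K k : ℝ, (∀ t ∈ Set.Icc 0 d.T, ∀ z x, |u t z x| ≤ K * Real.exp (k * |z|)) ∧
    ∀ t ∈ Set.Ioo 0 d.T, ∀ z (y : Vec n),
      |deriv (fun z' => u t z' (toTorus y)) z| ≤ K * Real.exp (k * |z|) ∧
      ‖gradX (u t z) y‖ ≤ K * Real.exp (k * |z|)
  equation : ∀ t ∈ Set.Ioo 0 d.T, ∀ z (y : Vec n),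
    -deriv (fun t' => u t' z (toTorus y)) t
      + d.ham t z (toTorus y) (gradX (u t z) y)
      - deriv (fun z' => u t z' (toTorus y)) z * d.postMean t z
      - d.σ ^ 2 / 2 * iteratedDeriv 2 (fun z' => u t z' (toTorus y)) z
      - d.σ' ^ 2 / 2 * lapX (u t z) y
    = d.avgF t z (toTorus y) ρ
  terminal : ∀ z x, u d.T z x = d.avgG z x ρ

/-- `m(s,t,z,x)` is, in every state `s`, a classical solution of the Fokker–Planck equation with
drift `-D_p H(t,z,x,D_x u)`, made of probability densities on `ℝ × 𝕋ⁿ`, and starting from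
`δ₀(dz) ⊗ ρ₀(dx)` (in the sense of weak convergence of probability measures). -/
structure SolvesFP (d : MFGData n) (u : ℝ → ℝ → Torus n → ℝ)
    (m : ℝ → ℝ → ℝ → Torus n → ℝ) : Prop where
  density : ∀ s, ∀ t ∈ Set.Ioc 0 d.T, IsProbDensity (m s t)
  isC12 : ∀ s, IsC12 d.T (m s)
  continuousOn : ∀ s, ContinuousOn (fun p : ℝ × ℝ × Torus n => m s p.1 p.2.1 p.2.2)
    (Set.Ioc 0 d.T ×ˢ Set.univ)
  flux_diff : ∀ s, ∀ t ∈ Set.Ioo 0 d.T, ∀ z, Differentiable ℝ fun y : Vec n =>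
    m s t z (toTorus y) • (-d.hamGrad t z (toTorus y) (gradX (u t z) y))
  equation : ∀ s, ∀ t ∈ Set.Ioo 0 d.T, ∀ z (y : Vec n),
    deriv (fun t' => m s t' z (toTorus y)) t
      + divX (fun y' : Vec n =>
          m s t z (toTorus y') • (-d.hamGrad t z (toTorus y') (gradX (u t z) y'))) y
      + s * deriv (fun z' => m s t z' (toTorus y)) z
      - d.σ ^ 2 / 2 * iteratedDeriv 2 (fun z' => m s t z' (toTorus y)) z
      - d.σ' ^ 2 / 2 * lapX (m s t z) y
    = 0
  initial : ∀ s, ∀ f : (ℝ × Torus n) →ᵇ ℝ,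
    Tendsto (fun t => ∫ q : ℝ × Torus n, f q * m s t q.1 q.2) (𝓝[>] 0)
      (𝓝 (∫ x, f (0, x) ∂(d.ρ₀ : Measure (Torus n))))

/-- `(u, m)` is a classical solution of the mean field game system. -/
structure IsSolution (d : MFGData n) (u : ℝ → ℝ → Torus n → ℝ)
    (m : ℝ → ℝ → ℝ → Torus n → ℝ) : Prop where
  hjb : d.SolvesHJB (posLaw m) u
  fp : d.SolvesFP u m

end MFGData

end

/-! The optimal drift depends on time, signal and position but not on the state, so all the laws
m(s,·) are driven by one drift and can be recovered from m(0,·). Multiplying a solution in state 0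
by the Girsanov factor exp(sz/σ² - s²t/(2σ²)) creates the transport term s D_z and keeps the initial
law (`IsFP.girsanov_mul`); uniqueness for the linear equation makes the product the solution in
state s (`IsFP.eq_girsanov_mul`). Bayes' rule with prior N(0,1) then says that averaging this factor
times f(s) over the prior gives `tilt` times the average of f under the belief (`tilt_mul_belief`).

The game is treated by the Lasry–Lions argument in state 0, with the weighted test function Ψ = tilt
· (u¹ - u²). The weight solves the backward heat equation in the signal and has logarithmic
derivative r_t(z)/σ², so conjugation by it turns the signal operator with drift r_t(z) of the
Hamilton–Jacobi–Bellman equation into the driftless adjoint operator of state 0 (`fpAdj_tilt_mul`).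
Pair Ψ with both densities and subtract. The initial terms cancel. By Bayes and Fubini, the terminal
term and the source term are prior averages of the statewise monotonicity expressions, hence
nonnegative (`MFGData.integral_tilt_mul_average_nonneg`). The remaining terms are two integrals of
nonnegative convexity excesses of H, which must therefore vanish. Strong convexity of C bounds the
excess below by the squared distance between the optimal drifts (`IsTiltMin.excess`), so the drifts
agree wherever m₂ is positive (`MFGData.IsSolution.drift_eq`). Thus m₂ solves the equation driven by
the drift of the first solution, and linear uniqueness gives m₁ = m₂
(`MFGData.IsSolution.density_eq`). The two value functions now have the same source and terminal
data, and a maximum principle with an exponential barrier identifies them (`MFGData.SolvesHJB.le`).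

The analytic core is linear uniqueness (`IsFP.unique`) for a drift growing like exp(k|z|) and a
measure as initial datum. The drift moves positions only, so testing with waves in z alone shows
that the signal has law N(st, σ²t); all its exponential moments are finite, which justifies duality
with growing test functions (`IsFP.pairing`). At positive times the L¹ distance between two
solutions does not increase: multiply the equation of the difference by a smoothed sign and absorb
the drift term into the position diffusion (`IsFP.integral_abs_sub_le`). At small times τ the
distance is O(√τ): pair the difference with the backward constant-coefficient flow of a
trigonometric polynomial close to its sign at time τ. The common initial term cancels, and the drift
costs a gradient of size (τ - t)^(-1/2) times a moment of the drift
(`IsFP.exists_integral_abs_sub_le_sqrt`). Together these two estimates force the distance to be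
zero. -/

open MeasureTheory ProbabilityTheory Filter Topology
open scoped NNReal ENNReal Laplacian BoundedContinuousFunction

noncomputable section

/-! ### The unit cube as a fundamental domain of the torus -/

section Cube

variable {n : ℕ}

/-- The closed unit cube. -/
def unitCube (n : ℕ) : Set (Vec n) := {y | ∀ i, y i ∈ Set.Icc (0 : ℝ) 1}

/-- Lebesgue measure on the unit cube. -/
def cubeMeasure (n : ℕ) : Measure (Vec n) := volume.restrict (unitCube n)

/-- Lebesgue measure on the product of the real line and the unit cube. -/
def stripMeasure (n : ℕ) : Measure (ℝ × Vec n) := (volume : Measure ℝ).prod (cubeMeasure n)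

/-- A function on `ℝⁿ` which factors through the torus. -/
def IsPeriodic {β : Type*} (f : Vec n → β) : Prop := ∀ y y', toTorus y = toTorus y' → f y = f y'

lemma continuous_toTorus : Continuous (toTorus : Vec n → Torus n) := by
  unfold toTorus
  refine continuous_pi fun i => ?_
  exact (AddCircle.continuous_mk' 1).comp (EuclideanSpace.proj (𝕜 := ℝ) i).continuous

lemma isOpenQuotientMap_toTorus : IsOpenQuotientMap (toTorus : Vec n → Torus n) := by
  have h1 : IsOpenQuotientMap (Pi.map (fun _ : Fin n => fun x : ℝ => (x : UnitAddCircle))) :=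
    IsOpenQuotientMap.piMap fun _ => QuotientAddGroup.isOpenQuotientMap_mk
  exact h1.comp (EuclideanSpace.equiv (Fin n) ℝ).toHomeomorph.isOpenQuotientMap

lemma unitCube_eq_preimage :
    unitCube n = (WithLp.ofLp : Vec n → Fin n → ℝ) ⁻¹' Set.Icc 0 1 := by
  ext y; simp [unitCube, Set.mem_Icc, Pi.le_def, forall_and]

lemma isCompact_unitCube : IsCompact (unitCube n) := by
  rw [unitCube_eq_preimage]
  exact (EuclideanSpace.equiv (Fin n) ℝ).toHomeomorph.isCompact_preimage.2 isCompact_Icc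

lemma measurableSet_unitCube : MeasurableSet (unitCube n) :=
  isCompact_unitCube.isClosed.measurableSet

lemma measurePreserving_ofLp_cube : MeasurePreserving (WithLp.ofLp : Vec n → Fin n → ℝ)
    (cubeMeasure n) (volume.restrict (Set.Icc 0 1)) := by
  rw [cubeMeasure, unitCube_eq_preimage]
  exact (PiLp.volume_preserving_ofLp (Fin n)).restrict_preimage measurableSet_Icc

lemma measurePreserving_toTorus :
    MeasurePreserving (toTorus : Vec n → Torus n) (cubeMeasure n) volume := by
  have h1 : MeasurePreserving (fun (y : Fin n → ℝ) i => (y i : UnitAddCircle))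
      (Measure.pi fun _ => volume.restrict (Set.Ioc (0 : ℝ) (0 + 1)))
      (Measure.pi fun _ => volume) :=
    measurePreserving_pi _ _ fun i => UnitAddCircle.measurePreserving_mk 0
  -- The half-open cube is the exact fundamental domain; the closed one differs from it by a null
  -- set and has the advantage of being compact.
  have h2 : (Measure.pi fun _ : Fin n => (volume : Measure ℝ).restrict (Set.Ioc (0 : ℝ) (0 + 1)))
      = volume.restrict (Set.Icc 0 1) := by
    rw [← Measure.restrict_pi_pi]
    refine Measure.restrict_congr_set ?_
    have := Measure.univ_pi_Ioc_ae_eq_Icc (μ := fun _ : Fin n => (volume : Measure ℝ))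
      (f := fun _ => 0) (g := fun _ => 1)
    rw [zero_add]
    exact this
  rw [h2] at h1
  exact h1.comp measurePreserving_ofLp_cube

instance : IsProbabilityMeasure (cubeMeasure n) :=
  ⟨by
    have := (measurePreserving_ofLp_cube (n := n)).measure_preimage
      (MeasurableSet.univ.nullMeasurableSet)
    rw [Set.preimage_univ] at this
    rw [this, Measure.restrict_apply_univ, Real.volume_Icc_pi]
    simp⟩

instance : SFinite (stripMeasure n) := by unfold stripMeasure; infer_instance

lemma exists_unitCube_toTorus_eq (y : Vec n) : ∃ y' ∈ unitCube n, toTorus y' = toTorus y := by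
  refine ⟨WithLp.toLp 2 fun i => Int.fract (y i),
    fun i => ⟨Int.fract_nonneg _, (Int.fract_lt_one _).le⟩, ?_⟩
  funext i
  simp [toTorus]

lemma toTorus_eq_of_sub_eq_intCast {y y' : Vec n} (h : ∀ i, ∃ k : ℤ, y i - y' i = k) :
    toTorus y = toTorus y' := by
  funext i
  obtain ⟨k, hk⟩ := h i
  have : y i = y' i + k := by linarith
  simp only [toTorus, this]
  rw [AddCircle.coe_add, add_eq_left, AddCircle.coe_eq_zero_iff]
  exact ⟨k, by simp⟩

lemma IsPeriodic.comp_toTorus {β : Type*} (f : Torus n → β) :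
    IsPeriodic fun y : Vec n => f (toTorus y) := fun _ _ h => by simp [h]

lemma IsPeriodic.add_single {β : Type*} {f : Vec n → β} (hf : IsPeriodic f) (y : Vec n)
    (i : Fin n) : f (y + EuclideanSpace.single i 1) = f y := by
  refine hf _ _ (toTorus_eq_of_sub_eq_intCast fun j => ?_)
  by_cases h : j = i
  · exact ⟨1, by simp [h]⟩
  · exact ⟨0, by simp [h]⟩

lemma IsPeriodic.add_vec {β : Type*} {f : Vec n → β} (hf : IsPeriodic f) {v : Vec n}
    (hv : ∀ i, ∃ k : ℤ, v i = k) (y : Vec n) : f (y + v) = f y :=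
  hf _ _ (toTorus_eq_of_sub_eq_intCast fun j => by simpa using hv j)

lemma toTorus_eq_iff {y y' : Vec n} : toTorus y = toTorus y' ↔ ∀ i, ∃ k : ℤ, y i - y' i = k := by
  refine ⟨fun h i => ?_, toTorus_eq_of_sub_eq_intCast⟩
  have := congrFun h i
  simp only [toTorus] at this
  rw [← sub_eq_zero, ← AddCircle.coe_sub, AddCircle.coe_eq_zero_iff] at this
  obtain ⟨k, hk⟩ := this
  exact ⟨k, by simpa using hk.symm⟩

/-- Derivatives of periodic functions are periodic. -/
lemma IsPeriodic.of_translate {β γ : Type*} {f : Vec n → β} (hf : IsPeriodic f) {g : Vec n → γ}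
    (hg : ∀ v : Vec n, (∀ y, f (y + v) = f y) → ∀ y, g (y + v) = g y) : IsPeriodic g := by
  intro y y' h
  rw [toTorus_eq_iff] at h
  have := hg (y - y') (fun x => hf.add_vec (by simpa using h) x) y'
  rwa [add_sub_cancel] at this

lemma IsPeriodic.gradient {f : Vec n → ℝ} (hf : IsPeriodic f) : IsPeriodic (gradient f) := by
  refine hf.of_translate fun v hv y => ?_
  have h1 : f = fun x => f (x + v) := funext fun x => (hv x).symm
  unfold _root_.gradient
  congr 1
  conv_rhs => rw [h1]
  rw [fderiv_comp_add_right]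

/-- The divergence theorem for periodic vector fields. -/
lemma integral_divX_eq_zero {V : Vec n → Vec n} (hV : IsPeriodic V) (hd : Differentiable ℝ V)
    (hc : Continuous (divX V)) : ∫ y, divX V y ∂cubeMeasure n = 0 := by
  cases n with
  -- The divergence theorem on boxes is stated for positive dimension; in dimension zero the
  -- divergence is an empty sum.
  | zero => simp [divX]
  | succ n =>
    have hmp := measurePreserving_ofLp_cube (n := n + 1)
    have hemb : MeasurableEmbedding (WithLp.ofLp : Vec (n + 1) → Fin (n + 1) → ℝ) :=
      (EuclideanSpace.equiv (Fin (n + 1)) ℝ).toHomeomorph.measurableEmbedding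
    let e := (EuclideanSpace.equiv (Fin (n + 1)) ℝ)
    have h0 : ∫ y, divX V y ∂cubeMeasure (n + 1)
        = ∫ x in Set.Icc (0 : Fin (n + 1) → ℝ) 1, divX V (e.symm x) :=
      hmp.integral_comp hemb fun x => divX V (e.symm x)
    rw [h0]
    have hder : ∀ x i, HasFDerivAt (fun x => V (e.symm x) i)
        ((EuclideanSpace.proj (𝕜 := ℝ) i).comp ((fderiv ℝ V (e.symm x)).comp
          (e.symm : (Fin (n + 1) → ℝ) →L[ℝ] Vec (n + 1)))) x := fun x i =>
      ((EuclideanSpace.proj (𝕜 := ℝ) i).hasFDerivAt).comp x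
        ((hd _).hasFDerivAt.comp x (e.symm : (Fin (n + 1) → ℝ) →L[ℝ] Vec (n + 1)).hasFDerivAt)
    have hdiv : ∀ x, divX V (e.symm x) = ∑ i : Fin (n + 1),
        ((EuclideanSpace.proj (𝕜 := ℝ) i).comp ((fderiv ℝ V (e.symm x)).comp
          (e.symm : (Fin (n + 1) → ℝ) →L[ℝ] Vec (n + 1)))) (Pi.single i 1) := by
      intro x
      rfl
    simp_rw [hdiv]
    rw [integral_divergence_of_hasFDerivAt_off_countable' (0 : Fin (n + 1) → ℝ) 1 (by simp)
      (fun i x => V (e.symm x) i) _ ∅ Set.countable_empty ?_ (fun x _ i => hder x i) ?_]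
    -- Only face integrals remain, and opposite faces differ by a lattice vector, so they cancel by
    -- periodicity.
    · refine Finset.sum_eq_zero fun i _ => ?_
      rw [sub_eq_zero]
      refine integral_congr_ae (ae_of_all _ fun x => ?_)
      simp only
      have : e.symm (i.insertNth ((1 : Fin (n + 1) → ℝ) i) x)
          = e.symm (i.insertNth ((0 : Fin (n + 1) → ℝ) i) x) + EuclideanSpace.single i 1 := by
        ext j
        refine Fin.succAboveCases i ?_ (fun j => ?_) j
        · simp [e]
        · simp [e]
      rw [this, hV.add_single]
    · exact fun i => (continuous_iff_continuousAt.2 fun x => (hder x i).continuousAt).continuousOn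
    · refine Continuous.integrableOn_Icc ?_
      simp_rw [← hdiv]
      exact hc.comp e.symm.continuous

lemma divX_smul {f : Vec n → ℝ} {g : Vec n} {V : Vec n → Vec n} {y : Vec n}
    (hf : HasGradientAt f g y) (hV : DifferentiableAt ℝ V y) :
    divX (fun y => f y • V y) y = f y * divX V y + inner ℝ g (V y) := by
  have h := (hf.hasFDerivAt.smul hV.hasFDerivAt).fderiv
  simp only [divX]
  rw [show (fun y => f y • V y) = f • V from rfl, h]
  simp [Finset.sum_add_distrib, Finset.mul_sum, PiLp.inner_apply, mul_comm]

lemma Continuous.integrable_cubeMeasure {f : Vec n → ℝ} (hf : Continuous f) :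
    Integrable f (cubeMeasure n) := hf.continuousOn.integrableOn_compact isCompact_unitCube

/-- Integration by parts on the torus. -/
lemma integral_mul_divX {f : Vec n → ℝ} {g V : Vec n → Vec n} (hfp : IsPeriodic f)
    (hf : ∀ y, HasGradientAt f (g y) y) (hg : Continuous g) (hVp : IsPeriodic V)
    (hV : Differentiable ℝ V) (hdV : Continuous (divX V)) :
    ∫ y, f y * divX V y ∂cubeMeasure n = -∫ y, inner ℝ (g y) (V y) ∂cubeMeasure n := by
  have hfc : Continuous f := continuous_iff_continuousAt.2 fun y => (hf y).continuousAt
  have h1 : divX (fun y => f y • V y) = fun y => f y * divX V y + inner ℝ (g y) (V y) :=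
    funext fun y => divX_smul (hf y) (hV y)
  have c1 : Continuous fun y => f y * divX V y := hfc.mul hdV
  have c2 : Continuous fun y => inner ℝ (g y) (V y) := hg.inner hV.continuous
  have h := integral_divX_eq_zero (V := fun y => f y • V y)
    (fun y y' hy => by simp only [hfp y y' hy, hVp y y' hy])
    (fun y => ((hf y).differentiableAt).smul (hV y)) (by rw [h1]; exact c1.add c2)
  rw [h1, integral_add c1.integrable_cubeMeasure c2.integrable_cubeMeasure] at h
  linarith

end Cube

/-! ### Integration by parts on the strip -/

section Strip

variable {n : ℕ}

/-- Vanishing for large signals. -/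
def SignalSupport {E : Type*} [Zero E] (R : ℝ) (f : ℝ → Vec n → E) : Prop :=
  ∀ z, R < |z| → ∀ y, f z y = 0

lemma stripMeasure_restrict (R : ℝ) : (stripMeasure n).restrict (Set.Icc (-R) R ×ˢ Set.univ)
    = ((volume : Measure ℝ).restrict (Set.Icc (-R) R)).prod (cubeMeasure n) := by
  rw [stripMeasure, ← Measure.prod_restrict, Measure.restrict_univ]

lemma isCompact_strip (R : ℝ) : IsCompact (Set.Icc (-R) R ×ˢ unitCube n) :=
  isCompact_Icc.prod isCompact_unitCube

lemma integrableOn_strip_iff {E : Type*} [NormedAddCommGroup E] {R : ℝ} {f : ℝ × Vec n → E} :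
    IntegrableOn f (Set.Icc (-R) R ×ˢ Set.univ) (stripMeasure n) ↔
      IntegrableOn f (Set.Icc (-R) R ×ˢ unitCube n) (volume.prod volume) := by
  rw [IntegrableOn, IntegrableOn, stripMeasure_restrict, cubeMeasure, Measure.prod_restrict]

lemma integrable_strip_of_signalSupport {f : ℝ → Vec n → ℝ} {R : ℝ}
    (hf : Continuous fun q : ℝ × Vec n => f q.1 q.2) (hs : SignalSupport R f) :
    Integrable (fun q : ℝ × Vec n => f q.1 q.2) (stripMeasure n) := by
  refine (integrableOn_iff_integrable_of_support_subset
    (s := Set.Icc (-R) R ×ˢ Set.univ) fun q hq => ?_).1 ?_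
  · refine ⟨?_, trivial⟩
    by_contra h
    exact hq (hs q.1 (by rw [← not_le, abs_le]; exact h) q.2)
  · rw [integrableOn_strip_iff]
    exact hf.continuousOn.integrableOn_compact (isCompact_strip R)

lemma SignalSupport.deriv {f fz : ℝ → Vec n → ℝ} {R : ℝ} (hs : SignalSupport R f)
    (hf : ∀ z y, HasDerivAt (fun z => f z y) (fz z y) z) : SignalSupport R fz := by
  intro z hz y
  have : (fun z => f z y) =ᶠ[𝓝 z] fun _ => 0 := by
    filter_upwards [(isOpen_lt continuous_const continuous_abs).mem_nhds hz] with z' hz'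
    exact hs z' hz' y
  exact (hf z y).unique ((hasDerivAt_const z (0 : ℝ)).congr_of_eventuallyEq this)

lemma SignalSupport.gradient {f : ℝ → Vec n → ℝ} {fg : ℝ → Vec n → Vec n} {R : ℝ}
    (hs : SignalSupport R f) (hf : ∀ z y, HasGradientAt (f z) (fg z y) y) :
    SignalSupport R fg := by
  intro z hz y
  have : f z = fun _ => 0 := funext fun y => hs z hz y
  have h := hf z y
  rw [this] at h
  exact h.unique (hasGradientAt_const y 0)

lemma SignalSupport.divX {V : ℝ → Vec n → Vec n} {R : ℝ}
    (hs : SignalSupport R V) : SignalSupport R fun z => divX (V z) := by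
  intro z hz y
  have : V z = fun _ => 0 := funext fun y => hs z hz y
  simp [_root_.divX, this]

/-- Compact signal support of one factor makes all three products integrable in z, so there is no
boundary term and the other factor may grow freely. Position is a mere parameter, integrated last.
-/
lemma strip_ibp_z {f fz g gz : ℝ → Vec n → ℝ} {R : ℝ} (hs : SignalSupport R f)
    (hf : ∀ z y, HasDerivAt (fun z => f z y) (fz z y) z)
    (hg : ∀ z y, HasDerivAt (fun z => g z y) (gz z y) z)
    (cf : Continuous fun q : ℝ × Vec n => f q.1 q.2)
    (cfz : Continuous fun q : ℝ × Vec n => fz q.1 q.2)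
    (cg : Continuous fun q : ℝ × Vec n => g q.1 q.2)
    (cgz : Continuous fun q : ℝ × Vec n => gz q.1 q.2) :
    ∫ q, f q.1 q.2 * gz q.1 q.2 ∂stripMeasure n = -∫ q, fz q.1 q.2 * g q.1 q.2 ∂stripMeasure n := by
  have hsz := hs.deriv hf
  have i1 := integrable_strip_of_signalSupport (cf.mul cgz) (f := fun z y => f z y * gz z y)
    (R := R) fun z hz y => by simp [hs z hz y]
  have i2 := integrable_strip_of_signalSupport (cfz.mul cg) (f := fun z y => fz z y * g z y)
    (R := R) fun z hz y => by simp [hsz z hz y]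
  unfold stripMeasure at *
  rw [integral_prod_symm _ i1, integral_prod_symm _ i2, ← integral_neg]
  refine integral_congr_ae (ae_of_all _ fun y => ?_)
  have key : ∀ {h : ℝ → ℝ}, Continuous h → (∀ z, R < |z| → h z = 0) → Integrable h := by
    intro h hc h0
    refine hc.integrable_of_hasCompactSupport ?_
    refine HasCompactSupport.intro (isCompact_Icc (a := -R) (b := R)) fun z hz => h0 z ?_
    rw [← not_le, abs_le]; exact hz
  refine integral_mul_deriv_eq_deriv_mul_of_integrable (u := fun z => f z y) (v := fun z => g z y)
    (u' := fun z => fz z y) (v' := fun z => gz z y)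
    (fun z _ => hf z y) (fun z _ => hg z y) (key ?_ ?_) (key ?_ ?_) (key ?_ ?_)
  · exact (cf.mul cgz).comp (Continuous.prodMk_left y)
  · intro z hz; simp [hs z hz y]
  · exact (cfz.mul cg).comp (Continuous.prodMk_left y)
  · intro z hz; simp [hsz z hz y]
  · exact (cf.mul cg).comp (Continuous.prodMk_left y)
  · intro z hz; simp [hs z hz y]

/-- On each slice of constant signal this is integration by parts on the torus; the support
condition only secures integrability over z. It may fall on either factor because the second
integration by parts of a Laplacian exchanges the roles of test function and density. -/
lemma strip_ibp_x {f : ℝ → Vec n → ℝ} {fg V : ℝ → Vec n → Vec n} {R : ℝ}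
    (hs : SignalSupport R f ∨ SignalSupport R V)
    (hfp : ∀ z, IsPeriodic (f z)) (hVp : ∀ z, IsPeriodic (V z))
    (hf : ∀ z y, HasGradientAt (f z) (fg z y) y)
    (hV : ∀ z, Differentiable ℝ (V z))
    (cf : Continuous fun q : ℝ × Vec n => f q.1 q.2)
    (cfg : Continuous fun q : ℝ × Vec n => fg q.1 q.2)
    (cV : Continuous fun q : ℝ × Vec n => V q.1 q.2)
    (cdV : Continuous fun q : ℝ × Vec n => divX (V q.1) q.2) :
    ∫ q, f q.1 q.2 * divX (V q.1) q.2 ∂stripMeasure n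
      = -∫ q, inner ℝ (fg q.1 q.2) (V q.1 q.2) ∂stripMeasure n := by
  have i1 := integrable_strip_of_signalSupport (cf.mul cdV)
    (f := fun z y => f z y * divX (V z) y) (R := R) fun z hz y => by
      rcases hs with hs | hs
      · simp [hs z hz y]
      · simp [hs.divX z hz y]
  have i2 := integrable_strip_of_signalSupport (cfg.inner (𝕜 := ℝ) cV)
    (f := fun z y => inner ℝ (fg z y) (V z y)) (R := R) fun z hz y => by
      rcases hs with hs | hs
      · simp [hs.gradient hf z hz y]
      · simp [hs z hz y]
  unfold stripMeasure at *
  rw [integral_prod _ i1, integral_prod _ i2, ← integral_neg]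
  refine integral_congr_ae (ae_of_all _ fun z => ?_)
  exact integral_mul_divX (hfp z) (hf z) (cfg.comp (Continuous.prodMk_right z)) (hVp z) (hV z)
    (cdV.comp (Continuous.prodMk_right z))

end Strip

/-! ### Functions of class `C^{1,2}` together with their derivatives -/

section Jets

variable {n : ℕ}

/-- A function `f(t,z,y)` together with candidates for its derivatives in `t`, in `z` (first and
second), its gradient in `y` and its Laplacian in `y`. -/
structure Jet (n : ℕ) where
  f : ℝ → ℝ → Vec n → ℝ
  ft : ℝ → ℝ → Vec n → ℝ
  fz : ℝ → ℝ → Vec n → ℝ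
  fzz : ℝ → ℝ → Vec n → ℝ
  fg : ℝ → ℝ → Vec n → Vec n
  fl : ℝ → ℝ → Vec n → ℝ

/-- Joint continuity in `(t,z,y)` for times in `I`. -/
def JointCont {E : Type*} [TopologicalSpace E] (I : Set ℝ) (f : ℝ → ℝ → Vec n → E) : Prop :=
  ContinuousOn (fun p : ℝ × ℝ × Vec n => f p.1 p.2.1 p.2.2) (I ×ˢ Set.univ)

/-- The components of a jet are the derivatives of its first component, for times in `I`. -/
structure Jet.IsC12 (I : Set ℝ) (J : Jet n) : Prop where
  periodic : ∀ t z, IsPeriodic (J.f t z)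
  hasDerivAt_t : ∀ t ∈ I, ∀ z y, HasDerivAt (fun t => J.f t z y) (J.ft t z y) t
  hasDerivAt_z : ∀ t ∈ I, ∀ z y, HasDerivAt (fun z => J.f t z y) (J.fz t z y) z
  hasDerivAt_zz : ∀ t ∈ I, ∀ z y, HasDerivAt (fun z => J.fz t z y) (J.fzz t z y) z
  hasGradientAt : ∀ t ∈ I, ∀ z y, HasGradientAt (J.f t z) (J.fg t z y) y
  differentiable_fg : ∀ t ∈ I, ∀ z, Differentiable ℝ (J.fg t z)
  divX_fg : ∀ t ∈ I, ∀ z y, divX (J.fg t z) y = J.fl t z y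
  cont_f : JointCont I J.f
  cont_ft : JointCont I J.ft
  cont_fz : JointCont I J.fz
  cont_fzz : JointCont I J.fzz
  cont_fg : JointCont I J.fg
  cont_fl : JointCont I J.fl

lemma JointCont.slice {E : Type*} [TopologicalSpace E] {I : Set ℝ} {f : ℝ → ℝ → Vec n → E}
    (hf : JointCont I f) {t : ℝ} (ht : t ∈ I) : Continuous fun q : ℝ × Vec n => f t q.1 q.2 :=
  ContinuousOn.comp_continuous hf (by fun_prop : Continuous fun q : ℝ × Vec n => (t, q.1, q.2))
    fun _ => ⟨ht, trivial⟩

lemma JointCont.mono {E : Type*} [TopologicalSpace E] {I I' : Set ℝ} {f : ℝ → ℝ → Vec n → E}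
    (hf : JointCont I f) (h : I' ⊆ I) : JointCont I' f :=
  ContinuousOn.mono hf (Set.prod_mono h subset_rfl)

lemma JointCont.congr {E : Type*} [TopologicalSpace E] {I : Set ℝ} {f g : ℝ → ℝ → Vec n → E}
    (hf : JointCont I f) (h : ∀ t ∈ I, ∀ z y, g t z y = f t z y) : JointCont I g :=
  ContinuousOn.congr hf fun p hp => h p.1 hp.1 _ _

lemma Jet.IsC12.mono {I I' : Set ℝ} {J : Jet n} (hJ : J.IsC12 I) (h : I' ⊆ I) : J.IsC12 I' where
  periodic := hJ.periodic
  hasDerivAt_t t ht := hJ.hasDerivAt_t t (h ht)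
  hasDerivAt_z t ht := hJ.hasDerivAt_z t (h ht)
  hasDerivAt_zz t ht := hJ.hasDerivAt_zz t (h ht)
  hasGradientAt t ht := hJ.hasGradientAt t (h ht)
  differentiable_fg t ht := hJ.differentiable_fg t (h ht)
  divX_fg t ht := hJ.divX_fg t (h ht)
  cont_f := hJ.cont_f.mono h
  cont_ft := hJ.cont_ft.mono h
  cont_fz := hJ.cont_fz.mono h
  cont_fzz := hJ.cont_fzz.mono h
  cont_fg := hJ.cont_fg.mono h
  cont_fl := hJ.cont_fl.mono h

lemma Jet.IsC12.periodic_fg {I : Set ℝ} {J : Jet n} (hJ : J.IsC12 I) {t : ℝ} (ht : t ∈ I) (z : ℝ) :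
    IsPeriodic (J.fg t z) := by
  have : J.fg t z = gradient (J.f t z) := funext fun y => (hJ.hasGradientAt t ht z y).gradient.symm
  rw [this]
  exact (hJ.periodic t z).gradient

/-- A function `e(t,z)` with its derivatives. -/
structure SignalJet where
  e : ℝ → ℝ → ℝ
  et : ℝ → ℝ → ℝ
  ez : ℝ → ℝ → ℝ
  ezz : ℝ → ℝ → ℝ

/-- The components of a signal jet are the derivatives of its first component. -/
structure SignalJet.IsC12 (I : Set ℝ) (a : SignalJet) : Prop where
  hasDerivAt_t : ∀ t ∈ I, ∀ z, HasDerivAt (fun t => a.e t z) (a.et t z) t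
  hasDerivAt_z : ∀ t ∈ I, ∀ z, HasDerivAt (fun z => a.e t z) (a.ez t z) z
  hasDerivAt_zz : ∀ t ∈ I, ∀ z, HasDerivAt (fun z => a.ez t z) (a.ezz t z) z
  cont_e : ContinuousOn (fun p : ℝ × ℝ => a.e p.1 p.2) (I ×ˢ Set.univ)
  cont_et : ContinuousOn (fun p : ℝ × ℝ => a.et p.1 p.2) (I ×ˢ Set.univ)
  cont_ez : ContinuousOn (fun p : ℝ × ℝ => a.ez p.1 p.2) (I ×ˢ Set.univ)
  cont_ezz : ContinuousOn (fun p : ℝ × ℝ => a.ezz p.1 p.2) (I ×ˢ Set.univ)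

lemma jointCont_of_signal {I : Set ℝ} {e : ℝ → ℝ → ℝ}
    (h : ContinuousOn (fun p : ℝ × ℝ => e p.1 p.2) (I ×ˢ Set.univ)) :
    JointCont I fun t z (_ : Vec n) => e t z :=
  h.comp (by fun_prop : Continuous fun p : ℝ × ℝ × Vec n => (p.1, p.2.1)).continuousOn
    fun _ hp => ⟨hp.1, trivial⟩

/-- The product of a signal jet and a jet. -/
def SignalJet.mul (a : SignalJet) (J : Jet n) : Jet n where
  f t z y := a.e t z * J.f t z y
  ft t z y := a.et t z * J.f t z y + a.e t z * J.ft t z y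
  fz t z y := a.ez t z * J.f t z y + a.e t z * J.fz t z y
  fzz t z y := a.ezz t z * J.f t z y + 2 * (a.ez t z * J.fz t z y) + a.e t z * J.fzz t z y
  fg t z y := a.e t z • J.fg t z y
  fl t z y := a.e t z * J.fl t z y

lemma divX_const_smul {V : Vec n → Vec n} (c : ℝ) {y : Vec n} (hV : DifferentiableAt ℝ V y) :
    divX (fun y => c • V y) y = c * divX V y := by
  simpa using divX_smul (hasGradientAt_const y c) hV

lemma HasGradientAt.const_mul' {f : Vec n → ℝ} {g y : Vec n} (hf : HasGradientAt f g y) (c : ℝ) :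
    HasGradientAt (fun y => c * f y) (c • g) y := by
  have h := (hf.hasFDerivAt.const_mul c).hasGradientAt
  rwa [map_smulₛₗ, LinearIsometryEquiv.symm_apply_apply] at h

lemma SignalJet.IsC12.mul {I : Set ℝ} {a : SignalJet} {J : Jet n} (ha : a.IsC12 I)
    (hJ : J.IsC12 I) : (a.mul J).IsC12 I where
  periodic t z y y' h := congrArg (a.e t z * ·) (hJ.periodic t z y y' h)
  hasDerivAt_t t ht z y := (ha.hasDerivAt_t t ht z).mul (hJ.hasDerivAt_t t ht z y)
  hasDerivAt_z t ht z y := (ha.hasDerivAt_z t ht z).mul (hJ.hasDerivAt_z t ht z y)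
  hasDerivAt_zz t ht z y := by
    have h := ((ha.hasDerivAt_zz t ht z).mul (hJ.hasDerivAt_z t ht z y)).add
      ((ha.hasDerivAt_z t ht z).mul (hJ.hasDerivAt_zz t ht z y))
    refine h.congr_deriv ?_
    simp only [SignalJet.mul]; ring
  hasGradientAt t ht z y := (hJ.hasGradientAt t ht z y).const_mul' _
  differentiable_fg t ht z := (hJ.differentiable_fg t ht z).const_smul (a.e t z)
  divX_fg t ht z y := by
    simp only [SignalJet.mul]
    rw [← hJ.divX_fg t ht z y]
    exact divX_const_smul (V := J.fg t z) _ (hJ.differentiable_fg t ht z y)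
  cont_f := (jointCont_of_signal ha.cont_e).mul hJ.cont_f
  cont_ft := ((jointCont_of_signal ha.cont_et).mul hJ.cont_f).add
    ((jointCont_of_signal ha.cont_e).mul hJ.cont_ft)
  cont_fz := ((jointCont_of_signal ha.cont_ez).mul hJ.cont_f).add
    ((jointCont_of_signal ha.cont_e).mul hJ.cont_fz)
  cont_fzz := (((jointCont_of_signal ha.cont_ezz).mul hJ.cont_f).add
    (((jointCont_of_signal ha.cont_ez).mul hJ.cont_fz).const_mul 2)).add
    ((jointCont_of_signal ha.cont_e).mul hJ.cont_fzz)
  cont_fg := (jointCont_of_signal ha.cont_e).smul hJ.cont_fg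
  cont_fl := (jointCont_of_signal ha.cont_e).mul hJ.cont_fl

/-- The difference of two jets. -/
def Jet.sub (J K : Jet n) : Jet n where
  f t z y := J.f t z y - K.f t z y
  ft t z y := J.ft t z y - K.ft t z y
  fz t z y := J.fz t z y - K.fz t z y
  fzz t z y := J.fzz t z y - K.fzz t z y
  fg t z y := J.fg t z y - K.fg t z y
  fl t z y := J.fl t z y - K.fl t z y

lemma divX_sub {V W : Vec n → Vec n} {y : Vec n} (hV : DifferentiableAt ℝ V y)
    (hW : DifferentiableAt ℝ W y) : divX (fun y => V y - W y) y = divX V y - divX W y := by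
  simp only [divX]
  rw [show (fun y => V y - W y) = V - W from rfl, fderiv_sub hV hW]
  simp [Finset.sum_sub_distrib]

lemma HasGradientAt.sub' {f g : Vec n → ℝ} {f' g' y : Vec n} (hf : HasGradientAt f f' y)
    (hg : HasGradientAt g g' y) : HasGradientAt (fun y => f y - g y) (f' - g') y := by
  have h := (hf.hasFDerivAt.sub hg.hasFDerivAt).hasGradientAt
  rwa [map_sub, LinearIsometryEquiv.symm_apply_apply, LinearIsometryEquiv.symm_apply_apply] at h

lemma Jet.IsC12.sub {I : Set ℝ} {J K : Jet n} (hJ : J.IsC12 I) (hK : K.IsC12 I) :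
    (J.sub K).IsC12 I where
  periodic t z y y' h := congrArg₂ (· - ·) (hJ.periodic t z y y' h) (hK.periodic t z y y' h)
  hasDerivAt_t t ht z y := (hJ.hasDerivAt_t t ht z y).sub (hK.hasDerivAt_t t ht z y)
  hasDerivAt_z t ht z y := (hJ.hasDerivAt_z t ht z y).sub (hK.hasDerivAt_z t ht z y)
  hasDerivAt_zz t ht z y := (hJ.hasDerivAt_zz t ht z y).sub (hK.hasDerivAt_zz t ht z y)
  hasGradientAt t ht z y := (hJ.hasGradientAt t ht z y).sub' (hK.hasGradientAt t ht z y)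
  differentiable_fg t ht z := (hJ.differentiable_fg t ht z).sub (hK.differentiable_fg t ht z)
  divX_fg t ht z y := by
    simp only [Jet.sub]
    rw [← hJ.divX_fg t ht z y, ← hK.divX_fg t ht z y]
    exact divX_sub (hJ.differentiable_fg t ht z y) (hK.differentiable_fg t ht z y)
  cont_f := ContinuousOn.sub hJ.cont_f hK.cont_f
  cont_ft := ContinuousOn.sub hJ.cont_ft hK.cont_ft
  cont_fz := ContinuousOn.sub hJ.cont_fz hK.cont_fz
  cont_fzz := ContinuousOn.sub hJ.cont_fzz hK.cont_fzz
  cont_fg := ContinuousOn.sub hJ.cont_fg hK.cont_fg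
  cont_fl := ContinuousOn.sub hJ.cont_fl hK.cont_fl

/-- The jet of a function on the torus. -/
def jetOf (w : ℝ → ℝ → Torus n → ℝ) : Jet n where
  f t z y := w t z (toTorus y)
  ft t z y := deriv (fun t' => w t' z (toTorus y)) t
  fz t z y := deriv (fun z' => w t z' (toTorus y)) z
  fzz t z y := iteratedDeriv 2 (fun z' => w t z' (toTorus y)) z
  fg t z y := gradX (w t z) y
  fl t z y := lapX (w t z) y

lemma toDual_symm_apply_coord (L : Vec n →L[ℝ] ℝ) (i : Fin n) :
    ((InnerProductSpace.toDual ℝ (Vec n)).symm L) i = L (EuclideanSpace.single i 1) := by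
  rw [← InnerProductSpace.toDual_symm_apply, EuclideanSpace.inner_single_right]
  simp

lemma fderiv_gradient {h : Vec n → ℝ} (hh : ContDiff ℝ 2 h) (y v : Vec n) :
    DifferentiableAt ℝ (gradient h) y ∧ fderiv ℝ (gradient h) y v
      = (InnerProductSpace.toDual ℝ (Vec n)).symm (fderiv ℝ (fderiv ℝ h) y v) := by
  have h1 : HasFDerivAt (fderiv ℝ h) (fderiv ℝ (fderiv ℝ h) y) y :=
    ((hh.fderiv_right (m := 1) (by norm_num)).differentiable (by norm_num) y).hasFDerivAt
  let e : (Vec n →L[ℝ] ℝ) →L[ℝ] Vec n := LinearMap.toContinuousLinearMap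
    { toFun := (InnerProductSpace.toDual ℝ (Vec n)).symm
      map_add' := map_add _
      map_smul' := fun c L => by simp }
  have h2 : HasFDerivAt (gradient h) (e.comp (fderiv ℝ (fderiv ℝ h) y)) y :=
    e.hasFDerivAt.comp y h1
  exact ⟨h2.differentiableAt, by rw [h2.fderiv]; rfl⟩

/-- Both sides are the trace of the second derivative in the standard orthonormal basis. It lets
Laplacians be integrated by parts as divergences. -/
lemma divX_gradient {h : Vec n → ℝ} (hh : ContDiff ℝ 2 h) (y : Vec n) :
    divX (gradient h) y = (Δ h) y := by
  rw [InnerProductSpace.laplacian_eq_iteratedFDeriv_orthonormalBasis h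
    (EuclideanSpace.basisFun (Fin n) ℝ)]
  simp only [divX]
  refine Finset.sum_congr rfl fun i _ => ?_
  rw [(fderiv_gradient hh y _).2, toDual_symm_apply_coord, iteratedFDeriv_two_apply]
  simp

/-- Every spatial component is a component of the first or second Fréchet derivative in the pair (z,
y), by the chain rule along the inclusions `z ↦ (z, y)` and `y ↦ (z, y)`. Joint continuity is
inherited from those derivatives. -/
lemma IsC12.jetOf {T : ℝ} {w : ℝ → ℝ → Torus n → ℝ} (hw : IsC12 T w) :
    (jetOf w).IsC12 (Set.Ioo 0 T) := by
  let g : ℝ → ℝ × Vec n → ℝ := fun t q => w t q.1 (toTorus q.2)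
  have hg1 : ∀ t ∈ Set.Ioo 0 T, ∀ q, HasFDerivAt (g t) (fderiv ℝ (g t) q) q := fun t ht q =>
    ((hw.space_diff t ht).differentiable (by norm_num) q).hasFDerivAt
  have hg2 : ∀ t ∈ Set.Ioo 0 T, ∀ q, HasFDerivAt (fderiv ℝ (g t)) (fderiv ℝ (fderiv ℝ (g t)) q) q :=
    fun t ht q => (((hw.space_diff t ht).fderiv_right (m := 1) (by norm_num)).differentiable
      (by norm_num) q).hasFDerivAt
  have dz : ∀ z (y : Vec n), HasDerivAt (fun z : ℝ => (z, y)) ((1 : ℝ), (0 : Vec n)) z :=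
    fun z y => (hasDerivAt_id z).prodMk (hasDerivAt_const z y)
  have dy : ∀ z (y : Vec n), HasFDerivAt (fun y : Vec n => (z, y))
      (ContinuousLinearMap.inr ℝ ℝ (Vec n)) y := fun z y => hasFDerivAt_prodMk_right z y
  have hz : ∀ t ∈ Set.Ioo 0 T, ∀ z y, HasDerivAt (fun z => w t z (toTorus y))
      (fderiv ℝ (g t) (z, y) (1, 0)) z := fun t ht z y =>
    (hg1 t ht (z, y)).comp_hasDerivAt (f := fun z : ℝ => (z, y)) z (dz z y)
  have hzz : ∀ t ∈ Set.Ioo 0 T, ∀ z y, HasDerivAt (fun z => fderiv ℝ (g t) (z, y) (1, 0))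
      (fderiv ℝ (fderiv ℝ (g t)) (z, y) (1, 0) (1, 0)) z := fun t ht z y => by
    have := ((hg2 t ht (z, y)).comp_hasDerivAt z (dz z y))
    simpa using this.clm_apply (hasDerivAt_const z ((1 : ℝ), (0 : Vec n)))
  have hzd : ∀ t ∈ Set.Ioo 0 T, ∀ z y, (_root_.jetOf w).fz t z y = fderiv ℝ (g t) (z, y) (1, 0) :=
    fun t ht z y => (hz t ht z y).deriv
  have hzzd : ∀ t ∈ Set.Ioo 0 T, ∀ z y, (_root_.jetOf w).fzz t z y
      = fderiv ℝ (fderiv ℝ (g t)) (z, y) (1, 0) (1, 0) := by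
    intro t ht z y
    simp only [_root_.jetOf, iteratedDeriv_succ, iteratedDeriv_zero]
    rw [funext fun z => (hz t ht z y).deriv]
    exact (hzz t ht z y).deriv
  have hC2 : ∀ t ∈ Set.Ioo 0 T, ∀ z, ContDiff ℝ 2 fun y : Vec n => w t z (toTorus y) :=
    fun t ht z => (hw.space_diff t ht).comp (contDiff_prodMk_right z)
  have hfd : ∀ t ∈ Set.Ioo 0 T, ∀ z, fderiv ℝ (fun y : Vec n => w t z (toTorus y))
      = fun y => (fderiv ℝ (g t) (z, y)).comp (ContinuousLinearMap.inr ℝ ℝ (Vec n)) :=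
    fun t ht z => funext fun y => ((hg1 t ht (z, y)).comp y (dy z y)).fderiv
  have hfdd : ∀ t ∈ Set.Ioo 0 T, ∀ z y v v', fderiv ℝ (fderiv ℝ (fun y : Vec n => w t z (toTorus y)))
      y v v' = fderiv ℝ (fderiv ℝ (g t)) (z, y) (0, v) (0, v') := by
    intro t ht z y v v'
    rw [hfd t ht z]
    have h1 := (hg2 t ht (z, y)).comp y (dy z y)
    have h2 := h1.clm_comp (hasFDerivAt_const (ContinuousLinearMap.inr ℝ ℝ (Vec n)) y)
    have h3 := h2.fderiv
    simp only [Function.comp_def] at h3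
    rw [h3]
    simp
  have hfl : ∀ t ∈ Set.Ioo 0 T, ∀ z y, (_root_.jetOf w).fl t z y
      = ∑ i : Fin n, fderiv ℝ (fderiv ℝ (g t)) (z, y) (0, EuclideanSpace.single i 1)
        (0, EuclideanSpace.single i 1) := by
    intro t ht z y
    simp only [_root_.jetOf, lapX]
    rw [InnerProductSpace.laplacian_eq_iteratedFDeriv_orthonormalBasis _
      (EuclideanSpace.basisFun (Fin n) ℝ)]
    refine Finset.sum_congr rfl fun i _ => ?_
    rw [iteratedFDeriv_two_apply, hfdd t ht]
    simp
  have c2 : ∀ v v' : ℝ × Vec n, ContinuousOn (fun p : ℝ × ℝ × Vec n =>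
      fderiv ℝ (fderiv ℝ (g p.1)) (p.2.1, p.2.2) v v') (Set.Ioo 0 T ×ˢ Set.univ) := fun v v' =>
    (hw.continuousOn_space₂.clm_apply continuousOn_const).clm_apply continuousOn_const
  have hproj : Continuous fun p : ℝ × ℝ × Vec n => (p.1, p.2.1, toTorus p.2.2) :=
    continuous_fst.prodMk ((continuous_fst.comp continuous_snd).prodMk
      (continuous_toTorus.comp (continuous_snd.comp continuous_snd)))
  exact
  { periodic := fun t z => IsPeriodic.comp_toTorus _
    hasDerivAt_t := fun t ht z y => (hw.time_diff t ht z _).hasDerivAt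
    hasDerivAt_z := fun t ht z y => by rw [hzd t ht]; exact hz t ht z y
    hasDerivAt_zz := fun t ht z y => by
      rw [hzzd t ht, funext fun z => hzd t ht z y]; exact hzz t ht z y
    hasGradientAt := fun t ht z y =>
      ((hC2 t ht z).differentiable (by norm_num) y).hasGradientAt
    differentiable_fg := fun t ht z y => (fderiv_gradient (hC2 t ht z) y 0).1
    divX_fg := fun t ht z y => divX_gradient (hC2 t ht z) y
    cont_f := hw.continuousOn.comp hproj.continuousOn fun p hp => ⟨hp.1, trivial⟩
    cont_ft := hw.continuousOn_time.comp hproj.continuousOn fun p hp => ⟨hp.1, trivial⟩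
    cont_fz := ContinuousOn.congr (hw.continuousOn_space₁.clm_apply continuousOn_const)
      fun p hp => hzd p.1 hp.1 p.2.1 p.2.2
    cont_fzz := ContinuousOn.congr (c2 (1, 0) (1, 0)) fun p hp => hzzd p.1 hp.1 p.2.1 p.2.2
    cont_fg := by
      have h1 : ContinuousOn (fun p : ℝ × ℝ × Vec n => (InnerProductSpace.toDual ℝ (Vec n)).symm
          ((fderiv ℝ (g p.1) p.2).comp (ContinuousLinearMap.inr ℝ ℝ (Vec n))))
          (Set.Ioo 0 T ×ˢ Set.univ) :=
        (InnerProductSpace.toDual ℝ (Vec n)).symm.continuous.comp_continuousOn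
          (hw.continuousOn_space₁.clm_comp continuousOn_const)
      refine h1.congr fun p hp => ?_
      simp only [_root_.jetOf, gradX, gradient, hfd p.1 hp.1 p.2.1]
    cont_fl := by
      have h1 : ContinuousOn (fun p : ℝ × ℝ × Vec n =>
          ∑ i : Fin n, fderiv ℝ (fderiv ℝ (g p.1)) (p.2.1, p.2.2) (0, EuclideanSpace.single i 1)
            (0, EuclideanSpace.single i 1)) (Set.Ioo 0 T ×ˢ Set.univ) :=
        continuousOn_finsetSum _ fun i _ => c2 _ _
      exact h1.congr fun p hp => hfl p.1 hp.1 p.2.1 p.2.2 }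

end Jets

/-! ### Integrals over time, signal and position -/

lemma integral_linear_comb₄ {α : Type*} [MeasurableSpace α] {μ : Measure α} {f₁ f₂ f₃ f₄ : α → ℝ}
    (h₁ : Integrable f₁ μ) (h₂ : Integrable f₂ μ) (h₃ : Integrable f₃ μ) (h₄ : Integrable f₄ μ)
    (a₁ a₂ a₃ a₄ : ℝ) :
    ∫ q, (a₁ * f₁ q + a₂ * f₂ q + a₃ * f₃ q + a₄ * f₄ q) ∂μ
      = a₁ * ∫ q, f₁ q ∂μ + a₂ * ∫ q, f₂ q ∂μ + a₃ * ∫ q, f₃ q ∂μ + a₄ * ∫ q, f₄ q ∂μ := by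
  have e₁ := h₁.const_mul a₁
  have e₂ := h₂.const_mul a₂
  have e₃ := h₃.const_mul a₃
  have e₄ := h₄.const_mul a₄
  have h12 : Integrable (fun q => a₁ * f₁ q + a₂ * f₂ q) μ := e₁.add e₂
  have h123 : Integrable (fun q => a₁ * f₁ q + a₂ * f₂ q + a₃ * f₃ q) μ := h12.add e₃
  rw [integral_add h123 e₄, integral_add h12 e₃, integral_add e₁ e₂]
  simp only [integral_const_mul]

section Slab

variable {n : ℕ}

/-- Lebesgue measure on `I × ℝ × [0,1]ⁿ`. -/
def slabMeasure (n : ℕ) (I : Set ℝ) : Measure (ℝ × ℝ × Vec n) :=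
  (volume.restrict I).prod (stripMeasure n)

lemma slabMeasure_eq_restrict (I : Set ℝ) :
    slabMeasure n I = ((volume : Measure ℝ).prod (stripMeasure n)).restrict (I ×ˢ Set.univ) := by
  rw [slabMeasure, ← Measure.prod_restrict, Measure.restrict_univ]

lemma JointCont.aestronglyMeasurable {I : Set ℝ} (hI : MeasurableSet I) {f : ℝ → ℝ → Vec n → ℝ}
    (hf : JointCont I f) :
    AEStronglyMeasurable (fun p : ℝ × ℝ × Vec n => f p.1 p.2.1 p.2.2) (slabMeasure n I) := by
  rw [slabMeasure_eq_restrict]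
  exact ContinuousOn.aestronglyMeasurable hf (hI.prod MeasurableSet.univ)

/-- By Tonelli, it suffices to bound the L¹ norms of the time slices uniformly over a time set of
finite length; this is the form in which moment bounds will be available. -/
lemma integrable_slab_of_bound {I : Set ℝ} (hI : MeasurableSet I) (hI' : volume I ≠ ⊤)
    {f : ℝ → ℝ → Vec n → ℝ} (hf : JointCont I f) {B : ℝ≥0∞} (hB : B ≠ ⊤)
    (h : ∀ t ∈ I, ∫⁻ q, ‖f t q.1 q.2‖ₑ ∂stripMeasure n ≤ B) :
    Integrable (fun p : ℝ × ℝ × Vec n => f p.1 p.2.1 p.2.2) (slabMeasure n I) := by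
  have hm := hf.aestronglyMeasurable hI
  refine ⟨hm, ?_⟩
  rw [hasFiniteIntegral_iff_enorm, slabMeasure, lintegral_prod _ (by exact hm.enorm)]
  calc ∫⁻ t in I, ∫⁻ q, ‖f t q.1 q.2‖ₑ ∂stripMeasure n ≤ ∫⁻ t in I, B :=
        setLIntegral_mono' hI h
    _ = B * volume I := by simp
    _ < ⊤ := ENNReal.mul_lt_top hB.lt_top hI'.lt_top

lemma exists_bound_of_signalSupport {a b : ℝ} {f : ℝ → ℝ → Vec n → ℝ} {R : ℝ}
    (hf : JointCont (Set.Icc a b) f) :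
    ∃ C, ∀ t ∈ Set.Icc a b, ∀ z, |z| ≤ R → ∀ y ∈ unitCube n, |f t z y| ≤ C := by
  have hc : IsCompact (Set.Icc a b ×ˢ (Set.Icc (-R) R ×ˢ unitCube n)) :=
    isCompact_Icc.prod (isCompact_strip R)
  obtain ⟨C, hC⟩ := hc.exists_bound_of_continuousOn
    (ContinuousOn.mono hf (Set.prod_mono subset_rfl (Set.subset_univ _)))
  exact ⟨C, fun t ht z hz y hy => hC (t, z, y) ⟨ht, abs_le.1 hz, hy⟩⟩

lemma stripMeasure_ae_mem_cube : ∀ᵐ q ∂stripMeasure n, q.2 ∈ unitCube n := by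
  have h : ∀ᵐ y ∂cubeMeasure n, y ∈ unitCube n := ae_restrict_mem measurableSet_unitCube
  exact Measure.quasiMeasurePreserving_snd.ae h

lemma stripMeasure_slice_lt_top (R : ℝ) :
    stripMeasure n (Set.Icc (-R) R ×ˢ Set.univ) < ⊤ := by
  rw [stripMeasure, Measure.prod_prod]
  simp

lemma lintegral_strip_le_of_signalSupport {f : ℝ → Vec n → ℝ} {R C : ℝ}
    (hs : SignalSupport R f) (hb : ∀ z, |z| ≤ R → ∀ y ∈ unitCube n, |f z y| ≤ C) :
    ∫⁻ q, ‖f q.1 q.2‖ₑ ∂stripMeasure n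
      ≤ ENNReal.ofReal C * stripMeasure n (Set.Icc (-R) R ×ˢ Set.univ) := by
  rw [← setLIntegral_const, ← lintegral_indicator (measurableSet_Icc.prod MeasurableSet.univ)]
  refine lintegral_mono_ae ?_
  filter_upwards [stripMeasure_ae_mem_cube] with q hq
  by_cases h : |q.1| ≤ R
  · rw [Set.indicator_of_mem (show q ∈ Set.Icc (-R) R ×ˢ Set.univ from ⟨abs_le.1 h, trivial⟩)]
    rw [← ofReal_norm]
    exact ENNReal.ofReal_le_ofReal (hb _ h _ hq)
  · simp [hs q.1 (not_le.1 h) q.2]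

lemma integrable_slab_of_signalSupport {a b : ℝ} {f : ℝ → ℝ → Vec n → ℝ} {R : ℝ}
    (hf : JointCont (Set.Icc a b) f) (hs : ∀ t ∈ Set.Icc a b, SignalSupport R (f t)) :
    Integrable (fun p : ℝ × ℝ × Vec n => f p.1 p.2.1 p.2.2) (slabMeasure n (Set.Icc a b)) := by
  obtain ⟨C, hC⟩ := exists_bound_of_signalSupport (R := R) hf
  exact integrable_slab_of_bound measurableSet_Icc (by simp) hf
    (ENNReal.mul_ne_top ENNReal.ofReal_ne_top (stripMeasure_slice_lt_top R).ne)
    fun t ht => lintegral_strip_le_of_signalSupport (hs t ht) (hC t ht)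

/-- Continuity in time of integrals with compact signal support. -/
lemma continuousOn_integral_strip {I : Set ℝ} {f : ℝ → ℝ → Vec n → ℝ} {R : ℝ}
    (hf : JointCont I f) (hs : ∀ t ∈ I, SignalSupport R (f t))
    (hI : ∀ t ∈ I, ∃ a b, Set.Icc a b ⊆ I ∧ Set.Icc a b ∈ 𝓝[I] t) :
    ContinuousOn (fun t => ∫ q, f t q.1 q.2 ∂stripMeasure n) I := by
  intro t ht
  obtain ⟨a, b, hab, hn⟩ := hI t ht
  -- Joint continuity on I need not give a global bound; a compact time neighbourhood inside I
  -- supplies the dominating constant.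
  obtain ⟨C, hC⟩ := exists_bound_of_signalSupport (R := R) (hf.mono hab)
  refine tendsto_integral_filter_of_dominated_convergence
    ((Set.Icc (-R) R ×ˢ Set.univ).indicator fun _ => C) ?_ ?_ ?_ ?_
  · filter_upwards [self_mem_nhdsWithin] with t' ht'
    exact (hf.slice ht').aestronglyMeasurable
  · filter_upwards [hn] with t' ht'
    filter_upwards [stripMeasure_ae_mem_cube] with q hq
    by_cases h : |q.1| ≤ R
    · rw [Set.indicator_of_mem (show q ∈ Set.Icc (-R) R ×ˢ Set.univ from ⟨abs_le.1 h, trivial⟩)]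
      exact hC _ ht' _ h _ hq
    · rw [Set.indicator_of_notMem (fun h' => h (abs_le.2 h'.1))]
      simp [hs t' (hab ht') q.1 (not_le.1 h) q.2]
  · refine (integrable_indicator_iff (measurableSet_Icc.prod MeasurableSet.univ)).2 ?_
    exact integrableOn_const (stripMeasure_slice_lt_top R).ne
  · refine ae_of_all _ fun q => ?_
    have h1 : ContinuousWithinAt (fun t => (t, q)) I t := by fun_prop
    exact (hf (t, q) ⟨ht, trivial⟩).tendsto.comp
      (tendsto_nhdsWithin_iff.2 ⟨h1, by filter_upwards [self_mem_nhdsWithin] with t' ht'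
                                        exact ⟨ht', trivial⟩⟩)

/-- The fundamental theorem of calculus under the integral over the strip. -/
lemma integral_strip_sub {t₁ t₂ R : ℝ} (h12 : t₁ ≤ t₂) {f ft : ℝ → ℝ → Vec n → ℝ}
    (hd : ∀ t ∈ Set.Icc t₁ t₂, ∀ z y, HasDerivAt (fun t => f t z y) (ft t z y) t)
    (hf : JointCont (Set.Icc t₁ t₂) f) (hft : JointCont (Set.Icc t₁ t₂) ft)
    (hs : ∀ t ∈ Set.Icc t₁ t₂, SignalSupport R (f t))
    (hst : ∀ t ∈ Set.Icc t₁ t₂, SignalSupport R (ft t)) :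
    ∫ q, f t₂ q.1 q.2 ∂stripMeasure n - ∫ q, f t₁ q.1 q.2 ∂stripMeasure n
      = ∫ t in t₁..t₂, ∫ q, ft t q.1 q.2 ∂stripMeasure n := by
  have m1 : t₁ ∈ Set.Icc t₁ t₂ := ⟨le_rfl, h12⟩
  have m2 : t₂ ∈ Set.Icc t₁ t₂ := ⟨h12, le_rfl⟩
  have hi := integrable_slab_of_signalSupport hft hst
  rw [slabMeasure] at hi
  rw [intervalIntegral.integral_of_le h12, ← integral_Icc_eq_integral_Ioc,
    integral_integral_swap (f := fun t (q : ℝ × Vec n) => ft t q.1 q.2) hi,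
    ← integral_sub (integrable_strip_of_signalSupport (hf.slice m2) (hs t₂ m2))
      (integrable_strip_of_signalSupport (hf.slice m1) (hs t₁ m1))]
  refine integral_congr_ae (ae_of_all _ fun q => ?_)
  simp only
  rw [integral_Icc_eq_integral_Ioc, ← intervalIntegral.integral_of_le h12]
  refine (intervalIntegral.integral_eq_sub_of_hasDerivAt (f := fun t => f t q.1 q.2)
    (fun t ht => hd t (by rwa [Set.uIcc_of_le h12] at ht) _ _) ?_).symm
  refine ContinuousOn.intervalIntegrable ?_
  rw [Set.uIcc_of_le h12]
  exact ContinuousOn.comp hft (by fun_prop : Continuous fun t : ℝ => (t, q.1, q.2)).continuousOn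
    fun t ht => ⟨ht, trivial⟩

end Slab

/-! ### Fokker–Planck equations -/

section FokkerPlanck

variable {n : ℕ}

/-- A continuous periodic drift with exponential growth. -/
structure IsDrift (T : ℝ) (b : ℝ → ℝ → Vec n → Vec n) : Prop where
  periodic : ∀ t ∈ Set.Ioo 0 T, ∀ z, IsPeriodic (b t z)
  cont : JointCont (Set.Ioo 0 T) b
  growth : ∃ K k : ℝ, ∀ t ∈ Set.Ioo 0 T, ∀ z y, ‖b t z y‖ ≤ K * Real.exp (k * |z|)

/-- The jet `J` is a probability solution of the Fokker–Planck equation with drift `s` in the signal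
and `b` in the position, starting from `δ₀ ⊗ ρ₀`. -/
structure IsFP (σ σ' T s : ℝ) (b : ℝ → ℝ → Vec n → Vec n) (ρ₀ : ProbabilityMeasure (Torus n))
    (J : Jet n) : Prop where
  c12 : J.IsC12 (Set.Ioo 0 T)
  cont : JointCont (Set.Ioc 0 T) J.f
  nonneg : ∀ t ∈ Set.Ioc 0 T, ∀ z y, 0 ≤ J.f t z y
  mass : ∀ t ∈ Set.Ioc 0 T, ∫⁻ q, ENNReal.ofReal (J.f t q.1 q.2) ∂stripMeasure n = 1
  flux_diff : ∀ t ∈ Set.Ioo 0 T, ∀ z, Differentiable ℝ fun y => J.f t z y • b t z y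
  equation : ∀ t ∈ Set.Ioo 0 T, ∀ z y, J.ft t z y + divX (fun y => J.f t z y • b t z y) y
    + s * J.fz t z y - σ ^ 2 / 2 * J.fzz t z y - σ' ^ 2 / 2 * J.fl t z y = 0
  initial : ∀ f : (ℝ × Torus n) →ᵇ ℝ,
    Tendsto (fun t => ∫ q, f (q.1, toTorus q.2) * J.f t q.1 q.2 ∂stripMeasure n) (𝓝[>] 0)
      (𝓝 (∫ x, f (0, x) ∂(ρ₀ : Measure (Torus n))))

/-- The part of the adjoint Fokker–Planck operator without time derivative. -/
def fpSpace (σ σ' s : ℝ) (b : ℝ → ℝ → Vec n → Vec n) (Ψ : Jet n) (t z : ℝ) (y : Vec n) : ℝ :=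
  s * Ψ.fz t z y + σ ^ 2 / 2 * Ψ.fzz t z y + σ' ^ 2 / 2 * Ψ.fl t z y
    + inner ℝ (Ψ.fg t z y) (b t z y)

/-- The adjoint Fokker–Planck operator. -/
def fpAdj (σ σ' s : ℝ) (b : ℝ → ℝ → Vec n → Vec n) (Ψ : Jet n) (t z : ℝ) (y : Vec n) : ℝ :=
  Ψ.ft t z y + fpSpace σ σ' s b Ψ t z y

variable {σ σ' T s : ℝ} {b : ℝ → ℝ → Vec n → Vec n} {ρ₀ : ProbabilityMeasure (Torus n)} {J : Jet n}

lemma jointCont_fpSpace {I : Set ℝ} {Ψ : Jet n} (hΨ : Ψ.IsC12 I) (hb : JointCont I b) :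
    JointCont I (fpSpace σ σ' s b Ψ) :=
  ((((hΨ.cont_fz.const_mul s).add (hΨ.cont_fzz.const_mul _)).add (hΨ.cont_fl.const_mul _)).add
    (ContinuousOn.inner hΨ.cont_fg hb))

lemma jointCont_fpAdj {I : Set ℝ} {Ψ : Jet n} (hΨ : Ψ.IsC12 I) (hb : JointCont I b) :
    JointCont I (fpAdj σ σ' s b Ψ) := ContinuousOn.add hΨ.cont_ft (jointCont_fpSpace hΨ hb)

/-- The flux is only assumed differentiable. Its divergence is nevertheless continuous, because the
equation expresses it through the other terms, which are. -/
lemma IsFP.continuous_div (h : IsFP σ σ' T s b ρ₀ J) {t : ℝ} (ht : t ∈ Set.Ioo 0 T) :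
    Continuous fun q : ℝ × Vec n => divX (fun y => J.f t q.1 y • b t q.1 y) q.2 := by
  have e : (fun q : ℝ × Vec n => divX (fun y => J.f t q.1 y • b t q.1 y) q.2)
      = fun q => σ ^ 2 / 2 * J.fzz t q.1 q.2 + σ' ^ 2 / 2 * J.fl t q.1 q.2 - J.ft t q.1 q.2
        - s * J.fz t q.1 q.2 := by
    funext q
    linarith [h.equation t ht q.1 q.2]
  rw [e]
  exact ((((h.c12.cont_fzz.slice ht).const_mul _).add ((h.c12.cont_fl.slice ht).const_mul _)).sub
    (h.c12.cont_ft.slice ht)).sub ((h.c12.cont_fz.slice ht).const_mul _)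

/-- The weak form of the Fokker–Planck equation at a fixed time. -/
lemma IsFP.weak_form (h : IsFP σ σ' T s b ρ₀ J) (hb : IsDrift T b) {t : ℝ} (ht : t ∈ Set.Ioo 0 T)
    {Ψ : Jet n} {I : Set ℝ} (hΨ : Ψ.IsC12 I) (htI : t ∈ I) {R : ℝ} (hs : SignalSupport R (Ψ.f t)) :
    ∫ q, Ψ.f t q.1 q.2 * J.ft t q.1 q.2 ∂stripMeasure n
      = ∫ q, fpSpace σ σ' s b Ψ t q.1 q.2 * J.f t q.1 q.2 ∂stripMeasure n := by
  have hJ := h.c12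
  have sz := hs.deriv (hΨ.hasDerivAt_z t htI)
  have szz := sz.deriv (hΨ.hasDerivAt_zz t htI)
  have sg := hs.gradient (hΨ.hasGradientAt t htI)
  have sl : SignalSupport R (Ψ.fl t) := fun z hz y => by
    rw [← hΨ.divX_fg t htI z y]; exact sg.divX z hz y
  have cJ := hJ.cont_f.slice ht
  have cJz := hJ.cont_fz.slice ht
  have cJzz := hJ.cont_fzz.slice ht
  have cJg := hJ.cont_fg.slice ht
  have cJl := hJ.cont_fl.slice ht
  have cΨ := hΨ.cont_f.slice htI
  have cΨz := hΨ.cont_fz.slice htI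
  have cΨzz := hΨ.cont_fzz.slice htI
  have cΨg := hΨ.cont_fg.slice htI
  have cΨl := hΨ.cont_fl.slice htI
  have cb := hb.cont.slice ht
  have cV : Continuous fun q : ℝ × Vec n => J.f t q.1 q.2 • b t q.1 q.2 := cJ.smul cb
  have cdV := h.continuous_div ht
  have eJl : ∀ z y, divX (J.fg t z) y = J.fl t z y := hJ.divX_fg t ht
  have eΨl : ∀ z y, divX (Ψ.fg t z) y = Ψ.fl t z y := hΨ.divX_fg t htI
  -- All derivatives are moved from the density to the test function: once for the drift and the
  -- transport, twice for the two diffusions, whose second steps are `I3'` and `I4'`. In `I4'` the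
  -- density is the scalar factor and the gradient of Ψ is the compactly supported field.
  have I1 := strip_ibp_x (V := fun z y => J.f t z y • b t z y) (Or.inl hs) (hΨ.periodic t)
    (fun z y y' e => by simp only [hJ.periodic t z y y' e, hb.periodic t ht z y y' e])
    (hΨ.hasGradientAt t htI) (h.flux_diff t ht) cΨ cΨg cV cdV
  have I2 := strip_ibp_z hs (hΨ.hasDerivAt_z t htI) (hJ.hasDerivAt_z t ht) cΨ cΨz cJ cJz
  have I3 := strip_ibp_z hs (hΨ.hasDerivAt_z t htI) (hJ.hasDerivAt_zz t ht) cΨ cΨz cJz cJzz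
  have I3' := strip_ibp_z sz (hΨ.hasDerivAt_zz t htI) (hJ.hasDerivAt_z t ht) cΨz cΨzz cJ cJz
  have I4 := strip_ibp_x (V := J.fg t) (Or.inl hs) (hΨ.periodic t) (hJ.periodic_fg ht)
    (hΨ.hasGradientAt t htI) (hJ.differentiable_fg t ht) cΨ cΨg cJg (by simpa only [eJl] using cJl)
  have I4' := strip_ibp_x (V := Ψ.fg t) (Or.inr sg) (hJ.periodic t) (hΨ.periodic_fg htI)
    (hJ.hasGradientAt t ht) (hΨ.differentiable_fg t htI) cJ cJg cΨg
    (by simpa only [eΨl] using cΨl)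
  simp only [eJl, eΨl] at I4 I4'
  have j1 := integrable_strip_of_signalSupport (cΨ.mul cdV) (R := R)
    (f := fun z y => Ψ.f t z y * divX (fun y => J.f t z y • b t z y) y)
    fun z hz y => by simp [hs z hz y]
  have j2 := integrable_strip_of_signalSupport (cΨ.mul cJz) (R := R)
    (f := fun z y => Ψ.f t z y * J.fz t z y) fun z hz y => by simp [hs z hz y]
  have j3 := integrable_strip_of_signalSupport (cΨ.mul cJzz) (R := R)
    (f := fun z y => Ψ.f t z y * J.fzz t z y) fun z hz y => by simp [hs z hz y]
  have j4 := integrable_strip_of_signalSupport (cΨ.mul cJl) (R := R)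
    (f := fun z y => Ψ.f t z y * J.fl t z y) fun z hz y => by simp [hs z hz y]
  have k1 := integrable_strip_of_signalSupport (cΨg.inner (𝕜 := ℝ) cV) (R := R)
    (f := fun z y => inner ℝ (Ψ.fg t z y) (J.f t z y • b t z y))
    fun z hz y => by simp [sg z hz y]
  have k2 := integrable_strip_of_signalSupport (cΨz.mul cJ) (R := R)
    (f := fun z y => Ψ.fz t z y * J.f t z y) fun z hz y => by simp [sz z hz y]
  have k3 := integrable_strip_of_signalSupport (cΨzz.mul cJ) (R := R)
    (f := fun z y => Ψ.fzz t z y * J.f t z y) fun z hz y => by simp [szz z hz y]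
  have k4 := integrable_strip_of_signalSupport (cJ.mul cΨl) (R := R)
    (f := fun z y => J.f t z y * Ψ.fl t z y) fun z hz y => by simp [sl z hz y]
  have eL : ∀ q : ℝ × Vec n, Ψ.f t q.1 q.2 * J.ft t q.1 q.2
      = σ ^ 2 / 2 * (Ψ.f t q.1 q.2 * J.fzz t q.1 q.2)
        + σ' ^ 2 / 2 * (Ψ.f t q.1 q.2 * J.fl t q.1 q.2)
        + (-1) * (Ψ.f t q.1 q.2 * divX (fun y => J.f t q.1 y • b t q.1 y) q.2)
        + (-s) * (Ψ.f t q.1 q.2 * J.fz t q.1 q.2) := fun q => by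
    linear_combination Ψ.f t q.1 q.2 * h.equation t ht q.1 q.2
  have eR : ∀ q : ℝ × Vec n, fpSpace σ σ' s b Ψ t q.1 q.2 * J.f t q.1 q.2
      = s * (Ψ.fz t q.1 q.2 * J.f t q.1 q.2) + σ ^ 2 / 2 * (Ψ.fzz t q.1 q.2 * J.f t q.1 q.2)
        + σ' ^ 2 / 2 * (J.f t q.1 q.2 * Ψ.fl t q.1 q.2)
        + 1 * inner ℝ (Ψ.fg t q.1 q.2) (J.f t q.1 q.2 • b t q.1 q.2) := fun q => by
    rw [fpSpace, inner_smul_right]; ring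
  have eg : ∀ q : ℝ × Vec n, inner ℝ (J.fg t q.1 q.2) (Ψ.fg t q.1 q.2)
      = inner ℝ (Ψ.fg t q.1 q.2) (J.fg t q.1 q.2) := fun q => real_inner_comm _ _
  simp only [eg] at I4'
  simp_rw [eL, eR]
  rw [integral_linear_comb₄ j3 j4 j1 j2, integral_linear_comb₄ k2 k3 k4 k1]
  rw [I1, I2, I3, I3', I4, I4']
  ring

/-- Duality with test functions of compact signal support, away from the initial time. -/
lemma IsFP.pairing_interior (h : IsFP σ σ' T s b ρ₀ J) (hb : IsDrift T b) {t₁ t₂ T' : ℝ}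
    (h0 : 0 < t₁) (h12 : t₁ ≤ t₂) (h2 : t₂ < T') (hT' : T' ≤ T)
    {Ψ : Jet n} (hΨ : Ψ.IsC12 (Set.Ioo 0 T')) {R : ℝ}
    (hs : ∀ t ∈ Set.Ioo 0 T', SignalSupport R (Ψ.f t)) :
    ∫ q, Ψ.f t₂ q.1 q.2 * J.f t₂ q.1 q.2 ∂stripMeasure n
        - ∫ q, Ψ.f t₁ q.1 q.2 * J.f t₁ q.1 q.2 ∂stripMeasure n
      = ∫ t in t₁..t₂, ∫ q, fpAdj σ σ' s b Ψ t q.1 q.2 * J.f t q.1 q.2 ∂stripMeasure n := by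
  have hsub : Set.Icc t₁ t₂ ⊆ Set.Ioo 0 T' := fun t ht =>
    ⟨h0.trans_le ht.1, ht.2.trans_lt h2⟩
  have hsub' : Set.Icc t₁ t₂ ⊆ Set.Ioo 0 T := fun t ht =>
    ⟨h0.trans_le ht.1, (ht.2.trans_lt h2).trans_le hT'⟩
  have hJ := h.c12.mono hsub'
  have hΨ' := hΨ.mono hsub
  have st : ∀ t ∈ Set.Icc t₁ t₂, SignalSupport R (Ψ.ft t) := fun t ht z hz y => by
    have : (fun t => Ψ.f t z y) =ᶠ[𝓝 t] fun _ => 0 := by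
      filter_upwards [isOpen_Ioo.mem_nhds (hsub ht)] with t' ht'
      exact hs t' ht' z hz y
    exact (hΨ'.hasDerivAt_t t ht z y).unique
      ((hasDerivAt_const t (0 : ℝ)).congr_of_eventuallyEq this)
  rw [integral_strip_sub (R := R) h12 (f := fun t z y => Ψ.f t z y * J.f t z y)
    (ft := fun t z y => Ψ.ft t z y * J.f t z y + Ψ.f t z y * J.ft t z y)
    (fun t ht z y => (hΨ'.hasDerivAt_t t ht z y).mul (hJ.hasDerivAt_t t ht z y))
    (ContinuousOn.mul hΨ'.cont_f hJ.cont_f)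
    (ContinuousOn.add (ContinuousOn.mul hΨ'.cont_ft hJ.cont_f)
      (ContinuousOn.mul hΨ'.cont_f hJ.cont_ft))
    (fun t ht z hz y => by simp [hs t (hsub ht) z hz y])
    (fun t ht z hz y => by simp [hs t (hsub ht) z hz y, st t ht z hz y])]
  refine intervalIntegral.integral_congr fun t ht => ?_
  rw [Set.uIcc_of_le h12] at ht
  have sz := (hs t (hsub ht)).deriv (hΨ'.hasDerivAt_z t ht)
  have szz := sz.deriv (hΨ'.hasDerivAt_zz t ht)
  have sg := (hs t (hsub ht)).gradient (hΨ'.hasGradientAt t ht)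
  have i1 := integrable_strip_of_signalSupport (R := R)
    ((hΨ'.cont_ft.slice ht).mul (hJ.cont_f.slice ht)) (f := fun z y => Ψ.ft t z y * J.f t z y)
    (fun z hz y => by simp [st t ht z hz y])
  have i2 := integrable_strip_of_signalSupport (R := R)
    ((hΨ'.cont_f.slice ht).mul (hJ.cont_ft.slice ht)) (f := fun z y => Ψ.f t z y * J.ft t z y)
    (fun z hz y => by simp [hs t (hsub ht) z hz y])
  have cS : Continuous fun q : ℝ × Vec n => fpSpace σ σ' s b Ψ t q.1 q.2 :=
    (jointCont_fpSpace hΨ' (hb.cont.mono hsub')).slice ht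
  have i3 := integrable_strip_of_signalSupport (R := R)
    (cS.mul (hJ.cont_f.slice ht)) (f := fun z y => fpSpace σ σ' s b Ψ t z y * J.f t z y)
    (fun z hz y => by
      have : Ψ.fl t z y = 0 := by rw [← hΨ'.divX_fg t ht z y]; exact sg.divX z hz y
      simp [fpSpace, sz z hz y, szz z hz y, sg z hz y, this])
  simp only [fpAdj, add_mul]
  rw [integral_add i1 i2, integral_add i1 i3, h.weak_form hb (hsub' ht) hΨ' ht (hs t (hsub ht))]

end FokkerPlanck

/-! ### Cutoffs in the signal -/

section Cutoff

/-- A smooth bump function on the line. -/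
def lineBump : ContDiffBump (0 : ℝ) := ⟨1, 2, by norm_num, by norm_num⟩

/-- The cutoff `z ↦ χ(z / R)` with its derivatives. -/
def cutoffJet (R : ℝ) : SignalJet where
  e _ z := lineBump (z / R)
  et _ _ := 0
  ez _ z := deriv lineBump (z / R) / R
  ezz _ z := deriv (deriv lineBump) (z / R) / R ^ 2

lemma contDiff_lineBump : ContDiff ℝ 3 lineBump := lineBump.contDiff

lemma contDiff_deriv_lineBump : ContDiff ℝ 2 (deriv lineBump) :=
  ((contDiff_succ_iff_deriv (n := 2)).1 (by exact_mod_cast contDiff_lineBump)).2.2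

lemma contDiff_deriv_deriv_lineBump : ContDiff ℝ 1 (deriv (deriv lineBump)) :=
  ((contDiff_succ_iff_deriv (n := 1)).1 (by exact_mod_cast contDiff_deriv_lineBump)).2.2

lemma exists_lineBump_bound : ∃ C : ℝ, 0 ≤ C ∧ ∀ z,
    |deriv lineBump z| ≤ C ∧ |deriv (deriv lineBump) z| ≤ C := by
  have h0 : HasCompactSupport (lineBump : ℝ → ℝ) := lineBump.hasCompactSupport
  obtain ⟨C₁, h1⟩ := contDiff_deriv_lineBump.continuous.bounded_above_of_compact_support h0.deriv
  obtain ⟨C₂, h2⟩ :=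
    contDiff_deriv_deriv_lineBump.continuous.bounded_above_of_compact_support h0.deriv.deriv
  exact ⟨max C₁ C₂, (norm_nonneg _).trans ((h1 0).trans (le_max_left _ _)),
    fun z => ⟨(h1 z).trans (le_max_left _ _), (h2 z).trans (le_max_right _ _)⟩⟩

lemma cutoffJet_isC12 (R : ℝ) (I : Set ℝ) : (cutoffJet R).IsC12 I where
  hasDerivAt_t t _ z := hasDerivAt_const t _
  hasDerivAt_z t _ z := by
    have h1 : HasDerivAt lineBump (deriv lineBump (z / R)) (z / R) :=
      (contDiff_lineBump.differentiable (by norm_num) _).hasDerivAt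
    have := h1.comp z ((hasDerivAt_id z).div_const R)
    simpa [cutoffJet, Function.comp_def, div_eq_mul_inv] using this
  hasDerivAt_zz t _ z := by
    have h1 : HasDerivAt (deriv lineBump) (deriv (deriv lineBump) (z / R)) (z / R) :=
      (contDiff_deriv_lineBump.differentiable (by norm_num) _).hasDerivAt
    have := (h1.comp z ((hasDerivAt_id z).div_const R)).div_const R
    refine this.congr_deriv ?_
    simp only [cutoffJet]
    ring
  cont_e := (contDiff_lineBump.continuous.comp
    (by fun_prop : Continuous fun p : ℝ × ℝ => p.2 / R)).continuousOn
  cont_et := continuousOn_const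
  cont_ez := ((contDiff_deriv_lineBump.continuous.comp
    (by fun_prop : Continuous fun p : ℝ × ℝ => p.2 / R)).div_const _).continuousOn
  cont_ezz := ((contDiff_deriv_deriv_lineBump.continuous.comp
    (by fun_prop : Continuous fun p : ℝ × ℝ => p.2 / R)).div_const _).continuousOn

lemma cutoff_nonneg (R t z : ℝ) : 0 ≤ (cutoffJet R).e t z := lineBump.nonneg

lemma cutoff_le_one (R t z : ℝ) : (cutoffJet R).e t z ≤ 1 := lineBump.le_one

lemma cutoff_eq_one {R t z : ℝ} (hR : 0 < R) (hz : |z| ≤ R) : (cutoffJet R).e t z = 1 := by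
  refine lineBump.one_of_mem_closedBall ?_
  simp only [Metric.mem_closedBall, dist_zero_right, Real.norm_eq_abs, abs_div, abs_of_pos hR]
  rw [div_le_iff₀ hR]
  simpa [lineBump] using hz

lemma cutoff_eq_zero {R t z : ℝ} (hR : 0 < R) (hz : 2 * R < |z|) : (cutoffJet R).e t z = 0 := by
  refine lineBump.zero_of_le_dist ?_
  simp only [dist_zero_right, Real.norm_eq_abs, abs_div, abs_of_pos hR]
  rw [le_div_iff₀ hR]
  simpa [lineBump] using hz.le

lemma tendsto_cutoff (t z : ℝ) :
    Tendsto (fun j : ℕ => (cutoffJet ((j : ℝ) + 1)).e t z) atTop (𝓝 1) := by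
  refine tendsto_const_nhds.congr' ?_
  obtain ⟨N, hN⟩ := exists_nat_ge |z|
  filter_upwards [eventually_ge_atTop N] with j hj
  have : (N : ℝ) ≤ j := by exact_mod_cast hj
  exact (cutoff_eq_one (by positivity) (by linarith)).symm

lemma tendsto_inv_nat_succ : Tendsto (fun j : ℕ => ((j : ℝ) + 1)⁻¹) atTop (𝓝 0) := by
  simpa using tendsto_one_div_add_atTop_nhds_zero_nat (𝕜 := ℝ)

lemma abs_cutoff_ez_le {C : ℝ} (hC : ∀ z, |deriv lineBump z| ≤ C ∧ |deriv (deriv lineBump) z| ≤ C)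
    {R : ℝ} (hR : 1 ≤ R) (t z : ℝ) :
    |(cutoffJet R).ez t z| ≤ C * R⁻¹ ∧ |(cutoffJet R).ezz t z| ≤ C * R⁻¹ := by
  have hR0 : 0 < R := by linarith
  have hC0 : 0 ≤ C := (abs_nonneg _).trans (hC 0).1
  constructor
  · simp only [cutoffJet]
    rw [abs_div, abs_of_pos hR0, div_eq_mul_inv]
    exact mul_le_mul_of_nonneg_right (hC _).1 (by positivity)
  · simp only [cutoffJet]
    rw [abs_div, abs_of_pos (pow_pos hR0 2), div_eq_mul_inv]
    refine mul_le_mul (hC _).2 ?_ (by positivity) hC0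
    -- Since R ≥ 1, R⁻² ≤ R⁻¹, and one rate serves for both derivatives.
    exact inv_anti₀ hR0 (by nlinarith)

end Cutoff

/-! ### Duality for Fokker–Planck equations -/

section Duality

variable {n : ℕ} {σ σ' T s : ℝ} {b : ℝ → ℝ → Vec n → Vec n} {ρ₀ : ProbabilityMeasure (Torus n)}
  {J : Jet n}

lemma IsFP.integrable (h : IsFP σ σ' T s b ρ₀ J) {t : ℝ} (ht : t ∈ Set.Ioc 0 T) :
    Integrable (fun q : ℝ × Vec n => J.f t q.1 q.2) (stripMeasure n) ∧
      ∫ q, J.f t q.1 q.2 ∂stripMeasure n = 1 := by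
  have hm : AEStronglyMeasurable (fun q : ℝ × Vec n => J.f t q.1 q.2) (stripMeasure n) :=
    (h.cont.slice ht).aestronglyMeasurable
  have h0 : 0 ≤ᵐ[stripMeasure n] fun q : ℝ × Vec n => J.f t q.1 q.2 :=
    ae_of_all _ fun q => h.nonneg t ht _ _
  refine ⟨⟨hm, ?_⟩, ?_⟩
  · rw [hasFiniteIntegral_iff_ofReal h0, h.mass t ht]; simp
  · rw [integral_eq_lintegral_of_nonneg_ae h0 hm, h.mass t ht]; simp

lemma IsFP.integrable_mul (h : IsFP σ σ' T s b ρ₀ J) {t : ℝ} (ht : t ∈ Set.Ioc 0 T)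
    {f : ℝ → Vec n → ℝ} (hf : Continuous fun q : ℝ × Vec n => f q.1 q.2) {C : ℝ}
    (hC : ∀ z, ∀ y ∈ unitCube n, |f z y| ≤ C) :
    Integrable (fun q : ℝ × Vec n => f q.1 q.2 * J.f t q.1 q.2) (stripMeasure n) := by
  refine ((h.integrable ht).1.const_mul C).mono' (hf.mul (h.cont.slice ht)).aestronglyMeasurable ?_
  filter_upwards [stripMeasure_ae_mem_cube] with q hq
  rw [norm_mul, Real.norm_eq_abs, Real.norm_eq_abs, abs_of_nonneg (h.nonneg t ht q.1 q.2)]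
  exact mul_le_mul_of_nonneg_right (hC _ _ hq) (h.nonneg t ht q.1 q.2)

lemma IsFP.abs_integral_mul_le (h : IsFP σ σ' T s b ρ₀ J) {t : ℝ} (ht : t ∈ Set.Ioc 0 T)
    {f : ℝ → Vec n → ℝ} {C : ℝ} (hC : ∀ z, ∀ y ∈ unitCube n, |f z y| ≤ C) :
    |∫ q, f q.1 q.2 * J.f t q.1 q.2 ∂stripMeasure n| ≤ C := by
  have h1 := norm_integral_le_of_norm_le (f := fun q : ℝ × Vec n => f q.1 q.2 * J.f t q.1 q.2)
    (μ := stripMeasure n) ((h.integrable ht).1.const_mul C) (by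
      filter_upwards [stripMeasure_ae_mem_cube] with q hq
      rw [norm_mul, Real.norm_eq_abs, Real.norm_eq_abs, abs_of_nonneg (h.nonneg t ht q.1 q.2)]
      exact mul_le_mul_of_nonneg_right (hC _ _ hq) (h.nonneg t ht q.1 q.2))
  rwa [integral_const_mul, (h.integrable ht).2, mul_one] at h1

lemma continuous_of_comp_toTorus {g : ℝ × Torus n → ℝ}
    (h : Continuous fun q : ℝ × Vec n => g (q.1, toTorus q.2)) : Continuous g := by
  have hq : IsOpenQuotientMap (Prod.map (id : ℝ → ℝ) (toTorus : Vec n → Torus n)) :=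
    IsOpenQuotientMap.id.prodMap isOpenQuotientMap_toTorus
  exact hq.continuous_comp_iff.1 h

/-- The initial condition, for time-dependent test functions of compact signal support. -/
lemma IsFP.tendsto_initial_of_signalSupport (h : IsFP σ σ' T s b ρ₀ J) {T' : ℝ} (h0 : 0 < T')
    (hT' : T' ≤ T) {Φ : ℝ → ℝ → Vec n → ℝ} (hΦ : JointCont (Set.Icc 0 T') Φ) {R : ℝ}
    (hs : ∀ t ∈ Set.Icc 0 T', SignalSupport R (Φ t)) {g : ℝ × Torus n → ℝ}
    (hg : ∀ z y, g (z, toTorus y) = Φ 0 z y) :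
    Tendsto (fun t => ∫ q, Φ t q.1 q.2 * J.f t q.1 q.2 ∂stripMeasure n) (𝓝[>] 0)
      (𝓝 (∫ x, g (0, x) ∂(ρ₀ : Measure (Torus n)))) := by
  have m0 : (0 : ℝ) ∈ Set.Icc 0 T' := ⟨le_rfl, h0.le⟩
  obtain ⟨C, hC⟩ := exists_bound_of_signalSupport (R := R) hΦ
  have hCpos : 0 ≤ |C| := abs_nonneg C
  have hC' : ∀ t ∈ Set.Icc 0 T', ∀ z, ∀ y ∈ unitCube n, |Φ t z y| ≤ |C| := fun t ht z y hy => by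
    by_cases hz : |z| ≤ R
    · exact (hC t ht z hz y hy).trans (le_abs_self C)
    · rw [hs t ht z (not_le.1 hz) y, abs_zero]; exact hCpos
  -- The initial condition is tested by functions on the torus itself, so the initial test function
  -- has to descend through the covering map as a bounded continuous function.
  have hgc : Continuous g := continuous_of_comp_toTorus (by simpa only [hg] using hΦ.slice m0)
  have hgb : ∀ q, ‖g q‖ ≤ |C| := by
    rintro ⟨z, x⟩
    obtain ⟨y, rfl⟩ := isOpenQuotientMap_toTorus.surjective x
    obtain ⟨y', hy', e⟩ := exists_unitCube_toTorus_eq y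
    rw [← e, hg]
    exact hC' 0 m0 z y' hy'
  have h1 := h.initial (BoundedContinuousFunction.ofNormedAddCommGroup g hgc |C| hgb)
  simp only [BoundedContinuousFunction.coe_ofNormedAddCommGroup, hg] at h1
  -- Freezing the test function at time 0 costs at most the supremum of Φ(t) - Φ(0), because the
  -- density has mass one; uniform continuity on the compact strip makes this small.
  have h2 : Tendsto (fun t => ∫ q, (Φ t q.1 q.2 - Φ 0 q.1 q.2) * J.f t q.1 q.2 ∂stripMeasure n)
      (𝓝[>] 0) (𝓝 0) := by
    rw [Metric.tendsto_nhds]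
    intro ε hε
    have hcomp : IsCompact (Set.Icc 0 T' ×ˢ (Set.Icc (-R) R ×ˢ unitCube n)) :=
      isCompact_Icc.prod (isCompact_strip R)
    have huc := hcomp.uniformContinuousOn_of_continuous
      (ContinuousOn.mono hΦ (Set.prod_mono subset_rfl (Set.subset_univ _)))
    obtain ⟨δ, hδ, hd⟩ := Metric.uniformContinuousOn_iff.1 huc (ε / 2) (by positivity)
    filter_upwards [Ioo_mem_nhdsGT (lt_min hδ h0)] with t ht
    have htT : t ∈ Set.Icc 0 T' := ⟨ht.1.le, (ht.2.trans_le (min_le_right _ _)).le⟩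
    rw [dist_zero_right]
    refine lt_of_le_of_lt (h.abs_integral_mul_le (C := ε / 2)
      (f := fun z y => Φ t z y - Φ 0 z y) ⟨ht.1, htT.2.trans hT'⟩ fun z y hy => ?_) (by linarith)
    by_cases hz : |z| ≤ R
    · refine (hd (t, z, y) ⟨htT, abs_le.1 hz, hy⟩ (0, z, y) ⟨m0, abs_le.1 hz, hy⟩ ?_).le
      rw [Prod.dist_eq]
      simp only [dist_self, Real.dist_eq, sub_zero]
      rw [max_eq_left (abs_nonneg _), abs_of_pos ht.1]
      exact ht.2.trans_le (min_le_left _ _)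
    · simp only [hs t htT z (not_le.1 hz) y, hs 0 m0 z (not_le.1 hz) y, sub_zero, abs_zero]
      positivity
  have h3 := h1.add h2
  rw [add_zero] at h3
  refine h3.congr' ?_
  filter_upwards [Ioc_mem_nhdsGT h0] with t ht
  have htT : t ∈ Set.Icc 0 T' := ⟨ht.1.le, ht.2⟩
  have htT2 : t ∈ Set.Ioc 0 T := ⟨ht.1, ht.2.trans hT'⟩
  have i0 := h.integrable_mul htT2 (hΦ.slice m0) (hC' 0 m0)
  have i1 := h.integrable_mul htT2 (hΦ.slice htT) (hC' t htT)
  simp only [sub_mul]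
  rw [integral_sub i1 i0]
  ring

/-- Duality with test functions of compact signal support, up to the initial time. -/
lemma IsFP.pairing_of_signalSupport (h : IsFP σ σ' T s b ρ₀ J) (hb : IsDrift T b) {T' : ℝ}
    (h0 : 0 < T') (hT' : T' ≤ T) {Ψ : Jet n} (hΨ : Ψ.IsC12 (Set.Ioo 0 T'))
    (hΨc : JointCont (Set.Icc 0 T') Ψ.f) {R : ℝ}
    (hs : ∀ t ∈ Set.Icc 0 T', SignalSupport R (Ψ.f t)) {g : ℝ × Torus n → ℝ}
    (hg : ∀ z y, g (z, toTorus y) = Ψ.f 0 z y)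
    (hi : Integrable (fun p : ℝ × ℝ × Vec n => fpAdj σ σ' s b Ψ p.1 p.2.1 p.2.2
      * J.f p.1 p.2.1 p.2.2) (slabMeasure n (Set.Ioo 0 T'))) :
    ∫ q, Ψ.f T' q.1 q.2 * J.f T' q.1 q.2 ∂stripMeasure n
        - ∫ x, g (0, x) ∂(ρ₀ : Measure (Torus n))
      = ∫ p, fpAdj σ σ' s b Ψ p.1 p.2.1 p.2.2 * J.f p.1 p.2.1 p.2.2
        ∂slabMeasure n (Set.Ioo 0 T') := by
  have hsI : ∀ t ∈ Set.Ioo 0 T', SignalSupport R (Ψ.f t) := fun t ht =>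
    hs t (Set.Ioo_subset_Icc_self ht)
  set G : ℝ → ℝ := fun t => ∫ q, fpAdj σ σ' s b Ψ t q.1 q.2 * J.f t q.1 q.2 ∂stripMeasure n with hG
  set Y : ℝ → ℝ := fun t => ∫ q, Ψ.f t q.1 q.2 * J.f t q.1 q.2 ∂stripMeasure n with hY
  have hGi : IntegrableOn G (Set.Ioo 0 T') := by
    have := hi.integral_prod_left
    exact this
  have hGi' : IntervalIntegrable G volume 0 T' := by
    rw [intervalIntegrable_iff_integrableOn_Ioo_of_le h0.le]; exact hGi
  have hpair : ∀ t₁ t₂, 0 < t₁ → t₁ ≤ t₂ → t₂ < T' → Y t₂ - Y t₁ = ∫ t in t₁..t₂, G t :=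
    fun t₁ t₂ h1 h12 h2 => h.pairing_interior hb h1 h12 h2 hT' hΨ hsI
  have hprim : ContinuousOn (fun t => ∫ r in (0 : ℝ)..t, G r) (Set.Icc 0 T') := by
    have := intervalIntegral.continuousOn_primitive_interval' hGi' (Set.left_mem_uIcc)
    rwa [Set.uIcc_of_le h0.le] at this
  have hsplit : ∀ t₁ t₂, 0 < t₁ → t₁ ≤ t₂ → t₂ < T' →
      Y t₂ - Y t₁ = (∫ r in (0 : ℝ)..t₂, G r) - ∫ r in (0 : ℝ)..t₁, G r := by
    intro t₁ t₂ h1 h12 h2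
    have hmono : ∀ c, 0 ≤ c → c ≤ T' → IntervalIntegrable G volume 0 c := fun c hc hc' =>
      hGi'.mono_set (by rw [Set.uIcc_of_le hc, Set.uIcc_of_le h0.le]
                        exact Set.Icc_subset_Icc_right hc')
    rw [hpair t₁ t₂ h1 h12 h2, intervalIntegral.integral_interval_sub_left
      (hmono t₂ (h1.le.trans h12) h2.le) (hmono t₁ h1.le (h12.trans h2.le))]
  have hYc : ContinuousOn Y (Set.Ioc 0 T') := by
    refine continuousOn_integral_strip (R := R) (f := fun t z y => Ψ.f t z y * J.f t z y)
      (ContinuousOn.mul (hΨc.mono Set.Ioc_subset_Icc_self)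
        (h.cont.mono (Set.Ioc_subset_Ioc_right hT'))) (fun t ht z hz y => ?_) fun t ht => ?_
    · simp [hs t (Set.Ioc_subset_Icc_self ht) z hz y]
    · refine ⟨t / 2, T', fun r hr => ⟨by linarith [ht.1, hr.1], hr.2⟩, ?_⟩
      filter_upwards [self_mem_nhdsWithin, mem_nhdsWithin_of_mem_nhds
        (Ioi_mem_nhds (show t / 2 < t by linarith [ht.1]))] with r hr hr'
      exact ⟨le_of_lt hr', hr.2⟩
  -- The equations hold only at interior times, so both ends are reached by limits: the upper end
  -- through continuity of the pairing `Y` on (0, T'], the lower end through the weak initial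
  -- condition.
  have htop : ∀ t₁, 0 < t₁ → t₁ < T' →
      Y T' - Y t₁ = (∫ r in (0 : ℝ)..T', G r) - ∫ r in (0 : ℝ)..t₁, G r := by
    intro t₁ h1 h2
    have l1 : Tendsto Y (𝓝[<] T') (𝓝 (Y T')) :=
      ((hYc T' ⟨h0, le_rfl⟩).mono_of_mem_nhdsWithin (by
        filter_upwards [Ioo_mem_nhdsLT h0] with r hr using ⟨hr.1, hr.2.le⟩)).tendsto
    have l2 : Tendsto (fun t => ∫ r in (0 : ℝ)..t, G r) (𝓝[<] T') (𝓝 (∫ r in (0 : ℝ)..T', G r)) :=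
      ((hprim T' ⟨h0.le, le_rfl⟩).mono_of_mem_nhdsWithin (by
        filter_upwards [Ioo_mem_nhdsLT h0] with r hr using ⟨hr.1.le, hr.2.le⟩)).tendsto
    refine tendsto_nhds_unique (l1.sub_const (Y t₁)) ((l2.sub_const _).congr' ?_)
    filter_upwards [Ioo_mem_nhdsLT h2] with r hr
    exact (hsplit t₁ r h1 hr.1.le hr.2).symm
  have hslab : ∫ p, fpAdj σ σ' s b Ψ p.1 p.2.1 p.2.2 * J.f p.1 p.2.1 p.2.2
      ∂slabMeasure n (Set.Ioo 0 T') = ∫ r in (0 : ℝ)..T', G r := by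
    rw [intervalIntegral.integral_of_le h0.le, integral_Ioc_eq_integral_Ioo, slabMeasure,
      integral_prod _ hi]
  rw [hslab]
  have l1 : Tendsto Y (𝓝[>] 0) (𝓝 (∫ x, g (0, x) ∂(ρ₀ : Measure (Torus n)))) :=
    h.tendsto_initial_of_signalSupport h0 hT' hΨc hs hg
  have l2 : Tendsto (fun t => ∫ r in (0 : ℝ)..t, G r) (𝓝[>] 0) (𝓝 (∫ r in (0 : ℝ)..0, G r)) :=
    ((hprim 0 ⟨le_rfl, h0.le⟩).mono_of_mem_nhdsWithin (by
      filter_upwards [Ioo_mem_nhdsGT h0] with r hr using ⟨hr.1.le, hr.2.le⟩)).tendsto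
  rw [intervalIntegral.integral_same] at l2
  have l3 := tendsto_nhds_unique (l1.const_sub (Y T')) (((l2.const_sub _)).congr' (by
    filter_upwards [Ioo_mem_nhdsGT h0] with r hr
    exact (htop r hr.1 hr.2).symm))
  rw [l3, sub_zero]

/-- The cutoff depends on the signal alone, so its commutator with the operator contains only its
own signal derivatives, which are of order 1/R. -/
lemma fpAdj_cutoff_mul (Ψ : Jet n) (R t z : ℝ) (y : Vec n) :
    fpAdj σ σ' s b ((cutoffJet R).mul Ψ) t z y
      = (cutoffJet R).e t z * fpAdj σ σ' s b Ψ t z y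
        + (s * ((cutoffJet R).ez t z * Ψ.f t z y) + σ ^ 2 * ((cutoffJet R).ez t z * Ψ.fz t z y)
          + σ ^ 2 / 2 * ((cutoffJet R).ezz t z * Ψ.f t z y)) := by
  simp only [fpAdj, fpSpace, SignalJet.mul, inner_smul_left]
  simp only [cutoffJet, conj_trivial]
  ring

/-- The weight W need only dominate f and have a finite moment; later it is an exponential, possibly
multiplied by `tilt`. -/
lemma IsFP.integrable_weight (h : IsFP σ σ' T s b ρ₀ J) {t : ℝ} (ht : t ∈ Set.Ioc 0 T)
    {f : ℝ → Vec n → ℝ} (hf : Continuous fun q : ℝ × Vec n => f q.1 q.2) {W : ℝ → ℝ}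
    {B : ℝ≥0∞} (hB : B ≠ ⊤)
    (hWB : ∫⁻ q, ENNReal.ofReal (W q.1 * J.f t q.1 q.2) ∂stripMeasure n ≤ B)
    (hfW : ∀ z y, |f z y| ≤ W z) :
    Integrable (fun q : ℝ × Vec n => f q.1 q.2 * J.f t q.1 q.2) (stripMeasure n) := by
  refine ⟨(hf.mul (h.cont.slice ht)).aestronglyMeasurable, ?_⟩
  rw [hasFiniteIntegral_iff_enorm]
  refine lt_of_le_of_lt (lintegral_mono fun q => ?_) (hWB.trans_lt hB.lt_top)
  rw [← ofReal_norm, norm_mul, Real.norm_eq_abs, Real.norm_eq_abs,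
    abs_of_nonneg (h.nonneg t ht q.1 q.2)]
  exact ENNReal.ofReal_le_ofReal
    (mul_le_mul_of_nonneg_right (hfW _ _) (h.nonneg t ht q.1 q.2))

lemma IsFP.integrable_slab_weight (h : IsFP σ σ' T s b ρ₀ J) {T' : ℝ} (hT' : T' ≤ T)
    {f : ℝ → ℝ → Vec n → ℝ} (hf : JointCont (Set.Ioo 0 T') f) {W : ℝ → ℝ → ℝ}
    {B : ℝ≥0∞} (hB : B ≠ ⊤)
    (hWB : ∀ t ∈ Set.Ioo 0 T', ∫⁻ q, ENNReal.ofReal (W t q.1 * J.f t q.1 q.2) ∂stripMeasure n ≤ B)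
    (hfW : ∀ t ∈ Set.Ioo 0 T', ∀ z y, |f t z y| ≤ W t z) :
    Integrable (fun p : ℝ × ℝ × Vec n => f p.1 p.2.1 p.2.2 * J.f p.1 p.2.1 p.2.2)
      (slabMeasure n (Set.Ioo 0 T')) := by
  have hsub : Set.Ioo 0 T' ⊆ Set.Ioc 0 T := fun t ht => ⟨ht.1, ht.2.le.trans hT'⟩
  refine integrable_slab_of_bound measurableSet_Ioo (by simp)
    (f := fun t z y => f t z y * J.f t z y) (ContinuousOn.mul hf (h.cont.mono hsub)) hB
    fun t ht => (lintegral_mono fun q => ?_).trans (hWB t ht)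
  rw [← ofReal_norm, norm_mul, Real.norm_eq_abs, Real.norm_eq_abs,
    abs_of_nonneg (h.nonneg t (hsub ht) q.1 q.2)]
  exact ENNReal.ofReal_le_ofReal
    (mul_le_mul_of_nonneg_right (hfW t ht _ _) (h.nonneg t (hsub ht) q.1 q.2))

/-- Duality between the Fokker–Planck equation and test functions dominated by a weight with
bounded moments. -/
theorem IsFP.pairing (h : IsFP σ σ' T s b ρ₀ J) (hb : IsDrift T b) {T' : ℝ}
    (h0 : 0 < T') (hT' : T' ≤ T) {ψ : Jet n} (hψ : ψ.IsC12 (Set.Ioo 0 T'))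
    (hψc : JointCont (Set.Icc 0 T') ψ.f) {W : ℝ → ℝ → ℝ}
    (hWc : ContinuousOn (fun p : ℝ × ℝ => W p.1 p.2) (Set.Ioc 0 T' ×ˢ Set.univ))
    {B : ℝ≥0∞} (hB : B ≠ ⊤)
    (hWB : ∀ t ∈ Set.Ioc 0 T', ∫⁻ q, ENNReal.ofReal (W t q.1 * J.f t q.1 q.2) ∂stripMeasure n ≤ B)
    (h1 : ∀ t ∈ Set.Ioc 0 T', ∀ z y, |ψ.f t z y| ≤ W t z)
    (h2 : ∀ t ∈ Set.Ioo 0 T', ∀ z y, |ψ.fz t z y| ≤ W t z)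
    (h3 : ∀ t ∈ Set.Ioo 0 T', ∀ z y, |fpAdj σ σ' s b ψ t z y| ≤ W t z)
    {g : ℝ × Torus n → ℝ} (hg : ∀ z y, g (z, toTorus y) = ψ.f 0 z y) :
    ∫ q, ψ.f T' q.1 q.2 * J.f T' q.1 q.2 ∂stripMeasure n
        - ∫ x, g (0, x) ∂(ρ₀ : Measure (Torus n))
      = ∫ p, fpAdj σ σ' s b ψ p.1 p.2.1 p.2.2 * J.f p.1 p.2.1 p.2.2
        ∂slabMeasure n (Set.Ioo 0 T') := by
  obtain ⟨C, hC0, hC⟩ := exists_lineBump_bound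
  -- The three commutator terms have coefficients |s|, σ² and σ²/2; D bounds their sum multiplied by
  -- the bound C on the derivatives of the bump.
  set D : ℝ := C * (|s| + 2 * σ ^ 2) with hD
  have hD0 : 0 ≤ D := by positivity
  have hIooIoc : Set.Ioo 0 T' ⊆ Set.Ioc 0 T' := Set.Ioo_subset_Ioc_self
  have hbT : JointCont (Set.Ioo 0 T') b := hb.cont.mono (Set.Ioo_subset_Ioo_right hT')
  have hW0 : ∀ t ∈ Set.Ioc 0 T', ∀ z, 0 ≤ W t z := fun t ht z =>
    (abs_nonneg _).trans (h1 t ht z 0)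
  have hcor : ∀ j : ℕ, ∀ t ∈ Set.Ioo 0 T', ∀ z y,
      |s * ((cutoffJet ((j : ℝ) + 1)).ez t z * ψ.f t z y)
        + σ ^ 2 * ((cutoffJet ((j : ℝ) + 1)).ez t z * ψ.fz t z y)
        + σ ^ 2 / 2 * ((cutoffJet ((j : ℝ) + 1)).ezz t z * ψ.f t z y)|
      ≤ D * ((j : ℝ) + 1)⁻¹ * W t z := by
    intro j t ht z y
    have hj : (0 : ℝ) ≤ j := Nat.cast_nonneg j
    obtain ⟨e1, e2⟩ := abs_cutoff_ez_le hC (R := (j : ℝ) + 1) (by linarith) t z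
    have hw := hW0 t (hIooIoc ht) z
    have a1 : |(cutoffJet ((j : ℝ) + 1)).ez t z * ψ.f t z y| ≤ C * ((j : ℝ) + 1)⁻¹ * W t z := by
      rw [abs_mul]; exact mul_le_mul e1 (h1 t (hIooIoc ht) z y) (abs_nonneg _) (by positivity)
    have a2 : |(cutoffJet ((j : ℝ) + 1)).ez t z * ψ.fz t z y| ≤ C * ((j : ℝ) + 1)⁻¹ * W t z := by
      rw [abs_mul]; exact mul_le_mul e1 (h2 t ht z y) (abs_nonneg _) (by positivity)
    have a3 : |(cutoffJet ((j : ℝ) + 1)).ezz t z * ψ.f t z y| ≤ C * ((j : ℝ) + 1)⁻¹ * W t z := by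
      rw [abs_mul]; exact mul_le_mul e2 (h1 t (hIooIoc ht) z y) (abs_nonneg _) (by positivity)
    set A := C * ((j : ℝ) + 1)⁻¹ * W t z with hA
    have hA0 : 0 ≤ A := by positivity
    calc _ ≤ |s| * A + σ ^ 2 * A + σ ^ 2 / 2 * A := by
          refine (abs_add_three _ _ _).trans ?_
          rw [abs_mul s, abs_mul (σ ^ 2), abs_mul (σ ^ 2 / 2), abs_of_nonneg (sq_nonneg σ),
            abs_of_nonneg (by positivity : 0 ≤ σ ^ 2 / 2)]
          gcongr
      _ ≤ D * ((j : ℝ) + 1)⁻¹ * W t z := by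
          have : D * ((j : ℝ) + 1)⁻¹ * W t z = (|s| + 2 * σ ^ 2) * A := by rw [hD, hA]; ring
          rw [this]
          nlinarith [mul_nonneg (sq_nonneg σ) hA0]
  have hadj : ∀ j : ℕ, ∀ t ∈ Set.Ioo 0 T', ∀ z y,
      |fpAdj σ σ' s b ((cutoffJet ((j : ℝ) + 1)).mul ψ) t z y| ≤ (1 + D) * W t z := by
    intro j t ht z y
    have hj : (0 : ℝ) ≤ j := Nat.cast_nonneg j
    rw [fpAdj_cutoff_mul]
    refine (abs_add_le _ _).trans ?_
    have e1 : |(cutoffJet ((j : ℝ) + 1)).e t z * fpAdj σ σ' s b ψ t z y| ≤ 1 * W t z := by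
      rw [abs_mul, abs_of_nonneg (cutoff_nonneg _ _ _)]
      exact mul_le_mul (cutoff_le_one _ _ _) (h3 t ht z y) (abs_nonneg _) zero_le_one
    have e2 := hcor j t ht z y
    have e3 : D * ((j : ℝ) + 1)⁻¹ * W t z ≤ D * W t z := by
      refine mul_le_mul_of_nonneg_right ?_ (hW0 t (hIooIoc ht) z)
      exact mul_le_of_le_one_right hD0 (inv_le_one_of_one_le₀ (by linarith))
    linarith
  have hWB' : ∀ t ∈ Set.Ioo 0 T',
      ∫⁻ q, ENNReal.ofReal (((1 + D) * W t q.1) * J.f t q.1 q.2) ∂stripMeasure n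
        ≤ ENNReal.ofReal (1 + D) * B := by
    intro t ht
    simp_rw [mul_assoc, ENNReal.ofReal_mul (show 0 ≤ 1 + D by positivity)]
    rw [lintegral_const_mul' _ _ ENNReal.ofReal_ne_top]
    exact mul_le_mul_right (hWB t (hIooIoc ht)) _
  have hB' : ENNReal.ofReal (1 + D) * B ≠ ⊤ := ENNReal.mul_ne_top ENNReal.ofReal_ne_top hB
  have hC12 : ∀ j : ℕ, ((cutoffJet ((j : ℝ) + 1)).mul ψ).IsC12 (Set.Ioo 0 T') := fun j =>
    (cutoffJet_isC12 _ _).mul hψ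
  have hid : ∀ j : ℕ, _ := fun j => h.pairing_of_signalSupport hb h0 hT' (hC12 j)
    (ContinuousOn.mul (jointCont_of_signal (cutoffJet_isC12 ((j : ℝ) + 1) _).cont_e) hψc)
    (R := 2 * ((j : ℝ) + 1))
    (fun t _ z hz y => by
      simp only [SignalJet.mul, cutoff_eq_zero (t := t) (by positivity : (0 : ℝ) < (j : ℝ) + 1) hz,
        zero_mul])
    (g := fun q => (cutoffJet ((j : ℝ) + 1)).e 0 q.1 * g q)
    (fun z y => by simp only [SignalJet.mul, hg])
    (h.integrable_slab_weight hT' (jointCont_fpAdj (hC12 j) hbT) (W := fun t z => (1 + D) * W t z)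
      hB' hWB' (hadj j))
  have hT'm : T' ∈ Set.Ioc 0 T' := ⟨h0, le_rfl⟩
  have hT'm2 : T' ∈ Set.Ioc 0 T := ⟨h0, hT'⟩
  have hWT : Integrable (fun q : ℝ × Vec n => W T' q.1 * J.f T' q.1 q.2) (stripMeasure n) :=
    h.integrable_weight hT'm2 ((jointCont_of_signal hWc).slice hT'm) hB (hWB T' hT'm)
      (fun z _ => (abs_of_nonneg (hW0 T' hT'm z)).le)
  have hWS : Integrable (fun p : ℝ × ℝ × Vec n => ((1 + D) * W p.1 p.2.1) * J.f p.1 p.2.1 p.2.2)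
      (slabMeasure n (Set.Ioo 0 T')) :=
    h.integrable_slab_weight hT' (f := fun t z _ => (1 + D) * W t z)
      (W := fun t z => (1 + D) * W t z)
      (((jointCont_of_signal hWc).mono hIooIoc).const_mul _) hB' hWB'
      fun t ht z _ => (abs_of_nonneg (mul_nonneg (by positivity) (hW0 t (hIooIoc ht) z))).le
  -- The cutoffs are removed by dominated convergence, with W times the density as dominating
  -- function at the final time and 1 + D times that on the slab.
  have l1 : Tendsto (fun j : ℕ => ∫ q, ((cutoffJet ((j : ℝ) + 1)).mul ψ).f T' q.1 q.2
      * J.f T' q.1 q.2 ∂stripMeasure n) atTop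
      (𝓝 (∫ q, ψ.f T' q.1 q.2 * J.f T' q.1 q.2 ∂stripMeasure n)) := by
    refine tendsto_integral_of_dominated_convergence _ (fun j => ?_) hWT (fun j => ?_) ?_
    · exact ((((jointCont_of_signal (cutoffJet_isC12 ((j : ℝ) + 1)
        (Set.Icc 0 T')).cont_e).slice (t := T') ⟨h0.le, le_rfl⟩).mul
        (hψc.slice ⟨h0.le, le_rfl⟩)).mul (h.cont.slice hT'm2)).aestronglyMeasurable
    · refine ae_of_all _ fun q => ?_
      rw [norm_mul, Real.norm_eq_abs, Real.norm_eq_abs, abs_of_nonneg (h.nonneg T' hT'm2 q.1 q.2)]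
      refine mul_le_mul_of_nonneg_right ?_ (h.nonneg T' hT'm2 q.1 q.2)
      simp only [SignalJet.mul]
      rw [abs_mul, abs_of_nonneg (cutoff_nonneg _ _ _)]
      exact (mul_le_of_le_one_left (abs_nonneg _) (cutoff_le_one _ _ _)).trans (h1 T' hT'm _ _)
    · refine ae_of_all _ fun q => ?_
      have := ((tendsto_cutoff T' q.1).mul_const (ψ.f T' q.1 q.2)).mul_const (J.f T' q.1 q.2)
      rwa [one_mul] at this
  have l2 : Tendsto (fun j : ℕ => ∫ p, fpAdj σ σ' s b ((cutoffJet ((j : ℝ) + 1)).mul ψ)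
      p.1 p.2.1 p.2.2 * J.f p.1 p.2.1 p.2.2 ∂slabMeasure n (Set.Ioo 0 T')) atTop
      (𝓝 (∫ p, fpAdj σ σ' s b ψ p.1 p.2.1 p.2.2 * J.f p.1 p.2.1 p.2.2
        ∂slabMeasure n (Set.Ioo 0 T'))) := by
    have hmem : ∀ᵐ p ∂slabMeasure n (Set.Ioo 0 T'), p.1 ∈ Set.Ioo 0 T' := by
      have : ∀ᵐ t ∂(volume : Measure ℝ).restrict (Set.Ioo 0 T'), t ∈ Set.Ioo 0 T' :=
        ae_restrict_mem measurableSet_Ioo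
      exact Measure.quasiMeasurePreserving_fst.ae this
    have hsub : Set.Ioo 0 T' ⊆ Set.Ioc 0 T := fun t ht => ⟨ht.1, ht.2.le.trans hT'⟩
    refine tendsto_integral_of_dominated_convergence _ (fun j => ?_) hWS (fun j => ?_) ?_
    · exact JointCont.aestronglyMeasurable measurableSet_Ioo
        (f := fun t z y => fpAdj σ σ' s b ((cutoffJet ((j : ℝ) + 1)).mul ψ) t z y * J.f t z y)
        (ContinuousOn.mul (jointCont_fpAdj (hC12 j) hbT) (h.cont.mono hsub))
    · filter_upwards [hmem] with p hp
      rw [norm_mul, Real.norm_eq_abs, Real.norm_eq_abs, abs_of_nonneg (h.nonneg _ (hsub hp) _ _)]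
      exact mul_le_mul_of_nonneg_right (hadj j _ hp _ _) (h.nonneg _ (hsub hp) _ _)
    · filter_upwards [hmem] with p hp
      simp_rw [fpAdj_cutoff_mul]
      have t1 := (tendsto_cutoff p.1 p.2.1).mul_const (fpAdj σ σ' s b ψ p.1 p.2.1 p.2.2)
      have t2 : Tendsto (fun j : ℕ => s * ((cutoffJet ((j : ℝ) + 1)).ez p.1 p.2.1
          * ψ.f p.1 p.2.1 p.2.2)
          + σ ^ 2 * ((cutoffJet ((j : ℝ) + 1)).ez p.1 p.2.1 * ψ.fz p.1 p.2.1 p.2.2)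
          + σ ^ 2 / 2 * ((cutoffJet ((j : ℝ) + 1)).ezz p.1 p.2.1 * ψ.f p.1 p.2.1 p.2.2))
          atTop (𝓝 0) := by
        have hz : Tendsto (fun j : ℕ => D * ((j : ℝ) + 1)⁻¹ * W p.1 p.2.1) atTop (𝓝 0) := by
          simpa using (tendsto_inv_nat_succ.const_mul D).mul_const (W p.1 p.2.1)
        exact squeeze_zero_norm (fun j => hcor j _ hp _ _) hz
      simpa using (t1.add t2).mul_const (J.f p.1 p.2.1 p.2.2)
  -- The initial law sits at signal 0, where every cutoff equals one, so the initial term does not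
  -- depend on the cutoff.
  refine tendsto_nhds_unique (l1.sub_const _) (l2.congr fun j => ?_)
  rw [← hid j]
  congr 1
  refine integral_congr_ae (ae_of_all _ fun x => ?_)
  simp only [cutoff_eq_one (t := 0) (z := 0) (by positivity : (0 : ℝ) < (j : ℝ) + 1)
    (by rw [abs_zero]; positivity), one_mul]

end Duality

/-! ### Plane waves -/

section PlaneWave

variable {n : ℕ}

/-- The wave `c exp(l (τ - t) + i (κ z + q · y))`. -/
def wave (c l : ℂ) (κ τ : ℝ) (q : Vec n) (t z : ℝ) (y : Vec n) : ℂ :=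
  c * Complex.exp (l * ((τ - t : ℝ) : ℂ) + Complex.I * ((κ * z + inner ℝ q y : ℝ) : ℂ))

/-- The real part of a plane wave, with its derivatives. -/
def waveJet (c l : ℂ) (κ τ : ℝ) (q : Vec n) : Jet n where
  f t z y := (wave c l κ τ q t z y).re
  ft t z y := (-l * wave c l κ τ q t z y).re
  fz t z y := (Complex.I * κ * wave c l κ τ q t z y).re
  fzz t z y := (-(κ : ℂ) ^ 2 * wave c l κ τ q t z y).re
  fg t z y := (Complex.I * wave c l κ τ q t z y).re • q
  fl t z y := (-(wave c l κ τ q t z y).re) * ‖q‖ ^ 2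

lemma hasDerivAt_wave_phase (c : ℂ) (a b : ℂ) (θ : ℝ) :
    HasDerivAt (fun θ : ℝ => c * Complex.exp (a * (θ : ℂ) + b))
      (a * (c * Complex.exp (a * (θ : ℂ) + b))) θ := by
  have h1 : HasDerivAt (fun θ : ℝ => a * (θ : ℂ) + b) a θ := by
    simpa using ((Complex.ofRealCLM.hasDerivAt (x := θ)).const_mul a).add_const b
  refine (h1.cexp.const_mul c).congr_deriv ?_
  ring

lemma HasDerivAt.complex_re {f : ℝ → ℂ} {f' : ℂ} {x : ℝ} (h : HasDerivAt f f' x) :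
    HasDerivAt (fun x => (f x).re) f'.re x :=
  (Complex.reCLM.hasFDerivAt (x := f x)).comp_hasDerivAt x h

lemma wave_hasDerivAt_t (c l : ℂ) (κ τ : ℝ) (q : Vec n) (t z : ℝ) (y : Vec n) :
    HasDerivAt (fun t => wave c l κ τ q t z y) (-l * wave c l κ τ q t z y) t := by
  have h := hasDerivAt_wave_phase c (-l)
    (l * τ + Complex.I * ((κ * z + inner ℝ q y : ℝ) : ℂ)) t
  have e : ∀ t : ℝ, c * Complex.exp (-l * (t : ℂ)
      + (l * τ + Complex.I * ((κ * z + inner ℝ q y : ℝ) : ℂ))) = wave c l κ τ q t z y := by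
    intro t; simp only [wave]; congr 2; push_cast; ring
  simpa only [e] using h

lemma wave_hasDerivAt_z (c l : ℂ) (κ τ : ℝ) (q : Vec n) (t z : ℝ) (y : Vec n) :
    HasDerivAt (fun z => wave c l κ τ q t z y) (Complex.I * κ * wave c l κ τ q t z y) z := by
  have h := hasDerivAt_wave_phase c (Complex.I * κ)
    (l * ((τ - t : ℝ) : ℂ) + Complex.I * ((inner ℝ q y : ℝ) : ℂ)) z
  have e : ∀ z : ℝ, c * Complex.exp (Complex.I * κ * (z : ℂ)
      + (l * ((τ - t : ℝ) : ℂ) + Complex.I * ((inner ℝ q y : ℝ) : ℂ))) = wave c l κ τ q t z y := by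
    intro z; simp only [wave]; congr 2; push_cast; ring
  simpa only [e] using h

lemma wave_hasGradientAt (a c l : ℂ) (κ τ : ℝ) (q : Vec n) (t z : ℝ) (y : Vec n) :
    HasGradientAt (fun y => (a * wave c l κ τ q t z y).re)
      ((Complex.I * (a * wave c l κ τ q t z y)).re • q) y := by
  have h := (hasDerivAt_wave_phase (a * c) Complex.I
    (l * ((τ - t : ℝ) : ℂ) + Complex.I * ((κ * z : ℝ) : ℂ)) (inner ℝ q y)).complex_re
  have e : ∀ y : Vec n, a * c * Complex.exp (Complex.I * ((inner ℝ q y : ℝ) : ℂ)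
      + (l * ((τ - t : ℝ) : ℂ) + Complex.I * ((κ * z : ℝ) : ℂ))) = a * wave c l κ τ q t z y := by
    intro y; simp only [wave, mul_assoc]; congr 3; push_cast; ring
  have h2 : HasFDerivAt (fun y : Vec n => inner ℝ q y) (innerSL ℝ q) y :=
    (innerSL ℝ q).hasFDerivAt
  have h3 := (h.comp_hasFDerivAt (f := fun y : Vec n => inner ℝ q y) y h2).hasGradientAt
  simp only [Function.comp_def, e] at h3
  convert h3 using 1
  rw [LinearIsometryEquiv.eq_symm_apply, map_smulₛₗ]
  rfl

lemma continuous_wave (c l : ℂ) (κ τ : ℝ) (q : Vec n) :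
    Continuous fun p : ℝ × ℝ × Vec n => wave c l κ τ q p.1 p.2.1 p.2.2 := by
  unfold wave
  fun_prop

/-- Dual lattice vectors. -/
def IsDualLattice (q : Vec n) : Prop := ∀ i, ∃ k : ℤ, q i = 2 * Real.pi * k

lemma IsDualLattice.wave_periodic {q : Vec n} (hq : IsDualLattice q) (c l : ℂ) (κ τ t z : ℝ) :
    IsPeriodic (wave c l κ τ q t z) := by
  intro y y' h
  rw [toTorus_eq_iff] at h
  choose j hj using h
  choose k hk using hq
  have e : (inner ℝ q y : ℝ) = inner ℝ q y' + 2 * Real.pi * (∑ i, k i * j i : ℤ) := by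
    have : (inner ℝ q (y - y') : ℝ) = 2 * Real.pi * (∑ i, k i * j i : ℤ) := by
      rw [PiLp.inner_apply]
      push_cast
      rw [Finset.mul_sum]
      refine Finset.sum_congr rfl fun i _ => ?_
      simp only [PiLp.sub_apply, hj, hk]
      simp
      ring
    rw [inner_sub_right] at this
    linarith
  simp only [wave]
  congr 1
  rw [e, Complex.exp_eq_exp_iff_exists_int]
  exact ⟨∑ i, k i * j i, by push_cast; ring⟩

lemma waveJet_isC12 {q : Vec n} (hq : IsDualLattice q) (c l : ℂ) (κ τ : ℝ) (I : Set ℝ) :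
    (waveJet c l κ τ q).IsC12 I := by
  have hc := continuous_wave c l κ τ q
  exact
  { periodic := fun t z y y' h => congrArg Complex.re (hq.wave_periodic c l κ τ t z y y' h)
    hasDerivAt_t := fun t _ z y => (wave_hasDerivAt_t c l κ τ q t z y).complex_re
    hasDerivAt_z := fun t _ z y => (wave_hasDerivAt_z c l κ τ q t z y).complex_re
    hasDerivAt_zz := fun t _ z y => by
      have h := ((wave_hasDerivAt_z c l κ τ q t z y).const_mul (Complex.I * κ)).complex_re
      refine h.congr_deriv ?_
      simp only [waveJet]
      congr 1
      linear_combination ((κ : ℂ) ^ 2 * wave c l κ τ q t z y) * Complex.I_sq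
    hasGradientAt := fun t _ z y => by
      have h := wave_hasGradientAt 1 c l κ τ q t z y
      simp only [one_mul] at h
      exact h
    differentiable_fg := fun t _ z y =>
      (wave_hasGradientAt Complex.I c l κ τ q t z y).differentiableAt.smul_const q
    divX_fg := fun t _ z y => by
      have h := divX_smul (V := fun _ : Vec n => q) (wave_hasGradientAt Complex.I c l κ τ q t z y)
        (differentiableAt_const q)
      simp only [waveJet]
      rw [h]
      have h0 : divX (fun _ : Vec n => q) y = 0 := by simp [divX]
      rw [h0, ← mul_assoc, Complex.I_mul_I, inner_smul_left]
      simp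
    cont_f := (Complex.continuous_re.comp hc).continuousOn
    cont_ft := (Complex.continuous_re.comp (hc.const_mul _)).continuousOn
    cont_fz := (Complex.continuous_re.comp (hc.const_mul _)).continuousOn
    cont_fzz := (Complex.continuous_re.comp (hc.const_mul _)).continuousOn
    cont_fg := ((Complex.continuous_re.comp (hc.const_mul _)).smul continuous_const).continuousOn
    cont_fl := ((Complex.continuous_re.comp hc).neg.mul continuous_const).continuousOn }

/-- The symbol of the constant coefficient part of the adjoint Fokker–Planck operator. -/
def waveSymbol (σ σ' s κ : ℝ) (q : Vec n) : ℂ :=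
  Complex.I * ((s * κ : ℝ) : ℂ) - ((σ ^ 2 / 2 * κ ^ 2 + σ' ^ 2 / 2 * ‖q‖ ^ 2 : ℝ) : ℂ)

lemma waveSymbol_re (σ σ' s κ : ℝ) (q : Vec n) :
    (waveSymbol σ σ' s κ q).re = -(σ ^ 2 / 2 * κ ^ 2 + σ' ^ 2 / 2 * ‖q‖ ^ 2) := by
  rw [waveSymbol, Complex.sub_re, Complex.re_mul_ofReal, Complex.ofReal_re]
  simp

lemma norm_wave (c l : ℂ) (κ τ : ℝ) (q : Vec n) (t z : ℝ) (y : Vec n) :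
    ‖wave c l κ τ q t z y‖ = ‖c‖ * Real.exp (l.re * (τ - t)) := by
  rw [wave, norm_mul, Complex.norm_exp, Complex.add_re, Complex.re_mul_ofReal]
  congr 2
  simp

/-- The symbol has nonpositive real part, so going backward from τ the wave can only decay. -/
lemma norm_wave_le (c : ℂ) {σ σ' s κ τ t : ℝ} (q : Vec n) (ht : t ≤ τ) (z : ℝ) (y : Vec n) :
    ‖wave c (waveSymbol σ σ' s κ q) κ τ q t z y‖ ≤ ‖c‖ := by
  rw [norm_wave, waveSymbol_re]
  refine mul_le_of_le_one_right (norm_nonneg _) (Real.exp_le_one_iff.2 ?_)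
  exact mul_nonpos_of_nonpos_of_nonneg (by rw [neg_nonpos]; positivity) (by linarith)

/-- The symbol is chosen so that the constant-coefficient part of the operator annihilates the wave
exactly; only the drift term survives. -/
lemma fpAdj_waveJet (σ σ' s κ τ : ℝ) (c : ℂ) (q : Vec n) (b : ℝ → ℝ → Vec n → Vec n)
    (t z : ℝ) (y : Vec n) :
    fpAdj σ σ' s b (waveJet c (waveSymbol σ σ' s κ q) κ τ q) t z y
      = (Complex.I * wave c (waveSymbol σ σ' s κ q) κ τ q t z y).re * inner ℝ q (b t z y) := by
  simp only [fpAdj, fpSpace, waveJet, inner_smul_left, conj_trivial]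
  set X := wave c (waveSymbol σ σ' s κ q) κ τ q t z y
  simp only [waveSymbol, Complex.mul_re, Complex.neg_re, Complex.neg_im, Complex.sub_re,
    Complex.sub_im, Complex.I_re, Complex.I_im, Complex.ofReal_re, Complex.ofReal_im,
    Complex.mul_im, sq]
  ring

end PlaneWave

/-! ### The law of the signal -/

section SignalLaw

variable {n : ℕ} {σ σ' T s : ℝ} {b : ℝ → ℝ → Vec n → Vec n} {ρ₀ : ProbabilityMeasure (Torus n)}
  {J : Jet n}

/-- A wave with zero position momentum is orthogonal to the drift, so it solves the adjoint equation
exactly and its pairing is conserved in time. The complex amplitude c lets real test functions see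
both parts of the characteristic function. -/
lemma IsFP.integral_wave (h : IsFP σ σ' T s b ρ₀ J) (hb : IsDrift T b) {t : ℝ}
    (ht : t ∈ Set.Ioc 0 T) (c : ℂ) (κ : ℝ) :
    ∫ q, (c * Complex.exp (Complex.I * ((κ * q.1 : ℝ) : ℂ))).re * J.f t q.1 q.2 ∂stripMeasure n
      = (c * Complex.exp (waveSymbol σ σ' s κ (0 : Vec n) * t)).re := by
  set l := waveSymbol σ σ' s κ (0 : Vec n) with hl
  have hq : IsDualLattice (0 : Vec n) := fun i => ⟨0, by simp⟩
  have hre : ∀ a : ℂ, |a.re| ≤ ‖a‖ := Complex.abs_re_le_norm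
  have h1 := h.pairing hb ht.1 ht.2 (waveJet_isC12 hq c l κ t (Set.Ioo 0 t))
    (waveJet_isC12 hq c l κ t (Set.Icc 0 t)).cont_f (W := fun _ _ => ‖c‖ * (1 + |κ|))
    continuousOn_const (B := ENNReal.ofReal (‖c‖ * (1 + |κ|))) ENNReal.ofReal_ne_top
    (fun r hr => by
      simp_rw [ENNReal.ofReal_mul (show 0 ≤ ‖c‖ * (1 + |κ|) by positivity)]
      rw [lintegral_const_mul' _ _ ENNReal.ofReal_ne_top, h.mass r ⟨hr.1, hr.2.trans ht.2⟩, mul_one])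
    (fun r hr z y => by
      refine (hre _).trans ((norm_wave_le c _ hr.2 z y).trans ?_)
      exact le_mul_of_one_le_right (norm_nonneg _) (by simp))
    (fun r hr z y => by
      refine (hre _).trans ?_
      rw [norm_mul, norm_mul, Complex.norm_I, one_mul, Complex.norm_real, Real.norm_eq_abs]
      refine (mul_le_mul_of_nonneg_left (norm_wave_le c _ hr.2.le z y) (abs_nonneg κ)).trans ?_
      nlinarith [norm_nonneg c, abs_nonneg κ])
    (fun r hr z y => by
      rw [hl, fpAdj_waveJet, inner_zero_left, mul_zero, abs_zero]; positivity)
    (g := fun q => (c * Complex.exp (l * (t : ℂ) + Complex.I * ((κ * q.1 : ℝ) : ℂ))).re)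
    (fun z y => by simp [waveJet, wave])
  have h2 : ∀ p : ℝ × ℝ × Vec n, fpAdj σ σ' s b (waveJet c l κ t 0) p.1 p.2.1 p.2.2 = 0 := by
    intro p; rw [hl, fpAdj_waveJet, inner_zero_left, mul_zero]
  simp only [h2, zero_mul, integral_zero, mul_zero, Complex.ofReal_zero, add_zero,
    integral_const, probReal_univ, one_smul] at h1
  rw [sub_eq_zero] at h1
  rw [← h1]
  refine integral_congr_ae (ae_of_all _ fun q => ?_)
  simp [waveJet, wave]

/-- The law of the signal is Gaussian. -/
lemma IsFP.map_fst_eq_gaussian (h : IsFP σ σ' T s b ρ₀ J) (hb : IsDrift T b) {t : ℝ}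
    (ht : t ∈ Set.Ioc 0 T) :
    ((stripMeasure n).withDensity fun q => ENNReal.ofReal (J.f t q.1 q.2)).map Prod.fst
      = gaussianReal (s * t) (σ ^ 2 * t).toNNReal := by
  set μ := (stripMeasure n).withDensity fun q : ℝ × Vec n => ENNReal.ofReal (J.f t q.1 q.2) with hμ
  have hmeas : Measurable fun q : ℝ × Vec n => J.f t q.1 q.2 := (h.cont.slice ht).measurable
  have hprob : IsProbabilityMeasure μ :=
    ⟨by rw [hμ, withDensity_apply _ MeasurableSet.univ, Measure.restrict_univ, h.mass t ht]⟩
  have : IsProbabilityMeasure (μ.map Prod.fst) :=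
    Measure.isProbabilityMeasure_map measurable_fst.aemeasurable
  refine Measure.ext_of_charFun ?_
  funext ξ
  rw [charFun_gaussianReal, charFun_apply_real, integral_map measurable_fst.aemeasurable
    (by fun_prop)]
  have hint : Integrable (fun q : ℝ × Vec n => Complex.exp (ξ * q.1 * Complex.I)) μ := by
    refine (integrable_const (1 : ℝ)).mono' (by fun_prop) (ae_of_all _ fun q => ?_)
    rw [show (ξ : ℂ) * q.1 * Complex.I = ((ξ * q.1 : ℝ) : ℂ) * Complex.I by push_cast; ring,
      Complex.norm_exp_ofReal_mul_I]
  have key : ∀ c : ℂ, (c * ∫ q, Complex.exp (ξ * q.1 * Complex.I) ∂μ).re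
      = (c * Complex.exp (waveSymbol σ σ' s ξ (0 : Vec n) * t)).re := by
    intro c
    rw [← h.integral_wave hb ht c ξ, ← integral_const_mul,
      ← Complex.reCLM_apply, ← ContinuousLinearMap.integral_comp_comm _ (hint.const_mul c), hμ,
      integral_withDensity_eq_integral_toReal_smul hmeas.ennreal_ofReal
        (ae_of_all _ fun _ => ENNReal.ofReal_lt_top)]
    refine integral_congr_ae (ae_of_all _ fun q => ?_)
    simp only [smul_eq_mul, ENNReal.toReal_ofReal (h.nonneg t ht q.1 q.2), Complex.reCLM_apply]
    rw [mul_comm]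
    congr 4
    push_cast; ring
  have e : ∫ q, Complex.exp (ξ * q.1 * Complex.I) ∂μ
      = Complex.exp (waveSymbol σ σ' s ξ (0 : Vec n) * t) := by
    -- The amplitudes 1 and -i give the real and imaginary parts.
    refine Complex.ext (by simpa using key 1) ?_
    have := key (-Complex.I)
    simpa using this
  rw [e, waveSymbol]
  congr 1
  rw [Real.coe_toNNReal _ (mul_nonneg (sq_nonneg σ) ht.1.le)]
  simp
  ring

/-- Moments of weights in the signal alone become Gaussian integrals that do not see the drift. This
is what tames a drift growing exponentially in z. -/
lemma IsFP.lintegral_signal (h : IsFP σ σ' T s b ρ₀ J) (hb : IsDrift T b) {t : ℝ}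
    (ht : t ∈ Set.Ioc 0 T) {W : ℝ → ℝ} (hW : Measurable W) (hW0 : ∀ z, 0 ≤ W z) :
    ∫⁻ q, ENNReal.ofReal (W q.1 * J.f t q.1 q.2) ∂stripMeasure n
      = ∫⁻ z, ENNReal.ofReal (W z) ∂gaussianReal (s * t) (σ ^ 2 * t).toNNReal := by
  have hmeas : Measurable fun q : ℝ × Vec n => J.f t q.1 q.2 := (h.cont.slice ht).measurable
  rw [← h.map_fst_eq_gaussian hb ht, lintegral_map hW.ennreal_ofReal measurable_fst,
    lintegral_withDensity_eq_lintegral_mul _ hmeas.ennreal_ofReal (by fun_prop)]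
  refine lintegral_congr fun q => ?_
  simp only [Pi.mul_apply]
  rw [ENNReal.ofReal_mul (hW0 _), mul_comm]

/-- Bound exp(k|z|) by exp(kz) + exp(-kz) and use the Gaussian moment generating function at ±k. -/
lemma lintegral_exp_abs_gaussianReal_le (k μ : ℝ) (v : ℝ≥0) :
    ∫⁻ z, ENNReal.ofReal (Real.exp (k * |z|)) ∂gaussianReal μ v
      ≤ ENNReal.ofReal (2 * Real.exp (|k| * |μ| + v * k ^ 2 / 2)) := by
  have hm : ∀ a : ℝ, ∫⁻ z, ENNReal.ofReal (Real.exp (a * z)) ∂gaussianReal μ v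
      = ENNReal.ofReal (Real.exp (μ * a + v * a ^ 2 / 2)) := by
    intro a
    rw [← ofReal_integral_eq_lintegral_ofReal (integrable_exp_mul_gaussianReal a)
      (ae_of_all _ fun _ => (Real.exp_pos _).le)]
    have := congrFun (mgf_id_gaussianReal (μ := μ) (v := v)) a
    simp only [mgf, id] at this
    rw [this]
  calc ∫⁻ z, ENNReal.ofReal (Real.exp (k * |z|)) ∂gaussianReal μ v
      ≤ ∫⁻ z, (ENNReal.ofReal (Real.exp (k * z)) + ENNReal.ofReal (Real.exp (-k * z)))
        ∂gaussianReal μ v := by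
        refine lintegral_mono fun z => ?_
        rcases abs_cases z with ⟨h, _⟩ | ⟨h, _⟩ <;> rw [h]
        · exact le_self_add
        · rw [show k * -z = -k * z by ring]; exact le_add_self
    _ = ENNReal.ofReal (Real.exp (μ * k + v * k ^ 2 / 2))
        + ENNReal.ofReal (Real.exp (μ * (-k) + v * (-k) ^ 2 / 2)) := by
        rw [lintegral_add_left (by fun_prop), hm, hm]
    _ ≤ _ := by
        rw [← ENNReal.ofReal_add (Real.exp_pos _).le (Real.exp_pos _).le, two_mul]
        have h1 : μ * k ≤ |k| * |μ| := by rw [← abs_mul, mul_comm]; exact le_abs_self _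
        have h2 : μ * (-k) ≤ |k| * |μ| := by
          rw [← abs_mul, mul_comm, ← abs_neg, ← neg_mul]; exact le_abs_self _
        refine ENNReal.ofReal_le_ofReal (add_le_add ?_ ?_) <;> rw [Real.exp_le_exp]
        · linarith
        · rw [neg_sq]; linarith

/-- Exponential moments of the signal are bounded uniformly in time. -/
lemma IsFP.exists_exp_moment_bound (h : IsFP σ σ' T s b ρ₀ J) (hb : IsDrift T b) (K k : ℝ) :
    ∃ B : ℝ, 0 ≤ B ∧ ∀ t ∈ Set.Ioc 0 T,
      ∫⁻ q, ENNReal.ofReal (K * Real.exp (k * |q.1|) * J.f t q.1 q.2) ∂stripMeasure n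
        ≤ ENNReal.ofReal B := by
  refine ⟨|K| * (2 * Real.exp (|k| * (|s| * T) + σ ^ 2 * T * k ^ 2 / 2)), by positivity,
    fun t ht => ?_⟩
  have h1 : ∫⁻ q, ENNReal.ofReal (K * Real.exp (k * |q.1|) * J.f t q.1 q.2) ∂stripMeasure n
      ≤ ENNReal.ofReal |K|
        * ∫⁻ q, ENNReal.ofReal (Real.exp (k * |q.1|) * J.f t q.1 q.2) ∂stripMeasure n := by
    rw [← lintegral_const_mul' _ _ ENNReal.ofReal_ne_top]
    refine lintegral_mono fun q => ?_
    rw [← ENNReal.ofReal_mul (abs_nonneg K), mul_assoc]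
    exact ENNReal.ofReal_le_ofReal (mul_le_mul_of_nonneg_right (le_abs_self K)
      (mul_nonneg (Real.exp_pos _).le (h.nonneg t ht _ _)))
  refine h1.trans ?_
  rw [h.lintegral_signal hb ht (W := fun z => Real.exp (k * |z|)) (by fun_prop)
    fun z => (Real.exp_pos _).le, ENNReal.ofReal_mul (abs_nonneg K)]
  refine mul_le_mul_right ((lintegral_exp_abs_gaussianReal_le _ _ _).trans ?_) _
  refine ENNReal.ofReal_le_ofReal (mul_le_mul_of_nonneg_left (Real.exp_le_exp.2 ?_) zero_le_two)
  rw [Real.coe_toNNReal _ (mul_nonneg (sq_nonneg σ) ht.1.le), abs_mul, abs_of_pos ht.1]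
  have := ht.2
  gcongr

end SignalLaw

/-! ### Contraction in `L¹` for Fokker–Planck equations -/

section SoftAbs

/-- A smooth convex approximation of the absolute value. -/
def softAbs (ε x : ℝ) : ℝ := √(x ^ 2 + ε ^ 2)

/-- The derivative of `softAbs`. -/
def softSign (ε x : ℝ) : ℝ := x / softAbs ε x

/-- The second derivative of `softAbs`. -/
def softBump (ε x : ℝ) : ℝ := ε ^ 2 / softAbs ε x ^ 3

variable {ε : ℝ}

lemma softAbs_pos (hε : 0 < ε) (x : ℝ) : 0 < softAbs ε x := Real.sqrt_pos.2 (by positivity)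

lemma softAbs_sq (hε : 0 < ε) (x : ℝ) : softAbs ε x ^ 2 = x ^ 2 + ε ^ 2 := Real.sq_sqrt (by positivity)

lemma abs_le_softAbs (ε x : ℝ) : |x| ≤ softAbs ε x := by
  rw [← Real.sqrt_sq_eq_abs]; exact Real.sqrt_le_sqrt (by nlinarith [sq_nonneg ε])

lemma softAbs_le (hε : 0 < ε) (x : ℝ) : softAbs ε x ≤ |x| + ε := by
  refine Real.sqrt_le_iff.2 ⟨by positivity, ?_⟩
  nlinarith [sq_abs x, abs_nonneg x, mul_nonneg (abs_nonneg x) hε.le]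

lemma softBump_nonneg (hε : 0 < ε) (x : ℝ) : 0 ≤ softBump ε x := by
  have := softAbs_pos hε x
  unfold softBump; positivity

/-- In the contraction estimate the drift enters only through the second derivative of the smoothed
modulus times w²|b|². This bound, uniform in w, makes that contribution vanish with ε wherever b is
bounded. -/
lemma softBump_mul_sq_le (hε : 0 < ε) (x : ℝ) : softBump ε x * x ^ 2 ≤ ε := by
  have h := softAbs_pos hε x
  have h2 := softAbs_sq hε x
  have h3 : ε ≤ softAbs ε x := Real.le_sqrt_of_sq_le (by nlinarith)
  rw [softBump, div_mul_eq_mul_div, div_le_iff₀ (by positivity)]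
  have h4 : x ^ 2 ≤ softAbs ε x ^ 2 := by rw [h2]; nlinarith
  calc ε ^ 2 * x ^ 2 ≤ ε * softAbs ε x * softAbs ε x ^ 2 := by
        have : ε ^ 2 ≤ ε * softAbs ε x := by nlinarith
        gcongr
    _ = _ := by ring

lemma hasDerivAt_softAbs (hε : 0 < ε) (x : ℝ) : HasDerivAt (softAbs ε) (softSign ε x) x := by
  have h0 : x ^ 2 + ε ^ 2 ≠ 0 := by positivity
  have h := ((hasDerivAt_pow 2 x).add_const (ε ^ 2)).sqrt h0
  refine h.congr_deriv ?_
  rw [softSign, softAbs]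
  have := (softAbs_pos hε x).ne'
  rw [softAbs] at this
  field_simp
  simp

lemma hasDerivAt_softSign (hε : 0 < ε) (x : ℝ) : HasDerivAt (softSign ε) (softBump ε x) x := by
  have hp := (softAbs_pos hε x).ne'
  have h := (hasDerivAt_id x).div (hasDerivAt_softAbs hε x) hp
  refine h.congr_deriv ?_
  rw [softBump, softSign]
  have h2 := softAbs_sq hε x
  simp only [id]
  field_simp
  linear_combination h2

lemma continuous_softAbs (hε : 0 < ε) : Continuous (softAbs ε) :=
  continuous_iff_continuousAt.2 fun x => (hasDerivAt_softAbs hε x).continuousAt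

lemma continuous_softSign (hε : 0 < ε) : Continuous (softSign ε) :=
  continuous_iff_continuousAt.2 fun x => (hasDerivAt_softSign hε x).continuousAt

lemma continuous_softBump (hε : 0 < ε) : Continuous (softBump ε) := by
  unfold softBump
  exact continuous_const.div ((continuous_softAbs hε).pow 3)
    fun x => pow_ne_zero 3 (softAbs_pos hε x).ne'

end SoftAbs

/-! ### Monotonicity of the L¹ distance in time -/

section Contraction

variable {n : ℕ} {σ σ' T s : ℝ} {b : ℝ → ℝ → Vec n → Vec n} {ρ₀ : ProbabilityMeasure (Torus n)}
  {J J₁ J₂ : Jet n}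

lemma HasGradientAt.comp_hasDerivAt' {φ : ℝ → ℝ} {φ' : ℝ} {f : Vec n → ℝ} {g y : Vec n}
    (hf : HasGradientAt f g y) (hφ : HasDerivAt φ φ' (f y)) :
    HasGradientAt (fun y => φ (f y)) (φ' • g) y := by
  have h := (hφ.comp_hasFDerivAt (f := f) y hf.hasFDerivAt).hasGradientAt
  rwa [map_smulₛₗ, LinearIsometryEquiv.symm_apply_apply] at h

/-- The Fokker–Planck equation without positivity, mass and initial condition. -/
structure IsFPLinear (σ σ' T s : ℝ) (b : ℝ → ℝ → Vec n → Vec n) (J : Jet n) : Prop where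
  c12 : J.IsC12 (Set.Ioo 0 T)
  flux_diff : ∀ t ∈ Set.Ioo 0 T, ∀ z, Differentiable ℝ fun y => J.f t z y • b t z y
  equation : ∀ t ∈ Set.Ioo 0 T, ∀ z y, J.ft t z y + divX (fun y => J.f t z y • b t z y) y
    + s * J.fz t z y - σ ^ 2 / 2 * J.fzz t z y - σ' ^ 2 / 2 * J.fl t z y = 0

lemma IsFP.sub (h₁ : IsFP σ σ' T s b ρ₀ J₁) (h₂ : IsFP σ σ' T s b ρ₀ J₂) :
    IsFPLinear σ σ' T s b (J₁.sub J₂) where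
  c12 := h₁.c12.sub h₂.c12
  flux_diff t ht z := by
    simp only [Jet.sub, sub_smul]
    exact (h₁.flux_diff t ht z).sub (h₂.flux_diff t ht z)
  equation t ht z y := by
    have e := divX_sub (h₁.flux_diff t ht z y) (h₂.flux_diff t ht z y)
    simp only [Jet.sub, sub_smul]
    rw [e]
    linarith [h₁.equation t ht z y, h₂.equation t ht z y]

lemma IsFPLinear.continuous_div (h : IsFPLinear σ σ' T s b J) {t : ℝ} (ht : t ∈ Set.Ioo 0 T) :
    Continuous fun q : ℝ × Vec n => divX (fun y => J.f t q.1 y • b t q.1 y) q.2 := by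
  have e : (fun q : ℝ × Vec n => divX (fun y => J.f t q.1 y • b t q.1 y) q.2)
      = fun q => σ ^ 2 / 2 * J.fzz t q.1 q.2 + σ' ^ 2 / 2 * J.fl t q.1 q.2 - J.ft t q.1 q.2
        - s * J.fz t q.1 q.2 := by
    funext q
    linarith [h.equation t ht q.1 q.2]
  rw [e]
  exact ((((h.c12.cont_fzz.slice ht).const_mul _).add ((h.c12.cont_fl.slice ht).const_mul _)).sub
    (h.c12.cont_ft.slice ht)).sub ((h.c12.cont_fz.slice ht).const_mul _)

/-- The dissipation inequality for a smooth approximation of the absolute value. -/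
lemma IsFPLinear.dissipation (h : IsFPLinear σ σ' T s b J) (hb : IsDrift T b) (hσ' : 0 < σ')
    {t : ℝ} (ht : t ∈ Set.Ioo 0 T) {ε R : ℝ} (hε : 0 < ε) (hR : 0 < R) :
    ∫ q, (cutoffJet R).e t q.1 * softSign ε (J.f t q.1 q.2) * J.ft t q.1 q.2 ∂stripMeasure n
      ≤ ∫ q, ((cutoffJet R).e t q.1 * (softBump ε (J.f t q.1 q.2) * J.f t q.1 q.2 ^ 2)
          * (‖b t q.1 q.2‖ ^ 2 / (2 * σ' ^ 2))
        + (s * (cutoffJet R).ez t q.1 + σ ^ 2 / 2 * (cutoffJet R).ezz t q.1)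
          * softAbs ε (J.f t q.1 q.2)) ∂stripMeasure n := by
  have hJ := h.c12
  have cJ := hJ.cont_f.slice ht
  have cJz := hJ.cont_fz.slice ht
  have cJzz := hJ.cont_fzz.slice ht
  have cJg := hJ.cont_fg.slice ht
  have cJl := hJ.cont_fl.slice ht
  have cb := hb.cont.slice ht
  have cV : Continuous fun q : ℝ × Vec n => J.f t q.1 q.2 • b t q.1 q.2 := cJ.smul cb
  have cdV := h.continuous_div ht
  have hχ := cutoffJet_isC12 R (Set.Ioo 0 T)
  have cχ : Continuous fun q : ℝ × Vec n => (cutoffJet R).e t q.1 :=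
    (jointCont_of_signal hχ.cont_e).slice ht
  have cχz : Continuous fun q : ℝ × Vec n => (cutoffJet R).ez t q.1 :=
    (jointCont_of_signal hχ.cont_ez).slice ht
  have cχzz : Continuous fun q : ℝ × Vec n => (cutoffJet R).ezz t q.1 :=
    (jointCont_of_signal hχ.cont_ezz).slice ht
  have cA : Continuous fun q : ℝ × Vec n => softAbs ε (J.f t q.1 q.2) :=
    (continuous_softAbs hε).comp cJ
  have cS : Continuous fun q : ℝ × Vec n => softSign ε (J.f t q.1 q.2) :=
    (continuous_softSign hε).comp cJ
  have cB : Continuous fun q : ℝ × Vec n => softBump ε (J.f t q.1 q.2) :=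
    (continuous_softBump hε).comp cJ
  have sχ : SignalSupport (2 * R) fun z (_ : Vec n) => (cutoffJet R).e t z :=
    fun z hz _ => cutoff_eq_zero hR hz
  have sχz : SignalSupport (2 * R) fun z (_ : Vec n) => (cutoffJet R).ez t z :=
    sχ.deriv fun z _ => hχ.hasDerivAt_z t ht z
  have sχzz : SignalSupport (2 * R) fun z (_ : Vec n) => (cutoffJet R).ezz t z :=
    sχz.deriv fun z _ => hχ.hasDerivAt_zz t ht z
  have eJl : ∀ z y, divX (J.fg t z) y = J.fl t z y := hJ.divX_fg t ht
  have dA : ∀ z y, HasDerivAt (fun z => softAbs ε (J.f t z y))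
      (softSign ε (J.f t z y) * J.fz t z y) z := fun z y =>
    HasDerivAt.comp (h₂ := softAbs ε) (h := fun z => J.f t z y) z
      (hasDerivAt_softAbs hε (J.f t z y)) (hJ.hasDerivAt_z t ht z y)
  have dη : ∀ z y, HasDerivAt (fun z => (cutoffJet R).e t z * softSign ε (J.f t z y))
      ((cutoffJet R).ez t z * softSign ε (J.f t z y)
        + (cutoffJet R).e t z * (softBump ε (J.f t z y) * J.fz t z y)) z := fun z y =>
    (hχ.hasDerivAt_z t ht z).mul
      (HasDerivAt.comp (h₂ := softSign ε) (h := fun z => J.f t z y) z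
        (hasDerivAt_softSign hε (J.f t z y)) (hJ.hasDerivAt_z t ht z y))
  have gη : ∀ z y, HasGradientAt (fun y => (cutoffJet R).e t z * softSign ε (J.f t z y))
      ((cutoffJet R).e t z • softBump ε (J.f t z y) • J.fg t z y) y := fun z y =>
    ((hJ.hasGradientAt t ht z y).comp_hasDerivAt' (hasDerivAt_softSign hε _)).const_mul' _
  have sη : SignalSupport (2 * R) fun z y => (cutoffJet R).e t z * softSign ε (J.f t z y) :=
    fun z hz y => by simp [sχ z hz y]
  have pη : ∀ z, IsPeriodic fun y => (cutoffJet R).e t z * softSign ε (J.f t z y) :=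
    fun z y y' e => by simp only [hJ.periodic t z y y' e]
  have I1 := strip_ibp_x (V := fun z y => J.f t z y • b t z y) (Or.inl sη) pη
    (fun z y y' e => by simp only [hJ.periodic t z y y' e, hb.periodic t ht z y y' e])
    gη (h.flux_diff t ht) (cχ.mul cS) (cχ.smul (cB.smul cJg)) cV cdV
  have I2 := strip_ibp_z sχ (fun z _ => hχ.hasDerivAt_z t ht z) dA cχ cχz cA (cS.mul cJz)
  have I3 := strip_ibp_z sη dη (hJ.hasDerivAt_zz t ht) (cχ.mul cS)
    ((cχz.mul cS).add (cχ.mul (cB.mul cJz))) cJz cJzz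
  have I3' := strip_ibp_z sχz (fun z _ => hχ.hasDerivAt_zz t ht z) dA cχz cχzz cA (cS.mul cJz)
  have I4 := strip_ibp_x (V := J.fg t) (Or.inl sη) pη (hJ.periodic_fg ht)
    gη (hJ.differentiable_fg t ht) (cχ.mul cS) (cχ.smul (cB.smul cJg)) cJg
    (by simpa only [eJl] using cJl)
  simp only [eJl] at I4
  have int : ∀ {f : ℝ → Vec n → ℝ}, Continuous (fun q : ℝ × Vec n => f q.1 q.2) →
      SignalSupport (2 * R) f → Integrable (fun q : ℝ × Vec n => f q.1 q.2) (stripMeasure n) :=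
    fun hc hs => integrable_strip_of_signalSupport hc hs
  have i1 := int (f := fun z y => (cutoffJet R).e t z * softSign ε (J.f t z y)
      * divX (fun y => J.f t z y • b t z y) y) ((cχ.mul cS).mul cdV)
    fun z hz y => by simp [sχ z hz y]
  have i2 := int (f := fun z y => (cutoffJet R).e t z * (softSign ε (J.f t z y) * J.fz t z y))
    (cχ.mul (cS.mul cJz)) fun z hz y => by simp [sχ z hz y]
  have i3 := int (f := fun z y => (cutoffJet R).e t z * softSign ε (J.f t z y) * J.fzz t z y)
    ((cχ.mul cS).mul cJzz) fun z hz y => by simp [sχ z hz y]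
  have i4 := int (f := fun z y => (cutoffJet R).e t z * softSign ε (J.f t z y) * J.fl t z y)
    ((cχ.mul cS).mul cJl) fun z hz y => by simp [sχ z hz y]
  have k1 := int (f := fun z y => inner ℝ ((cutoffJet R).e t z • softBump ε (J.f t z y) • J.fg t z y)
      (J.f t z y • b t z y)) ((cχ.smul (cB.smul cJg)).inner cV)
    fun z hz y => by simp [sχ z hz y]
  have k4 := int (f := fun z y => inner ℝ ((cutoffJet R).e t z • softBump ε (J.f t z y) • J.fg t z y)
      (J.fg t z y)) ((cχ.smul (cB.smul cJg)).inner cJg)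
    fun z hz y => by simp [sχ z hz y]
  have k2 := int (f := fun z y => (cutoffJet R).ez t z * softAbs ε (J.f t z y)) (cχz.mul cA)
    fun z hz y => by simp [sχz z hz y]
  have k3 := int (f := fun z y => (cutoffJet R).ezz t z * softAbs ε (J.f t z y)) (cχzz.mul cA)
    fun z hz y => by simp [sχzz z hz y]
  have k5 := int (f := fun z y => (cutoffJet R).ez t z * (softSign ε (J.f t z y) * J.fz t z y))
    (cχz.mul (cS.mul cJz)) fun z hz y => by simp [sχz z hz y]
  have k6 := int (f := fun z y => (cutoffJet R).e t z * (softBump ε (J.f t z y) * J.fz t z y)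
      * J.fz t z y)
    ((cχ.mul (cB.mul cJz)).mul cJz) fun z hz y => by simp [sχ z hz y]
  have eL : ∀ q : ℝ × Vec n,
      (cutoffJet R).e t q.1 * softSign ε (J.f t q.1 q.2) * J.ft t q.1 q.2
      = σ ^ 2 / 2 * ((cutoffJet R).e t q.1 * softSign ε (J.f t q.1 q.2) * J.fzz t q.1 q.2)
        + σ' ^ 2 / 2 * ((cutoffJet R).e t q.1 * softSign ε (J.f t q.1 q.2) * J.fl t q.1 q.2)
        + (-1) * ((cutoffJet R).e t q.1 * softSign ε (J.f t q.1 q.2)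
          * divX (fun y => J.f t q.1 y • b t q.1 y) q.2)
        + (-s) * ((cutoffJet R).e t q.1 * (softSign ε (J.f t q.1 q.2) * J.fz t q.1 q.2)) :=
    fun q => by
      linear_combination ((cutoffJet R).e t q.1 * softSign ε (J.f t q.1 q.2))
        * h.equation t ht q.1 q.2
  have I3s : ∫ q, ((cutoffJet R).ez t q.1 * softSign ε (J.f t q.1 q.2)
        + (cutoffJet R).e t q.1 * (softBump ε (J.f t q.1 q.2) * J.fz t q.1 q.2)) * J.fz t q.1 q.2
        ∂stripMeasure n
      = ∫ q, (cutoffJet R).ez t q.1 * (softSign ε (J.f t q.1 q.2) * J.fz t q.1 q.2) ∂stripMeasure n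
        + ∫ q, (cutoffJet R).e t q.1 * (softBump ε (J.f t q.1 q.2) * J.fz t q.1 q.2) * J.fz t q.1 q.2
          ∂stripMeasure n := by
    rw [← integral_add k5 k6]
    exact integral_congr_ae (ae_of_all _ fun q => by simp only; ring)
  -- The signal diffusion is dissipative on the convex function `softAbs`; its contribution is
  -- discarded.
  have hpos : 0 ≤ ∫ q, (cutoffJet R).e t q.1 * (softBump ε (J.f t q.1 q.2) * J.fz t q.1 q.2)
      * J.fz t q.1 q.2 ∂stripMeasure n := by
    refine integral_nonneg fun q => ?_
    have e : (cutoffJet R).e t q.1 * (softBump ε (J.f t q.1 q.2) * J.fz t q.1 q.2) * J.fz t q.1 q.2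
      = (cutoffJet R).e t q.1 * softBump ε (J.f t q.1 q.2) * J.fz t q.1 q.2 ^ 2 := by ring
    simp only [e, Pi.zero_apply]
    exact mul_nonneg (mul_nonneg (cutoff_nonneg _ _ _) (softBump_nonneg hε _)) (sq_nonneg _)
  simp_rw [eL]
  rw [integral_linear_comb₄ i3 i4 i1 i2, I1, I2, I3, I3s, I3', I4]
  have h5 := integral_linear_comb₄ k1 k4 k2 k3 1 (-(σ' ^ 2 / 2)) s (σ ^ 2 / 2)
  calc _ ≤ 1 * ∫ q, inner ℝ ((cutoffJet R).e t q.1 • softBump ε (J.f t q.1 q.2) • J.fg t q.1 q.2)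
          (J.f t q.1 q.2 • b t q.1 q.2) ∂stripMeasure n
        + -(σ' ^ 2 / 2) * ∫ q, inner ℝ ((cutoffJet R).e t q.1 • softBump ε (J.f t q.1 q.2)
          • J.fg t q.1 q.2) (J.fg t q.1 q.2) ∂stripMeasure n
        + s * ∫ q, (cutoffJet R).ez t q.1 * softAbs ε (J.f t q.1 q.2) ∂stripMeasure n
        + σ ^ 2 / 2 * ∫ q, (cutoffJet R).ezz t q.1 * softAbs ε (J.f t q.1 q.2) ∂stripMeasure n := by
        nlinarith [mul_nonneg (sq_nonneg σ) hpos]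
    _ = _ := h5.symm
    _ ≤ _ := by
        refine integral_mono ((((k1.const_mul _).add (k4.const_mul _)).add (k2.const_mul _)).add
          (k3.const_mul _)) ?_ fun q => ?_
        · refine int (f := fun z y => (cutoffJet R).e t z
            * (softBump ε (J.f t z y) * J.f t z y ^ 2) * (‖b t z y‖ ^ 2 / (2 * σ' ^ 2))
            + (s * (cutoffJet R).ez t z + σ ^ 2 / 2 * (cutoffJet R).ezz t z)
            * softAbs ε (J.f t z y)) ?_ fun z hz y => by simp [sχ z hz y, sχz z hz y, sχzz z hz y]
          exact ((cχ.mul (cB.mul (cJ.pow 2))).mul ((cb.norm.pow 2).div_const _)).add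
            (((cχz.const_mul _).add (cχzz.const_mul _)).mul cA)
        · simp only [inner_smul_left, inner_smul_right, conj_trivial, real_inner_self_eq_norm_sq]
          set χ := (cutoffJet R).e t q.1
          set B := softBump ε (J.f t q.1 q.2)
          set w := J.f t q.1 q.2
          set g := J.fg t q.1 q.2
          set β := b t q.1 q.2
          have hχB : 0 ≤ χ * B := mul_nonneg (cutoff_nonneg _ _ _) (softBump_nonneg hε _)
          -- Young's inequality with the weight σ'²: the gradient part is absorbed by the position
          -- diffusion, leaving only w²|b|²/(2σ'²).
          have hin : w * inner ℝ g β ≤ σ' ^ 2 / 2 * ‖g‖ ^ 2 + w ^ 2 * (‖β‖ ^ 2 / (2 * σ' ^ 2)) := by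
            have h1 : w * inner ℝ g β ≤ |w| * (‖g‖ * ‖β‖) := by
              refine (le_abs_self _).trans ?_
              rw [abs_mul]
              exact mul_le_mul_of_nonneg_left (abs_real_inner_le_norm _ _) (abs_nonneg _)
            have h2 : σ' ^ 2 / 2 * ‖g‖ ^ 2 + w ^ 2 * (‖β‖ ^ 2 / (2 * σ' ^ 2)) - |w| * (‖g‖ * ‖β‖)
                = (σ' * ‖g‖ - |w| * ‖β‖ / σ') ^ 2 / 2 := by
              rw [← sq_abs w]
              field_simp
              ring
            nlinarith [sq_nonneg (σ' * ‖g‖ - |w| * ‖β‖ / σ')]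
          nlinarith [mul_le_mul_of_nonneg_left hin hχB]

/-- The flow of a Fokker–Planck equation is a contraction for the `L¹` norm. -/
lemma IsFP.integral_abs_sub_le (h₁ : IsFP σ σ' T s b ρ₀ J₁) (h₂ : IsFP σ σ' T s b ρ₀ J₂)
    (hb : IsDrift T b) (hσ' : 0 < σ') {t₁ t₂ : ℝ} (h0 : 0 < t₁) (h12 : t₁ ≤ t₂) (h2 : t₂ < T) :
    ∫ q, |J₁.f t₂ q.1 q.2 - J₂.f t₂ q.1 q.2| ∂stripMeasure n
      ≤ ∫ q, |J₁.f t₁ q.1 q.2 - J₂.f t₁ q.1 q.2| ∂stripMeasure n := by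
  have hL := h₁.sub h₂
  set w := J₁.sub J₂ with hw
  have hJ := hL.c12
  have hsub : Set.Icc t₁ t₂ ⊆ Set.Ioo 0 T := fun t ht =>
    ⟨h0.trans_le ht.1, ht.2.trans_lt h2⟩
  have m1 : t₁ ∈ Set.Icc t₁ t₂ := ⟨le_rfl, h12⟩
  have m2 : t₂ ∈ Set.Icc t₁ t₂ := ⟨h12, le_rfl⟩
  obtain ⟨K, k, hK⟩ := hb.growth
  obtain ⟨C, hC0, hC⟩ := exists_lineBump_bound
  set D : ℝ := (|s| + σ ^ 2 / 2) * C with hD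
  have hD0 : 0 ≤ D := by positivity
  have hwi : ∀ t ∈ Set.Icc t₁ t₂,
      Integrable (fun q : ℝ × Vec n => |w.f t q.1 q.2|) (stripMeasure n)
      ∧ ∫ q, |w.f t q.1 q.2| ∂stripMeasure n ≤ 2 := by
    intro t ht
    have ht' : t ∈ Set.Ioc 0 T := ⟨(hsub ht).1, (hsub ht).2.le⟩
    obtain ⟨a1, a2⟩ := h₁.integrable ht'
    obtain ⟨b1, b2⟩ := h₂.integrable ht'
    refine ⟨(a1.sub b1).abs, ?_⟩
    calc ∫ q, |w.f t q.1 q.2| ∂stripMeasure n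
        ≤ ∫ q, (J₁.f t q.1 q.2 + J₂.f t q.1 q.2) ∂stripMeasure n := by
          refine integral_mono (a1.sub b1).abs (a1.add b1) fun q => ?_
          have := h₁.nonneg t ht' q.1 q.2
          have := h₂.nonneg t ht' q.1 q.2
          simp only [hw, Jet.sub]
          rw [abs_le]; constructor <;> linarith
      _ = 2 := by rw [integral_add a1 b1, a2, b2]; norm_num
  -- The limits are taken in a fixed order: ε → 0 for fixed R, where the drift is bounded on the
  -- support of the cutoff, and only afterwards R → ∞, which removes the commutator error of order
  -- 1/R.
  have key : ∀ R : ℝ, 1 ≤ R →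
      ∫ q, (cutoffJet R).e 0 q.1 * |w.f t₂ q.1 q.2| ∂stripMeasure n
        ≤ ∫ q, |w.f t₁ q.1 q.2| ∂stripMeasure n + 2 * D * (t₂ - t₁) * R⁻¹ := by
    intro R hR
    have hR0 : 0 < R := by linarith
    set S : Set (ℝ × Vec n) := Set.Icc (-(2 * R)) (2 * R) ×ˢ Set.univ with hS
    have hSm : MeasurableSet S := measurableSet_Icc.prod MeasurableSet.univ
    have hSf : stripMeasure n S ≠ ⊤ := (stripMeasure_slice_lt_top (2 * R)).ne
    set V : ℝ := (stripMeasure n).real S with hV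
    -- A bound for |b|²/(2σ'²) where |z| ≤ 2R.
    set A : ℝ := K ^ 2 * Real.exp (2 * (|k| * (2 * R))) / (2 * σ' ^ 2) with hA
    have hA0 : 0 ≤ A := by positivity
    have hRi : R⁻¹ ≤ 1 := inv_le_one_of_one_le₀ hR
    have hRi0 : 0 ≤ R⁻¹ := by positivity
    have hχ : ∀ (t z : ℝ), z ∉ Set.Icc (-(2 * R)) (2 * R) → (cutoffJet R).e t z = 0 := by
      intro t z hz
      exact cutoff_eq_zero hR0 (by rw [← not_le, abs_le]; exact hz)
    refine le_of_forall_pos_le_add fun δ hδ => ?_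
    -- M collects the errors proportional to ε: the integrated dissipation term and the cost ε V of
    -- replacing the modulus by `softAbs` at time t₁. The extra 1 keeps M positive.
    set M : ℝ := (A + D) * V * (t₂ - t₁) + V + 1 with hM
    have hM0 : 0 < M := by
      have : 0 ≤ (A + D) * V * (t₂ - t₁) :=
        mul_nonneg (mul_nonneg (by linarith) measureReal_nonneg) (by linarith)
      have : 0 ≤ V := measureReal_nonneg
      linarith
    set ε : ℝ := δ / M with hεd
    have hε : 0 < ε := by positivity
    set Y : ℝ → ℝ := fun t => ∫ q, (cutoffJet R).e t q.1 * softAbs ε (w.f t q.1 q.2)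
      ∂stripMeasure n with hY
    have hχc := cutoffJet_isC12 R (Set.Icc t₁ t₂)
    have hJ' := hJ.mono hsub
    have cχ : ∀ t ∈ Set.Icc t₁ t₂, Continuous fun q : ℝ × Vec n => (cutoffJet R).e t q.1 :=
      fun t ht => (jointCont_of_signal hχc.cont_e).slice ht
    have cA : JointCont (Set.Icc t₁ t₂) fun t z y => softAbs ε (w.f t z y) :=
      (continuous_softAbs hε).comp_continuousOn hJ'.cont_f
    have hYd : Y t₂ - Y t₁ = ∫ t in t₁..t₂, ∫ q, (cutoffJet R).e t q.1
        * softSign ε (w.f t q.1 q.2) * w.ft t q.1 q.2 ∂stripMeasure n := by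
      refine integral_strip_sub (R := 2 * R) h12
        (f := fun t z y => (cutoffJet R).e t z * softAbs ε (w.f t z y))
        (ft := fun t z y => (cutoffJet R).e t z * softSign ε (w.f t z y) * w.ft t z y)
        (fun t ht z y => ?_) ?_ ?_ (fun t ht z hz y => ?_) (fun t ht z hz y => ?_)
      · refine ((hχc.hasDerivAt_t t ht z).mul ((hasDerivAt_softAbs hε (w.f t z y)).comp t
          (hJ'.hasDerivAt_t t ht z y))).congr_deriv ?_
        simp only [cutoffJet, zero_mul, zero_add, mul_assoc]
      · exact (jointCont_of_signal hχc.cont_e).mul cA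
      · exact ((jointCont_of_signal hχc.cont_e).mul
          ((continuous_softSign hε).comp_continuousOn hJ'.cont_f)).mul hJ'.cont_ft
      · simp only [cutoff_eq_zero (t := t) hR0 hz, zero_mul]
      · simp only [cutoff_eq_zero (t := t) hR0 hz, zero_mul]
    have hG : ∀ t ∈ Set.Icc t₁ t₂, ∫ q, (cutoffJet R).e t q.1
        * softSign ε (w.f t q.1 q.2) * w.ft t q.1 q.2 ∂stripMeasure n
        ≤ ε * ((A + D) * V) + 2 * D * R⁻¹ := by
      intro t ht
      refine (hL.dissipation hb hσ' (hsub ht) hε hR0).trans ?_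
      obtain ⟨i1, i2⟩ := hwi t ht
      have hχz : ∀ z, z ∉ Set.Icc (-(2 * R)) (2 * R) →
          (cutoffJet R).ez t z = 0 ∧ (cutoffJet R).ezz t z = 0 := by
        intro z hz
        have hz' : 2 * R < |z| := by rw [← not_le, abs_le]; exact hz
        have s1 : SignalSupport (2 * R) fun z (_ : Vec n) => (cutoffJet R).e t z :=
          fun z hz _ => cutoff_eq_zero hR0 hz
        have s2 := s1.deriv fun z _ => hχc.hasDerivAt_z t ht z
        have s3 := s2.deriv fun z _ => hχc.hasDerivAt_zz t ht z
        exact ⟨s2 z hz' 0, s3 z hz' 0⟩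
      rw [← setIntegral_eq_integral_of_forall_compl_eq_zero (s := S)]
      swap
      · intro q hq
        have hq' : q.1 ∉ Set.Icc (-(2 * R)) (2 * R) := fun h => hq ⟨h, trivial⟩
        rw [hχ t q.1 hq', (hχz q.1 hq').1, (hχz q.1 hq').2]
        ring
      have hint : IntegrableOn (fun q : ℝ × Vec n => ε * (A + D) + D * R⁻¹ * |w.f t q.1 q.2|) S
          (stripMeasure n) :=
        (integrableOn_const hSf).add ((i1.const_mul _).integrableOn)
      have hle : ∀ q ∈ S, (cutoffJet R).e t q.1 * (softBump ε (w.f t q.1 q.2) * w.f t q.1 q.2 ^ 2)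
            * (‖b t q.1 q.2‖ ^ 2 / (2 * σ' ^ 2))
          + (s * (cutoffJet R).ez t q.1 + σ ^ 2 / 2 * (cutoffJet R).ezz t q.1)
            * softAbs ε (w.f t q.1 q.2)
          ≤ ε * (A + D) + D * R⁻¹ * |w.f t q.1 q.2| := by
        intro q hq
        obtain ⟨e1, e2⟩ := abs_cutoff_ez_le hC hR t q.1
        have hbb : ‖b t q.1 q.2‖ ^ 2 / (2 * σ' ^ 2) ≤ A := by
          rw [hA]
          refine div_le_div_of_nonneg_right ?_ (by positivity)
          have hb1 : ‖b t q.1 q.2‖ ≤ |K| * Real.exp (|k| * (2 * R)) := by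
            refine (hK t (hsub ht) q.1 q.2).trans ?_
            refine mul_le_mul (le_abs_self K) (Real.exp_le_exp.2 ?_) (Real.exp_pos _).le
              (abs_nonneg K)
            exact mul_le_mul (le_abs_self k) (abs_le.2 hq.1) (abs_nonneg _) (abs_nonneg _)
          calc ‖b t q.1 q.2‖ ^ 2 ≤ (|K| * Real.exp (|k| * (2 * R))) ^ 2 := by gcongr
            _ = K ^ 2 * Real.exp (2 * (|k| * (2 * R))) := by
                rw [mul_pow, sq_abs, ← Real.exp_nat_mul]; norm_num
        have f1 : (cutoffJet R).e t q.1 * (softBump ε (w.f t q.1 q.2) * w.f t q.1 q.2 ^ 2) ≤ ε :=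
          (mul_le_of_le_one_left (mul_nonneg (softBump_nonneg hε _) (sq_nonneg _))
            (cutoff_le_one _ _ _)).trans (softBump_mul_sq_le hε _)
        have f2 : (cutoffJet R).e t q.1 * (softBump ε (w.f t q.1 q.2) * w.f t q.1 q.2 ^ 2)
            * (‖b t q.1 q.2‖ ^ 2 / (2 * σ' ^ 2)) ≤ ε * A :=
          mul_le_mul f1 hbb (by positivity) hε.le
        have f3 : s * (cutoffJet R).ez t q.1 + σ ^ 2 / 2 * (cutoffJet R).ezz t q.1 ≤ D * R⁻¹ := by
          have g1 : s * (cutoffJet R).ez t q.1 ≤ |s| * (C * R⁻¹) := by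
            refine (le_abs_self _).trans ?_
            rw [abs_mul]; exact mul_le_mul_of_nonneg_left e1 (abs_nonneg _)
          have g2 : σ ^ 2 / 2 * (cutoffJet R).ezz t q.1 ≤ σ ^ 2 / 2 * (C * R⁻¹) :=
            mul_le_mul_of_nonneg_left ((le_abs_self _).trans e2) (by positivity)
          rw [hD]; linarith
        have f4 : (s * (cutoffJet R).ez t q.1 + σ ^ 2 / 2 * (cutoffJet R).ezz t q.1)
            * softAbs ε (w.f t q.1 q.2) ≤ D * R⁻¹ * (|w.f t q.1 q.2| + ε) :=
          mul_le_mul f3 (softAbs_le hε _) (softAbs_pos hε _).le (by positivity)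
        have f5 : D * R⁻¹ * ε ≤ D * ε :=
          mul_le_mul_of_nonneg_right (mul_le_of_le_one_right hD0 hRi) hε.le
        linarith
      have hcont : Continuous fun q : ℝ × Vec n =>
          (cutoffJet R).e t q.1 * (softBump ε (w.f t q.1 q.2) * w.f t q.1 q.2 ^ 2)
            * (‖b t q.1 q.2‖ ^ 2 / (2 * σ' ^ 2))
          + (s * (cutoffJet R).ez t q.1 + σ ^ 2 / 2 * (cutoffJet R).ezz t q.1)
            * softAbs ε (w.f t q.1 q.2) :=
        (((cχ t ht).mul (((continuous_softBump hε).comp (hJ'.cont_f.slice ht)).mul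
          ((hJ'.cont_f.slice ht).pow 2))).mul
          (((hb.cont.slice (hsub ht)).norm.pow 2).div_const _)).add
          (((((jointCont_of_signal hχc.cont_ez).slice ht).const_mul _).add
          (((jointCont_of_signal hχc.cont_ezz).slice ht).const_mul _)).mul (cA.slice ht))
      have hi0 : IntegrableOn (fun q : ℝ × Vec n =>
          (cutoffJet R).e t q.1 * (softBump ε (w.f t q.1 q.2) * w.f t q.1 q.2 ^ 2)
            * (‖b t q.1 q.2‖ ^ 2 / (2 * σ' ^ 2))
          + (s * (cutoffJet R).ez t q.1 + σ ^ 2 / 2 * (cutoffJet R).ezz t q.1)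
            * softAbs ε (w.f t q.1 q.2)) S (stripMeasure n) := by
        rw [hS, integrableOn_strip_iff]
        exact hcont.continuousOn.integrableOn_compact (isCompact_strip _)
      refine (setIntegral_mono_on hi0 hint hSm hle).trans ?_
      rw [integral_add (integrableOn_const (C := ε * (A + D)) hSf) ((i1.const_mul _).integrableOn),
        setIntegral_const, integral_const_mul, smul_eq_mul]
      have hset : ∫ q in S, |w.f t q.1 q.2| ∂stripMeasure n ≤ 2 :=
        (setIntegral_le_integral i1 (ae_of_all _ fun q => abs_nonneg _)).trans i2
      have : D * R⁻¹ * ∫ q in S, |w.f t q.1 q.2| ∂stripMeasure n ≤ D * R⁻¹ * 2 :=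
        mul_le_mul_of_nonneg_left hset (by positivity)
      have e : (stripMeasure n).real S * (ε * (A + D)) = ε * ((A + D) * V) := by rw [hV]; ring
      linarith
    have hGi : ∫ t in t₁..t₂, ∫ q, (cutoffJet R).e t q.1
        * softSign ε (w.f t q.1 q.2) * w.ft t q.1 q.2 ∂stripMeasure n
        ≤ (t₂ - t₁) * (ε * ((A + D) * V) + 2 * D * R⁻¹) := by
      -- A non-integrable function has integral zero by convention, which also satisfies the bound,
      -- so integrability in time need not be proved.
      by_cases hii : IntervalIntegrable (fun t => ∫ q, (cutoffJet R).e t q.1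
        * softSign ε (w.f t q.1 q.2) * w.ft t q.1 q.2 ∂stripMeasure n) volume t₁ t₂
      · have := intervalIntegral.integral_mono_on h12 hii
          (intervalIntegrable_const (c := ε * ((A + D) * V) + 2 * D * R⁻¹)) hG
        rwa [intervalIntegral.integral_const, smul_eq_mul] at this
      · rw [intervalIntegral.integral_undef hii]
        have : 0 ≤ V := measureReal_nonneg
        exact mul_nonneg (by linarith) (by positivity)
    have hlow : ∫ q, (cutoffJet R).e 0 q.1 * |w.f t₂ q.1 q.2| ∂stripMeasure n ≤ Y t₂ := by
      refine integral_mono_of_nonneg (ae_of_all _ fun q =>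
        mul_nonneg (cutoff_nonneg _ _ _) (abs_nonneg _)) ?_ (ae_of_all _ fun q =>
        mul_le_mul_of_nonneg_left (abs_le_softAbs ε _) (cutoff_nonneg _ _ _))
      exact integrable_strip_of_signalSupport ((cχ t₂ m2).mul (cA.slice m2)) (R := 2 * R)
        (f := fun z y => (cutoffJet R).e t₂ z * softAbs ε (w.f t₂ z y))
        fun z hz y => by simp only [cutoff_eq_zero (t := t₂) hR0 hz, zero_mul]
    have hup : Y t₁ ≤ ∫ q, |w.f t₁ q.1 q.2| ∂stripMeasure n + ε * V := by
      have hind : Integrable (S.indicator fun _ => ε) (stripMeasure n) :=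
        (integrable_indicator_iff hSm).2 (integrableOn_const hSf)
      calc Y t₁ ≤ ∫ q, (|w.f t₁ q.1 q.2| + S.indicator (fun _ => ε) q) ∂stripMeasure n := by
            refine integral_mono_of_nonneg (ae_of_all _ fun q =>
              mul_nonneg (cutoff_nonneg _ _ _) (softAbs_pos hε _).le)
              ((hwi t₁ m1).1.add hind) (ae_of_all _ fun q => ?_)
            by_cases hq : q ∈ S
            · simp only [Set.indicator_of_mem hq]
              exact (mul_le_of_le_one_left (softAbs_pos hε _).le (cutoff_le_one _ _ _)).trans
                (softAbs_le hε _)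
            · simp only [Set.indicator_of_notMem hq, add_zero]
              rw [hχ t₁ q.1 fun h => hq ⟨h, trivial⟩, zero_mul]
              exact abs_nonneg _
        _ = _ := by
            rw [integral_add (hwi t₁ m1).1 hind, integral_indicator hSm, setIntegral_const,
              smul_eq_mul, mul_comm]
    have hεM : ε * M = δ := by rw [hεd]; field_simp
    have : ε * M = (t₂ - t₁) * (ε * ((A + D) * V)) + ε * V + ε := by rw [hM]; ring
    nlinarith
  have l1 : Tendsto (fun j : ℕ => ∫ q, (cutoffJet ((j : ℝ) + 1)).e 0 q.1 * |w.f t₂ q.1 q.2|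
      ∂stripMeasure n) atTop (𝓝 (∫ q, |w.f t₂ q.1 q.2| ∂stripMeasure n)) := by
    refine tendsto_integral_of_dominated_convergence _ (fun j => ?_) (hwi t₂ m2).1 (fun j => ?_) ?_
    · exact (((jointCont_of_signal (cutoffJet_isC12 ((j : ℝ) + 1) {0}).cont_e).slice
        rfl).mul (hJ.cont_f.slice (hsub m2)).abs).aestronglyMeasurable
    · refine ae_of_all _ fun q => ?_
      rw [Real.norm_eq_abs, abs_mul, abs_of_nonneg (cutoff_nonneg _ _ _), abs_abs]
      exact mul_le_of_le_one_left (abs_nonneg _) (cutoff_le_one _ _ _)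
    · refine ae_of_all _ fun q => ?_
      simpa using (tendsto_cutoff 0 q.1).mul_const |w.f t₂ q.1 q.2|
  have l2 : Tendsto (fun j : ℕ => ∫ q, |w.f t₁ q.1 q.2| ∂stripMeasure n
      + 2 * D * (t₂ - t₁) * ((j : ℝ) + 1)⁻¹) atTop
      (𝓝 (∫ q, |w.f t₁ q.1 q.2| ∂stripMeasure n)) := by
    simpa using (tendsto_inv_nat_succ.const_mul (2 * D * (t₂ - t₁))).const_add
      (∫ q, |w.f t₁ q.1 q.2| ∂stripMeasure n)
  exact le_of_tendsto_of_tendsto' l1 l2 fun j => key _ (by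
    have : (0 : ℝ) ≤ j := Nat.cast_nonneg j
    linarith)

end Contraction

/-! ### Gaussian smoothing of trigonometric polynomials -/

section GaussianSmoothing

variable {ι : Type*} [Fintype ι]

/-- The exponential monomials `exp(2πi k · X)`. -/
def latticeWave (k : ι → ℤ) (X : ι → ℝ) : ℂ :=
  Complex.exp (Complex.I * ((∑ i, 2 * Real.pi * k i * X i : ℝ) : ℂ))

lemma integral_exp_I_gaussianReal (θ : ℝ) :
    ∫ x, Complex.exp (Complex.I * θ * x) ∂gaussianReal 0 1 = Complex.exp (-(θ : ℂ) ^ 2 / 2) := by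
  have h := complexMGF_id_gaussianReal (μ := 0) (v := 1) (Complex.I * θ)
  simp only [complexMGF, id] at h
  rw [h]
  congr 1
  rw [mul_pow, Complex.I_sq]
  push_cast
  ring

/-- Differentiate the complex moment generating function exp(z²/2) at iθ. -/
lemma integral_mul_exp_I_gaussianReal (θ : ℝ) :
    ∫ x, (x : ℂ) * Complex.exp (Complex.I * θ * x) ∂gaussianReal 0 1
      = Complex.I * θ * Complex.exp (-(θ : ℂ) ^ 2 / 2) := by
  have h := hasDerivAt_complexMGF (X := id) (μ := gaussianReal 0 1) (z := Complex.I * θ) (by simp)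
  have e : complexMGF id (gaussianReal 0 1) = fun z => Complex.exp (z ^ 2 / 2) := by
    funext z
    rw [complexMGF_id_gaussianReal]
    congr 1
    push_cast
    ring
  rw [e] at h
  have h2 : HasDerivAt (fun z : ℂ => Complex.exp (z ^ 2 / 2))
      (Complex.exp ((Complex.I * θ) ^ 2 / 2) * (2 * (Complex.I * θ) / 2)) (Complex.I * θ) := by
    simpa using ((hasDerivAt_pow 2 (Complex.I * (θ : ℂ))).div_const 2).cexp
  have h3 := h.unique h2
  simp only [id] at h3
  rw [h3, mul_pow, Complex.I_sq]
  ring_nf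

lemma integral_abs_gaussianReal_le : Integrable (fun x : ℝ => |x|) (gaussianReal 0 1) ∧
    ∫ x, |x| ∂gaussianReal 0 1 ≤ 1 := by
  have hL2 : MemLp id 2 (gaussianReal 0 1) := memLp_id_gaussianReal 2
  have hi : Integrable (fun x : ℝ => |x|) (gaussianReal 0 1) :=
    ((hL2.integrable (by norm_num))).abs
  have hs : Integrable (fun x : ℝ => x ^ 2) (gaussianReal 0 1) := hL2.integrable_sq
  have hv : ∫ x, x ^ 2 ∂gaussianReal 0 1 = 1 := by
    have h1 := variance_id_gaussianReal (μ := 0) (v := 1)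
    rw [variance_of_integral_eq_zero measurable_id.aemeasurable (by simp)] at h1
    simpa using h1
  refine ⟨hi, ?_⟩
  calc ∫ x, |x| ∂gaussianReal 0 1 ≤ ∫ x, (1 + x ^ 2) / 2 ∂gaussianReal 0 1 := by
        refine integral_mono hi (((integrable_const 1).add hs).div_const 2) fun x => ?_
        simp only
        nlinarith [sq_abs x, sq_nonneg (|x| - 1)]
    _ = 1 := by
        rw [integral_div, integral_add (integrable_const 1) hs, hv]
        simp

lemma latticeWave_add_mul (k : ι → ℤ) (X a ζ : ι → ℝ) :
    latticeWave k (fun i => X i + a i * ζ i)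
      = latticeWave k X * ∏ i, Complex.exp (Complex.I * ((2 * Real.pi * k i * a i : ℝ) : ℂ) * ζ i) := by
  rw [latticeWave, latticeWave, ← Complex.exp_sum, ← Complex.exp_add]
  congr 1
  push_cast
  rw [Finset.mul_sum, Finset.mul_sum, ← Finset.sum_add_distrib]
  exact Finset.sum_congr rfl fun i _ => by ring

lemma continuous_latticeWave (k : ι → ℤ) : Continuous (latticeWave k) := by
  unfold latticeWave; fun_prop

lemma norm_latticeWave (k : ι → ℤ) (X : ι → ℝ) : ‖latticeWave k X‖ = 1 := by
  rw [latticeWave, mul_comm, Complex.norm_exp_ofReal_mul_I]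

/-- The coordinates of ζ are independent, so the integral factorises; only the l-th factor carries
the extra ζ_l, which produces iθ_l. This is Gaussian integration by parts, written on exponentials.
-/
lemma integral_latticeWave_gaussian [DecidableEq ι] (k : ι → ℤ) (X a : ι → ℝ) (l : ι) :
    ∫ ζ, latticeWave k (fun i => X i + a i * ζ i) * (ζ l : ℂ)
        ∂Measure.pi (fun _ : ι => gaussianReal 0 1)
      = latticeWave k X * (Complex.I * ((2 * Real.pi * k l * a l : ℝ) : ℂ)
        * Complex.exp (-((∑ i, (2 * Real.pi * k i * a i) ^ 2 / 2 : ℝ) : ℂ))) := by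
  set θ : ι → ℝ := fun i => 2 * Real.pi * k i * a i with hθ
  let h : ι → ℝ → ℂ := fun i x => Complex.exp (Complex.I * θ i * x) * (if i = l then (x : ℂ) else 1)
  have e1 : ∀ ζ : ι → ℝ, latticeWave k (fun i => X i + a i * ζ i) * (ζ l : ℂ)
      = latticeWave k X * ∏ i, h i (ζ i) := by
    intro ζ
    rw [latticeWave_add_mul, Finset.prod_mul_distrib, Finset.prod_ite_eq' Finset.univ l,
      if_pos (Finset.mem_univ l), mul_assoc]
  have e2 : ∀ i, ∫ x, h i x ∂gaussianReal 0 1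
      = Complex.exp (-(θ i : ℂ) ^ 2 / 2) * (if i = l then Complex.I * θ i else 1) := by
    intro i
    by_cases hi : i = l
    · simp only [h, if_pos hi]
      rw [← integral_mul_exp_I_gaussianReal (θ i) |>.trans (mul_comm _ _)]
      exact integral_congr_ae (ae_of_all _ fun x => mul_comm _ _)
    · simp only [h, if_neg hi, mul_one]
      exact integral_exp_I_gaussianReal (θ i)
  simp_rw [e1]
  rw [integral_const_mul, integral_fintype_prod_eq_prod]
  simp_rw [e2]
  rw [Finset.prod_mul_distrib, Finset.prod_ite_eq' Finset.univ l, if_pos (Finset.mem_univ l),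
    ← Complex.exp_sum]
  congr 1
  rw [mul_comm]
  congr 2
  push_cast
  rw [← Finset.sum_neg_distrib]
  exact Finset.sum_congr rfl fun i _ => by simp only [hθ]; push_cast; ring

/-- The gradient bound for the heat semigroup on trigonometric polynomials. -/
lemma norm_gaussian_gradient_le [DecidableEq ι] {S : Finset (ι → ℤ)} {c : (ι → ℤ) → ℂ} {M : ℝ}
    (hM : ∀ X, ‖∑ k ∈ S, c k * latticeWave k X‖ ≤ M) {a : ι → ℝ} {l : ι} (hl : 0 < a l)
    (X : ι → ℝ) :
    ‖∑ k ∈ S, c k * (latticeWave k X * (Complex.I * ((2 * Real.pi * k l : ℝ) : ℂ)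
        * Complex.exp (-((∑ i, (2 * Real.pi * k i * a i) ^ 2 / 2 : ℝ) : ℂ))))‖ ≤ M / a l := by
  set ν := Measure.pi (fun _ : ι => gaussianReal 0 1)
  have hM0 : 0 ≤ M := (norm_nonneg _).trans (hM X)
  have hmp : MeasurePreserving (Function.eval l) ν (gaussianReal 0 1) := measurePreserving_eval _ l
  have habs : Integrable (fun ζ : ι → ℝ => |ζ l|) ν :=
    hmp.integrable_comp_of_integrable integral_abs_gaussianReal_le.1
  have habs1 : ∫ ζ, |ζ l| ∂ν ≤ 1 := by
    have : ∫ ζ, |ζ l| ∂ν = ∫ x, |x| ∂gaussianReal 0 1 := by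
      rw [← hmp.map_eq, integral_map hmp.measurable.aemeasurable (by fun_prop)]
    rw [this]; exact integral_abs_gaussianReal_le.2
  have hi : ∀ k : ι → ℤ, Integrable (fun ζ : ι → ℝ =>
      c k * (latticeWave k (fun i => X i + a i * ζ i) * (ζ l : ℂ))) ν := by
    intro k
    refine (habs.mono' ?_ (ae_of_all _ fun ζ => ?_)).const_mul (c k)
    · exact (((continuous_latticeWave k).comp (by fun_prop)).mul
        (by fun_prop)).aestronglyMeasurable
    · rw [norm_mul, norm_latticeWave, one_mul, Complex.norm_real, Real.norm_eq_abs]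
  -- The l-th derivative of the smoothed polynomial P is the expectation of P(X + aζ) ζ_l / a_l, in
  -- which P is no longer differentiated. Hence sup |P| and E|ζ_l| ≤ 1 suffice.
  have e : ∑ k ∈ S, c k * (latticeWave k X * (Complex.I * ((2 * Real.pi * k l : ℝ) : ℂ)
        * Complex.exp (-((∑ i, (2 * Real.pi * k i * a i) ^ 2 / 2 : ℝ) : ℂ))))
      = ((a l)⁻¹ : ℝ) * ∫ ζ, (∑ k ∈ S, c k * latticeWave k (fun i => X i + a i * ζ i)) * (ζ l : ℂ)
        ∂ν := by
    simp_rw [Finset.sum_mul, mul_assoc]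
    rw [integral_finsetSum _ fun k _ => hi k, Finset.mul_sum]
    refine Finset.sum_congr rfl fun k _ => ?_
    rw [integral_const_mul, integral_latticeWave_gaussian]
    have : (a l : ℂ) ≠ 0 := by exact_mod_cast hl.ne'
    push_cast
    field_simp
  rw [e, norm_mul, Complex.norm_real, Real.norm_eq_abs, abs_of_pos (inv_pos.2 hl), div_eq_inv_mul]
  refine mul_le_mul_of_nonneg_left ?_ (inv_pos.2 hl).le
  calc _ ≤ ∫ ζ, M * |ζ l| ∂ν := by
        refine norm_integral_le_of_norm_le (habs.const_mul M) (ae_of_all _ fun ζ => ?_)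
        rw [norm_mul, Complex.norm_real, Real.norm_eq_abs]
        exact mul_le_mul_of_nonneg_right (hM _) (abs_nonneg _)
    _ ≤ M := by
        rw [integral_const_mul]
        exact mul_le_of_le_one_right hM0 habs1

end GaussianSmoothing

/-! ### Approximation by trigonometric polynomials -/

section Approximation

variable {n : ℕ}

open UnitAddTorus in
-- Density of the Fourier monomials. The extra coordinate `none` is reserved for the signal, made
-- periodic with a large period.
lemma exists_trigPoly_near (f : C(UnitAddTorus (Option (Fin n)), ℂ)) {δ : ℝ} (hδ : 0 < δ) :
    ∃ (S : Finset (Option (Fin n) → ℤ)) (c : (Option (Fin n) → ℤ) → ℂ), ∀ X : Option (Fin n) → ℝ,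
      ‖f (fun i => (X i : UnitAddCircle)) - ∑ k ∈ S, c k * latticeWave k X‖ ≤ δ := by
  have hf : f ∈ (Submodule.span ℂ (Set.range (mFourier (d := Option (Fin n))))).topologicalClosure := by
    rw [span_mFourier_closure_eq_top]; trivial
  obtain ⟨p, hp, hpf⟩ := Metric.mem_closure_iff.1 hf δ hδ
  obtain ⟨c, rfl⟩ := Finsupp.mem_span_range_iff_exists_finsupp.1 hp
  refine ⟨c.support, c, fun X => ?_⟩
  have h1 : ‖(f - c.sum fun i a => a • mFourier i) (fun i => (X i : UnitAddCircle))‖ ≤ δ := by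
    rw [dist_eq_norm] at hpf
    exact (ContinuousMap.norm_coe_le_norm _ _).trans hpf.le
  refine le_of_eq_of_le ?_ h1
  congr 1
  rw [ContinuousMap.sub_apply, Finsupp.sum, ContinuousMap.sum_apply]
  congr 1
  refine Finset.sum_congr rfl fun k _ => ?_
  rw [ContinuousMap.smul_apply, smul_eq_mul, latticeWave]
  congr 1
  simp only [mFourier, ContinuousMap.coe_mk, fourier_coe_apply]
  rw [← Complex.exp_sum]
  congr 1
  push_cast
  rw [Finset.mul_sum]
  exact Finset.sum_congr rfl fun i _ => by simp; ring

/-- A bounded continuous function on `ℝ × 𝕋ⁿ` is approximated, locally uniformly in the signal,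
by trigonometric polynomials with the same bound. -/
lemma exists_trigPoly_approx {g : ℝ × Torus n → ℝ} (hg : Continuous g) (hg1 : ∀ q, |g q| ≤ 1)
    {L δ : ℝ} (hL : 0 < L) (hδ : 0 < δ) (hδ1 : δ ≤ 1) :
    ∃ (S : Finset (Option (Fin n) → ℤ)) (c : (Option (Fin n) → ℤ) → ℂ),
      (∀ X, ‖∑ k ∈ S, c k * latticeWave k X‖ ≤ 2) ∧
      ∀ z, |z| ≤ L / 4 → ∀ y : Vec n,
        |g (z, toTorus y) - (∑ k ∈ S, c k * latticeWave k
          (fun i => i.elim (z / L) fun j => y j)).re| ≤ δ := by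
  -- On the circle ‖θ + 1/4‖ - 1/4 is continuous and equals θ for |θ| ≤ 1/4. Composing g with L
  -- times it periodises the signal without changing g for |z| ≤ L/4, and keeps the bound on g.
  let f : C(UnitAddTorus (Option (Fin n)), ℂ) :=
    { toFun := fun θ => ((g (L * (‖θ none + ((1 / 4 : ℝ) : UnitAddCircle)‖ - 1 / 4),
        fun i => θ (some i)) : ℝ) : ℂ)
      continuous_toFun := by
        refine Complex.continuous_ofReal.comp (hg.comp ?_)
        fun_prop }
  obtain ⟨S, c, h⟩ := exists_trigPoly_near f hδ
  refine ⟨S, c, fun X => ?_, fun z hz y => ?_⟩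
  · have h1 := h X
    have h2 : ‖f (fun i => (X i : UnitAddCircle))‖ ≤ 1 := by
      simp only [f, ContinuousMap.coe_mk, Complex.norm_real, Real.norm_eq_abs]
      exact hg1 _
    calc ‖∑ k ∈ S, c k * latticeWave k X‖
        = ‖f (fun i => (X i : UnitAddCircle)) - (f (fun i => (X i : UnitAddCircle))
          - ∑ k ∈ S, c k * latticeWave k X)‖ := by congr 1; ring
      _ ≤ 1 + δ := (norm_sub_le _ _).trans (add_le_add h2 h1)
      _ ≤ 2 := by linarith
  · have h1 := (Complex.abs_re_le_norm _).trans (h (fun i => i.elim (z / L) fun j => y j))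
    have hz' := abs_le.1 hz
    have e : ‖(((z / L : ℝ) : UnitAddCircle) + ((1 / 4 : ℝ) : UnitAddCircle))‖ = z / L + 1 / 4 := by
      have b1 : -(1 / 4) ≤ z / L := by rw [le_div_iff₀ hL]; linarith [hz'.1]
      have b2 : z / L ≤ 1 / 4 := by rw [div_le_iff₀ hL]; linarith [hz'.2]
      rw [← AddCircle.coe_add, (AddCircle.norm_coe_eq_abs_iff 1 one_ne_zero).2,
        abs_of_nonneg (by linarith)]
      rw [abs_of_nonneg (by linarith), abs_one]
      linarith
    have e2 : f (fun i => ((i.elim (z / L) fun j => y j : ℝ) : UnitAddCircle))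
        = ((g (z, toTorus y) : ℝ) : ℂ) := by
      simp only [f, ContinuousMap.coe_mk, Option.elim]
      rw [e]
      congr 3
      field_simp
      ring
    rw [e2] at h1
    simpa using h1

end Approximation

/-! ### The smoothing estimate -/

section Smoothing

variable {n : ℕ} {σ σ' T s : ℝ} {b : ℝ → ℝ → Vec n → Vec n} {ρ₀ : ProbabilityMeasure (Torus n)}
  {J₁ J₂ : Jet n}

/-- The dual lattice vector with given integer coordinates. -/
def latticeVec (k : Option (Fin n) → ℤ) : Vec n := WithLp.toLp 2 fun j => 2 * Real.pi * k (some j)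

lemma isDualLattice_latticeVec (k : Option (Fin n) → ℤ) : IsDualLattice (latticeVec k) :=
  fun i => ⟨k (some i), rfl⟩

/-- At time t the wave is its terminal monomial, shifted by s(τ - t) in the signal and damped by the
characteristic function of Gaussian noise with deviations σ√(τ - t)/L and σ'√(τ - t). It is thus in
the form required by `norm_gaussian_gradient_le`. -/
lemma wave_eq_latticeWave (c : ℂ) (k : Option (Fin n) → ℤ) (L τ t z : ℝ) (ht : t ≤ τ) (y : Vec n) :
    wave c (waveSymbol σ σ' s (2 * Real.pi * k none / L) (latticeVec k))
        (2 * Real.pi * k none / L) τ (latticeVec k) t z y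
      = c * (latticeWave k (fun i => i.elim ((z + s * (τ - t)) / L) fun j => y j)
        * Complex.exp (-((∑ i, (2 * Real.pi * k i * Option.elim i (σ * √(τ - t) / L)
          fun _ => σ' * √(τ - t)) ^ 2 / 2 : ℝ) : ℂ))) := by
  have hs : √(τ - t) ^ 2 = τ - t := Real.sq_sqrt (by linarith)
  rw [wave, latticeWave, ← Complex.exp_add]
  congr 2
  have e1 : (inner ℝ (latticeVec k) y : ℝ) = ∑ j, 2 * Real.pi * k (some j) * y j := by
    rw [PiLp.inner_apply]
    exact Finset.sum_congr rfl fun j _ => by simp [latticeVec, mul_comm]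
  have e2 : ‖latticeVec k‖ ^ 2 = ∑ j, (2 * Real.pi * k (some j)) ^ 2 := by
    rw [EuclideanSpace.norm_sq_eq]
    exact Finset.sum_congr rfl fun j _ => by rw [Real.norm_eq_abs, sq_abs]; rfl
  rw [e1, Fintype.sum_option, Fintype.sum_option, waveSymbol, e2]
  simp only [Option.elim]
  have e3 : ∑ j, (2 * Real.pi * (k (some j)) * (σ' * √(τ - t))) ^ 2 / 2
      = σ' ^ 2 / 2 * (τ - t) * ∑ j, (2 * Real.pi * k (some j)) ^ 2 := by
    rw [Finset.mul_sum]
    refine Finset.sum_congr rfl fun j _ => ?_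
    rw [mul_pow, mul_pow σ', hs]; ring
  have e4 : (2 * Real.pi * (k none) * (σ * √(τ - t) / L)) ^ 2 / 2
      = σ ^ 2 / 2 * (2 * Real.pi * (k none) / L) ^ 2 * (τ - t) := by
    rw [mul_pow, div_pow, mul_pow σ, hs]; ring
  rw [e3, e4]
  push_cast
  ring

/-- Only the scalar product of b with the position gradient of the smoothed polynomial is left. Each
of the n coordinates of that gradient is at most 2/(σ'√(τ - t)), independently of the polynomial and
of L. -/
lemma abs_sum_fpAdj_wave_le (hσ' : 0 < σ') {S : Finset (Option (Fin n) → ℤ)}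
    {c : (Option (Fin n) → ℤ) → ℂ} (hc : ∀ X, ‖∑ k ∈ S, c k * latticeWave k X‖ ≤ 2) (L : ℝ)
    {τ t : ℝ} (ht : t < τ) (z : ℝ) (y : Vec n) :
    |∑ k ∈ S, fpAdj σ σ' s b (waveJet (c k) (waveSymbol σ σ' s (2 * Real.pi * k none / L)
        (latticeVec k)) (2 * Real.pi * k none / L) τ (latticeVec k)) t z y|
      ≤ n * (2 / (σ' * √(τ - t))) * ‖b t z y‖ := by
  have hsq : 0 < √(τ - t) := Real.sqrt_pos.2 (by linarith)
  set a : Option (Fin n) → ℝ := fun i => Option.elim i (σ * √(τ - t) / L) fun _ => σ' * √(τ - t)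
    with ha
  set X : Option (Fin n) → ℝ := fun i => i.elim ((z + s * (τ - t)) / L) fun j => y j with hX
  have e : ∑ k ∈ S, fpAdj σ σ' s b (waveJet (c k) (waveSymbol σ σ' s (2 * Real.pi * k none / L)
        (latticeVec k)) (2 * Real.pi * k none / L) τ (latticeVec k)) t z y
      = ∑ j, b t z y j * (∑ k ∈ S, c k * (latticeWave k X
        * (Complex.I * ((2 * Real.pi * k (some j) : ℝ) : ℂ)
        * Complex.exp (-((∑ i, (2 * Real.pi * k i * a i) ^ 2 / 2 : ℝ) : ℂ))))).re := by
    simp_rw [fpAdj_waveJet, Complex.re_sum, Finset.mul_sum]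
    rw [Finset.sum_comm]
    refine Finset.sum_congr rfl fun k _ => ?_
    rw [PiLp.inner_apply, Finset.mul_sum]
    refine Finset.sum_congr rfl fun j _ => ?_
    rw [wave_eq_latticeWave _ _ _ _ _ _ ht.le]
    have e1 : c k * (latticeWave k X * (Complex.I * ((2 * Real.pi * k (some j) : ℝ) : ℂ)
        * Complex.exp (-((∑ i, (2 * Real.pi * k i * a i) ^ 2 / 2 : ℝ) : ℂ))))
        = (Complex.I * (c k * (latticeWave k X
        * Complex.exp (-((∑ i, (2 * Real.pi * k i * a i) ^ 2 / 2 : ℝ) : ℂ)))))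
          * ((2 * Real.pi * k (some j) : ℝ) : ℂ) := by ring
    rw [e1, Complex.re_mul_ofReal]
    simp only [latticeVec, RCLike.inner_apply, conj_trivial]
    ring
  rw [e]
  calc _ ≤ ∑ j : Fin n, ‖b t z y‖ * (2 / (σ' * √(τ - t))) := by
        refine (Finset.abs_sum_le_sum_abs _ _).trans (Finset.sum_le_sum fun j _ => ?_)
        rw [abs_mul]
        refine mul_le_mul ?_ ?_ (abs_nonneg _) (norm_nonneg _)
        · rw [← Real.norm_eq_abs]; exact PiLp.norm_apply_le _ _
        · exact (Complex.abs_re_le_norm _).trans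
            (norm_gaussian_gradient_le hc (a := a) (l := some j) (mul_pos hσ' hsq) X)
    _ = _ := by simp; ring

/-- Duality of the difference of two solutions with a plane wave. -/
lemma IsFP.pairing_wave (h : IsFP σ σ' T s b ρ₀ J₁) (hb : IsDrift T b) {τ : ℝ}
    (hτ : τ ∈ Set.Ioc 0 T) (c : ℂ) (κ : ℝ) {q : Vec n} (hq : IsDualLattice q) {g : ℝ × Torus n → ℝ}
    (hg : ∀ z y, g (z, toTorus y) = (waveJet c (waveSymbol σ σ' s κ q) κ τ q).f 0 z y) :
    (∫ p, (waveJet c (waveSymbol σ σ' s κ q) κ τ q).f τ p.1 p.2 * J₁.f τ p.1 p.2 ∂stripMeasure n)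
        - ∫ x, g (0, x) ∂(ρ₀ : Measure (Torus n))
      = ∫ p, fpAdj σ σ' s b (waveJet c (waveSymbol σ σ' s κ q) κ τ q) p.1 p.2.1 p.2.2
          * J₁.f p.1 p.2.1 p.2.2 ∂slabMeasure n (Set.Ioo 0 τ) ∧
    Integrable (fun p : ℝ × ℝ × Vec n =>
      fpAdj σ σ' s b (waveJet c (waveSymbol σ σ' s κ q) κ τ q) p.1 p.2.1 p.2.2
          * J₁.f p.1 p.2.1 p.2.2) (slabMeasure n (Set.Ioo 0 τ)) := by
  obtain ⟨K, k, hK⟩ := hb.growth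
  -- The first summand dominates the wave and its signal derivative, the second the drift term, up
  -- to the exponential growth of the drift.
  set A := ‖c‖ * (1 + |κ|) + ‖c‖ * ‖q‖ * |K| with hA
  obtain ⟨B, hB0, hB⟩ := h.exists_exp_moment_bound hb A |k|
  have hre : ∀ a : ℂ, |a.re| ≤ ‖a‖ := Complex.abs_re_le_norm
  have hexp : ∀ z : ℝ, 1 ≤ Real.exp (|k| * |z|) := fun z => Real.one_le_exp (by positivity)
  have hA1 : ∀ z x : ℝ, x ≤ A → x ≤ A * Real.exp (|k| * |z|) := fun z x hx =>
    hx.trans (le_mul_of_one_le_right (by positivity) (hexp z))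
  have hlt : ∀ t ∈ Set.Ioc 0 τ, t ∈ Set.Ioc 0 T := fun t ht => ⟨ht.1, ht.2.trans hτ.2⟩
  have h3 : ∀ r ∈ Set.Ioo 0 τ, ∀ z y,
      |fpAdj σ σ' s b (waveJet c (waveSymbol σ σ' s κ q) κ τ q) r z y|
        ≤ A * Real.exp (|k| * |z|) := by
    intro r hr z y
    rw [fpAdj_waveJet, abs_mul]
    have i1 : |(Complex.I * wave c (waveSymbol σ σ' s κ q) κ τ q r z y).re| ≤ ‖c‖ := by
      refine (hre _).trans ?_
      rw [norm_mul, Complex.norm_I, one_mul]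
      exact norm_wave_le c _ hr.2.le z y
    have i2 : |inner ℝ q (b r z y)| ≤ ‖q‖ * (|K| * Real.exp (|k| * |z|)) := by
      refine (abs_real_inner_le_norm _ _).trans (mul_le_mul_of_nonneg_left ?_ (norm_nonneg _))
      refine (hK r ⟨hr.1, hr.2.trans_le hτ.2⟩ z y).trans ?_
      refine mul_le_mul (le_abs_self K) (Real.exp_le_exp.2 ?_) (Real.exp_pos _).le (abs_nonneg _)
      exact mul_le_mul_of_nonneg_right (le_abs_self k) (abs_nonneg _)
    calc _ ≤ ‖c‖ * (‖q‖ * (|K| * Real.exp (|k| * |z|))) :=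
          mul_le_mul i1 i2 (abs_nonneg _) (norm_nonneg _)
      _ = (‖c‖ * ‖q‖ * |K|) * Real.exp (|k| * |z|) := by ring
      _ ≤ _ := by
          refine mul_le_mul_of_nonneg_right ?_ (Real.exp_pos _).le
          rw [hA]; have : 0 ≤ ‖c‖ * (1 + |κ|) := by positivity
          linarith
  have hnA : ‖c‖ * (1 + |κ|) ≤ A := by
    rw [hA]; have : 0 ≤ ‖c‖ * ‖q‖ * |K| := by positivity
    linarith
  refine ⟨h.pairing hb hτ.1 hτ.2 (waveJet_isC12 hq c _ κ τ _) (waveJet_isC12 hq c _ κ τ _).cont_f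
    (W := fun _ z => A * Real.exp (|k| * |z|)) (by fun_prop)
    (B := ENNReal.ofReal B) ENNReal.ofReal_ne_top (fun r hr => hB r (hlt r hr))
    (fun r hr z y => hA1 z _ ?_) (fun r hr z y => hA1 z _ ?_) h3 hg,
    h.integrable_slab_weight hτ.2 (jointCont_fpAdj (waveJet_isC12 hq c _ κ τ _)
      (hb.cont.mono (Set.Ioo_subset_Ioo_right hτ.2))) (B := ENNReal.ofReal B) ENNReal.ofReal_ne_top
      (fun r hr => hB r (hlt r ⟨hr.1, hr.2.le⟩)) h3⟩
  · refine ((hre _).trans (norm_wave_le c _ hr.2 z y)).trans (le_trans ?_ hnA)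
    exact le_mul_of_one_le_right (norm_nonneg _) (by simp)
  · refine (hre _).trans (le_trans ?_ hnA)
    rw [norm_mul, norm_mul, Complex.norm_I, one_mul, Complex.norm_real, Real.norm_eq_abs]
    refine (mul_le_mul_of_nonneg_left (norm_wave_le c _ hr.2.le z y) (abs_nonneg κ)).trans ?_
    nlinarith [norm_nonneg c, abs_nonneg κ]

/-- The gradient of the smoothed test function blows up at t = τ, but integrably; its total is the
source of the rate √τ. -/
lemma integral_inv_sqrt_sub {τ : ℝ} (hτ : 0 < τ) :
    IntegrableOn (fun r => (√(τ - r))⁻¹) (Set.Ioo 0 τ) ∧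
      ∫ r in Set.Ioo 0 τ, (√(τ - r))⁻¹ = 2 * √τ := by
  have e : ∀ x : ℝ, (√x)⁻¹ = x⁻¹ ^ (1 / 2 : ℝ) := fun x => by
    rw [← Real.sqrt_inv, Real.sqrt_eq_rpow]
  have hd : ∀ r ∈ Set.Ioo 0 τ, HasDerivAt (fun r => -2 * √(τ - r)) ((√(τ - r))⁻¹) r := by
    intro r hr
    have h1 : HasDerivAt (fun r => τ - r) (-1) r := by simpa using (hasDerivAt_id r).const_sub τ
    refine ((h1.sqrt (by linarith [hr.2])).const_mul (-2)).congr_deriv ?_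
    have : √(τ - r) ≠ 0 := (Real.sqrt_pos.2 (by linarith [hr.2])).ne'
    field_simp
  have hc : ContinuousOn (fun r => -2 * √(τ - r)) (Set.Icc 0 τ) := by fun_prop
  have hi : IntervalIntegrable (fun r => (√(τ - r))⁻¹) volume 0 τ :=
    intervalIntegral.intervalIntegrable_deriv_of_nonneg (by rwa [Set.uIcc_of_le hτ.le])
      (by simpa [hτ.le] using hd) (fun r _ => by positivity)
  have h2 := intervalIntegral.integral_eq_sub_of_hasDerivAt_of_le hτ.le hc hd hi
  rw [intervalIntegral.integral_of_le hτ.le, integral_Ioc_eq_integral_Ioo] at h2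
  refine ⟨((intervalIntegrable_iff_integrableOn_Ioo_of_le hτ.le).1 hi), h2.trans ?_⟩
  simp

/-- Two solutions with the same initial law are close for small times. -/
lemma IsFP.exists_integral_abs_sub_le_sqrt (h₁ : IsFP σ σ' T s b ρ₀ J₁)
    (h₂ : IsFP σ σ' T s b ρ₀ J₂) (hb : IsDrift T b) (hσ' : 0 < σ') :
    ∃ C : ℝ, ∀ τ ∈ Set.Ioo 0 T,
      ∫ q, |J₁.f τ q.1 q.2 - J₂.f τ q.1 q.2| ∂stripMeasure n ≤ C * √τ := by
  obtain ⟨K, k, hK⟩ := hb.growth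
  obtain ⟨B₁, hB₁0, hB₁⟩ := h₁.exists_exp_moment_bound hb |K| k
  obtain ⟨B₂, hB₂0, hB₂⟩ := h₂.exists_exp_moment_bound hb |K| k
  set D := (n : ℝ) * (2 / σ') * (B₁ + B₂) with hD
  refine ⟨2 * D, fun τ hτ => ?_⟩
  have hτ' : τ ∈ Set.Ioc 0 T := ⟨hτ.1, hτ.2.le⟩
  set w : ℝ → Vec n → ℝ := fun z y => J₁.f τ z y - J₂.f τ z y with hw
  have hwc : Continuous fun q : ℝ × Vec n => w q.1 q.2 :=
    (h₁.cont.slice hτ').sub (h₂.cont.slice hτ')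
  have hwi : Integrable (fun q : ℝ × Vec n => w q.1 q.2) (stripMeasure n) :=
    (h₁.integrable hτ').1.sub (h₂.integrable hτ').1
  -- the estimate for trigonometric polynomials
  have main : ∀ (S : Finset (Option (Fin n) → ℤ)) (c : (Option (Fin n) → ℤ) → ℂ) (L : ℝ),
      (∀ X, ‖∑ k ∈ S, c k * latticeWave k X‖ ≤ 2) →
      |∫ q, (∑ k ∈ S, c k * latticeWave k (fun i => i.elim (q.1 / L) fun j => q.2 j)).re
        * w q.1 q.2 ∂stripMeasure n| ≤ 2 * D * √τ := by
    intro S c L hc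
    set Ψ : (Option (Fin n) → ℤ) → Jet n := fun k => waveJet (c k)
      (waveSymbol σ σ' s (2 * Real.pi * k none / L) (latticeVec k)) (2 * Real.pi * k none / L) τ
        (latticeVec k) with hΨ
    have hΨτ : ∀ k z (y : Vec n), (Ψ k).f τ z y
        = (c k * latticeWave k (fun i => i.elim (z / L) fun j => y j)).re := by
      intro k z y
      simp only [hΨ, waveJet]
      rw [wave_eq_latticeWave _ _ _ _ _ _ le_rfl]
      simp [latticeWave]
    have hp : ∀ k, ∫ p, (Ψ k).f τ p.1 p.2 * w p.1 p.2 ∂stripMeasure n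
          = ∫ p, fpAdj σ σ' s b (Ψ k) p.1 p.2.1 p.2.2 *
            (J₁.f p.1 p.2.1 p.2.2 - J₂.f p.1 p.2.1 p.2.2) ∂slabMeasure n (Set.Ioo 0 τ) ∧
        Integrable (fun p : ℝ × ℝ × Vec n => fpAdj σ σ' s b (Ψ k) p.1 p.2.1 p.2.2 *
            (J₁.f p.1 p.2.1 p.2.2 - J₂.f p.1 p.2.1 p.2.2)) (slabMeasure n (Set.Ioo 0 τ)) := by
      intro k
      have hqd := isDualLattice_latticeVec k
      have hper := (waveJet_isC12 hqd (c k) (waveSymbol σ σ' s (2 * Real.pi * k none / L)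
        (latticeVec k)) (2 * Real.pi * k none / L) τ Set.univ).periodic
      -- An arbitrary lift to the universal cover; periodicity makes the choice harmless.
      let g : ℝ × Torus n → ℝ := fun q => (Ψ k).f 0 q.1
        (Function.surjInv isOpenQuotientMap_toTorus.surjective q.2)
      have hg : ∀ z y, g (z, toTorus y) = (Ψ k).f 0 z y := fun z y =>
        hper 0 z _ _ (Function.surjInv_eq _ _)
      obtain ⟨e1, i1⟩ := h₁.pairing_wave hb hτ' (c k) (2 * Real.pi * k none / L) hqd hg
      obtain ⟨e2, i2⟩ := h₂.pairing_wave hb hτ' (c k) (2 * Real.pi * k none / L) hqd hg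
      have cΨ : Continuous fun q : ℝ × Vec n => (Ψ k).f τ q.1 q.2 :=
        (waveJet_isC12 hqd (c k) _ (2 * Real.pi * k none / L) τ Set.univ).cont_f.slice trivial
      have bΨ : ∀ z, ∀ y ∈ unitCube n, |(Ψ k).f τ z y| ≤ ‖c k‖ := fun z y _ =>
        (Complex.abs_re_le_norm _).trans (norm_wave_le (c k) _ le_rfl z y)
      have j1 := h₁.integrable_mul hτ' cΨ bΨ
      have j2 := h₂.integrable_mul hτ' cΨ bΨ
      refine ⟨?_, ?_⟩
      -- Both pairings contain the same initial integral against ρ₀, which cancels.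
      · simp only [hw, mul_sub]
        rw [integral_sub j1 j2, integral_sub i1 i2, ← e1, ← e2]
        ring
      · simp only [mul_sub]
        exact i1.sub i2
    have j : ∀ k, Integrable (fun p : ℝ × Vec n => (Ψ k).f τ p.1 p.2 * w p.1 p.2)
        (stripMeasure n) := by
      intro k
      have cΨ : Continuous fun q : ℝ × Vec n => (Ψ k).f τ q.1 q.2 :=
        (waveJet_isC12 (isDualLattice_latticeVec k) (c k) _ (2 * Real.pi * k none / L) τ
          Set.univ).cont_f.slice trivial
      refine hwi.bdd_mul (c := ‖c k‖) cΨ.aestronglyMeasurable (ae_of_all _ fun q => ?_)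
      exact (Complex.abs_re_le_norm _).trans (norm_wave_le (c k) _ le_rfl _ _)
    have e : ∫ q, (∑ k ∈ S, c k * latticeWave k (fun i => i.elim (q.1 / L) fun j => q.2 j)).re
        * w q.1 q.2 ∂stripMeasure n
        = ∫ p, (∑ k ∈ S, fpAdj σ σ' s b (Ψ k) p.1 p.2.1 p.2.2) *
            (J₁.f p.1 p.2.1 p.2.2 - J₂.f p.1 p.2.1 p.2.2) ∂slabMeasure n (Set.Ioo 0 τ) := by
      simp_rw [Complex.re_sum, ← hΨτ, Finset.sum_mul]
      rw [integral_finsetSum _ fun k _ => j k, integral_finsetSum _ fun k _ => (hp k).2]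
      exact Finset.sum_congr rfl fun k _ => (hp k).1
    have hi : Integrable (fun p : ℝ × ℝ × Vec n => (∑ k ∈ S, fpAdj σ σ' s b (Ψ k) p.1 p.2.1 p.2.2) *
            (J₁.f p.1 p.2.1 p.2.2 - J₂.f p.1 p.2.1 p.2.2)) (slabMeasure n (Set.Ioo 0 τ)) := by
      simp_rw [Finset.sum_mul]
      exact integrable_finsetSum _ fun k _ => (hp k).2
    rw [e, slabMeasure, integral_prod _ (by rwa [slabMeasure] at hi)]
    obtain ⟨si, se⟩ := integral_inv_sqrt_sub hτ.1
    rw [show 2 * D * √τ = ∫ r in Set.Ioo 0 τ, D * (√(τ - r))⁻¹ by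
      rw [integral_const_mul, se]; ring, ← Real.norm_eq_abs]
    refine norm_integral_le_of_norm_le (si.const_mul D) ?_
    filter_upwards [ae_restrict_mem measurableSet_Ioo] with r hr
    have hrT : r ∈ Set.Ioc 0 T := ⟨hr.1, (hr.2.trans hτ.2).le⟩
    have hrT' : r ∈ Set.Ioo 0 T := ⟨hr.1, hr.2.trans hτ.2⟩
    have g1 := h₁.integrable_weight hrT (f := fun z _ => |K| * Real.exp (k * |z|)) (by fun_prop)
      ENNReal.ofReal_ne_top (hB₁ r hrT) (fun z y => (abs_of_nonneg (by positivity)).le)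
    have g2 := h₂.integrable_weight hrT (f := fun z _ => |K| * Real.exp (k * |z|)) (by fun_prop)
      ENNReal.ofReal_ne_top (hB₂ r hrT) (fun z y => (abs_of_nonneg (by positivity)).le)
    have v1 : ∫ q, |K| * Real.exp (k * |q.1|) * J₁.f r q.1 q.2 ∂stripMeasure n ≤ B₁ := by
      rw [integral_eq_lintegral_of_nonneg_ae (ae_of_all _ fun q =>
        mul_nonneg (by positivity) (h₁.nonneg r hrT _ _)) g1.aestronglyMeasurable]
      exact ENNReal.toReal_le_of_le_ofReal hB₁0 (hB₁ r hrT)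
    have v2 : ∫ q, |K| * Real.exp (k * |q.1|) * J₂.f r q.1 q.2 ∂stripMeasure n ≤ B₂ := by
      rw [integral_eq_lintegral_of_nonneg_ae (ae_of_all _ fun q =>
        mul_nonneg (by positivity) (h₂.nonneg r hrT _ _)) g2.aestronglyMeasurable]
      exact ENNReal.toReal_le_of_le_ofReal hB₂0 (hB₂ r hrT)
    have hc0 : 0 ≤ (n : ℝ) * (2 / (σ' * √(τ - r))) := by positivity
    refine (norm_integral_le_of_norm_le (g := fun q : ℝ × Vec n => n * (2 / (σ' * √(τ - r))) *
      (|K| * Real.exp (k * |q.1|) * J₁.f r q.1 q.2 + |K| * Real.exp (k * |q.1|) * J₂.f r q.1 q.2))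
      ((g1.add g2).const_mul _) (ae_of_all _ fun q => ?_)).trans ?_
    · rw [norm_mul, Real.norm_eq_abs, Real.norm_eq_abs, ← mul_add, ← mul_assoc]
      refine mul_le_mul ((abs_sum_fpAdj_wave_le hσ' hc L hr.2 q.1 q.2).trans ?_) ?_
        (abs_nonneg _) (by positivity)
      · refine mul_le_mul_of_nonneg_left ((hK r hrT' q.1 q.2).trans ?_) hc0
        exact mul_le_mul_of_nonneg_right (le_abs_self K) (Real.exp_pos _).le
      · refine (abs_sub _ _).trans ?_
        rw [abs_of_nonneg (h₁.nonneg r hrT _ _), abs_of_nonneg (h₂.nonneg r hrT _ _)]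
    · rw [integral_const_mul, integral_add g1 g2]
      refine (mul_le_mul_of_nonneg_left (add_le_add v1 v2) hc0).trans (le_of_eq ?_)
      rw [hD]
      have : √(τ - r) ≠ 0 := (Real.sqrt_pos.2 (by linarith [hr.2])).ne'
      field_simp
  -- approximation of the sign
  have hper : ∀ z, IsPeriodic (w z) := fun z y y' e => by
    simp only [hw, h₁.c12.periodic τ z y y' e, h₂.c12.periodic τ z y y' e]
  -- The sign of w is regularised to w/(|w| + δ) with δ = 1/(j+1). The period 4(j+1) makes the
  -- approximation valid for |z| ≤ j+1, a range exhausting the line.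
  have hex : ∀ j : ℕ, ∃ (S : Finset (Option (Fin n) → ℤ)) (c : (Option (Fin n) → ℤ) → ℂ),
      (∀ X, ‖∑ k ∈ S, c k * latticeWave k X‖ ≤ 2) ∧
      ∀ z, |z| ≤ (4 * ((j : ℝ) + 1)) / 4 → ∀ y : Vec n,
        |w z y / (|w z y| + ((j : ℝ) + 1)⁻¹) - (∑ k ∈ S, c k * latticeWave k
          (fun i => i.elim (z / (4 * ((j : ℝ) + 1))) fun j => y j)).re| ≤ ((j : ℝ) + 1)⁻¹ := by
    intro j
    have hj : (0 : ℝ) < ((j : ℝ) + 1)⁻¹ := by positivity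
    let g : ℝ × Torus n → ℝ := fun q =>
      w q.1 (Function.surjInv isOpenQuotientMap_toTorus.surjective q.2)
        / (|w q.1 (Function.surjInv isOpenQuotientMap_toTorus.surjective q.2)| + ((j : ℝ) + 1)⁻¹)
    have hg : ∀ z y, g (z, toTorus y) = w z y / (|w z y| + ((j : ℝ) + 1)⁻¹) := fun z y => by
      simp only [g]
      rw [hper z _ y (Function.surjInv_eq _ _)]
    have hgc : Continuous g := continuous_of_comp_toTorus (by
      simp only [hg]
      exact hwc.div (by fun_prop) fun q => by positivity)
    have hg1 : ∀ q, |g q| ≤ 1 := fun q => by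
      simp only [g]
      rw [abs_div, abs_of_pos (show 0 < |w q.1 (Function.surjInv
        isOpenQuotientMap_toTorus.surjective q.2)| + ((j : ℝ) + 1)⁻¹ by positivity)]
      exact div_le_one_of_le₀ (by linarith) (by positivity)
    obtain ⟨S, c, hc1, hc2⟩ := exists_trigPoly_approx hgc hg1
      (L := 4 * ((j : ℝ) + 1)) (by positivity) hj (inv_le_one_of_one_le₀ (by simp))
    exact ⟨S, c, hc1, fun z hz y => by rw [← hg]; exact hc2 z hz y⟩
  choose S c hc1 hc2 using hex
  have hlim : Tendsto (fun j : ℕ => ∫ q, (∑ k ∈ S j, c j k * latticeWave k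
      (fun i => i.elim (q.1 / (4 * ((j : ℝ) + 1))) fun j => q.2 j)).re * w q.1 q.2 ∂stripMeasure n)
      atTop (𝓝 (∫ q, |w q.1 q.2| ∂stripMeasure n)) := by
    refine tendsto_integral_of_dominated_convergence (fun q => 2 * |w q.1 q.2|) (fun j => ?_)
      (hwi.abs.const_mul 2) (fun j => ae_of_all _ fun q => ?_) (ae_of_all _ fun q => ?_)
    · refine ((Complex.continuous_re.comp (continuous_finsetSum _ fun k _ => continuous_const.mul
        ((continuous_latticeWave k).comp ?_))).mul hwc).aestronglyMeasurable
      refine continuous_pi fun i => ?_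
      cases i <;> simp only [Option.elim] <;> fun_prop
    · rw [norm_mul, Real.norm_eq_abs, Real.norm_eq_abs]
      exact mul_le_mul_of_nonneg_right ((Complex.abs_re_le_norm _).trans (hc1 j _)) (abs_nonneg _)
    · have t0 := tendsto_inv_nat_succ
      have t1 : Tendsto (fun j : ℕ => |w q.1 q.2| - (∑ k ∈ S j, c j k * latticeWave k
          (fun i => i.elim (q.1 / (4 * ((j : ℝ) + 1))) fun j => q.2 j)).re * w q.1 q.2)
          atTop (𝓝 0) := by
        have t2 : Tendsto (fun j : ℕ => ((j : ℝ) + 1)⁻¹ + ((j : ℝ) + 1)⁻¹ * |w q.1 q.2|)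
            atTop (𝓝 0) := by simpa using t0.add (t0.mul_const _)
        refine squeeze_zero_norm' ?_ t2
        obtain ⟨N, hN⟩ := exists_nat_ge |q.1|
        filter_upwards [eventually_ge_atTop N] with j hj
        have hj0 : (0 : ℝ) < ((j : ℝ) + 1)⁻¹ := by positivity
        have hz : |q.1| ≤ (4 * ((j : ℝ) + 1)) / 4 := by
          have : (N : ℝ) ≤ j := by exact_mod_cast hj
          linarith
        have h1 := hc2 j q.1 hz q.2
        set P := (∑ k ∈ S j, c j k * latticeWave k
          (fun i => i.elim (q.1 / (4 * ((j : ℝ) + 1))) fun j => q.2 j)).re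
        set x := w q.1 q.2
        set δ := ((j : ℝ) + 1)⁻¹
        -- The defect is the regularisation error, at most δ, plus the polynomial error, at most
        -- δ|x|.
        have e1 : |x| - P * x = δ * (|x| / (|x| + δ)) + (x / (|x| + δ) - P) * x := by
          have : |x| + δ ≠ 0 := by positivity
          field_simp
          linear_combination sq_abs x
        rw [e1, Real.norm_eq_abs]
        refine (abs_add_le _ _).trans (add_le_add ?_ ?_)
        · rw [abs_of_nonneg (by positivity)]
          exact mul_le_of_le_one_right hj0.le (div_le_one_of_le₀ (by linarith) (by positivity))
        · rw [abs_mul]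
          exact mul_le_mul_of_nonneg_right h1 (abs_nonneg _)
      simpa using (tendsto_const_nhds (x := |w q.1 q.2|)).sub t1
  exact le_of_tendsto hlim (Eventually.of_forall fun j =>
    (le_abs_self _).trans (main (S j) (c j) _ (hc1 j)))

end Smoothing

/-! ### Uniqueness for the Fokker–Planck equation -/

section Uniqueness

variable {n : ℕ} {σ σ' T s : ℝ} {b : ℝ → ℝ → Vec n → Vec n} {ρ₀ : ProbabilityMeasure (Torus n)}
  {J J₁ J₂ : Jet n}

lemma measurePreserving_strip : MeasurePreserving (fun q : ℝ × Vec n => (q.1, toTorus q.2))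
    (stripMeasure n) (volume : Measure (ℝ × Torus n)) :=
  (MeasurePreserving.id (volume : Measure ℝ)).prod measurePreserving_toTorus

/-- A continuous periodic function which vanishes almost everywhere vanishes. -/
lemma eq_zero_of_ae_strip {w : ℝ → Vec n → ℝ}
    (hc : Continuous fun q : ℝ × Vec n => w q.1 q.2) (hp : ∀ z, IsPeriodic (w z))
    (h0 : ∀ᵐ q ∂stripMeasure n, w q.1 q.2 = 0) (z : ℝ) (y : Vec n) : w z y = 0 := by
  let g : ℝ × Torus n → ℝ := fun q => w q.1
    (Function.surjInv isOpenQuotientMap_toTorus.surjective q.2)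
  have hg : ∀ z y, g (z, toTorus y) = w z y := fun z y => hp z _ _ (Function.surjInv_eq _ _)
  have hgc : Continuous g := continuous_of_comp_toTorus (by simpa only [hg] using hc)
  have h2 : ∀ᵐ q ∂(volume : Measure (ℝ × Torus n)), g q = 0 := by
    rw [← measurePreserving_strip.map_eq]
    refine (ae_map_iff measurePreserving_strip.measurable.aemeasurable
      (hgc.measurable (measurableSet_singleton 0))).2 ?_
    filter_upwards [h0] with q hq
    simpa [hg] using hq
  have h3 : g = fun _ => 0 := (hgc.ae_eq_iff_eq _ continuous_const).1 h2
  rw [← hg, h3]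

/-- A continuous periodic function with vanishing `L¹` norm vanishes. -/
lemma eq_zero_of_integral_abs_strip {w : ℝ → Vec n → ℝ}
    (hc : Continuous fun q : ℝ × Vec n => w q.1 q.2) (hp : ∀ z, IsPeriodic (w z))
    (hi : Integrable (fun q : ℝ × Vec n => w q.1 q.2) (stripMeasure n))
    (h0 : ∫ q, |w q.1 q.2| ∂stripMeasure n ≤ 0) (z : ℝ) (y : Vec n) : w z y = 0 := by
  have h1 : (fun q : ℝ × Vec n => |w q.1 q.2|) =ᵐ[stripMeasure n] 0 :=
    (integral_eq_zero_iff_of_nonneg (fun _ => abs_nonneg _) hi.abs).1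
      (le_antisymm h0 (integral_nonneg fun _ => abs_nonneg _))
  exact eq_zero_of_ae_strip hc hp (h1.mono fun q hq => by simpa using hq) z y

/-- Uniqueness of the solution of the Fokker–Planck equation. -/
theorem IsFP.unique (h₁ : IsFP σ σ' T s b ρ₀ J₁) (h₂ : IsFP σ σ' T s b ρ₀ J₂) (hb : IsDrift T b)
    (hσ' : 0 < σ') {t : ℝ} (ht : t ∈ Set.Ioc 0 T) (z : ℝ) (y : Vec n) :
    J₁.f t z y = J₂.f t z y := by
  have interior : ∀ t ∈ Set.Ioo 0 T, J₁.f t z y = J₂.f t z y := by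
    intro t ht
    have ht' : t ∈ Set.Ioc 0 T := ⟨ht.1, ht.2.le⟩
    obtain ⟨C, hC⟩ := h₁.exists_integral_abs_sub_le_sqrt h₂ hb hσ'
    have h0 : ∫ q, |J₁.f t q.1 q.2 - J₂.f t q.1 q.2| ∂stripMeasure n ≤ 0 := by
      have hlim : Tendsto (fun τ : ℝ => C * √τ) (𝓝[>] 0) (𝓝 0) := by
        have : Tendsto (fun τ : ℝ => C * √τ) (𝓝 0) (𝓝 (C * √0)) := by
          refine Continuous.tendsto ?_ 0
          fun_prop
        simpa using this.mono_left nhdsWithin_le_nhds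
      -- The distance at time t is at most the distance at any earlier τ, which is O(√τ).
      refine ge_of_tendsto hlim ?_
      filter_upwards [Ioo_mem_nhdsGT ht.1] with τ hτ
      exact (h₁.integral_abs_sub_le h₂ hb hσ' hτ.1 hτ.2.le ht.2).trans (hC τ ⟨hτ.1, hτ.2.trans ht.2⟩)
    have := eq_zero_of_integral_abs_strip (w := fun z y => J₁.f t z y - J₂.f t z y)
      ((h₁.cont.slice ht').sub (h₂.cont.slice ht'))
      (fun z y y' e => by simp only [h₁.c12.periodic t z y y' e, h₂.c12.periodic t z y y' e])
      ((h₁.integrable ht').1.sub (h₂.integrable ht').1) h0 z y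
    linarith
  rcases ht.2.lt_or_eq with hlt | rfl
  · exact interior t ⟨ht.1, hlt⟩
  -- At the final time the equation is not available; equality passes to the limit by continuity.
  · have hl : ∀ {J : Jet n}, IsFP σ σ' t s b ρ₀ J →
        Tendsto (fun r => J.f r z y) (𝓝[<] t) (𝓝 (J.f t z y)) := fun h =>
      (h.cont (t, z, y) ⟨ht, trivial⟩).tendsto.comp (f := fun r => (r, z, y))
        (tendsto_nhdsWithin_iff.2 ⟨(Continuous.tendsto (by fun_prop) t).mono_left nhdsWithin_le_nhds,
          by filter_upwards [Ioo_mem_nhdsLT ht.1] with r hr using ⟨⟨hr.1, hr.2.le⟩, trivial⟩⟩)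
    refine tendsto_nhds_unique (hl h₁) ((hl h₂).congr' ?_)
    filter_upwards [Ioo_mem_nhdsLT ht.1] with r hr using (interior r hr).symm

/-! ### Girsanov's transformation between states -/

/-- The density of the law of the signal in state `s` with respect to that in state `0`. -/
def girsanov (σ s t z : ℝ) : ℝ := Real.exp (s * z / σ ^ 2 - s ^ 2 * t / (2 * σ ^ 2))

/-- The function `girsanov` with its derivatives. -/
def girsanovJet (σ s : ℝ) : SignalJet where
  e := girsanov σ s
  et t z := -(s ^ 2 / (2 * σ ^ 2)) * girsanov σ s t z
  ez t z := s / σ ^ 2 * girsanov σ s t z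
  ezz t z := (s / σ ^ 2) ^ 2 * girsanov σ s t z

lemma continuous_girsanov (σ s : ℝ) : Continuous fun p : ℝ × ℝ => girsanov σ s p.1 p.2 := by
  unfold girsanov; fun_prop

lemma girsanovJet_isC12 (σ s : ℝ) (I : Set ℝ) : (girsanovJet σ s).IsC12 I := by
  have hz : ∀ t z, HasDerivAt (girsanov σ s t) (s / σ ^ 2 * girsanov σ s t z) z := by
    intro t z
    have h := ((((hasDerivAt_id z).const_mul s).div_const (σ ^ 2)).sub_const
      (s ^ 2 * t / (2 * σ ^ 2))).exp
    refine h.congr_deriv ?_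
    simp only [girsanov, id]; ring
  exact
  { hasDerivAt_t := fun t _ z => by
      have h := ((((hasDerivAt_id t).const_mul (s ^ 2)).div_const (2 * σ ^ 2)).const_sub
        (s * z / σ ^ 2)).exp
      refine h.congr_deriv ?_
      simp only [girsanovJet, girsanov, id]; ring
    hasDerivAt_z := fun t _ z => hz t z
    hasDerivAt_zz := fun t _ z => ((hz t z).const_mul (s / σ ^ 2)).congr_deriv (by
      simp only [girsanovJet]; ring)
    cont_e := (continuous_girsanov σ s).continuousOn
    cont_et := ((continuous_girsanov σ s).const_mul _).continuousOn
    cont_ez := ((continuous_girsanov σ s).const_mul _).continuousOn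
    cont_ezz := ((continuous_girsanov σ s).const_mul _).continuousOn }

/-- Girsanov's transformation of a solution in state `0` into a solution in state `s`. -/
theorem IsFP.girsanov_mul (h : IsFP σ σ' T 0 b ρ₀ J) (hb : IsDrift T b) (hσ : 0 < σ) (hT : 0 < T) (s : ℝ) :
    IsFP σ σ' T s b ρ₀ ((girsanovJet σ s).mul J) := by
  have ha := girsanovJet_isC12 σ s
  have hnn : ∀ t ∈ Set.Ioc 0 T, ∀ z y, 0 ≤ ((girsanovJet σ s).mul J).f t z y := fun t ht z y =>
    mul_nonneg (Real.exp_pos _).le (h.nonneg t ht z y)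
  have hcont : JointCont (Set.Ioc 0 T) ((girsanovJet σ s).mul J).f :=
    (jointCont_of_signal (ha _).cont_e).mul h.cont
  have hmass : ∀ t ∈ Set.Ioc 0 T,
      ∫⁻ q, ENNReal.ofReal (((girsanovJet σ s).mul J).f t q.1 q.2) ∂stripMeasure n = 1 := by
    intro t ht
    -- The mass is the expectation of the Girsanov exponential for a signal of law N(0, σ²t), equal
    -- to one by the Gaussian moment generating function.
    have h1 := h.lintegral_signal hb ht (W := girsanov σ s t) (by unfold girsanov; fun_prop)
      fun z => (Real.exp_pos _).le
    refine h1.trans ?_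
    have e : ∀ z, girsanov σ s t z
        = Real.exp (-(s ^ 2 * t / (2 * σ ^ 2))) * Real.exp (s / σ ^ 2 * z) := fun z => by
      rw [girsanov, ← Real.exp_add]; congr 1; ring
    simp_rw [e, ENNReal.ofReal_mul (Real.exp_pos _).le]
    rw [lintegral_const_mul _ (by fun_prop),
      ← ofReal_integral_eq_lintegral_ofReal (integrable_exp_mul_gaussianReal _)
        (ae_of_all _ fun _ => (Real.exp_pos _).le)]
    have hm := congrFun (mgf_id_gaussianReal (μ := 0 * t) (v := (σ ^ 2 * t).toNNReal)) (s / σ ^ 2)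
    simp only [mgf, id] at hm
    rw [hm, ← ENNReal.ofReal_mul (Real.exp_pos _).le, ← Real.exp_add,
      Real.coe_toNNReal _ (mul_nonneg (sq_nonneg σ) ht.1.le)]
    rw [show -(s ^ 2 * t / (2 * σ ^ 2)) + (0 * t * (s / σ ^ 2) + σ ^ 2 * t * (s / σ ^ 2) ^ 2 / 2) = 0 by
      field_simp; ring]
    simp
  have hint : ∀ t ∈ Set.Ioc 0 T, Integrable (fun q : ℝ × Vec n =>
      ((girsanovJet σ s).mul J).f t q.1 q.2) (stripMeasure n) ∧
      ∫ q, ((girsanovJet σ s).mul J).f t q.1 q.2 ∂stripMeasure n = 1 := by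
    intro t ht
    have hm := (hcont.slice ht).aestronglyMeasurable (μ := stripMeasure n)
    refine ⟨⟨hm, ?_⟩, ?_⟩
    · rw [hasFiniteIntegral_iff_ofReal (ae_of_all _ fun q => hnn t ht _ _), hmass t ht]
      exact ENNReal.one_lt_top
    · rw [integral_eq_lintegral_of_nonneg_ae (ae_of_all _ fun q => hnn t ht _ _) hm, hmass t ht]
      rfl
  refine ⟨(ha _).mul h.c12, hcont, hnn, hmass, fun t ht z => ?_, fun t ht z y => ?_, fun f => ?_⟩
  · have := (h.flux_diff t ht z).const_smul (girsanov σ s t z)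
    rw [show (fun y => ((girsanovJet σ s).mul J).f t z y • b t z y)
      = girsanov σ s t z • fun y => J.f t z y • b t z y from funext fun y => mul_smul _ _ _]
    exact this
  · have h1 := h.equation t ht z y
    have h2 := divX_const_smul (girsanov σ s t z) (h.flux_diff t ht z y)
    simp only [smul_smul] at h2
    simp only [SignalJet.mul, girsanovJet]
    rw [h2]
    have : σ ≠ 0 := hσ.ne'
    -- After elimination of the flux, the cross term of the second signal derivative cancels the
    -- transport term s D_z, and the zero-order terms cancel each other.
    rw [show divX (fun y => J.f t z y • b t z y) y = -J.ft t z y + σ ^ 2 / 2 * J.fzz t z y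
      + σ' ^ 2 / 2 * J.fl t z y by linarith]
    field_simp
    ring
  -- The Girsanov factor is unbounded, so the initial condition is first proved with a cutoff in the
  -- signal, which is one near the initial signal 0.
  · have key : ∀ f : (ℝ × Torus n) →ᵇ ℝ,
        Tendsto (fun t => ∫ q, ((cutoffJet 1).e t q.1 * girsanov σ s t q.1 * f (q.1, toTorus q.2))
          * J.f t q.1 q.2 ∂stripMeasure n) (𝓝[>] 0) (𝓝 (∫ x, f (0, x) ∂(ρ₀ : Measure (Torus n)))) := by
      intro f
      have e : ∀ x : Torus n, f (0, x) = (cutoffJet 1).e 0 0 * girsanov σ s 0 0 * f (0, x) := by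
        intro x
        rw [cutoff_eq_one one_pos (by simp)]
        simp [girsanov]
      rw [integral_congr_ae (ae_of_all _ e)]
      refine h.tendsto_initial_of_signalSupport hT le_rfl
        (Φ := fun t z y => (cutoffJet 1).e t z * girsanov σ s t z * f (z, toTorus y))
        (((jointCont_of_signal (cutoffJet_isC12 1 _).cont_e).mul
          (jointCont_of_signal (ha _).cont_e)).mul ?_) (R := 2) ?_
        (g := fun q => (cutoffJet 1).e 0 q.1 * girsanov σ s 0 q.1 * f q) (fun z y => rfl)
      · have := f.continuous
        have := continuous_toTorus (n := n)
        exact Continuous.continuousOn (by fun_prop)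
      · intro t _ z hz y
        simp only
        rw [cutoff_eq_zero one_pos (by simpa using hz)]
        ring
    -- No mass escapes: the total mass is one and, by `key` with a constant function, so is the
    -- limit of the mass inside the cutoff. Hence the part removed by the cutoff tends to zero.
    have tail : Tendsto (fun t => ‖f‖ * (1 - ∫ q, ((cutoffJet 1).e t q.1 * girsanov σ s t q.1
        * BoundedContinuousFunction.const (ℝ × Torus n) (1 : ℝ) (q.1, toTorus q.2))
          * J.f t q.1 q.2 ∂stripMeasure n)) (𝓝[>] 0) (𝓝 0) := by
      have := ((key (BoundedContinuousFunction.const _ 1)).const_sub 1).const_mul ‖f‖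
      simpa using this
    have hd : Tendsto (fun t => ∫ q, f (q.1, toTorus q.2) * ((girsanovJet σ s).mul J).f t q.1 q.2
          ∂stripMeasure n - ∫ q, ((cutoffJet 1).e t q.1 * girsanov σ s t q.1 * f (q.1, toTorus q.2))
          * J.f t q.1 q.2 ∂stripMeasure n) (𝓝[>] 0) (𝓝 0) := by
      refine squeeze_zero_norm' ?_ tail
      filter_upwards [Ioo_mem_nhdsGT hT] with t ht
      have ht' : t ∈ Set.Ioc 0 T := ⟨ht.1, ht.2.le⟩
      obtain ⟨i0, m0⟩ := hint t ht'
      have hfc : Continuous fun q : ℝ × Vec n => f (q.1, toTorus q.2) :=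
        f.continuous.comp (continuous_fst.prodMk (continuous_toTorus.comp continuous_snd))
      have hχc : Continuous fun q : ℝ × Vec n => (cutoffJet 1).e t q.1 :=
        (jointCont_of_signal (n := n) (cutoffJet_isC12 1 Set.univ).cont_e).slice trivial
      have i1 : Integrable (fun q : ℝ × Vec n => f (q.1, toTorus q.2)
          * ((girsanovJet σ s).mul J).f t q.1 q.2) (stripMeasure n) :=
        i0.bdd_mul (c := ‖f‖) hfc.aestronglyMeasurable (ae_of_all _ fun q => f.norm_coe_le_norm _)
      have χ1 : ∀ z, ‖(cutoffJet 1).e t z‖ ≤ 1 := fun z => by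
        rw [Real.norm_eq_abs, abs_of_nonneg (cutoff_nonneg 1 t z)]; exact cutoff_le_one 1 t z
      have i2 := i1.bdd_mul (c := 1) hχc.aestronglyMeasurable (ae_of_all _ fun q => χ1 q.1)
      have i3 := i0.bdd_mul (c := 1) hχc.aestronglyMeasurable (ae_of_all _ fun q => χ1 q.1)
      have e2 : ∀ q : ℝ × Vec n, ((cutoffJet 1).e t q.1 * girsanov σ s t q.1 * f (q.1, toTorus q.2))
          * J.f t q.1 q.2 = (cutoffJet 1).e t q.1 * (f (q.1, toTorus q.2)
          * ((girsanovJet σ s).mul J).f t q.1 q.2) := fun q => by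
        simp only [SignalJet.mul, girsanovJet]; ring
      have e3 : ∀ q : ℝ × Vec n, ((cutoffJet 1).e t q.1 * girsanov σ s t q.1
          * BoundedContinuousFunction.const (ℝ × Torus n) (1 : ℝ) (q.1, toTorus q.2))
          * J.f t q.1 q.2 = (cutoffJet 1).e t q.1 * ((girsanovJet σ s).mul J).f t q.1 q.2 :=
        fun q => by simp only [SignalJet.mul, girsanovJet, BoundedContinuousFunction.const_apply]; ring
      simp_rw [e2, e3]
      have e4 : 1 - ∫ q, (cutoffJet 1).e t q.1 * ((girsanovJet σ s).mul J).f t q.1 q.2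
            ∂stripMeasure n = ∫ q, (((girsanovJet σ s).mul J).f t q.1 q.2
          - (cutoffJet 1).e t q.1 * ((girsanovJet σ s).mul J).f t q.1 q.2) ∂stripMeasure n := by
        rw [integral_sub i0 i3, m0]
      rw [← integral_sub i1 i2, e4, ← integral_const_mul]
      refine norm_integral_le_of_norm_le ((i0.sub i3).const_mul _) (ae_of_all _ fun q => ?_)
      have c0 := cutoff_le_one 1 t q.1
      have c1 := hnn t ht' q.1 q.2
      rw [← one_sub_mul, norm_mul, norm_mul, Real.norm_eq_abs, abs_of_nonneg (by linarith),
        Real.norm_eq_abs (((girsanovJet σ s).mul J).f t q.1 q.2), abs_of_nonneg c1]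
      have c2 := f.norm_coe_le_norm (q.1, toTorus q.2)
      rw [← one_sub_mul]
      calc _ = ‖f (q.1, toTorus q.2)‖
            * ((1 - (cutoffJet 1).e t q.1) * ((girsanovJet σ s).mul J).f t q.1 q.2) := by ring
        _ ≤ _ := mul_le_mul_of_nonneg_right c2 (mul_nonneg (by linarith) c1)
    simpa using hd.add (key f)

/-- In state `s`, the solution is obtained from the one in state `0`. -/
lemma IsFP.eq_girsanov_mul (h₀ : IsFP σ σ' T 0 b ρ₀ J₁) (h : IsFP σ σ' T s b ρ₀ J₂)
    (hb : IsDrift T b) (hσ : 0 < σ) (hσ' : 0 < σ') {t : ℝ} (ht : t ∈ Set.Ioc 0 T) (z : ℝ)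
    (y : Vec n) : J₂.f t z y = girsanov σ s t z * J₁.f t z y :=
  h.unique (h₀.girsanov_mul hb hσ (ht.1.trans_le ht.2) s) hb hσ' ht z y

end Uniqueness

/-! ### From densities on the torus to jets on the universal cover -/

section Conversion

variable {n : ℕ} {d : MFGData n} {u : ℝ → ℝ → Torus n → ℝ} {m : ℝ → ℝ → ℝ → Torus n → ℝ}

/-- The optimal drift. -/
def MFGData.drift (d : MFGData n) (u : ℝ → ℝ → Torus n → ℝ) (t z : ℝ) (y : Vec n) : Vec n :=
  -d.hamGrad t z (toTorus y) (gradX (u t z) y)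

lemma MFGData.SolvesFP.isFP (h : d.SolvesFP u m) (hT : 0 < d.T) (s : ℝ) :
    IsFP d.σ d.σ' d.T s (d.drift u) d.ρ₀ (jetOf (m s)) where
  c12 := (h.isC12 s).jetOf
  cont := (h.continuousOn s).comp (f := fun p : ℝ × ℝ × Vec n => (p.1, p.2.1, toTorus p.2.2))
    (Continuous.continuousOn (by have := continuous_toTorus (n := n); fun_prop))
    fun p hp => ⟨hp.1, trivial⟩
  nonneg t ht z y := (h.density s t ht).1 z _
  mass t ht := by
    rw [← (h.density s t ht).2.2]
    exact measurePreserving_strip.lintegral_comp (h.density s t ht).2.1.ennreal_ofReal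
  flux_diff := h.flux_diff s
  equation t ht z y := h.equation s t ht z y
  initial f := by
    refine (h.initial s f).congr' ?_
    filter_upwards [Ioo_mem_nhdsGT hT] with t ht
    have hm := (h.density s t ⟨ht.1, ht.2.le⟩).2.1
    rw [← measurePreserving_strip.map_eq]
    exact integral_map measurePreserving_strip.measurable.aemeasurable
      (f.continuous.measurable.mul hm).aestronglyMeasurable

end Conversion

/-! ### The Legendre transform of a strongly convex function -/

section Legendre

variable {n : ℕ} {g : Vec n → ℝ} {c : ℝ}

/-- The transform `p ↦ sup_α (-α · p - g(α))`. -/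
def legendre (g : Vec n → ℝ) (p : Vec n) : ℝ := ⨆ α : Vec n, (-(inner ℝ α p) - g α)

/-- The control attaining the supremum in `legendre`. -/
def legendreMax (g : Vec n → ℝ) (p : Vec n) : Vec n := -gradient (legendre g) p

/-- The control `α` minimizes `g + ⟨·, p⟩`. -/
def IsTiltMin (g : Vec n → ℝ) (p α : Vec n) : Prop :=
  ∀ β, g α + inner ℝ α p ≤ g β + inner ℝ β p

lemma StrongConvexOn.segment_le (hg : StrongConvexOn Set.univ c g) (x y : Vec n) {θ : ℝ}
    (h0 : 0 ≤ θ) (h1 : θ ≤ 1) :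
    g (x + θ • (y - x)) ≤ (1 - θ) * g x + θ * g y - θ * (1 - θ) * (c / 2 * ‖y - x‖ ^ 2) := by
  have h := hg.2 (Set.mem_univ x) (Set.mem_univ y) (sub_nonneg.2 h1) h0 (by ring)
  have e : (1 - θ) • x + θ • y = x + θ • (y - x) := by module
  rw [e, norm_sub_rev] at h
  simp only [smul_eq_mul] at h
  linarith

/-- Compare the minimizer with points α + θ(β - α), divide by θ and let θ → 0; the modulus of strong
convexity survives in full. -/
lemma IsTiltMin.add_sq_le (hg : StrongConvexOn Set.univ c g) {p α : Vec n} (h : IsTiltMin g p α)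
    (β : Vec n) : g α + inner ℝ α p + c / 2 * ‖β - α‖ ^ 2 ≤ g β + inner ℝ β p := by
  have key : ∀ θ ∈ Set.Ioo (0 : ℝ) 1, g α + inner ℝ α p + (1 - θ) * (c / 2 * ‖β - α‖ ^ 2)
      ≤ g β + inner ℝ β p := by
    intro θ hθ
    have h1 := hg.segment_le α β hθ.1.le hθ.2.le
    have h2 := h (α + θ • (β - α))
    rw [inner_add_left, inner_smul_left, inner_sub_left] at h2
    simp only [conj_trivial] at h2
    have : θ * (g α + inner ℝ α p + (1 - θ) * (c / 2 * ‖β - α‖ ^ 2))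
      ≤ θ * (g β + inner ℝ β p) := by nlinarith
    exact le_of_mul_le_mul_left this hθ.1
  have hl : Tendsto (fun θ : ℝ => g α + inner ℝ α p + (1 - θ) * (c / 2 * ‖β - α‖ ^ 2)) (𝓝[>] 0)
      (𝓝 (g α + inner ℝ α p + (1 - 0) * (c / 2 * ‖β - α‖ ^ 2))) := by
    refine (Continuous.tendsto ?_ 0).mono_left nhdsWithin_le_nhds
    fun_prop
  rw [sub_zero, one_mul] at hl
  refine le_of_tendsto hl ?_
  filter_upwards [Ioo_mem_nhdsGT one_pos] with θ hθ using key θ hθ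

/-- Coercivity of strongly convex functions. -/
lemma StrongConvexOn.norm_le_of_tilt_le (hg : StrongConvexOn Set.univ c g) (hc : 0 < c) {A : ℝ}
    (hA : ∀ e, ‖e‖ ≤ 1 → |g e| ≤ A) {p α : Vec n} (h : g α + inner ℝ α p ≤ g 0) :
    ‖α‖ ≤ 2 / c * (2 * A + ‖p‖) + 1 := by
  have hA0 : 0 ≤ A := (abs_nonneg _).trans (hA 0 (by simp))
  rcases le_or_gt ‖α‖ 1 with h1 | h1
  · have : 0 ≤ 2 / c * (2 * A + ‖p‖) := by positivity
    linarith
  have hr : 0 < ‖α‖ := by linarith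
  -- Strong convexity between 0 and α is read at the unit vector along α, where g is bounded by A.
  -- The quadratic term then forces growth of g that the linear tilt cannot compensate.
  have h2 := hg.segment_le 0 α (θ := ‖α‖⁻¹) (by positivity) (inv_le_one_of_one_le₀ h1.le)
  rw [zero_add, sub_zero] at h2
  have h3 := (abs_le.1 (hA (‖α‖⁻¹ • α) (by rw [norm_smul]; simp [hr.ne']))).1
  have h4 := (abs_le.1 (hA 0 (by simp))).2
  have h5 := (abs_le.1 (abs_real_inner_le_norm α p)).1
  have h6 : ‖α‖ * g (‖α‖⁻¹ • α) ≤ (‖α‖ - 1) * g 0 + g α - (‖α‖ - 1) * (c / 2 * ‖α‖) := by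
    calc _ ≤ ‖α‖ * ((1 - ‖α‖⁻¹) * g 0 + ‖α‖⁻¹ * g α
          - ‖α‖⁻¹ * (1 - ‖α‖⁻¹) * (c / 2 * ‖α‖ ^ 2)) := mul_le_mul_of_nonneg_left h2 hr.le
      _ = _ := by field_simp
  have h7 : ‖α‖ * (c / 2 * (‖α‖ - 1)) ≤ ‖α‖ * (2 * A + ‖p‖) := by nlinarith
  have h8 := le_of_mul_le_mul_left h7 hr
  have h9 : ‖α‖ - 1 ≤ 2 / c * (2 * A + ‖p‖) := by
    rw [div_mul_eq_mul_div, le_div_iff₀ hc]; linarith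
  linarith

lemma exists_isTiltMin (hg : StrongConvexOn Set.univ c g) (hc : 0 < c) (hgc : Continuous g)
    (p : Vec n) : ∃ α, IsTiltMin g p α := by
  obtain ⟨A, hA⟩ := (isCompact_closedBall (0 : Vec n) 1).exists_bound_of_continuousOn
    hgc.continuousOn
  have hA' : ∀ e, ‖e‖ ≤ 1 → |g e| ≤ A := fun e he => hA e (by simpa using he)
  have hA0 : 0 ≤ A := (abs_nonneg _).trans (hA' 0 (by simp))
  set R := 2 / c * (2 * A + ‖p‖) + 1
  have hR : 0 ≤ R := by positivity
  obtain ⟨α, -, hα⟩ := (isCompact_closedBall (0 : Vec n) R).exists_isMinOn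
    ⟨0, by simpa using hR⟩ (f := fun α => g α + inner ℝ α p) (by fun_prop)
  have h0 : g α + inner ℝ α p ≤ g 0 := by
    simpa using hα (Metric.mem_closedBall_self hR)
  refine ⟨α, fun β => ?_⟩
  rcases le_or_gt ‖β‖ R with hβ | hβ
  · exact hα (by simpa using hβ)
  · refine h0.trans (le_of_not_gt fun h => hβ.not_ge ?_)
    exact hg.norm_le_of_tilt_le hc hA' h.le

lemma IsTiltMin.legendre_eq {p α : Vec n} (h : IsTiltMin g p α) :
    legendre g p = -(inner ℝ α p) - g α := by
  have hb : ∀ β, -(inner ℝ β p) - g β ≤ -(inner ℝ α p) - g α := fun β => by linarith [h β]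
  exact le_antisymm (ciSup_le hb) (le_ciSup (f := fun β => -(inner ℝ β p) - g β)
    ⟨_, Set.forall_mem_range.2 hb⟩ α)

/-- Each minimizer tested against the other gives a quadratic gap. One gap is the lower bound, which
later controls the distance of the drifts; their sum makes the minimizer 1/c-Lipschitz in the tilt,
which yields the upper bound. -/
lemma IsTiltMin.excess (hg : StrongConvexOn Set.univ c g) (hc : 0 < c) {p q α β : Vec n}
    (hα : IsTiltMin g p α) (hβ : IsTiltMin g q β) :
    c / 2 * ‖β - α‖ ^ 2 ≤ legendre g q - legendre g p + inner ℝ α (q - p) ∧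
      legendre g q - legendre g p + inner ℝ α (q - p) ≤ ‖q - p‖ ^ 2 / c := by
  have h1 := hβ.add_sq_le hg α
  have h2 := hα.add_sq_le hg β
  rw [norm_sub_rev] at h1
  rw [hα.legendre_eq, hβ.legendre_eq]
  have e1 : inner ℝ α (q - p) = inner ℝ α q - inner ℝ α p := inner_sub_right _ _ _
  have e2 : inner ℝ (α - β) (q - p)
      = inner ℝ α q - inner ℝ α p - (inner ℝ β q - inner ℝ β p) := by
    rw [inner_sub_left, inner_sub_right, inner_sub_right]
  have h3 := real_inner_le_norm (α - β) (q - p)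
  rw [norm_sub_rev α β] at h3
  have h4 : c * ‖β - α‖ ^ 2 ≤ ‖β - α‖ * ‖q - p‖ := by linarith
  have h5 : ‖β - α‖ ≤ ‖q - p‖ / c := by
    rw [le_div_iff₀ hc]
    rcases (norm_nonneg (β - α)).eq_or_lt with h | h
    · rw [← h, zero_mul]; exact norm_nonneg _
    · refine le_of_mul_le_mul_left ?_ h; linarith
  refine ⟨by linarith, ?_⟩
  have h6 : ‖β - α‖ * ‖q - p‖ ≤ ‖q - p‖ / c * ‖q - p‖ :=
    mul_le_mul_of_nonneg_right h5 (norm_nonneg _)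
  have h7 : ‖q - p‖ / c * ‖q - p‖ = ‖q - p‖ ^ 2 / c := by ring
  have h8 : 0 ≤ c / 2 * ‖β - α‖ ^ 2 := by positivity
  linarith

/-- Envelope theorem: the excess of the transform over its affine approximation of slope -α at p
lies between 0 and |q - p|²/c. -/
lemma IsTiltMin.hasGradientAt (hg : StrongConvexOn Set.univ c g) (hc : 0 < c) (hgc : Continuous g)
    {p α : Vec n} (h : IsTiltMin g p α) : HasGradientAt (legendre g) (-α) p := by
  rw [hasGradientAt_iff_isLittleO]
  have h1 : (fun q => legendre g q - legendre g p - inner ℝ (-α) (q - p))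
      =O[𝓝 p] fun q => ‖q - p‖ ^ 2 := by
    refine Asymptotics.IsBigO.of_bound c⁻¹ (Eventually.of_forall fun q => ?_)
    obtain ⟨β, hβ⟩ := exists_isTiltMin hg hc hgc q
    obtain ⟨l, u⟩ := h.excess hg hc hβ
    have : 0 ≤ c / 2 * ‖β - α‖ ^ 2 := by positivity
    rw [inner_neg_left, sub_neg_eq_add, Real.norm_eq_abs, abs_of_nonneg (by linarith),
      Real.norm_eq_abs, abs_of_nonneg (sq_nonneg _)]
    refine u.trans (le_of_eq ?_)
    rw [div_eq_inv_mul]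
  refine h1.trans_isLittleO ?_
  have h2 : (fun x : Vec n => ‖x‖ ^ 2) =o[𝓝 0] fun x => x := Asymptotics.isLittleO_norm_pow_id one_lt_two
  have h3 : Tendsto (fun q : Vec n => q - p) (𝓝 p) (𝓝 0) := by
    have : Tendsto (fun q : Vec n => q - p) (𝓝 p) (𝓝 (p - p)) := by
      refine Continuous.tendsto ?_ p
      fun_prop
    simpa using this
  exact h2.comp_tendsto h3

/-- The control is defined as minus a gradient, to match the drift of the game; this identifies it
with an actual minimizer. -/
lemma isTiltMin_legendreMax (hg : StrongConvexOn Set.univ c g) (hc : 0 < c) (hgc : Continuous g)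
    (p : Vec n) : IsTiltMin g p (legendreMax g p) := by
  obtain ⟨α, hα⟩ := exists_isTiltMin hg hc hgc p
  rw [legendreMax, (hα.hasGradientAt hg hc hgc).gradient, neg_neg]
  exact hα

/-- Continuous dependence of the maximizer on parameters. -/
lemma continuous_legendreMax {Θ : Type*} [TopologicalSpace Θ] {g : Θ → Vec n → ℝ} (hc : 0 < c)
    (hg : ∀ θ, StrongConvexOn Set.univ c (g θ))
    (hgc : Continuous fun q : Θ × Vec n => g q.1 q.2) :
    Continuous fun q : Θ × Vec n => legendreMax (g q.1) q.2 := by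
  have hs : ∀ θ, Continuous (g θ) := fun θ =>
    hgc.comp (by fun_prop : Continuous fun α : Vec n => (θ, α))
  have hmin := fun q : Θ × Vec n => isTiltMin_legendreMax (hg q.1) hc (hs q.1) q.2
  rw [continuous_iff_continuousAt]
  intro q₀
  rw [ContinuousAt, Metric.tendsto_nhds]
  intro ε hε
  set α₀ := legendreMax (g q₀.1) q₀.2 with hα₀
  let f : Θ × Vec n → Vec n → ℝ := fun q α =>
    (g q.1 α + inner ℝ α q.2) - (g q.1 α₀ + inner ℝ α₀ q.2)
  have hfc : Continuous fun z : (Θ × Vec n) × Vec n => f z.1 z.2 := by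
    have h1 : Continuous fun z : (Θ × Vec n) × Vec n => g z.1.1 z.2 :=
      hgc.comp (by fun_prop : Continuous fun z : (Θ × Vec n) × Vec n => (z.1.1, z.2))
    have h2 : Continuous fun z : (Θ × Vec n) × Vec n => g z.1.1 α₀ :=
      hgc.comp (by fun_prop : Continuous fun z : (Θ × Vec n) × Vec n => (z.1.1, α₀))
    exact (h1.add (by fun_prop)).sub (h2.add (by fun_prop))
  -- On a small sphere about α₀ the tilted cost strictly exceeds its central value: at q₀ by
  -- quadratic growth, for nearby parameters by compactness. Convexity then excludes minimizers
  -- outside the sphere.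
  have hev : ∀ᶠ q in 𝓝 q₀, ∀ α ∈ Metric.sphere α₀ (ε / 2), 0 < f q α := by
    refine (isCompact_sphere α₀ (ε / 2)).eventually_forall_of_forall_eventually fun α hα => ?_
    refine hfc.continuousAt.eventually_const_lt ?_
    have h1 := (hmin q₀).add_sq_le (hg q₀.1) α
    have h2 : ‖α - α₀‖ = ε / 2 := by simpa [dist_eq_norm] using hα
    rw [← hα₀, h2] at h1
    have : 0 < c / 2 * (ε / 2) ^ 2 := by positivity
    simp only [f]
    linarith
  filter_upwards [hev] with q hq
  by_contra hcon
  set α := legendreMax (g q.1) q.2 with hα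
  have hr : ε ≤ ‖α - α₀‖ := by rw [← dist_eq_norm]; exact not_lt.1 hcon
  have hr0 : 0 < ‖α - α₀‖ := hε.trans_le hr
  have hθ1 : ε / 2 / ‖α - α₀‖ ≤ 1 := by rw [div_le_one hr0]; linarith
  -- The point where the segment from α₀ to the distant minimizer crosses the sphere.
  have h1 := hq (α₀ + (ε / 2 / ‖α - α₀‖) • (α - α₀)) (by
    rw [mem_sphere_iff_norm, add_sub_cancel_left, norm_smul, Real.norm_eq_abs,
      abs_of_nonneg (by positivity)]
    field_simp)
  have h2 := (hg q.1).segment_le α₀ α (θ := ε / 2 / ‖α - α₀‖) (by positivity) hθ1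
  have h3 : 0 ≤ ε / 2 / ‖α - α₀‖ * (1 - ε / 2 / ‖α - α₀‖) * (c / 2 * ‖α - α₀‖ ^ 2) :=
    mul_nonneg (mul_nonneg (by positivity) (by linarith)) (by positivity)
  have h4 := hmin q α₀
  rw [← hα] at h4
  simp only [f] at h1
  rw [inner_add_left, inner_smul_left, inner_sub_left] at h1
  simp only [conj_trivial] at h1
  have h5 : 0 < ε / 2 / ‖α - α₀‖ := by positivity
  nlinarith

lemma continuous_legendre {Θ : Type*} [TopologicalSpace Θ] {g : Θ → Vec n → ℝ} (hc : 0 < c)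
    (hg : ∀ θ, StrongConvexOn Set.univ c (g θ))
    (hgc : Continuous fun q : Θ × Vec n => g q.1 q.2) :
    Continuous fun q : Θ × Vec n => legendre (g q.1) q.2 := by
  have hs : ∀ θ, Continuous (g θ) := fun θ =>
    hgc.comp (by fun_prop : Continuous fun α : Vec n => (θ, α))
  have hm := continuous_legendreMax hc hg hgc
  simp_rw [fun q : Θ × Vec n => (isTiltMin_legendreMax (hg q.1) hc (hs q.1) q.2).legendre_eq]
  exact (hm.inner continuous_snd).neg.sub (hgc.comp (continuous_fst.prodMk hm))

end Legendre

/-! ### Gaussian averages -/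

section GaussianAverage

lemma integrable_gaussianReal_of_exp_bound {f : ℝ → ℝ} (hm : Measurable f) {K k : ℝ}
    (hf : ∀ s, |f s| ≤ K * Real.exp (k * |s|)) (μ : ℝ) (v : ℝ≥0) :
    Integrable f (gaussianReal μ v) ∧
      |∫ s, f s ∂gaussianReal μ v| ≤ K * (2 * Real.exp (|k| * |μ| + v * k ^ 2 / 2)) := by
  have hK : 0 ≤ K := by
    have := (abs_nonneg _).trans (hf 0)
    exact nonneg_of_mul_nonneg_left this (Real.exp_pos _)
  have h1 := lintegral_exp_abs_gaussianReal_le k μ v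
  have hi : Integrable (fun s => Real.exp (k * |s|)) (gaussianReal μ v) := by
    refine ⟨by fun_prop, ?_⟩
    rw [hasFiniteIntegral_iff_ofReal (ae_of_all _ fun s => (Real.exp_pos _).le)]
    exact h1.trans_lt ENNReal.ofReal_lt_top
  have hle : ∫ s, Real.exp (k * |s|) ∂gaussianReal μ v
      ≤ 2 * Real.exp (|k| * |μ| + v * k ^ 2 / 2) := by
    rw [integral_eq_lintegral_of_nonneg_ae (ae_of_all _ fun s => (Real.exp_pos _).le)
      hi.aestronglyMeasurable]
    exact ENNReal.toReal_le_of_le_ofReal (by positivity) h1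
  refine ⟨(hi.const_mul K).mono' hm.aestronglyMeasurable (ae_of_all _ hf), ?_⟩
  refine (norm_integral_le_of_norm_le (f := f) (hi.const_mul K) (ae_of_all _ hf)).trans ?_
  rw [integral_const_mul]
  exact mul_le_mul_of_nonneg_left hle hK

/-- From (s - r)² ≥ s²/2 - r². The bound is uniform over bounded means and variances in [v₀, 1], and
will dominate when means and variances vary. -/
lemma gaussianPDFReal_le {v₀ R r s : ℝ} {v : ℝ≥0} (h0 : 0 < v₀) (hv₀ : v₀ ≤ v) (hv1 : v ≤ 1)
    (hr : |r| ≤ R) : gaussianPDFReal r v s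
      ≤ (√(2 * Real.pi * v₀))⁻¹ * (Real.exp (R ^ 2 / 2) * Real.exp (-(1 / 4) * s ^ 2)) := by
  have hv : (0 : ℝ) < v := h0.trans_le hv₀
  have hv1' : (v : ℝ) ≤ 1 := by exact_mod_cast hv1
  rw [gaussianPDFReal, ← Real.exp_add]
  refine mul_le_mul ?_ (Real.exp_le_exp.2 ?_) (Real.exp_pos _).le (by positivity)
  · gcongr
  · have h1 : (s - r) ^ 2 / 2 ≤ (s - r) ^ 2 / (2 * v) := by gcongr; linarith
    have h2 : r ^ 2 ≤ R ^ 2 := sq_le_sq' (by linarith [(abs_le.1 hr).1]) (abs_le.1 hr).2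
    rw [neg_div]
    nlinarith [sq_nonneg (s - 2 * r)]

/-- Gaussian averages depend continuously on parameters. -/
lemma continuous_integral_gaussianReal {Θ : Type*} [TopologicalSpace Θ]
    [FirstCountableTopology Θ] {f : Θ → ℝ → ℝ} {r : Θ → ℝ} {v : Θ → ℝ≥0} (hr : Continuous r)
    (hv : Continuous v) (hv0 : ∀ θ, 0 < v θ) (hv1 : ∀ θ, v θ ≤ 1) (hm : ∀ θ, Measurable (f θ))
    (hf : ∀ s, Continuous fun θ => f θ s)
    (hb : ∀ θ₀, ∃ K k : ℝ, ∀ᶠ θ in 𝓝 θ₀, ∀ s, |f θ s| ≤ K * Real.exp (k * |s|)) :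
    Continuous fun θ => ∫ s, f θ s ∂gaussianReal (r θ) (v θ) := by
  simp_rw [fun θ => integral_gaussianReal_eq_integral_smul (f := f θ) (μ := r θ) (hv0 θ).ne',
    smul_eq_mul]
  rw [continuous_iff_continuousAt]
  intro θ₀
  obtain ⟨K, k, hK⟩ := hb θ₀
  have hv' : Continuous fun θ => (v θ : ℝ) := NNReal.continuous_coe.comp hv
  have hpos : (0 : ℝ) < v θ₀ := hv0 θ₀
  have e1 : ∀ᶠ θ in 𝓝 θ₀, (v θ₀ : ℝ) / 2 < v θ :=
    hv'.continuousAt.eventually_const_lt (by linarith)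
  have e2 : ∀ᶠ θ in 𝓝 θ₀, |r θ| < |r θ₀| + 1 :=
    hr.abs.continuousAt.eventually_lt_const (by linarith)
  refine continuousAt_of_dominated (bound := fun s => (√(2 * Real.pi * (v θ₀ / 2)))⁻¹
    * (Real.exp ((|r θ₀| + 1) ^ 2 / 2)) * (|K| * Real.exp (2 * k ^ 2))
      * Real.exp (-(1 / 8) * s ^ 2)) ?_ ?_ ?_ ?_
  · exact Eventually.of_forall fun θ =>
      ((measurable_gaussianPDFReal _ _).mul (hm θ)).aestronglyMeasurable
  · filter_upwards [hK, e1, e2] with θ h1 h2 h3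
    refine ae_of_all _ fun s => ?_
    rw [norm_mul, Real.norm_eq_abs, Real.norm_eq_abs, abs_of_nonneg (gaussianPDFReal_nonneg _ _ _)]
    -- Completing the square, k|s| ≤ 2k² + s²/8: half of the available Gaussian decay pays for the
    -- exponential growth.
    have h4 : |f θ s| ≤ |K| * (Real.exp (2 * k ^ 2) * Real.exp (1 / 8 * s ^ 2)) := by
      refine (h1 s).trans (mul_le_mul (le_abs_self K) ?_ (Real.exp_pos _).le (abs_nonneg _))
      rw [← Real.exp_add, Real.exp_le_exp]
      nlinarith [sq_nonneg (|s| - 4 * k), sq_abs s]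
    refine (mul_le_mul (gaussianPDFReal_le (half_pos hpos) h2.le (hv1 θ) h3.le) h4 (abs_nonneg _)
      (by positivity)).trans (le_of_eq ?_)
    rw [show -(1 / 8) * s ^ 2 = -(1 / 4) * s ^ 2 + 1 / 8 * s ^ 2 by ring, Real.exp_add]
    ring
  · exact (integrable_exp_neg_mul_sq (by norm_num)).const_mul _
  · refine ae_of_all _ fun s => ContinuousAt.mul ?_ (hf s).continuousAt
    have hne : √(2 * Real.pi * v θ₀) ≠ 0 := (Real.sqrt_pos.2 (by positivity)).ne'
    simp only [gaussianPDFReal]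
    refine ContinuousAt.mul (ContinuousAt.inv₀ ?_ hne) ?_
    · exact (Continuous.continuousAt (by fun_prop))
    · refine Real.continuous_exp.continuousAt.comp (ContinuousAt.div ?_ ?_ (by positivity))
      · exact Continuous.continuousAt (by fun_prop)
      · exact Continuous.continuousAt (by fun_prop)

end GaussianAverage

/-! ### The averaged running cost and the Hamiltonian -/

section Hamiltonian

variable {n : ℕ}

namespace MFGData

open scoped Pointwise in
/-- The running cost grows at most exponentially, uniformly for bounded controls. -/
lemma RegularRunningCost.exists_bound {C : ℝ → Torus n → Vec n → ℝ} (hC : RegularRunningCost C)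
    (R : ℝ) : ∃ K k : ℝ, ∀ s x α, ‖α‖ ≤ R → |C s x α| ≤ K * Real.exp (k * |s|) := by
  obtain ⟨c, hc, hconv⟩ := hC.strongConvex
  have hcx : ∀ s x, ConvexOn ℝ Set.univ (C s x) := fun s x =>
    ((hconv s x).strictConvexOn hc).convexOn
  -- The growth hypothesis treats one control at a time. A ball of controls fits in a dilated
  -- simplex, and a convex function is bounded above there by its values at the finitely many
  -- vertices.
  obtain ⟨b, hb, -⟩ := exists_mem_interior_convexHull_affineBasis
    (Filter.univ_mem : Set.univ ∈ 𝓝 (0 : Vec n))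
  obtain ⟨ε, hε, hball⟩ := Metric.mem_nhds_iff.1 (mem_interior_iff_mem_nhds.1 hb)
  set a := (|R| + 1) / ε with ha
  have hapos : 0 < a := by positivity
  choose K k hKk using fun i => hC.growth (a • b i)
  obtain ⟨K₀, k₀, h₀⟩ := hC.growth 0
  set K' := ∑ i, |K i| with hK'
  set k' := ∑ i, |k i| with hk'
  have hup : ∀ s x α, ‖α‖ ≤ R → C s x α ≤ K' * Real.exp (k' * |s|) := by
    intro s x α hα
    have hmem : α ∈ convexHull ℝ (a • Set.range b) := by
      rw [convexHull_smul, Set.mem_smul_set]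
      refine ⟨a⁻¹ • α, hball ?_, by rw [smul_smul, mul_inv_cancel₀ hapos.ne', one_smul]⟩
      rw [mem_ball_zero_iff, norm_smul, Real.norm_eq_abs, abs_of_pos (inv_pos.2 hapos), ha, inv_div,
        div_mul_eq_mul_div, div_lt_iff₀ (by positivity)]
      exact mul_lt_mul_of_pos_left (by linarith [le_abs_self R]) hε
    obtain ⟨β, hβ, hle⟩ := (hcx s x).exists_ge_of_mem_convexHull (Set.subset_univ _) hmem
    obtain ⟨_, ⟨i, rfl⟩, rfl⟩ := hβ
    refine hle.trans ((le_abs_self _).trans ((hKk i s x).trans ?_))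
    refine mul_le_mul ?_ (Real.exp_le_exp.2 (mul_le_mul_of_nonneg_right ?_ (abs_nonneg _)))
      (Real.exp_pos _).le (Finset.sum_nonneg fun _ _ => abs_nonneg _)
    · exact (le_abs_self _).trans
        (Finset.single_le_sum (f := fun i => |K i|) (fun _ _ => abs_nonneg _) (Finset.mem_univ i))
    · exact (le_abs_self _).trans
        (Finset.single_le_sum (f := fun i => |k i|) (fun _ _ => abs_nonneg _) (Finset.mem_univ i))
  have hk'0 : 0 ≤ k' := Finset.sum_nonneg fun _ _ => abs_nonneg _
  have hK'0 : 0 ≤ K' := Finset.sum_nonneg fun _ _ => abs_nonneg _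
  refine ⟨2 * |K₀| + K', |k₀| + k', fun s x α hα => ?_⟩
  have h1 := hup s x α hα
  have h2 := hup s x (-α) (by rwa [norm_neg])
  -- The lower bound comes from midpoint convexity at 0, using the upper bound at -α.
  have h3 : C s x ((1 / 2 : ℝ) • α + (1 / 2 : ℝ) • -α)
      ≤ (1 / 2 : ℝ) • C s x α + (1 / 2 : ℝ) • C s x (-α) :=
    (hcx s x).2 (Set.mem_univ α) (Set.mem_univ (-α)) (by norm_num) (by norm_num) (by norm_num)
  rw [smul_neg, add_neg_cancel] at h3
  simp only [smul_eq_mul] at h3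
  have h4 := (abs_le.1 (h₀ s x)).1
  have e1 : Real.exp (k' * |s|) ≤ Real.exp ((|k₀| + k') * |s|) := by
    gcongr; linarith [abs_nonneg k₀]
  have e2 : K₀ * Real.exp (k₀ * |s|) ≤ |K₀| * Real.exp ((|k₀| + k') * |s|) := by
    refine mul_le_mul (le_abs_self _) ?_ (Real.exp_pos _).le (abs_nonneg _)
    gcongr; linarith [le_abs_self k₀]
  have e3 := mul_le_mul_of_nonneg_left e1 hK'0
  have e4 : 0 ≤ |K₀| * Real.exp ((|k₀| + k') * |s|) := by positivity
  rw [abs_le, add_mul]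
  constructor <;> linarith

variable {d : MFGData n}

lemma postVar_coe (hd : d.Nondegenerate) {t : ℝ} (ht : 0 ≤ t) :
    (d.postVar t : ℝ) = d.σ ^ 2 / (d.σ ^ 2 + t) :=
  Real.coe_toNNReal _ (by have := hd.σ_pos; positivity)

lemma postVar_pos (hd : d.Nondegenerate) {t : ℝ} (ht : 0 ≤ t) : 0 < d.postVar t :=
  Real.toNNReal_pos.2 (by have := hd.σ_pos; positivity)

lemma postVar_le_one (hd : d.Nondegenerate) {t : ℝ} (ht : 0 ≤ t) : d.postVar t ≤ 1 := by
  have := hd.σ_pos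
  rw [← NNReal.coe_le_coe, postVar_coe hd ht, NNReal.coe_one, div_le_one (by positivity)]
  linarith

lemma abs_postMean_le (hd : d.Nondegenerate) {t : ℝ} (ht : 0 ≤ t) (z : ℝ) :
    |d.postMean t z| ≤ |z| / d.σ ^ 2 := by
  have := hd.σ_pos
  rw [postMean, abs_div, abs_of_pos (show 0 < t + d.σ ^ 2 by positivity)]
  gcongr
  linarith

lemma belief_average (hd : d.Nondegenerate) {f : ℝ → ℝ} (hm : Measurable f) {K k : ℝ}
    (hf : ∀ s, |f s| ≤ K * Real.exp (k * |s|)) {t : ℝ} (ht : 0 ≤ t) (z : ℝ) :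
    Integrable f (d.belief t z) ∧ |∫ s, f s ∂d.belief t z|
      ≤ 2 * K * Real.exp (k ^ 2 / 2) * Real.exp (|k| / d.σ ^ 2 * |z|) := by
  obtain ⟨h1, h2⟩ := integrable_gaussianReal_of_exp_bound hm hf (d.postMean t z) (d.postVar t)
  have hK : 0 ≤ K := nonneg_of_mul_nonneg_left ((abs_nonneg _).trans (hf 0)) (Real.exp_pos _)
  refine ⟨h1, h2.trans ?_⟩
  rw [show 2 * K * Real.exp (k ^ 2 / 2) * Real.exp (|k| / d.σ ^ 2 * |z|)
    = K * (2 * (Real.exp (|k| / d.σ ^ 2 * |z|) * Real.exp (k ^ 2 / 2))) by ring, ← Real.exp_add]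
  refine mul_le_mul_of_nonneg_left (mul_le_mul_of_nonneg_left (Real.exp_le_exp.2 ?_) zero_le_two) hK
  have a1 := mul_le_mul_of_nonneg_left (abs_postMean_le hd ht z) (abs_nonneg k)
  have a2 : (d.postVar t : ℝ) ≤ 1 := by exact_mod_cast postVar_le_one hd ht
  have a3 := mul_le_mul_of_nonneg_right a2 (sq_nonneg k)
  rw [div_mul_eq_mul_div, ← mul_div_assoc] at *
  linarith

lemma integrable_C (hd : d.Nondegenerate) (hC : RegularRunningCost d.C) {t : ℝ} (ht : 0 ≤ t)
    (z : ℝ) (x : Torus n) (α : Vec n) : Integrable (fun s => d.C s x α) (d.belief t z) := by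
  obtain ⟨K, k, h⟩ := hC.growth α
  exact (belief_average hd (hC.measurable x α) (fun s => h s x) ht z).1

/-- The belief is a probability measure, so averaging the convexity inequality keeps the same
modulus c. -/
lemma strongConvexOn_avgC (hd : d.Nondegenerate) (hC : RegularRunningCost d.C) {c : ℝ}
    (hc : ∀ s x, StrongConvexOn Set.univ c (d.C s x)) {t : ℝ} (ht : 0 ≤ t) (z : ℝ) (x : Torus n) :
    StrongConvexOn Set.univ c (d.avgC t z x) := by
  refine ⟨convex_univ, fun α _ β _ a b ha hb hab => ?_⟩
  have i := fun γ => integrable_C hd hC ht z x γ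
  have : IsProbabilityMeasure (d.belief t z) := by unfold belief; infer_instance
  have i2 : Integrable (fun s => a * d.C s x α + b * d.C s x β) (d.belief t z) :=
    ((i α).const_mul a).add ((i β).const_mul b)
  have h1 : ∫ s, d.C s x (a • α + b • β) ∂d.belief t z ≤ ∫ s, (a * d.C s x α + b * d.C s x β
      - a * b * (c / 2 * ‖α - β‖ ^ 2)) ∂d.belief t z :=
    integral_mono (i _) (i2.sub (integrable_const _))
      fun s => (hc s x).2 (Set.mem_univ α) (Set.mem_univ β) ha hb hab
  refine h1.trans (le_of_eq ?_)
  rw [integral_sub i2 (integrable_const _),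
    integral_add ((i α).const_mul a) ((i β).const_mul b), integral_const_mul, integral_const_mul]
  simp [avgC]

/-- Domination uses the exponential bound uniform over bounded controls. Times are restricted to [0,
∞), where the posterior variance is positive and at most one. -/
lemma continuous_avgC (hd : d.Nondegenerate) (hC : RegularRunningCost d.C) :
    Continuous fun q : (Set.Ici (0 : ℝ) × ℝ × Torus n) × Vec n =>
      d.avgC q.1.1 q.1.2.1 q.1.2.2 q.2 := by
  have hσ := hd.σ_pos
  refine continuous_integral_gaussianReal
    (f := fun (q : (Set.Ici (0 : ℝ) × ℝ × Torus n) × Vec n) s => d.C s q.1.2.2 q.2)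
    (r := fun q => d.postMean q.1.1 q.1.2.1) (v := fun q => d.postVar q.1.1) ?_ ?_
    (fun q => postVar_pos hd q.1.1.2) (fun q => postVar_le_one hd q.1.1.2)
    (fun q => hC.measurable _ _) (fun s => ?_) (fun q₀ => ?_)
  · unfold postMean
    refine Continuous.div (by fun_prop) (by fun_prop) fun q => ?_
    have : (0 : ℝ) ≤ q.1.1 := q.1.1.2
    positivity
  · unfold postVar
    refine continuous_real_toNNReal.comp (Continuous.div (by fun_prop) (by fun_prop) fun q => ?_)
    have : (0 : ℝ) ≤ q.1.1 := q.1.1.2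
    positivity
  · exact (hC.continuous s).comp (by fun_prop :
      Continuous fun q : (Set.Ici (0 : ℝ) × ℝ × Torus n) × Vec n => (q.1.2.2, q.2))
  · obtain ⟨K, k, h⟩ := hC.exists_bound (‖q₀.2‖ + 1)
    refine ⟨K, k, ?_⟩
    have : ∀ᶠ q : (Set.Ici (0 : ℝ) × ℝ × Torus n) × Vec n in 𝓝 q₀, ‖q.2‖ < ‖q₀.2‖ + 1 :=
      continuous_snd.norm.continuousAt.eventually_lt_const (by linarith)
    filter_upwards [this] with q hq s using h s _ _ hq.le

lemma continuous_avgC_slice (hd : d.Nondegenerate) (hC : RegularRunningCost d.C) {t : ℝ}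
    (ht : 0 ≤ t) (z : ℝ) (x : Torus n) : Continuous (d.avgC t z x) :=
  (continuous_avgC hd hC).comp
    (by fun_prop : Continuous fun α : Vec n => (((⟨t, ht⟩ : Set.Ici (0 : ℝ)), z, x), α))

/-- The optimal control depends continuously on its arguments. -/
lemma continuousOn_hamGrad (hd : d.Nondegenerate) (hC : RegularRunningCost d.C) :
    ContinuousOn (fun q : (ℝ × ℝ × Torus n) × Vec n => d.hamGrad q.1.1 q.1.2.1 q.1.2.2 q.2)
      ((Set.Ici 0 ×ˢ Set.univ) ×ˢ Set.univ) := by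
  obtain ⟨c, hc, hconv⟩ := hC.strongConvex
  have h := continuous_legendreMax (Θ := Set.Ici (0 : ℝ) × ℝ × Torus n)
    (g := fun θ => d.avgC θ.1 θ.2.1 θ.2.2) hc
    (fun θ => strongConvexOn_avgC hd hC hconv θ.1.2 _ _) (continuous_avgC hd hC)
  rw [continuousOn_iff_continuous_domRestrict]
  have h2 := h.neg.comp (by fun_prop : Continuous
    fun q : ((Set.Ici (0 : ℝ) ×ˢ (Set.univ : Set (ℝ × Torus n))) ×ˢ (Set.univ : Set (Vec n)) : Set _)
      => (((⟨q.1.1.1, q.2.1.1⟩ : Set.Ici (0 : ℝ)), q.1.1.2.1, q.1.1.2.2), q.1.2))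
  refine h2.congr fun q => ?_
  simp [legendreMax, hamGrad]
  rfl

lemma continuousOn_ham (hd : d.Nondegenerate) (hC : RegularRunningCost d.C) :
    ContinuousOn (fun q : (ℝ × ℝ × Torus n) × Vec n => d.ham q.1.1 q.1.2.1 q.1.2.2 q.2)
      ((Set.Ici 0 ×ˢ Set.univ) ×ˢ Set.univ) := by
  obtain ⟨c, hc, hconv⟩ := hC.strongConvex
  have h := continuous_legendre (Θ := Set.Ici (0 : ℝ) × ℝ × Torus n)
    (g := fun θ => d.avgC θ.1 θ.2.1 θ.2.2) hc
    (fun θ => strongConvexOn_avgC hd hC hconv θ.1.2 _ _) (continuous_avgC hd hC)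
  rw [continuousOn_iff_continuous_domRestrict]
  have h2 := h.comp (by fun_prop : Continuous
    fun q : ((Set.Ici (0 : ℝ) ×ˢ (Set.univ : Set (ℝ × Torus n))) ×ˢ (Set.univ : Set (Vec n)) : Set _)
      => (((⟨q.1.1.1, q.2.1.1⟩ : Set.Ici (0 : ℝ)), q.1.1.2.1, q.1.1.2.2), q.1.2))
  refine h2.congr fun q => ?_
  simp only [Function.comp_apply, Set.domRestrict_apply, legendre, ham]

/-- Growth of the optimal control. -/
lemma exists_norm_hamGrad_le (hd : d.Nondegenerate) (hC : RegularRunningCost d.C) :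
    ∃ K k D : ℝ, ∀ t, 0 ≤ t → ∀ z x p,
      ‖d.hamGrad t z x p‖ ≤ K * Real.exp (k * |z|) + D * ‖p‖ := by
  obtain ⟨c, hc, hconv⟩ := hC.strongConvex
  obtain ⟨K, k, h⟩ := hC.exists_bound 1
  set K' := 2 * K * Real.exp (k ^ 2 / 2)
  set k' := |k| / d.σ ^ 2
  refine ⟨2 / c * (2 * K') + 1, k', 2 / c, fun t ht z x p => ?_⟩
  have hmin := isTiltMin_legendreMax (strongConvexOn_avgC hd hC hconv ht z x) hc
    (continuous_avgC_slice hd hC ht z x) p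
  have hb := (strongConvexOn_avgC hd hC hconv ht z x).norm_le_of_tilt_le hc
    (fun e he => (belief_average hd (hC.measurable x e) (fun s => h s x e he) ht z).2)
    (by simpa using hmin 0)
  have e : ‖d.hamGrad t z x p‖ = ‖legendreMax (d.avgC t z x) p‖ := by
    rw [legendreMax, norm_neg]; rfl
  have h1 : 1 ≤ Real.exp (k' * |z|) := Real.one_le_exp (by positivity)
  rw [e]
  refine hb.trans ?_
  rw [mul_add]
  linarith

/-- Two-sided bounds on the excess of the Hamiltonian. -/
lemma exists_ham_excess (hd : d.Nondegenerate) (hC : RegularRunningCost d.C) :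
    ∃ c : ℝ, 0 < c ∧ ∀ t, 0 ≤ t → ∀ z x p q,
      c / 2 * ‖d.hamGrad t z x q - d.hamGrad t z x p‖ ^ 2
        ≤ d.ham t z x q - d.ham t z x p - inner ℝ (d.hamGrad t z x p) (q - p) ∧
      d.ham t z x q - d.ham t z x p - inner ℝ (d.hamGrad t z x p) (q - p) ≤ ‖q - p‖ ^ 2 / c := by
  obtain ⟨c, hc, hconv⟩ := hC.strongConvex
  refine ⟨c, hc, fun t ht z x p q => ?_⟩
  have hg := strongConvexOn_avgC hd hC hconv ht z x
  have hgc := continuous_avgC_slice hd hC ht z x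
  obtain ⟨h1, h2⟩ := (isTiltMin_legendreMax hg hc hgc p).excess hg hc
    (isTiltMin_legendreMax hg hc hgc q)
  have e : ∀ p, legendreMax (d.avgC t z x) p = -d.hamGrad t z x p := fun p => rfl
  rw [e, e, inner_neg_left, ← sub_eq_add_neg] at h1
  rw [e, inner_neg_left, ← sub_eq_add_neg] at h2
  rw [show -d.hamGrad t z x q - -d.hamGrad t z x p = -(d.hamGrad t z x q - d.hamGrad t z x p) by
    abel, norm_neg] at h1
  exact ⟨h1, h2⟩

/-- The optimal drift is continuous, with exponential growth. -/
lemma SolvesHJB.isDrift {ρ : ℝ → ℝ → ProbabilityMeasure (Torus n)} {u : ℝ → ℝ → Torus n → ℝ}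
    (hd : d.Nondegenerate) (hC : RegularRunningCost d.C) (h : d.SolvesHJB ρ u) :
    IsDrift d.T (d.drift u) := by
  have hj := h.isC12.jetOf
  refine ⟨fun t ht z y y' e => ?_, ?_, ?_⟩
  · have h1 : gradX (u t z) y = gradX (u t z) y' := hj.periodic_fg ht z y y' e
    simp only [drift, e, h1]
  · have h1 : JointCont (Set.Ioo 0 d.T) fun t z y => gradX (u t z) y := hj.cont_fg
    refine ContinuousOn.neg ((continuousOn_hamGrad hd hC).comp
      (f := fun p : ℝ × ℝ × Vec n => ((p.1, p.2.1, toTorus p.2.2), gradX (u p.1 p.2.1) p.2.2))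
      (ContinuousOn.prodMk (Continuous.continuousOn (by
        have := continuous_toTorus (n := n); fun_prop)) h1)
      fun p hp => ⟨⟨hp.1.1.le, trivial⟩, trivial⟩)
  · obtain ⟨K, k, D, hD⟩ := exists_norm_hamGrad_le hd hC
    obtain ⟨K', k', -, hK'⟩ := h.growth
    refine ⟨|K| + |D| * |K'|, |k| + |k'|, fun t ht z y => ?_⟩
    rw [drift, norm_neg]
    refine (hD t ht.1.le z _ _).trans ?_
    have h2 := (hK' t ht z y).2
    have e1 : Real.exp (k * |z|) ≤ Real.exp ((|k| + |k'|) * |z|) := by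
      gcongr; linarith [le_abs_self k, abs_nonneg k']
    have e2 : Real.exp (k' * |z|) ≤ Real.exp ((|k| + |k'|) * |z|) := by
      gcongr; linarith [le_abs_self k', abs_nonneg k]
    have h3 : ‖gradX (u t z) y‖ ≤ |K'| * Real.exp ((|k| + |k'|) * |z|) :=
      h2.trans (mul_le_mul (le_abs_self _) e2 (Real.exp_pos _).le (abs_nonneg _))
    have h4 : D * ‖gradX (u t z) y‖ ≤ |D| * (|K'| * Real.exp ((|k| + |k'|) * |z|)) :=
      mul_le_mul (le_abs_self _) h3 (norm_nonneg _) (abs_nonneg _)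
    have h5 : K * Real.exp (k * |z|) ≤ |K| * Real.exp ((|k| + |k'|) * |z|) :=
      mul_le_mul (le_abs_self _) e1 (Real.exp_pos _).le (abs_nonneg _)
    linarith

end MFGData

end Hamiltonian

/-! ### The likelihood of the signal -/

section Tilt

variable {n : ℕ} {σ : ℝ}

/-- The Gaussian average over the states of the densities `girsanov`. -/
def tilt (σ t z : ℝ) : ℝ :=
  σ * Real.exp (z ^ 2 / (2 * σ ^ 2 * (σ ^ 2 + t)) - Real.log (σ ^ 2 + t) / 2)

/-- The function `tilt` with its derivatives. -/
def tiltJet (σ : ℝ) : SignalJet where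
  e := tilt σ
  et t z := (-(z ^ 2 / (2 * σ ^ 2 * (σ ^ 2 + t) ^ 2)) - 1 / (2 * (σ ^ 2 + t))) * tilt σ t z
  ez t z := z / (σ ^ 2 * (σ ^ 2 + t)) * tilt σ t z
  ezz t z := (1 / (σ ^ 2 * (σ ^ 2 + t)) + (z / (σ ^ 2 * (σ ^ 2 + t))) ^ 2) * tilt σ t z

lemma tilt_pos (hσ : 0 < σ) (t z : ℝ) : 0 < tilt σ t z := mul_pos hσ (Real.exp_pos _)

lemma continuousOn_tilt (hσ : 0 < σ) :
    ContinuousOn (fun p : ℝ × ℝ => tilt σ p.1 p.2) (Set.Ici 0 ×ˢ Set.univ) := by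
  intro p hp
  have hp : 0 ≤ p.1 := hp.1
  have ha : σ ^ 2 + p.1 ≠ 0 := by positivity
  unfold tilt
  refine ContinuousAt.continuousWithinAt (ContinuousAt.mul continuousAt_const
    (Real.continuous_exp.continuousAt.comp (ContinuousAt.sub ?_ ?_)))
  · exact ContinuousAt.div (by fun_prop) (by fun_prop) (by positivity)
  · exact (ContinuousAt.log (f := fun p : ℝ × ℝ => σ ^ 2 + p.1) (by fun_prop) ha).div_const 2

lemma tiltJet_isC12 (hσ : 0 < σ) : (tiltJet σ).IsC12 (Set.Ici 0) := by
  have hz : ∀ t ∈ Set.Ici (0 : ℝ), ∀ z,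
      HasDerivAt (tilt σ t) (z / (σ ^ 2 * (σ ^ 2 + t)) * tilt σ t z) z := by
    intro t ht z
    have ht : 0 ≤ t := ht
    have h := ((((hasDerivAt_pow 2 z).div_const (2 * σ ^ 2 * (σ ^ 2 + t))).sub_const
      (Real.log (σ ^ 2 + t) / 2)).exp).const_mul σ
    refine h.congr_deriv ?_
    simp only [tilt]
    have : σ ^ 2 + t ≠ 0 := by positivity
    push_cast
    field_simp
  have hc := continuousOn_tilt hσ
  have hpos : ∀ p ∈ Set.Ici (0 : ℝ) ×ˢ (Set.univ : Set ℝ), σ ^ 2 + p.1 ≠ 0 := fun p hp => by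
    have : 0 ≤ p.1 := hp.1
    positivity
  have hq : ContinuousOn (fun p : ℝ × ℝ => p.2 / (σ ^ 2 * (σ ^ 2 + p.1)))
      (Set.Ici 0 ×ˢ Set.univ) :=
    ContinuousOn.div (by fun_prop) (by fun_prop) fun p hp => mul_ne_zero (by positivity) (hpos p hp)
  refine ⟨fun t ht z => ?_, hz, fun t ht z => ?_, hc, ?_, hq.mul hc, ?_⟩
  · have ht : 0 ≤ t := ht
    have ha : σ ^ 2 + t ≠ 0 := by positivity
    have h1 : HasDerivAt (fun t => σ ^ 2 + t) 1 t := (hasDerivAt_id t).const_add _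
    have h2 : HasDerivAt (fun t => z ^ 2 / (2 * σ ^ 2 * (σ ^ 2 + t)))
        (-(z ^ 2 / (2 * σ ^ 2 * (σ ^ 2 + t) ^ 2))) t := by
      have := (hasDerivAt_const t (z ^ 2)).div (h1.const_mul (2 * σ ^ 2))
        (mul_ne_zero (by positivity) ha)
      refine this.congr_deriv ?_
      field_simp
      ring
    refine (((h2.sub ((h1.log ha).div_const 2)).exp).const_mul σ).congr_deriv ?_
    simp only [tiltJet, tilt, Pi.sub_apply]
    field_simp
  · have h := ((hasDerivAt_id z).div_const (σ ^ 2 * (σ ^ 2 + t))).mul (hz t ht z)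
    refine h.congr_deriv ?_
    simp only [tiltJet, id]
    ring
  · refine ContinuousOn.mul (ContinuousOn.sub (ContinuousOn.neg ?_) ?_) hc
    · exact ContinuousOn.div (by fun_prop) (by fun_prop) fun p hp =>
        mul_ne_zero (by positivity) (pow_ne_zero 2 (hpos p hp))
    · exact ContinuousOn.div (by fun_prop) (by fun_prop) fun p hp =>
        mul_ne_zero (by positivity) (hpos p hp)
  · refine ContinuousOn.mul (ContinuousOn.add ?_ (hq.pow 2)) hc
    exact ContinuousOn.div (by fun_prop) (by fun_prop) fun p hp =>
      mul_ne_zero (by positivity) (hpos p hp)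

/-- The definition keeps the logarithm in the exponent so that all derivatives come from a single
exponential; this is the usual form. -/
lemma tilt_eq {t : ℝ} (hσ : 0 < σ) (ht : 0 ≤ t) (z : ℝ) :
    tilt σ t z = σ / √(σ ^ 2 + t) * Real.exp (z ^ 2 / (2 * σ ^ 2 * (σ ^ 2 + t))) := by
  have ha : 0 < σ ^ 2 + t := by positivity
  rw [tilt, Real.exp_sub, Real.exp_half, Real.exp_log ha]
  ring

/-- Averaging the signal laws N(st, σ²t) over s of law N(0,1) gives N(0, t² + σ²t). So although the
weight grows like a Gaussian exponential, weighting the state-zero law by it leaves a Gaussian, with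
all exponential moments. -/
lemma tilt_mul_gaussianPDFReal {t : ℝ} (hσ : 0 < σ) (ht : 0 < t) (z : ℝ) :
    tilt σ t z * gaussianPDFReal 0 (σ ^ 2 * t).toNNReal z
      = gaussianPDFReal 0 (t * (σ ^ 2 + t)).toNNReal z := by
  have ha : 0 < σ ^ 2 + t := by positivity
  rw [tilt_eq hσ ht.le, gaussianPDFReal, gaussianPDFReal, Real.coe_toNNReal _ (by positivity),
    Real.coe_toNNReal _ (by positivity)]
  have e1 : √(2 * Real.pi * (σ ^ 2 * t)) = σ * √(2 * Real.pi * t) := by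
    rw [show 2 * Real.pi * (σ ^ 2 * t) = σ ^ 2 * (2 * Real.pi * t) by ring,
      Real.sqrt_mul (by positivity), Real.sqrt_sq hσ.le]
  have e2 : √(2 * Real.pi * (t * (σ ^ 2 + t))) = √(2 * Real.pi * t) * √(σ ^ 2 + t) := by
    rw [← Real.sqrt_mul (by positivity)]; congr 1; ring
  have h1 : 0 < √(2 * Real.pi * t) := Real.sqrt_pos.2 (by positivity)
  have h2 : 0 < √(σ ^ 2 + t) := Real.sqrt_pos.2 ha
  rw [e1, e2, show σ / √(σ ^ 2 + t) * Real.exp (z ^ 2 / (2 * σ ^ 2 * (σ ^ 2 + t)))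
      * ((σ * √(2 * Real.pi * t))⁻¹ * Real.exp (-(z - 0) ^ 2 / (2 * (σ ^ 2 * t))))
    = (√(2 * Real.pi * t) * √(σ ^ 2 + t))⁻¹ * (Real.exp (z ^ 2 / (2 * σ ^ 2 * (σ ^ 2 + t)))
      * Real.exp (-(z - 0) ^ 2 / (2 * (σ ^ 2 * t)))) by field_simp, ← Real.exp_add]
  congr 2
  field_simp
  ring

lemma lintegral_tilt_mul_gaussianReal {t : ℝ} (hσ : 0 < σ) (ht : 0 < t) {W : ℝ → ℝ}
    (hW : Measurable W) :
    ∫⁻ z, ENNReal.ofReal (tilt σ t z * W z) ∂gaussianReal 0 (σ ^ 2 * t).toNNReal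
      = ∫⁻ z, ENNReal.ofReal (W z) ∂gaussianReal 0 (t * (σ ^ 2 + t)).toNNReal := by
  have hm : Measurable (tilt σ t) := by unfold tilt; fun_prop
  rw [gaussianReal_of_var_ne_zero _ (Real.toNNReal_pos.2 (by positivity)).ne',
    gaussianReal_of_var_ne_zero _ (Real.toNNReal_pos.2 (by positivity)).ne',
    lintegral_withDensity_eq_lintegral_mul _ (measurable_gaussianPDF _ _) (by fun_prop),
    lintegral_withDensity_eq_lintegral_mul _ (measurable_gaussianPDF _ _) (by fun_prop)]
  refine lintegral_congr fun z => ?_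
  simp only [Pi.mul_apply, gaussianPDF]
  rw [← tilt_mul_gaussianPDFReal hσ ht, ← ENNReal.ofReal_mul (gaussianPDFReal_nonneg _ _ _),
    ← ENNReal.ofReal_mul (mul_nonneg (tilt_pos hσ _ _).le (gaussianPDFReal_nonneg _ _ _))]
  congr 1
  ring

/-- Weighted exponential moments of the signal, uniformly in time. -/
lemma IsFP.lintegral_tilt_le {σ' T : ℝ} {b : ℝ → ℝ → Vec n → Vec n}
    {ρ₀ : ProbabilityMeasure (Torus n)} {J : Jet n} (h : IsFP σ σ' T 0 b ρ₀ J) (hb : IsDrift T b)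
    (hσ : 0 < σ) {K : ℝ} (hK : 0 ≤ K) (k : ℝ) {t : ℝ} (ht : t ∈ Set.Ioc 0 T) :
    ∫⁻ q, ENNReal.ofReal (tilt σ t q.1 * (K * Real.exp (k * |q.1|)) * J.f t q.1 q.2)
        ∂stripMeasure n
      ≤ ENNReal.ofReal (K * (2 * Real.exp (T * (σ ^ 2 + T) * k ^ 2 / 2))) := by
  have ht0 : 0 < t := ht.1
  rw [h.lintegral_signal hb ht (W := fun z => tilt σ t z * (K * Real.exp (k * |z|)))
    (by unfold tilt; fun_prop) (fun z => mul_nonneg (tilt_pos hσ _ _).le (by positivity)), zero_mul,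
    lintegral_tilt_mul_gaussianReal hσ ht0 (W := fun z => K * Real.exp (k * |z|)) (by fun_prop)]
  simp_rw [ENNReal.ofReal_mul hK]
  rw [lintegral_const_mul _ (by fun_prop)]
  refine mul_le_mul_right ((lintegral_exp_abs_gaussianReal_le k 0 _).trans ?_) _
  refine ENNReal.ofReal_le_ofReal (mul_le_mul_of_nonneg_left (Real.exp_le_exp.2 ?_) zero_le_two)
  rw [Real.coe_toNNReal _ (by positivity), abs_zero, mul_zero, zero_add]
  have := ht.2
  have hT : 0 < T := ht0.trans_le this
  gcongr

/-- Bayes' rule: the prior is N(0,1), the likelihood is the Girsanov factor, the evidence is `tilt`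
and the posterior is the belief. On densities it is a completion of the square in s. -/
lemma tilt_mul_belief {d : MFGData n} (hd : d.Nondegenerate) {t : ℝ} (ht : 0 ≤ t) (z : ℝ)
    (f : ℝ → ℝ) : tilt d.σ t z * ∫ s, f s ∂d.belief t z
      = ∫ s, girsanov d.σ s t z * f s ∂gaussianReal 0 1 := by
  have hσ := hd.σ_pos
  have ha : 0 < d.σ ^ 2 + t := by positivity
  rw [MFGData.belief, integral_gaussianReal_eq_integral_smul (MFGData.postVar_pos hd ht).ne',
    integral_gaussianReal_eq_integral_smul one_ne_zero, ← integral_const_mul]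
  refine integral_congr_ae (ae_of_all _ fun s => ?_)
  simp only [smul_eq_mul]
  rw [← mul_assoc, ← mul_assoc]
  congr 1
  rw [tilt_eq hσ ht, gaussianPDFReal, gaussianPDFReal, MFGData.postVar_coe hd ht, NNReal.coe_one,
    mul_one, girsanov]
  have e1 : √(2 * Real.pi * (d.σ ^ 2 / (d.σ ^ 2 + t))) = √(2 * Real.pi) * d.σ / √(d.σ ^ 2 + t) := by
    rw [← mul_div_assoc, Real.sqrt_div (by positivity), Real.sqrt_mul (by positivity),
      Real.sqrt_sq hσ.le]
  have h1 : 0 < √(2 * Real.pi) := Real.sqrt_pos.2 (by positivity)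
  have h2 : 0 < √(d.σ ^ 2 + t) := Real.sqrt_pos.2 ha
  rw [e1, show ∀ A B : ℝ, d.σ / √(d.σ ^ 2 + t) * A * ((√(2 * Real.pi) * d.σ / √(d.σ ^ 2 + t))⁻¹ * B)
    = (√(2 * Real.pi))⁻¹ * (A * B) by intro A B; field_simp, ← Real.exp_add, mul_assoc (√(2 * Real.pi))⁻¹,
    ← Real.exp_add, MFGData.postMean]
  congr 2
  have h3 : t + d.σ ^ 2 ≠ 0 := by positivity
  field_simp
  ring

end Tilt

/-! ### The law of the positions -/

section PositionLaw

variable {n : ℕ} {d : MFGData n} {u u₁ u₂ : ℝ → ℝ → Torus n → ℝ}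
  {m m₁ m₂ : ℝ → ℝ → ℝ → Torus n → ℝ}

lemma posMarginal_eq_map {f : ℝ → Torus n → ℝ} (hf : Measurable fun q : ℝ × Torus n => f q.1 q.2) :
    posMarginal f = ((volume : Measure (ℝ × Torus n)).withDensity
      fun q => ENNReal.ofReal (f q.1 q.2)).map Prod.snd := by
  ext A hA
  rw [posMarginal, withDensity_apply _ hA, Measure.map_apply measurable_snd hA,
    withDensity_apply _ (measurable_snd hA), ← Set.univ_prod, Measure.volume_eq_prod,
    ← Measure.prod_restrict, Measure.restrict_univ,
    lintegral_prod_symm _ hf.ennreal_ofReal.aemeasurable]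

lemma integral_posLaw {s t : ℝ} (h : IsProbDensity (m s t)) {g : Torus n → ℝ} (hg : Continuous g) :
    ∫ x, g x ∂(posLaw m s t : Measure (Torus n))
      = ∫ q, g (toTorus q.2) * m s t q.1 (toTorus q.2) ∂stripMeasure n := by
  obtain ⟨h0, hm, h1⟩ := h
  have hmap := posMarginal_eq_map hm
  have hprob : IsProbabilityMeasure (posMarginal (m s t)) := by
    have : IsProbabilityMeasure ((volume : Measure (ℝ × Torus n)).withDensity
        fun q => ENNReal.ofReal (m s t q.1 q.2)) :=
      ⟨by rw [withDensity_apply _ MeasurableSet.univ, Measure.restrict_univ, h1]⟩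
    rw [hmap]
    exact Measure.isProbabilityMeasure_map measurable_snd.aemeasurable
  have hlaw : posLaw m s t = ⟨posMarginal (m s t), hprob⟩ := dif_pos hprob
  rw [hlaw, ProbabilityMeasure.coe_mk, hmap,
    integral_map measurable_snd.aemeasurable hg.aestronglyMeasurable,
    integral_withDensity_eq_integral_toReal_smul hm.ennreal_ofReal
      (ae_of_all _ fun _ => ENNReal.ofReal_lt_top), ← measurePreserving_strip.map_eq]
  rw [integral_map measurePreserving_strip.measurable.aemeasurable]
  · refine integral_congr_ae (ae_of_all _ fun q => ?_)
    simp only [smul_eq_mul, ENNReal.toReal_ofReal (h0 _ _)]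
    rw [mul_comm]
  · exact (hm.ennreal_ofReal.ennreal_toReal.smul (hg.measurable.comp
      measurable_snd)).aestronglyMeasurable

namespace MFGData

lemma SolvesFP.eq_girsanov (hd : d.Nondegenerate) (h : d.SolvesFP u m)
    (hb : IsDrift d.T (d.drift u)) (s : ℝ) {t : ℝ} (ht : t ∈ Set.Ioc 0 d.T) (z : ℝ) (y : Vec n) :
    m s t z (toTorus y) = girsanov d.σ s t z * m 0 t z (toTorus y) :=
  (h.isFP hd.T_pos 0).eq_girsanov_mul (h.isFP hd.T_pos s) hb hd.σ_pos hd.σ'_pos ht z y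

/-- The densities vary with s only through the Girsanov factor, dominated near s₀ by an exponential
of |z|. This continuity supplies the measurability in s needed to average interaction costs over the
belief. -/
lemma SolvesFP.continuous_posLaw (hd : d.Nondegenerate) (h : d.SolvesFP u m)
    (hb : IsDrift d.T (d.drift u)) {t : ℝ} (ht : t ∈ Set.Ioc 0 d.T) :
    Continuous fun s => posLaw m s t := by
  have hσ := hd.σ_pos
  have h0 := h.isFP hd.T_pos 0
  rw [continuous_iff_continuousAt]
  intro s₀
  rw [ContinuousAt, ProbabilityMeasure.tendsto_iff_forall_integral_tendsto]
  intro f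
  simp_rw [integral_posLaw (h.density _ t ht) f.continuous]
  set k := (|s₀| + 1) / d.σ ^ 2
  obtain ⟨B, hB0, hB⟩ := h0.exists_exp_moment_bound hb ‖f‖ k
  have hi := h0.integrable_weight ht (f := fun z _ => ‖f‖ * Real.exp (k * |z|)) (by fun_prop)
    ENNReal.ofReal_ne_top (hB t ht) (fun z y => (abs_of_nonneg (by positivity)).le)
  refine tendsto_integral_filter_of_dominated_convergence _ (Eventually.of_forall fun s => ?_) ?_ hi
    (ae_of_all _ fun q => ?_)
  · have h1 : Continuous fun q : ℝ × Vec n => m s t q.1 (toTorus q.2) :=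
      (h.isFP hd.T_pos s).cont.slice ht
    exact ((f.continuous.comp (continuous_toTorus.comp continuous_snd)).mul h1).aestronglyMeasurable
  · filter_upwards [Metric.ball_mem_nhds s₀ one_pos] with s hs
    refine ae_of_all _ fun q => ?_
    rw [h.eq_girsanov hd hb s ht, norm_mul, norm_mul, ← mul_assoc]
    have h1 := h0.nonneg t ht q.1 q.2
    have e : ‖m 0 t q.1 (toTorus q.2)‖ = (jetOf (m 0)).f t q.1 q.2 := by
      rw [Real.norm_eq_abs]; exact abs_of_nonneg h1
    rw [e]
    refine mul_le_mul_of_nonneg_right (mul_le_mul (f.norm_coe_le_norm _) ?_ (norm_nonneg _)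
      (norm_nonneg _)) h1
    rw [girsanov, Real.norm_eq_abs, Real.abs_exp, Real.exp_le_exp]
    have h2 : |s| ≤ |s₀| + 1 := by
      rw [Real.ball_eq_Ioo] at hs
      have := abs_sub_abs_le_abs_sub s s₀
      have h3 : |s - s₀| < 1 := abs_lt.2 ⟨by linarith [hs.1], by linarith [hs.2]⟩
      linarith
    have h3 : s * q.1 ≤ (|s₀| + 1) * |q.1| :=
      (le_abs_self _).trans (by rw [abs_mul]; gcongr)
    have h4 : 0 ≤ s ^ 2 * t / (2 * d.σ ^ 2) := by have := ht.1; positivity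
    have h5 : s * q.1 / d.σ ^ 2 ≤ (|s₀| + 1) * |q.1| / d.σ ^ 2 := by gcongr
    have e2 : k * |q.1| = (|s₀| + 1) * |q.1| / d.σ ^ 2 := by simp only [k]; ring
    linarith
  · refine Tendsto.const_mul _ ?_
    rw [h.eq_girsanov hd hb s₀ ht]
    refine Tendsto.congr (fun s => (h.eq_girsanov hd hb s ht q.1 q.2).symm) ?_
    refine Tendsto.mul_const _ (Continuous.tendsto ?_ s₀)
    unfold girsanov; fun_prop

/-- The averaged interaction costs inherit the monotonicity. -/
lemma integral_tilt_mul_average_nonneg {A : ℝ → Torus n → ProbabilityMeasure (Torus n) → ℝ}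
    (hd : d.Nondegenerate) (hA : RegularInteraction A) (hmono : StatewiseMonotone A)
    (h₁ : d.SolvesFP u₁ m₁) (h₂ : d.SolvesFP u₂ m₂) (hb₁ : IsDrift d.T (d.drift u₁))
    (hb₂ : IsDrift d.T (d.drift u₂)) {t : ℝ} (ht : t ∈ Set.Ioc 0 d.T) :
    0 ≤ ∫ q, tilt d.σ t q.1 * ((∫ s, A s (toTorus q.2) (posLaw m₁ s t) ∂d.belief t q.1)
        - ∫ s, A s (toTorus q.2) (posLaw m₂ s t) ∂d.belief t q.1)
      * (m₁ 0 t q.1 (toTorus q.2) - m₂ 0 t q.1 (toTorus q.2)) ∂stripMeasure n := by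
  obtain ⟨K, k, hK⟩ := hA.growth
  have hK0 : 0 ≤ K := nonneg_of_mul_nonneg_left ((abs_nonneg _).trans
    (hK 0 (toTorus 0) d.ρ₀)) (Real.exp_pos _)
  have c₁ := h₁.continuous_posLaw hd hb₁ ht
  have c₂ := h₂.continuous_posLaw hd hb₂ ht
  have hc₁ : Continuous fun p : ℝ × Torus n => A p.1 p.2 (posLaw m₁ p.1 t) :=
    hA.continuous.comp (continuous_fst.prodMk (continuous_snd.prodMk (c₁.comp continuous_fst)))
  have hc₂ : Continuous fun p : ℝ × Torus n => A p.1 p.2 (posLaw m₂ p.1 t) :=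
    hA.continuous.comp (continuous_fst.prodMk (continuous_snd.prodMk (c₂.comp continuous_fst)))
  let D : ℝ → Torus n → ℝ := fun s x => A s x (posLaw m₁ s t) - A s x (posLaw m₂ s t)
  have hDc : Continuous fun p : ℝ × Torus n => D p.1 p.2 := hc₁.sub hc₂
  have hDb : ∀ s x, |D s x| ≤ 2 * K * Real.exp (k * |s|) := fun s x => by
    refine (abs_sub _ _).trans ?_
    linarith [hK s x (posLaw m₁ s t), hK s x (posLaw m₂ s t)]
  have i₁ := fun s => (h₁.isFP hd.T_pos s).integrable ht
  have i₂ := fun s => (h₂.isFP hd.T_pos s).integrable ht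
  have n₁ := fun s => (h₁.isFP hd.T_pos s).nonneg t ht
  have n₂ := fun s => (h₂.isFP hd.T_pos s).nonneg t ht
  have k₁ := fun s => (h₁.isFP hd.T_pos s).cont.slice ht
  have k₂ := fun s => (h₂.isFP hd.T_pos s).cont.slice ht
  simp only [jetOf] at i₁ i₂ n₁ n₂ k₁ k₂
  let w : ℝ × Vec n → ℝ := fun q => m₁ 0 t q.1 (toTorus q.2) - m₂ 0 t q.1 (toTorus q.2)
  have hwc : Continuous w := (k₁ 0).sub (k₂ 0)
  have hgw : ∀ s (q : ℝ × Vec n), girsanov d.σ s t q.1 * w q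
      = m₁ s t q.1 (toTorus q.2) - m₂ s t q.1 (toTorus q.2) := fun s q => by
    rw [h₁.eq_girsanov hd hb₁ s ht, h₂.eq_girsanov hd hb₂ s ht]; ring
  let G : ℝ × Vec n → ℝ → ℝ := fun q s => girsanov d.σ s t q.1 * D s (toTorus q.2) * w q
  have hGc : Continuous fun p : (ℝ × Vec n) × ℝ => G p.1 p.2 := by
    refine Continuous.mul (Continuous.mul (by unfold girsanov; fun_prop) ?_)
      (hwc.comp continuous_fst)
    exact hDc.comp (continuous_snd.prodMk (continuous_toTorus.comp
      (continuous_snd.comp continuous_fst)))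
  -- By Bayes' rule the weighted belief average becomes an average over the fixed prior N(0,1),
  -- which no longer depends on the signal.
  have e1 : ∀ q : ℝ × Vec n, tilt d.σ t q.1 *
      ((∫ s, A s (toTorus q.2) (posLaw m₁ s t) ∂d.belief t q.1)
        - ∫ s, A s (toTorus q.2) (posLaw m₂ s t) ∂d.belief t q.1)
      * (m₁ 0 t q.1 (toTorus q.2) - m₂ 0 t q.1 (toTorus q.2)) = ∫ s, G q s ∂gaussianReal 0 1 := by
    intro q
    have j₁ : Integrable (fun s => A s (toTorus q.2) (posLaw m₁ s t)) (d.belief t q.1) :=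
      (belief_average hd (hc₁.comp (by fun_prop :
      Continuous fun s : ℝ => (s, toTorus q.2))).measurable
      (fun s => hK s (toTorus q.2) _) ht.1.le q.1).1
    have j₂ : Integrable (fun s => A s (toTorus q.2) (posLaw m₂ s t)) (d.belief t q.1) :=
      (belief_average hd (hc₂.comp (by fun_prop :
      Continuous fun s : ℝ => (s, toTorus q.2))).measurable
      (fun s => hK s (toTorus q.2) _) ht.1.le q.1).1
    rw [← integral_sub j₁ j₂, tilt_mul_belief hd ht.1.le, ← integral_mul_const]
  -- The Girsanov factor turns the state-zero densities back into those of state s, whose masses are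
  -- one. The dominating function `M` therefore has slice integral 4K exp(k|s|), integrable under
  -- the prior.
  have hint : Integrable (Function.uncurry G) ((stripMeasure n).prod (gaussianReal 0 1)) := by
    let M : (ℝ × Vec n) × ℝ → ℝ := fun p => 2 * K * Real.exp (k * |p.2|)
      * (m₁ p.2 t p.1.1 (toTorus p.1.2) + m₂ p.2 t p.1.1 (toTorus p.1.2))
    have hM0 : ∀ p, 0 ≤ M p := fun p =>
      mul_nonneg (by positivity) (add_nonneg (n₁ _ _ _) (n₂ _ _ _))
    have hMc : Continuous M := by
      have e : M = fun p => 2 * K * Real.exp (k * |p.2|) * (girsanov d.σ p.2 t p.1.1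
          * (m₁ 0 t p.1.1 (toTorus p.1.2) + m₂ 0 t p.1.1 (toTorus p.1.2))) := by
        funext p
        simp only [M]
        rw [h₁.eq_girsanov hd hb₁ p.2 ht, h₂.eq_girsanov hd hb₂ p.2 ht]; ring
      rw [e]
      exact Continuous.mul (by fun_prop) (Continuous.mul (by unfold girsanov; fun_prop)
        (((k₁ 0).add (k₂ 0)).comp continuous_fst))
    have hMi : Integrable M ((stripMeasure n).prod (gaussianReal 0 1)) := by
      rw [integrable_prod_iff' hMc.aestronglyMeasurable]
      refine ⟨ae_of_all _ fun s =>
        ((i₁ s).1.add (i₂ s).1).const_mul (2 * K * Real.exp (k * |s|)), ?_⟩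
      have e : ∀ s, ∫ q, ‖M (q, s)‖ ∂stripMeasure n = 4 * K * Real.exp (k * |s|) := by
        intro s
        simp_rw [Real.norm_eq_abs, abs_of_nonneg (hM0 _)]
        simp only [M]
        rw [integral_const_mul, integral_add (i₁ s).1 (i₂ s).1, (i₁ s).2, (i₂ s).2]
        ring
      simp_rw [e]
      exact (integrable_gaussianReal_of_exp_bound (K := 4 * K) (k := k) (by fun_prop)
        (fun s => (abs_of_nonneg (by positivity)).le) 0 1).1
    refine hMi.mono' hGc.aestronglyMeasurable (ae_of_all _ fun p => ?_)
    simp only [Function.uncurry, G, M]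
    rw [mul_right_comm, hgw, mul_comm, norm_mul]
    refine mul_le_mul (hDb _ _) ?_ (norm_nonneg _) (by positivity)
    refine (norm_sub_le _ _).trans ?_
    rw [Real.norm_eq_abs, Real.norm_eq_abs, abs_of_nonneg (n₁ _ _ _), abs_of_nonneg (n₂ _ _ _)]
  simp_rw [e1]
  rw [integral_integral_swap hint]
  refine integral_nonneg fun s => ?_
  have hDs : Continuous (D s) := hDc.comp (by fun_prop : Continuous fun x : Torus n => (s, x))
  have l₁ : Integrable (fun q : ℝ × Vec n => D s (toTorus q.2) * m₁ s t q.1 (toTorus q.2))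
      (stripMeasure n) := (i₁ s).1.bdd_mul (c := 2 * K * Real.exp (k * |s|))
    (hDs.comp (continuous_toTorus.comp continuous_snd)).aestronglyMeasurable
    (ae_of_all _ fun q => hDb _ _)
  have l₂ : Integrable (fun q : ℝ × Vec n => D s (toTorus q.2) * m₂ s t q.1 (toTorus q.2))
      (stripMeasure n) := (i₂ s).1.bdd_mul (c := 2 * K * Real.exp (k * |s|))
    (hDs.comp (continuous_toTorus.comp continuous_snd)).aestronglyMeasurable
    (ae_of_all _ fun q => hDb _ _)
  have e2 : ∫ q, G q s ∂stripMeasure n = ∫ x, D s x ∂(posLaw m₁ s t : Measure (Torus n))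
      - ∫ x, D s x ∂(posLaw m₂ s t : Measure (Torus n)) := by
    rw [integral_posLaw (h₁.density s t ht) hDs, integral_posLaw (h₂.density s t ht) hDs,
      ← integral_sub l₁ l₂]
    refine integral_congr_ae (ae_of_all _ fun q => ?_)
    simp only [G]
    rw [mul_right_comm, hgw]; ring
  simp only [Pi.zero_apply]
  rw [e2]
  -- Monotonicity is assumed only for distinct laws; for equal ones the expression is zero.
  by_cases hρ : posLaw m₁ s t = posLaw m₂ s t
  · rw [hρ, sub_self]
  · exact hmono s _ _ hρ

end MFGData

end PositionLaw

/-! ### Uniqueness of the game distribution -/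

section LasryLions

variable {n : ℕ}

lemma le_exp_growth {a K k K' k' r : ℝ} (h : a ≤ K * Real.exp (k * r)) (hK : |K| ≤ K')
    (hk : |k| ≤ k') (hr : 0 ≤ r) : a ≤ K' * Real.exp (k' * r) := by
  refine h.trans (mul_le_mul ((le_abs_self K).trans hK) (Real.exp_le_exp.2 ?_) (Real.exp_pos _).le
    ((abs_nonneg K).trans hK))
  exact mul_le_mul_of_nonneg_right ((le_abs_self k).trans hk) hr

lemma SignalJet.IsC12.mono {I I' : Set ℝ} {a : SignalJet} (ha : a.IsC12 I) (h : I' ⊆ I) :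
    a.IsC12 I' where
  hasDerivAt_t t ht := ha.hasDerivAt_t t (h ht)
  hasDerivAt_z t ht := ha.hasDerivAt_z t (h ht)
  hasDerivAt_zz t ht := ha.hasDerivAt_zz t (h ht)
  cont_e := ha.cont_e.mono (Set.prod_mono h subset_rfl)
  cont_et := ha.cont_et.mono (Set.prod_mono h subset_rfl)
  cont_ez := ha.cont_ez.mono (Set.prod_mono h subset_rfl)
  cont_ezz := ha.cont_ezz.mono (Set.prod_mono h subset_rfl)

/-- A continuous periodic function which vanishes almost everywhere on a time slab vanishes. -/
lemma eq_zero_of_ae_slab {T : ℝ} {f : ℝ → ℝ → Vec n → ℝ} (hf : JointCont (Set.Ioo 0 T) f)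
    (hp : ∀ t ∈ Set.Ioo 0 T, ∀ z, IsPeriodic (f t z))
    (h0 : ∀ᵐ p ∂slabMeasure n (Set.Ioo 0 T), f p.1 p.2.1 p.2.2 = 0) {t : ℝ}
    (ht : t ∈ Set.Ioo 0 T) (z : ℝ) (y : Vec n) : f t z y = 0 := by
  have h1 := Measure.ae_ae_of_ae_prod h0
  have h2 : (fun t => f t z y) =ᵐ[volume.restrict (Set.Ioo 0 T)] fun _ => 0 := by
    filter_upwards [h1, ae_restrict_mem measurableSet_Ioo] with r hr hrT
    exact eq_zero_of_ae_strip (hf.slice hrT) (hp r hrT) hr z y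
  refine Measure.eqOn_open_of_ae_eq h2 isOpen_Ioo ?_ continuousOn_const ht
  exact ContinuousOn.comp hf (f := fun t => (t, z, y)) (by fun_prop) fun r hr => ⟨hr, trivial⟩

/-- The weight solves the backward heat equation in the signal, so its derivatives cancel except in
the cross term, where σ² times its logarithmic derivative is r_t(z). This Doob transform passes from
the signal in state 0 to the signal seen by a player who does not know the state. -/
lemma fpAdj_tilt_mul {σ σ' : ℝ} (hσ : 0 < σ) (b : ℝ → ℝ → Vec n → Vec n) (V : Jet n) {t : ℝ}
    (ht : 0 ≤ t) (z : ℝ) (y : Vec n) :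
    fpAdj σ σ' 0 b ((tiltJet σ).mul V) t z y = tilt σ t z * (V.ft t z y
      + z / (t + σ ^ 2) * V.fz t z y + σ ^ 2 / 2 * V.fzz t z y + σ' ^ 2 / 2 * V.fl t z y
      + inner ℝ (V.fg t z y) (b t z y)) := by
  have ha : t + σ ^ 2 ≠ 0 := by positivity
  simp only [fpAdj, fpSpace, SignalJet.mul, tiltJet, inner_smul_left, conj_trivial]
  rw [add_comm (σ ^ 2) t]
  field_simp
  ring

namespace MFGData

variable {d : MFGData n} {u₁ u₂ : ℝ → ℝ → Torus n → ℝ} {m₁ m₂ : ℝ → ℝ → ℝ → Torus n → ℝ}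

/-- The optimal drifts of two solutions agree wherever the second density is positive. -/
lemma IsSolution.drift_eq (hd : d.Nondegenerate) (hC : RegularRunningCost d.C)
    (hF : RegularInteraction d.F) (hG : RegularInteraction d.G) (hFm : StatewiseMonotone d.F)
    (hGm : StatewiseMonotone d.G) (h₁ : d.IsSolution u₁ m₁) (h₂ : d.IsSolution u₂ m₂) {t : ℝ}
    (ht : t ∈ Set.Ioo 0 d.T) (z : ℝ) (y : Vec n) :
    ‖d.drift u₁ t z y - d.drift u₂ t z y‖ ^ 2 * m₂ 0 t z (toTorus y) = 0 := by
  have hσ := hd.σ_pos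
  have hT := hd.T_pos
  have hb₁ := h₁.hjb.isDrift hd hC
  have hb₂ := h₂.hjb.isDrift hd hC
  have fp₁ := h₁.fp.isFP hT 0
  have fp₂ := h₂.fp.isFP hT 0
  have hU₁ := h₁.hjb.isC12.jetOf
  have hU₂ := h₂.hjb.isC12.jetOf
  obtain ⟨c, hc, hexc⟩ := exists_ham_excess hd hC
  obtain ⟨K₁, k₁, hu₁, hdu₁⟩ := h₁.hjb.growth
  obtain ⟨K₂, k₂, hu₂, hdu₂⟩ := h₂.hjb.growth
  obtain ⟨K₃, k₃, hFb⟩ := hF.growth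
  set K := |K₁| + |K₂| with hK
  set k := |k₁| + |k₂| with hk
  have hK₁ : |K₁| ≤ K := by rw [hK]; linarith [abs_nonneg K₂]
  have hK₂ : |K₂| ≤ K := by rw [hK]; linarith [abs_nonneg K₁]
  have hk₁ : |k₁| ≤ k := by rw [hk]; linarith [abs_nonneg k₂]
  have hk₂ : |k₂| ≤ k := by rw [hk]; linarith [abs_nonneg k₁]
  have hK0 : 0 ≤ K := by positivity
  have hk0 : 0 ≤ k := by positivity
  set K' := |2 * K₃ * Real.exp (k₃ ^ 2 / 2)| with hK'
  set k' := |k₃| / d.σ ^ 2 with hk'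
  have hk'0 : 0 ≤ k' := by positivity
  -- One weight dominates everything: the first two summands serve the signal derivative of Ψ and Ψ
  -- itself, the third the Hamiltonian excess, the last the source difference. In the exponent
  -- below, 2k is for squared gradients, k' for the source and 1 for the factor z in the derivative
  -- of `tilt`.
  set A := 2 * K / d.σ ^ 4 + 2 * K + 4 * K ^ 2 / c + 2 * K' with hA
  set κ := 2 * k + k' + 1 with hκ
  have hA0 : 0 ≤ A := by positivity
  let W : ℝ → ℝ → ℝ := fun t z => tilt d.σ t z * (A * Real.exp (κ * |z|))
  have hexp : ∀ l z : ℝ, l ≤ κ → Real.exp (l * |z|) ≤ Real.exp (κ * |z|) := fun l z hl =>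
    Real.exp_le_exp.2 (mul_le_mul_of_nonneg_right hl (abs_nonneg z))
  set V := (jetOf u₁).sub (jetOf u₂) with hV
  set Ψ := (tiltJet d.σ).mul V with hΨ
  have hVc : V.IsC12 (Set.Ioo 0 d.T) := hU₁.sub hU₂
  have hΨc : Ψ.IsC12 (Set.Ioo 0 d.T) :=
    ((tiltJet_isC12 hσ).mono fun t ht => ht.1.le).mul hVc
  have hWc : ContinuousOn (fun p : ℝ × ℝ => W p.1 p.2) (Set.Ioc 0 d.T ×ˢ Set.univ) :=
    ((continuousOn_tilt hσ).mono (Set.prod_mono (fun t ht => ht.1.le) subset_rfl)).mul (by fun_prop)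
  have tcont : ∀ {u m}, d.IsSolution u m →
      JointCont (Set.Icc 0 d.T) fun t z (y : Vec n) => u t z (toTorus y) := fun h =>
    h.hjb.continuousOn.comp (f := fun p : ℝ × ℝ × Vec n => (p.1, p.2.1, toTorus p.2.2))
      (Continuous.continuousOn (by have := continuous_toTorus (n := n); fun_prop))
      fun p hp => ⟨hp.1, trivial⟩
  have hΨc0 : JointCont (Set.Icc 0 d.T) Ψ.f :=
    (jointCont_of_signal ((tiltJet_isC12 hσ).mono fun t ht => ht.1).cont_e).mul
      ((tcont h₁).sub (tcont h₂))
  -- bounds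
  have bv : ∀ t ∈ Set.Icc 0 d.T, ∀ z y, |V.f t z y| ≤ 2 * K * Real.exp (k * |z|) := by
    intro t ht z y
    refine (abs_sub _ _).trans ?_
    have a1 := le_exp_growth (hu₁ t ht z (toTorus y)) hK₁ hk₁ (abs_nonneg z)
    have a2 := le_exp_growth (hu₂ t ht z (toTorus y)) hK₂ hk₂ (abs_nonneg z)
    simp only [jetOf]
    linarith
  have bvz : ∀ t ∈ Set.Ioo 0 d.T, ∀ z y, |V.fz t z y| ≤ 2 * K * Real.exp (k * |z|) := by
    intro t ht z y
    refine (abs_sub _ _).trans ?_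
    have a1 := le_exp_growth (hdu₁ t ht z y).1 hK₁ hk₁ (abs_nonneg z)
    have a2 := le_exp_growth (hdu₂ t ht z y).1 hK₂ hk₂ (abs_nonneg z)
    simp only [jetOf]
    linarith
  have bvg : ∀ t ∈ Set.Ioo 0 d.T, ∀ z y,
      ‖gradX (u₁ t z) y - gradX (u₂ t z) y‖ ≤ 2 * K * Real.exp (k * |z|) := by
    intro t ht z y
    refine (norm_sub_le _ _).trans ?_
    have a1 := le_exp_growth (hdu₁ t ht z y).2 hK₁ hk₁ (abs_nonneg z)
    have a2 := le_exp_growth (hdu₂ t ht z y).2 hK₂ hk₂ (abs_nonneg z)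
    linarith
  have bF : ∀ {u m}, d.IsSolution u m → ∀ t ∈ Set.Ioo 0 d.T, ∀ z (y : Vec n),
      |d.avgF t z (toTorus y) (posLaw m)| ≤ K' * Real.exp (k' * |z|) := by
    intro u m h t ht z y
    have hc' := h.fp.continuous_posLaw hd (h.hjb.isDrift hd hC) ⟨ht.1, ht.2.le⟩
    have hm : Measurable fun s => d.F s (toTorus y) (posLaw m s t) :=
      (hF.continuous.comp (continuous_id.prodMk (continuous_const.prodMk hc'))).measurable
    refine le_exp_growth (belief_average hd hm (fun s => hFb s _ _) ht.1.le z).2 le_rfl ?_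
      (abs_nonneg z)
    rw [abs_of_nonneg hk'0]
  -- the excess terms
  let ham₁ : ℝ → ℝ → Vec n → ℝ := fun t z y => d.ham t z (toTorus y) (gradX (u₁ t z) y)
  let ham₂ : ℝ → ℝ → Vec n → ℝ := fun t z y => d.ham t z (toTorus y) (gradX (u₂ t z) y)
  let p₁ : ℝ → ℝ → Vec n → Vec n := fun t z y => gradX (u₁ t z) y
  let p₂ : ℝ → ℝ → Vec n → Vec n := fun t z y => gradX (u₂ t z) y
  let B₁ : ℝ → ℝ → Vec n → ℝ := fun t z y => tilt d.σ t z *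
    (ham₂ t z y - ham₁ t z y + inner ℝ (p₂ t z y - p₁ t z y) (d.drift u₁ t z y))
  let B₂ : ℝ → ℝ → Vec n → ℝ := fun t z y => tilt d.σ t z *
    (ham₁ t z y - ham₂ t z y + inner ℝ (p₁ t z y - p₂ t z y) (d.drift u₂ t z y))
  let D : ℝ → ℝ → Vec n → ℝ := fun t z y => tilt d.σ t z *
    (d.avgF t z (toTorus y) (posLaw m₁) - d.avgF t z (toTorus y) (posLaw m₂))
  have hB₁ : ∀ t ∈ Set.Ioo 0 d.T, ∀ z y, 0 ≤ B₁ t z y ∧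
      B₁ t z y ≤ tilt d.σ t z * (4 * K ^ 2 / c * Real.exp (κ * |z|)) := by
    intro t ht z y
    obtain ⟨l, r⟩ := hexc t ht.1.le z (toTorus y) (p₁ t z y) (p₂ t z y)
    have e : ham₂ t z y - ham₁ t z y + inner ℝ (p₂ t z y - p₁ t z y) (d.drift u₁ t z y)
        = d.ham t z (toTorus y) (p₂ t z y) - d.ham t z (toTorus y) (p₁ t z y)
          - inner ℝ (d.hamGrad t z (toTorus y) (p₁ t z y)) (p₂ t z y - p₁ t z y) := by
      simp only [drift, inner_neg_right]
      rw [real_inner_comm]; ring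
    simp only [B₁]
    rw [e]
    refine ⟨mul_nonneg (tilt_pos hσ _ _).le (le_trans (by positivity) l),
      mul_le_mul_of_nonneg_left (r.trans ?_) (tilt_pos hσ _ _).le⟩
    have h3 : ‖p₂ t z y - p₁ t z y‖ ^ 2 ≤ (2 * K * Real.exp (k * |z|)) ^ 2 := by
      rw [norm_sub_rev]; exact pow_le_pow_left₀ (norm_nonneg _) (bvg t ht z y) 2
    have h4 : (2 * K * Real.exp (k * |z|)) ^ 2 = 4 * K ^ 2 * Real.exp (2 * k * |z|) := by
      rw [mul_pow, ← Real.exp_nat_mul]; push_cast; ring_nf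
    have h5 := hexp (2 * k) z (by rw [hκ]; linarith)
    rw [div_mul_eq_mul_div]
    refine div_le_div_of_nonneg_right (h3.trans (h4.le.trans ?_)) hc.le
    exact mul_le_mul_of_nonneg_left h5 (by positivity)
  have hB₂ : ∀ t ∈ Set.Ioo 0 d.T, ∀ z y,
      tilt d.σ t z * (c / 2 * ‖d.drift u₁ t z y - d.drift u₂ t z y‖ ^ 2) ≤ B₂ t z y ∧
      B₂ t z y ≤ tilt d.σ t z * (4 * K ^ 2 / c * Real.exp (κ * |z|)) := by
    intro t ht z y
    obtain ⟨l, r⟩ := hexc t ht.1.le z (toTorus y) (p₂ t z y) (p₁ t z y)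
    have e : ham₁ t z y - ham₂ t z y + inner ℝ (p₁ t z y - p₂ t z y) (d.drift u₂ t z y)
        = d.ham t z (toTorus y) (p₁ t z y) - d.ham t z (toTorus y) (p₂ t z y)
          - inner ℝ (d.hamGrad t z (toTorus y) (p₂ t z y)) (p₁ t z y - p₂ t z y) := by
      simp only [drift, inner_neg_right]
      rw [real_inner_comm]; ring
    have e' : ‖d.drift u₁ t z y - d.drift u₂ t z y‖ = ‖d.hamGrad t z (toTorus y) (p₁ t z y)
        - d.hamGrad t z (toTorus y) (p₂ t z y)‖ := by
      rw [← norm_neg]; congr 1; simp only [drift, p₁, p₂]; abel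
    simp only [B₂]
    rw [e, e']
    refine ⟨mul_le_mul_of_nonneg_left l (tilt_pos hσ _ _).le,
      mul_le_mul_of_nonneg_left (r.trans ?_) (tilt_pos hσ _ _).le⟩
    have h3 : ‖p₁ t z y - p₂ t z y‖ ^ 2 ≤ (2 * K * Real.exp (k * |z|)) ^ 2 :=
      pow_le_pow_left₀ (norm_nonneg _) (bvg t ht z y) 2
    have h4 : (2 * K * Real.exp (k * |z|)) ^ 2 = 4 * K ^ 2 * Real.exp (2 * k * |z|) := by
      rw [mul_pow, ← Real.exp_nat_mul]; push_cast; ring_nf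
    have h5 := hexp (2 * k) z (by rw [hκ]; linarith)
    rw [div_mul_eq_mul_div]
    refine div_le_div_of_nonneg_right (h3.trans (h4.le.trans ?_)) hc.le
    exact mul_le_mul_of_nonneg_left h5 (by positivity)
  have hB₂0 : ∀ t ∈ Set.Ioo 0 d.T, ∀ z y, 0 ≤ B₂ t z y := fun t ht z y =>
    le_trans (mul_nonneg (tilt_pos hσ _ _).le (by positivity)) (hB₂ t ht z y).1
  have hDb : ∀ t ∈ Set.Ioo 0 d.T, ∀ z y,
      |D t z y| ≤ tilt d.σ t z * (2 * K' * Real.exp (κ * |z|)) := by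
    intro t ht z y
    rw [abs_mul, abs_of_pos (tilt_pos hσ _ _)]
    refine mul_le_mul_of_nonneg_left ?_ (tilt_pos hσ _ _).le
    refine (abs_sub _ _).trans ?_
    have a3 := mul_le_mul_of_nonneg_left (hexp k' z (by rw [hκ]; linarith)) (abs_nonneg
      (2 * K₃ * Real.exp (k₃ ^ 2 / 2)))
    linarith [bF h₁ t ht z y, bF h₂ t ht z y]
  -- Inserting both Hamilton–Jacobi–Bellman equations, only the convexity excess of H and the source
  -- difference remain.
  have adj₁ : ∀ t ∈ Set.Ioo 0 d.T, ∀ z y,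
      fpAdj d.σ d.σ' 0 (d.drift u₁) Ψ t z y = -B₁ t z y - D t z y := by
    intro t ht z y
    rw [hΨ, fpAdj_tilt_mul hσ _ _ ht.1.le]
    have q1 := h₁.hjb.equation t ht z y
    have q2 := h₂.hjb.equation t ht z y
    simp only [B₁, D, hV, Jet.sub, jetOf, ham₁, ham₂, p₁, p₂, postMean, inner_sub_left] at *
    linear_combination tilt d.σ t z * (q2 - q1)
  have adj₂ : ∀ t ∈ Set.Ioo 0 d.T, ∀ z y,
      fpAdj d.σ d.σ' 0 (d.drift u₂) Ψ t z y = B₂ t z y - D t z y := by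
    intro t ht z y
    rw [hΨ, fpAdj_tilt_mul hσ _ _ ht.1.le]
    have q1 := h₁.hjb.equation t ht z y
    have q2 := h₂.hjb.equation t ht z y
    simp only [B₂, D, hV, Jet.sub, jetOf, ham₁, ham₂, p₁, p₂, postMean, inner_sub_left] at *
    linear_combination tilt d.σ t z * (q2 - q1)
  -- comparison with the weight
  have hsplit : ∀ t z x, x ≤ A → tilt d.σ t z * (x * Real.exp (κ * |z|)) ≤ W t z :=
    fun t z x hx => mul_le_mul_of_nonneg_left
      (mul_le_mul_of_nonneg_right hx (Real.exp_pos _).le) (tilt_pos hσ _ _).le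
  have q1 : 0 ≤ 2 * K / d.σ ^ 4 := by positivity
  have q2 : 0 ≤ 4 * K ^ 2 / c := by positivity
  have q3 : 0 ≤ 2 * K' := by positivity
  have wB₁ : ∀ t ∈ Set.Ioo 0 d.T, ∀ z y, |B₁ t z y| ≤ W t z := fun t ht z y => by
    rw [abs_of_nonneg (hB₁ t ht z y).1]
    exact (hB₁ t ht z y).2.trans (hsplit t z _ (by rw [hA]; linarith))
  have wB₂ : ∀ t ∈ Set.Ioo 0 d.T, ∀ z y, |B₂ t z y| ≤ W t z := fun t ht z y => by
    rw [abs_of_nonneg (hB₂0 t ht z y)]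
    exact (hB₂ t ht z y).2.trans (hsplit t z _ (by rw [hA]; linarith))
  have wD : ∀ t ∈ Set.Ioo 0 d.T, ∀ z y, |D t z y| ≤ W t z := fun t ht z y =>
    (hDb t ht z y).trans (hsplit t z _ (by rw [hA]; linarith))
  have wsum : ∀ t z, tilt d.σ t z * (4 * K ^ 2 / c * Real.exp (κ * |z|))
      + tilt d.σ t z * (2 * K' * Real.exp (κ * |z|)) ≤ W t z := fun t z => by
    have := hsplit t z (4 * K ^ 2 / c + 2 * K') (by rw [hA]; linarith)
    refine le_trans (le_of_eq ?_) this
    ring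
  have wΨ : ∀ t ∈ Set.Icc 0 d.T, ∀ z y, |Ψ.f t z y| ≤ W t z := fun t ht z y => by
    have h5 := mul_le_mul_of_nonneg_left (hexp k z (by rw [hκ]; linarith))
      (show 0 ≤ 2 * K by positivity)
    have : |Ψ.f t z y| ≤ tilt d.σ t z * (2 * K * Real.exp (κ * |z|)) := by
      simp only [hΨ, SignalJet.mul, tiltJet]
      rw [abs_mul, abs_of_pos (tilt_pos hσ _ _)]
      exact mul_le_mul_of_nonneg_left ((bv t ht z y).trans h5) (tilt_pos hσ _ _).le
    exact this.trans (hsplit t z _ (by rw [hA]; linarith))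
  have wΨz : ∀ t ∈ Set.Ioo 0 d.T, ∀ z y, |Ψ.fz t z y| ≤ W t z := fun t ht z y => by
    have ht0 : 0 < t := ht.1
    have htp := tilt_pos hσ t z
    have h1 : |z / (d.σ ^ 2 * (d.σ ^ 2 + t))| ≤ Real.exp |z| / d.σ ^ 4 := by
      rw [abs_div, abs_of_pos (show 0 < d.σ ^ 2 * (d.σ ^ 2 + t) by positivity)]
      refine div_le_div₀ (Real.exp_pos _).le ?_ (by positivity) ?_
      · linarith [Real.add_one_le_exp |z|]
      · nlinarith [sq_nonneg d.σ, mul_nonneg (sq_nonneg d.σ) ht0.le]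
    have h2 : Real.exp |z| * Real.exp (k * |z|) ≤ Real.exp (κ * |z|) := by
      rw [← Real.exp_add, show |z| + k * |z| = (k + 1) * |z| by ring]
      exact hexp _ z (by rw [hκ]; linarith)
    have h3 := hexp k z (by rw [hκ]; linarith)
    have h4 : |Ψ.fz t z y| ≤ tilt d.σ t z * ((2 * K / d.σ ^ 4 + 2 * K) * Real.exp (κ * |z|)) := by
      simp only [hΨ, SignalJet.mul, tiltJet]
      refine (abs_add_le _ _).trans ?_
      rw [abs_mul, abs_mul, abs_mul, abs_of_pos htp]
      have a1 : |z / (d.σ ^ 2 * (d.σ ^ 2 + t))| * |V.f t z y|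
          ≤ 2 * K / d.σ ^ 4 * Real.exp (κ * |z|) := by
        calc _ ≤ Real.exp |z| / d.σ ^ 4 * (2 * K * Real.exp (k * |z|)) :=
              mul_le_mul h1 (bv t ⟨ht.1.le, ht.2.le⟩ z y) (abs_nonneg _) (by positivity)
          _ = 2 * K / d.σ ^ 4 * (Real.exp |z| * Real.exp (k * |z|)) := by ring
          _ ≤ _ := mul_le_mul_of_nonneg_left h2 (by positivity)
      have a2 : |V.fz t z y| ≤ 2 * K * Real.exp (κ * |z|) :=
        (bvz t ht z y).trans (mul_le_mul_of_nonneg_left h3 (by positivity))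
      calc _ = tilt d.σ t z * (|z / (d.σ ^ 2 * (d.σ ^ 2 + t))| * |V.f t z y| + |V.fz t z y|) := by
            ring
        _ ≤ _ := mul_le_mul_of_nonneg_left (by linarith) htp.le
    exact h4.trans (hsplit t z _ (by rw [hA]; linarith))
  have wadj₁ : ∀ t ∈ Set.Ioo 0 d.T, ∀ z y,
      |fpAdj d.σ d.σ' 0 (d.drift u₁) Ψ t z y| ≤ W t z := fun t ht z y => by
    rw [adj₁ t ht]
    refine (abs_sub _ _).trans (le_trans (add_le_add ?_ (hDb t ht z y)) (wsum t z))
    rw [abs_neg, abs_of_nonneg (hB₁ t ht z y).1]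
    exact (hB₁ t ht z y).2
  have wadj₂ : ∀ t ∈ Set.Ioo 0 d.T, ∀ z y,
      |fpAdj d.σ d.σ' 0 (d.drift u₂) Ψ t z y| ≤ W t z := fun t ht z y => by
    rw [adj₂ t ht]
    refine (abs_sub _ _).trans (le_trans (add_le_add ?_ (hDb t ht z y)) (wsum t z))
    rw [abs_of_nonneg (hB₂0 t ht z y)]
    exact (hB₂ t ht z y).2
  have mom₁ : ∀ t ∈ Set.Ioc 0 d.T, ∫⁻ q, ENNReal.ofReal (W t q.1 * (jetOf (m₁ 0)).f t q.1 q.2)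
      ∂stripMeasure n ≤ _ := fun t ht => fp₁.lintegral_tilt_le hb₁ hσ hA0 κ ht
  have mom₂ : ∀ t ∈ Set.Ioc 0 d.T, ∫⁻ q, ENNReal.ofReal (W t q.1 * (jetOf (m₂ 0)).f t q.1 q.2)
      ∂stripMeasure n ≤ _ := fun t ht => fp₂.lintegral_tilt_le hb₂ hσ hA0 κ ht
  have mom₁' := fun t (ht : t ∈ Set.Ioo 0 d.T) => mom₁ t ⟨ht.1, ht.2.le⟩
  have mom₂' := fun t (ht : t ∈ Set.Ioo 0 d.T) => mom₂ t ⟨ht.1, ht.2.le⟩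
  -- continuity
  have hcomp : ∀ {u m}, d.IsSolution u m → JointCont (Set.Ioo 0 d.T)
      (fun t z y => d.ham t z (toTorus y) (gradX (u t z) y)) := fun {u m} h =>
    (continuousOn_ham hd hC).comp
      (f := fun p : ℝ × ℝ × Vec n => ((p.1, p.2.1, toTorus p.2.2), gradX (u p.1 p.2.1) p.2.2))
      (ContinuousOn.prodMk (Continuous.continuousOn (by
        have := continuous_toTorus (n := n); fun_prop)) h.hjb.isC12.jetOf.cont_fg)
      fun p hp => ⟨⟨hp.1.1.le, trivial⟩, trivial⟩
  have tiltc : JointCont (n := n) (Set.Ioo 0 d.T) fun t z _ => tilt d.σ t z :=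
    jointCont_of_signal ((continuousOn_tilt hσ).mono
      (Set.prod_mono (fun t ht => ht.1.le) subset_rfl))
  have cp₁ : JointCont (Set.Ioo 0 d.T) p₁ := hU₁.cont_fg
  have cp₂ : JointCont (Set.Ioo 0 d.T) p₂ := hU₂.cont_fg
  have cB₁ : JointCont (Set.Ioo 0 d.T) B₁ := ContinuousOn.mul tiltc
    (((hcomp h₂).sub (hcomp h₁)).add (ContinuousOn.inner (ContinuousOn.sub cp₂ cp₁) hb₁.cont))
  have cB₂ : JointCont (Set.Ioo 0 d.T) B₂ := ContinuousOn.mul tiltc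
    (((hcomp h₁).sub (hcomp h₂)).add (ContinuousOn.inner (ContinuousOn.sub cp₁ cp₂) hb₂.cont))
  -- Continuity of the source difference is read off from the equation, which avoids studying how
  -- the position laws vary in time.
  have cD : JointCont (Set.Ioo 0 d.T) D := by
    refine JointCont.congr (f := fun t z y => -B₁ t z y - fpAdj d.σ d.σ' 0 (d.drift u₁) Ψ t z y)
      (ContinuousOn.sub (ContinuousOn.neg cB₁) (jointCont_fpAdj hΨc hb₁.cont)) fun t ht z y => ?_
    rw [adj₁ t ht]; ring
  -- duality
  let g : ℝ × Torus n → ℝ := fun q => tilt d.σ 0 q.1 * (u₁ 0 q.1 q.2 - u₂ 0 q.1 q.2)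
  have hg : ∀ z y, g (z, toTorus y) = Ψ.f 0 z y := fun z y => rfl
  have e₁ := fp₁.pairing hb₁ hT le_rfl hΨc hΨc0 hWc ENNReal.ofReal_ne_top mom₁
    (fun t ht => wΨ t ⟨ht.1.le, ht.2⟩) wΨz wadj₁ hg
  have e₂ := fp₂.pairing hb₂ hT le_rfl hΨc hΨc0 hWc ENNReal.ofReal_ne_top mom₂
    (fun t ht => wΨ t ⟨ht.1.le, ht.2⟩) wΨz wadj₂ hg
  have iB₁ := fp₁.integrable_slab_weight le_rfl cB₁ ENNReal.ofReal_ne_top mom₁' wB₁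
  have iB₂ := fp₂.integrable_slab_weight le_rfl cB₂ ENNReal.ofReal_ne_top mom₂' wB₂
  have iD₁ := fp₁.integrable_slab_weight le_rfl cD ENNReal.ofReal_ne_top mom₁' wD
  have iD₂ := fp₂.integrable_slab_weight le_rfl cD ENNReal.ofReal_ne_top mom₂' wD
  have hslab : ∀ᵐ p ∂slabMeasure n (Set.Ioo 0 d.T), p.1 ∈ Set.Ioo 0 d.T := by
    have : ∀ᵐ t ∂(volume : Measure ℝ).restrict (Set.Ioo 0 d.T), t ∈ Set.Ioo 0 d.T :=
      ae_restrict_mem measurableSet_Ioo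
    exact Measure.quasiMeasurePreserving_fst.ae this
  have r₁ : ∫ p, fpAdj d.σ d.σ' 0 (d.drift u₁) Ψ p.1 p.2.1 p.2.2 * (jetOf (m₁ 0)).f p.1 p.2.1 p.2.2
        ∂slabMeasure n (Set.Ioo 0 d.T)
      = -(∫ p, B₁ p.1 p.2.1 p.2.2 * (jetOf (m₁ 0)).f p.1 p.2.1 p.2.2
        ∂slabMeasure n (Set.Ioo 0 d.T)) - ∫ p, D p.1 p.2.1 p.2.2 * (jetOf (m₁ 0)).f p.1 p.2.1 p.2.2
        ∂slabMeasure n (Set.Ioo 0 d.T) := by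
    have iB₁n : Integrable (fun p : ℝ × ℝ × Vec n =>
        -(B₁ p.1 p.2.1 p.2.2 * (jetOf (m₁ 0)).f p.1 p.2.1 p.2.2))
        (slabMeasure n (Set.Ioo 0 d.T)) := iB₁.neg
    rw [← integral_neg, ← integral_sub iB₁n iD₁]
    refine integral_congr_ae ?_
    filter_upwards [hslab] with p hp
    rw [adj₁ _ hp]; ring
  have r₂ : ∫ p, fpAdj d.σ d.σ' 0 (d.drift u₂) Ψ p.1 p.2.1 p.2.2 * (jetOf (m₂ 0)).f p.1 p.2.1 p.2.2
        ∂slabMeasure n (Set.Ioo 0 d.T)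
      = (∫ p, B₂ p.1 p.2.1 p.2.2 * (jetOf (m₂ 0)).f p.1 p.2.1 p.2.2
        ∂slabMeasure n (Set.Ioo 0 d.T)) - ∫ p, D p.1 p.2.1 p.2.2 * (jetOf (m₂ 0)).f p.1 p.2.1 p.2.2
        ∂slabMeasure n (Set.Ioo 0 d.T) := by
    rw [← integral_sub iB₂ iD₂]
    refine integral_congr_ae ?_
    filter_upwards [hslab] with p hp
    rw [adj₂ _ hp]; ring
  have hTT : d.T ∈ Set.Ioc 0 d.T := ⟨hT, le_rfl⟩
  have iT₁ := fp₁.integrable_weight hTT (hΨc0.slice ⟨hT.le, le_rfl⟩) ENNReal.ofReal_ne_top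
    (mom₁ _ hTT) (wΨ _ ⟨hT.le, le_rfl⟩)
  have iT₂ := fp₂.integrable_weight hTT (hΨc0.slice ⟨hT.le, le_rfl⟩) ENNReal.ofReal_ne_top
    (mom₂ _ hTT) (wΨ _ ⟨hT.le, le_rfl⟩)
  -- monotonicity
  have monoG : 0 ≤ ∫ q, Ψ.f d.T q.1 q.2 * (jetOf (m₁ 0)).f d.T q.1 q.2 ∂stripMeasure n
      - ∫ q, Ψ.f d.T q.1 q.2 * (jetOf (m₂ 0)).f d.T q.1 q.2 ∂stripMeasure n := by
    rw [← integral_sub iT₁ iT₂]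
    refine (integral_tilt_mul_average_nonneg hd hG hGm h₁.fp h₂.fp hb₁ hb₂ hTT).trans (le_of_eq ?_)
    refine integral_congr_ae (ae_of_all _ fun q => ?_)
    simp only [hΨ, hV, SignalJet.mul, Jet.sub, tiltJet, jetOf]
    rw [h₁.hjb.terminal, h₂.hjb.terminal, avgG, avgG]
    ring
  have monoF : 0 ≤ ∫ p, D p.1 p.2.1 p.2.2 * (jetOf (m₁ 0)).f p.1 p.2.1 p.2.2
        ∂slabMeasure n (Set.Ioo 0 d.T) - ∫ p, D p.1 p.2.1 p.2.2 * (jetOf (m₂ 0)).f p.1 p.2.1 p.2.2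
        ∂slabMeasure n (Set.Ioo 0 d.T) := by
    rw [← integral_sub iD₁ iD₂]
    refine le_of_le_of_eq ?_ (integral_prod _ (iD₁.sub iD₂)).symm
    refine setIntegral_nonneg measurableSet_Ioo fun t ht => ?_
    refine (integral_tilt_mul_average_nonneg hd hF hFm h₁.fp h₂.fp hb₁ hb₂
      ⟨ht.1, ht.2.le⟩).trans (le_of_eq ?_)
    refine integral_congr_ae (ae_of_all _ fun q => ?_)
    simp only [D, jetOf, avgF, Pi.sub_apply]
    ring
  have pos₁ : 0 ≤ ∫ p, B₁ p.1 p.2.1 p.2.2 * (jetOf (m₁ 0)).f p.1 p.2.1 p.2.2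
        ∂slabMeasure n (Set.Ioo 0 d.T) := by
    refine integral_nonneg_of_ae ?_
    filter_upwards [hslab] with p hp
    exact mul_nonneg (hB₁ _ hp _ _).1 (fp₁.nonneg _ ⟨hp.1, hp.2.le⟩ _ _)
  have nn₂ : 0 ≤ᵐ[slabMeasure n (Set.Ioo 0 d.T)] fun p => B₂ p.1 p.2.1 p.2.2
      * (jetOf (m₂ 0)).f p.1 p.2.1 p.2.2 := by
    filter_upwards [hslab] with p hp
    exact mul_nonneg (hB₂0 _ hp _ _) (fp₂.nonneg _ ⟨hp.1, hp.2.le⟩ _ _)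
  have zero₂ : ∫ p, B₂ p.1 p.2.1 p.2.2 * (jetOf (m₂ 0)).f p.1 p.2.1 p.2.2
        ∂slabMeasure n (Set.Ioo 0 d.T) = 0 := by
    -- Subtracting the two dualities gives ∫B₁m₁ + ∫B₂m₂ = -(terminal term) - (source term) ≤ 0, and
    -- both integrals are nonnegative.
    refine le_antisymm ?_ (integral_nonneg_of_ae nn₂)
    linarith
  have ae₂ := (integral_eq_zero_iff_of_nonneg_ae nn₂ iB₂).1 zero₂
  refine eq_zero_of_ae_slab (f := fun t z y => ‖d.drift u₁ t z y - d.drift u₂ t z y‖ ^ 2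
    * m₂ 0 t z (toTorus y)) ?_ ?_ ?_ ht z y
  · exact ((ContinuousOn.sub hb₁.cont hb₂.cont).norm.pow 2).mul
      (fp₂.cont.mono Set.Ioo_subset_Ioc_self)
  · intro t ht z y y' e
    simp only [hb₁.periodic t ht z y y' e, hb₂.periodic t ht z y y' e, e]
  · filter_upwards [hslab, ae₂] with p hp hp0
    have l := (hB₂ p.1 hp p.2.1 p.2.2).1
    have nn := fp₂.nonneg p.1 ⟨hp.1, hp.2.le⟩ p.2.1 p.2.2
    have htp := tilt_pos hσ p.1 p.2.1
    simp only [Pi.zero_apply, jetOf] at hp0 nn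
    rcases mul_eq_zero.1 hp0 with h | h
    · rw [h] at l
      have l2 : ‖d.drift u₁ p.1 p.2.1 p.2.2 - d.drift u₂ p.1 p.2.1 p.2.2‖ ^ 2 ≤ 0 := by
        by_contra hcon
        have := mul_pos htp (mul_pos (half_pos hc) (not_le.1 hcon))
        linarith
      rw [le_antisymm l2 (by positivity), zero_mul]
    · rw [h, mul_zero]

/-- Uniqueness of the game distribution. -/
theorem IsSolution.density_eq (hd : d.Nondegenerate) (hC : RegularRunningCost d.C)
    (hF : RegularInteraction d.F) (hG : RegularInteraction d.G) (hFm : StatewiseMonotone d.F)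
    (hGm : StatewiseMonotone d.G) (h₁ : d.IsSolution u₁ m₁) (h₂ : d.IsSolution u₂ m₂) (s : ℝ)
    {t : ℝ} (ht : t ∈ Set.Ioc 0 d.T) (z : ℝ) (x : Torus n) : m₁ s t z x = m₂ s t z x := by
  have hb₁ := h₁.hjb.isDrift hd hC
  have hb₂ := h₂.hjb.isDrift hd hC
  have fp₂ := h₂.fp.isFP hd.T_pos s
  -- The flux does not see the drift where the density vanishes, and by the Girsanov formula a zero
  -- of the state-zero density is a zero in every state.
  have key : ∀ t ∈ Set.Ioo 0 d.T, ∀ z, (fun y => (jetOf (m₂ s)).f t z y • d.drift u₁ t z y)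
      = fun y => (jetOf (m₂ s)).f t z y • d.drift u₂ t z y := by
    intro t ht z
    funext y
    have h := IsSolution.drift_eq hd hC hF hG hFm hGm h₁ h₂ ht z y
    have hgir := h₂.fp.eq_girsanov hd hb₂ s ⟨ht.1, ht.2.le⟩ z y
    rcases mul_eq_zero.1 h with h | h
    · rw [sub_eq_zero.1 (norm_eq_zero.1 (pow_eq_zero_iff two_ne_zero |>.1 h))]
    · have : (jetOf (m₂ s)).f t z y = 0 := by simp only [jetOf]; rw [hgir, h, mul_zero]
      rw [this, zero_smul, zero_smul]
  have fp₂' : IsFP d.σ d.σ' d.T s (d.drift u₁) d.ρ₀ (jetOf (m₂ s)) :=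
    { fp₂ with
      flux_diff := fun t ht z => by rw [key t ht z]; exact fp₂.flux_diff t ht z
      equation := fun t ht z y => by rw [key t ht z]; exact fp₂.equation t ht z y }
  obtain ⟨y, rfl⟩ := isOpenQuotientMap_toTorus.surjective x
  exact (h₁.fp.isFP hd.T_pos s).unique fp₂' hb₁ hd.σ'_pos ht z y

end MFGData

end LasryLions

/-! ### Uniqueness of the value function -/

section MaximumPrinciple

variable {n : ℕ}

/-- If the second derivative were positive, the point would also be a local minimum, so the function
would be locally constant, a contradiction. -/
lemma IsLocalMax.second_deriv_nonpos {f f' : ℝ → ℝ} {f'' x : ℝ} (h : IsLocalMax f x)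
    (hf : ∀ y, HasDerivAt f (f' y) y) (hf' : HasDerivAt f' f'' x) : f'' ≤ 0 := by
  by_contra! hpos
  have e : deriv f = f' := funext fun y => (hf y).deriv
  have hmin : IsLocalMin f x := isLocalMin_of_deriv_deriv_pos (by rwa [e, hf'.deriv])
    h.deriv_eq_zero (hf x).continuousAt
  have hc : f =ᶠ[𝓝 x] fun _ => f x := by
    filter_upwards [h, hmin] with y h1 h2 using le_antisymm h1 h2
  have h1 : f' =ᶠ[𝓝 x] fun _ => 0 := by
    filter_upwards [hc.eventuallyEq_nhds] with y hy
    rw [← (hf y).deriv, hy.deriv_eq, deriv_const]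
  have h2 := hf'.deriv
  rw [h1.deriv_eq, deriv_const] at h2
  exact hpos.ne h2

/-- The one-variable statement along each coordinate line, summed over the coordinates. -/
lemma divX_nonpos_of_isLocalMax {f : Vec n → ℝ} {g : Vec n → Vec n} {y : Vec n}
    (h : IsLocalMax f y) (hf : ∀ y, HasGradientAt f (g y) y) (hg : DifferentiableAt ℝ g y) :
    divX g y ≤ 0 := by
  refine Finset.sum_nonpos fun i _ => ?_
  set e : Vec n := EuclideanSpace.single i 1 with he
  have hl : ∀ r : ℝ, HasDerivAt (fun r : ℝ => y + r • e) e r := fun r => by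
    simpa using ((hasDerivAt_id r).smul_const e).const_add y
  have h1 : ∀ r : ℝ, HasDerivAt (fun r : ℝ => f (y + r • e)) (g (y + r • e) i) r := fun r => by
    have := (hf (y + r • e)).hasFDerivAt.comp_hasDerivAt r (hl r)
    refine this.congr_deriv ?_
    rw [InnerProductSpace.toDual_apply_apply, he, EuclideanSpace.inner_single_right]
    simp
  have h2 : HasDerivAt (fun r : ℝ => g (y + r • e) i) ((fderiv ℝ g y e) i) 0 := by
    have h0 : HasFDerivAt g (fderiv ℝ g y) (y + (0 : ℝ) • e) := by
      simpa using hg.hasFDerivAt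
    have h3 := h0.comp_hasDerivAt (0 : ℝ) (hl 0)
    exact ((EuclideanSpace.proj (𝕜 := ℝ) i).hasFDerivAt).comp_hasDerivAt (0 : ℝ) h3
  refine IsLocalMax.second_deriv_nonpos (f := fun r : ℝ => f (y + r • e)) (x := 0) ?_ h1 h2
  have h4 : Tendsto (fun r : ℝ => y + r • e) (𝓝 0) (𝓝 y) := by
    have : Continuous fun r : ℝ => y + r • e := by fun_prop
    simpa using this.tendsto 0
  have := h4.eventually h
  simpa [IsLocalMax, IsMaxFilter] using this

/-! ### The barrier and the comparison principle -/

/-- A barrier growing exponentially in the signal and blowing up at time zero. -/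
def barrier (σ κ B t z : ℝ) : ℝ := Real.exp (-(B * t)) * Real.cosh (κ * z / (t + σ ^ 2)) + t⁻¹

lemma hasDerivAt_barrier_t {σ κ B t : ℝ} (ht : 0 < t) (z : ℝ) :
    HasDerivAt (fun t => barrier σ κ B t z)
      (Real.exp (-(B * t)) * (-B * Real.cosh (κ * z / (t + σ ^ 2))
        - κ * z / (t + σ ^ 2) ^ 2 * Real.sinh (κ * z / (t + σ ^ 2))) - (t ^ 2)⁻¹) t := by
  have ha : t + σ ^ 2 ≠ 0 := by positivity
  have h1 : HasDerivAt (fun t => Real.exp (-(B * t))) (Real.exp (-(B * t)) * (-B)) t := by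
    simpa using (((hasDerivAt_id t).const_mul B).neg).exp
  have h2 : HasDerivAt (fun t => κ * z / (t + σ ^ 2)) (-(κ * z) / (t + σ ^ 2) ^ 2) t := by
    refine ((hasDerivAt_const t (κ * z)).div ((hasDerivAt_id t).add_const (σ ^ 2)) ha).congr_deriv ?_
    simp
  refine ((h1.mul h2.cosh).add (hasDerivAt_inv ht.ne')).congr_deriv ?_
  ring

lemma hasDerivAt_barrier_z {σ κ B t z : ℝ} :
    HasDerivAt (fun z => barrier σ κ B t z)
      (Real.exp (-(B * t)) * (κ / (t + σ ^ 2) * Real.sinh (κ * z / (t + σ ^ 2)))) z := by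
  have h2 : HasDerivAt (fun z => κ * z / (t + σ ^ 2)) (κ / (t + σ ^ 2)) z := by
    simpa using ((hasDerivAt_id z).const_mul κ).div_const (t + σ ^ 2)
  refine ((h2.cosh.const_mul (Real.exp (-(B * t)))).add_const t⁻¹).congr_deriv ?_
  ring

lemma hasDerivAt_barrier_zz {σ κ B t z : ℝ} :
    HasDerivAt (fun z => Real.exp (-(B * t)) * (κ / (t + σ ^ 2) * Real.sinh (κ * z / (t + σ ^ 2))))
      (Real.exp (-(B * t)) * ((κ / (t + σ ^ 2)) ^ 2 * Real.cosh (κ * z / (t + σ ^ 2)))) z := by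
  have h2 : HasDerivAt (fun z => κ * z / (t + σ ^ 2)) (κ / (t + σ ^ 2)) z := by
    simpa using ((hasDerivAt_id z).const_mul κ).div_const (t + σ ^ 2)
  refine ((h2.sinh.const_mul (κ / (t + σ ^ 2))).const_mul (Real.exp (-(B * t)))).congr_deriv ?_
  ring

/-- The barrier is a strict supersolution of the transport-diffusion operator of the signal. -/
lemma barrier_supersolution {σ κ t : ℝ} (hσ : 0 < σ) (ht : 0 < t) (z : ℝ) :
    Real.exp (-(κ ^ 2 / (2 * σ ^ 2) * t)) * (-(κ ^ 2 / (2 * σ ^ 2)) * Real.cosh (κ * z / (t + σ ^ 2))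
        - κ * z / (t + σ ^ 2) ^ 2 * Real.sinh (κ * z / (t + σ ^ 2))) - (t ^ 2)⁻¹
      + z / (t + σ ^ 2) * (Real.exp (-(κ ^ 2 / (2 * σ ^ 2) * t))
        * (κ / (t + σ ^ 2) * Real.sinh (κ * z / (t + σ ^ 2))))
      + σ ^ 2 / 2 * (Real.exp (-(κ ^ 2 / (2 * σ ^ 2) * t))
        * ((κ / (t + σ ^ 2)) ^ 2 * Real.cosh (κ * z / (t + σ ^ 2)))) < 0 := by
  have hE := Real.exp_pos (-(κ ^ 2 / (2 * σ ^ 2) * t))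
  have hC := Real.cosh_pos (κ * z / (t + σ ^ 2))
  generalize Real.exp (-(κ ^ 2 / (2 * σ ^ 2) * t)) = E at *
  generalize Real.cosh (κ * z / (t + σ ^ 2)) = Ch at *
  generalize Real.sinh (κ * z / (t + σ ^ 2)) = Sh
  -- This fixes the decay rate κ²/(2σ²): it must absorb the signal diffusion of the hyperbolic
  -- cosine, worst at t = 0. The transport terms cancel because z/(t + σ²) is constant along the
  -- characteristics of the drift r_t(z).
  have h1 : σ ^ 2 / 2 * (κ / (t + σ ^ 2)) ^ 2 ≤ κ ^ 2 / (2 * σ ^ 2) := by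
    have h3 : (σ ^ 2) ^ 2 ≤ (t + σ ^ 2) ^ 2 := by gcongr; linarith
    rw [div_pow, div_mul_div_comm, div_le_div_iff₀ (by positivity) (by positivity)]
    nlinarith [mul_le_mul_of_nonneg_left h3 (sq_nonneg κ)]
  have h2 : (0 : ℝ) < (t ^ 2)⁻¹ := by positivity
  have h3 := mul_le_mul_of_nonneg_right h1 (mul_pos hE hC).le
  have ha : t + σ ^ 2 ≠ 0 := by positivity
  have e : z / (t + σ ^ 2) * (E * (κ / (t + σ ^ 2) * Sh)) = E * (κ * z / (t + σ ^ 2) ^ 2 * Sh) := by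
    field_simp
  rw [e]
  nlinarith

lemma continuousOn_barrier {σ κ B : ℝ} :
    ContinuousOn (fun p : ℝ × ℝ × Torus n => barrier σ κ B p.1 p.2.1)
      (Set.Ioi 0 ×ˢ Set.univ) := by
  have h0 : ContinuousOn (fun p : ℝ × ℝ × Torus n => p.1) (Set.Ioi 0 ×ˢ Set.univ) := by fun_prop
  refine ContinuousOn.add (ContinuousOn.mul (by fun_prop) (Real.continuous_cosh.comp_continuousOn
    (ContinuousOn.div (by fun_prop) (by fun_prop) fun p hp => ?_))) (h0.inv₀ fun p hp => ?_)
  · have : (0 : ℝ) < p.1 := hp.1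
    positivity
  · exact (show (0 : ℝ) < p.1 from hp.1).ne'

lemma inv_le_barrier (σ κ B t z : ℝ) : t⁻¹ ≤ barrier σ κ B t z := by
  have := mul_pos (Real.exp_pos (-(B * t))) (Real.cosh_pos (κ * z / (t + σ ^ 2)))
  rw [barrier]; linarith

/-- The factor T + σ² in κ compensates the denominator t + σ², so the rate k is reached at every
time up to T. -/
lemma exp_le_barrier {σ k B t T : ℝ} (hσ : 0 < σ) (hk : 0 ≤ k) (hB : 0 ≤ B) (ht : 0 < t)
    (htT : t ≤ T) (z : ℝ) :
    Real.exp (-(B * T)) / 2 * Real.exp (k * |z|) ≤ barrier σ (k * (T + σ ^ 2)) B t z := by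
  have hT : 0 < T := ht.trans_le htT
  have h1 : Real.exp (k * |z|) / 2 ≤ Real.cosh (k * (T + σ ^ 2) * z / (t + σ ^ 2)) := by
    rw [← Real.cosh_abs, Real.cosh_eq]
    have : k * |z| ≤ |k * (T + σ ^ 2) * z / (t + σ ^ 2)| := by
      rw [abs_div, abs_mul, abs_of_nonneg (by positivity : 0 ≤ k * (T + σ ^ 2)),
        abs_of_pos (by positivity : 0 < t + σ ^ 2), le_div_iff₀ (by positivity)]
      nlinarith [mul_nonneg hk (abs_nonneg z)]
    have := Real.exp_le_exp.2 this
    linarith [Real.exp_pos (-|k * (T + σ ^ 2) * z / (t + σ ^ 2)|)]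
  have h2 : Real.exp (-(B * T)) ≤ Real.exp (-(B * t)) :=
    Real.exp_le_exp.2 (by nlinarith)
  have h3 := mul_le_mul h2 h1 (by positivity) (Real.exp_pos _).le
  have h4 : (0 : ℝ) < t⁻¹ := by positivity
  rw [barrier]; linarith

namespace MFGData

variable {d : MFGData n} {u₁ u₂ : ℝ → ℝ → Torus n → ℝ}
  {ρ₁ ρ₂ : ℝ → ℝ → ProbabilityMeasure (Torus n)}

/-- The difference of two solutions with the same source cannot touch a multiple of the barrier
from below at an interior point. -/
lemma SolvesHJB.not_isMax (hd : d.Nondegenerate) (h₁ : d.SolvesHJB ρ₁ u₁)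
    (h₂ : d.SolvesHJB ρ₂ u₂)
    (hF : ∀ t ∈ Set.Ioo 0 d.T, ∀ z x, d.avgF t z x ρ₁ = d.avgF t z x ρ₂) {κ ε t z : ℝ}
    (hε : 0 < ε) (ht : t ∈ Set.Ioo 0 d.T) (x : Torus n)
    (hmax : ∀ t' ∈ Set.Ioo 0 d.T, ∀ z' x',
      u₁ t' z' x' - u₂ t' z' x' - ε * barrier d.σ κ (κ ^ 2 / (2 * d.σ ^ 2)) t' z'
        ≤ u₁ t z x - u₂ t z x - ε * barrier d.σ κ (κ ^ 2 / (2 * d.σ ^ 2)) t z) : False := by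
  obtain ⟨y, rfl⟩ := isOpenQuotientMap_toTorus.surjective x
  have hV := h₁.isC12.jetOf.sub h₂.isC12.jetOf
  set V := (jetOf u₁).sub (jetOf u₂) with hVdef
  set B := κ ^ 2 / (2 * d.σ ^ 2) with hB
  have hm : ∀ t' ∈ Set.Ioo 0 d.T, ∀ z' y', V.f t' z' y' - ε * barrier d.σ κ B t' z'
      ≤ V.f t z y - ε * barrier d.σ κ B t z := fun t' ht' z' y' => hmax t' ht' z' (toTorus y')
  have ht0 : 0 < t := ht.1
  have mt : IsLocalMax (fun t' => V.f t' z y - ε * barrier d.σ κ B t' z) t := by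
    filter_upwards [isOpen_Ioo.mem_nhds ht] with t' ht' using hm t' ht' z y
  have mz : IsLocalMax (fun z' => V.f t z' y - ε * barrier d.σ κ B t z') z :=
    Eventually.of_forall fun z' => hm t ht z' y
  -- The barrier is independent of the position, so the difference itself is maximal in y.
  have my : IsLocalMax (V.f t z) y := Eventually.of_forall fun y' => by
    have := hm t ht z y'; linarith
  have e_t := mt.hasDerivAt_eq_zero
    ((hV.hasDerivAt_t t ht z y).sub ((hasDerivAt_barrier_t ht0 z).const_mul ε))
  have e_z := mz.hasDerivAt_eq_zero
    ((hV.hasDerivAt_z t ht z y).sub (hasDerivAt_barrier_z.const_mul ε))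
  have e_zz := mz.second_deriv_nonpos
    (fun z' => (hV.hasDerivAt_z t ht z' y).sub (hasDerivAt_barrier_z.const_mul ε))
    ((hV.hasDerivAt_zz t ht z y).sub (hasDerivAt_barrier_zz.const_mul ε))
  have e_g : V.fg t z y = 0 := by
    have := my.hasFDerivAt_eq_zero (hV.hasGradientAt t ht z y).hasFDerivAt
    simpa using this
  have e_l := divX_nonpos_of_isLocalMax my (hV.hasGradientAt t ht z)
    (hV.differentiable_fg t ht z y)
  rw [hV.divX_fg t ht] at e_l
  have hs := barrier_supersolution (κ := κ) hd.σ_pos ht0 z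
  have q1 := h₁.equation t ht z y
  have q2 := h₂.equation t ht z y
  rw [hF t ht] at q1
  simp only [hVdef, Jet.sub, jetOf] at e_t e_z e_zz e_g e_l
  -- The position gradients coincide at the maximum, so the two Hamiltonians are equal and drop out;
  -- no linearisation of H is needed.
  rw [sub_eq_zero.1 e_g] at q1
  rw [← hB] at hs
  have hs' := mul_neg_of_pos_of_neg hε hs
  have p1 := mul_le_mul_of_nonneg_left e_zz (show 0 ≤ d.σ ^ 2 / 2 by positivity)
  have p2 := mul_le_mul_of_nonneg_left e_l (show 0 ≤ d.σ' ^ 2 / 2 by positivity)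
  rw [postMean] at q1 q2
  have e_z' := mul_eq_zero_of_right (z / (t + d.σ ^ 2)) e_z
  linarith

/-- Comparison of two solutions with the same source and terminal condition. -/
lemma SolvesHJB.le (hd : d.Nondegenerate) (h₁ : d.SolvesHJB ρ₁ u₁) (h₂ : d.SolvesHJB ρ₂ u₂)
    (hF : ∀ t ∈ Set.Ioo 0 d.T, ∀ z x, d.avgF t z x ρ₁ = d.avgF t z x ρ₂)
    (hG : ∀ z x, d.avgG z x ρ₁ = d.avgG z x ρ₂) {t : ℝ} (ht : t ∈ Set.Icc 0 d.T) (z : ℝ)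
    (x : Torus n) : u₁ t z x ≤ u₂ t z x := by
  have hσ := hd.σ_pos
  have hT := hd.T_pos
  obtain ⟨K₁, k₁, hu₁, -⟩ := h₁.growth
  obtain ⟨K₂, k₂, hu₂, -⟩ := h₂.growth
  set K := |K₁| + |K₂| with hK
  set k := |k₁| + |k₂| with hk
  have hK0 : 0 ≤ K := by positivity
  have hk0 : 0 ≤ k := by positivity
  -- The rate k + 1 beats the growth rate k of the two solutions, which confines the positivity set
  -- of `ψ` to bounded signals.
  set κ := (k + 1) * (d.T + d.σ ^ 2) with hκ
  set B := κ ^ 2 / (2 * d.σ ^ 2) with hB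
  have hB0 : 0 ≤ B := by positivity
  have bv : ∀ t ∈ Set.Icc 0 d.T, ∀ z x, u₁ t z x - u₂ t z x ≤ 2 * K * Real.exp (k * |z|) := by
    intro t ht z x
    have a1 := le_exp_growth (hu₁ t ht z x) (K' := K) (by rw [hK]; linarith [abs_nonneg K₂])
      (k' := k) (by rw [hk]; linarith [abs_nonneg k₂]) (abs_nonneg z)
    have a2 := le_exp_growth (hu₂ t ht z x) (K' := K) (by rw [hK]; linarith [abs_nonneg K₁])
      (k' := k) (by rw [hk]; linarith [abs_nonneg k₁]) (abs_nonneg z)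
    linarith [le_abs_self (u₁ t z x), neg_abs_le (u₂ t z x)]
  have main : ∀ t ∈ Set.Ioc 0 d.T, ∀ z x, ∀ ε > 0,
      u₁ t z x - u₂ t z x ≤ ε * barrier d.σ κ B t z := by
    intro t ht z x ε hε
    by_contra! hcon
    let ψ : ℝ × ℝ × Torus n → ℝ := fun p =>
      u₁ p.1 p.2.1 p.2.2 - u₂ p.1 p.2.1 p.2.2 - ε * barrier d.σ κ B p.1 p.2.1
    have hψ : 0 < ψ (t, z, x) := sub_pos.2 hcon
    -- R is where the exponential part of the barrier overtakes the difference. Then `τ` comes from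
    -- the term 1/t, which keeps the maximum away from time 0, where no derivatives are available.
    set R := 4 * K * Real.exp (B * d.T) / ε with hR
    set τ := ε / (2 * K * Real.exp (k * R) + 1) with hτ
    have hR0 : 0 ≤ R := by positivity
    have hτ0 : 0 < τ := by positivity
    have hloc : ∀ p : ℝ × ℝ × Torus n, p.1 ∈ Set.Ioc 0 d.T → 0 < ψ p →
        p ∈ Set.Icc τ d.T ×ˢ Set.Icc (-R) R ×ˢ Set.univ := by
      rintro ⟨t, z, x⟩ ht hp
      have b := bv t ⟨ht.1.le, ht.2⟩ z x
      have hp' : ε * barrier d.σ κ B t z < u₁ t z x - u₂ t z x := sub_pos.1 hp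
      have hz : |z| ≤ R := by
        have b2 := exp_le_barrier (B := B) hσ (by positivity : 0 ≤ k + 1) hB0 ht.1 ht.2 z
        have b3 : ε * (Real.exp (-(B * d.T)) / 2 * Real.exp ((k + 1) * |z|))
            < 2 * K * Real.exp (k * |z|) :=
          (mul_le_mul_of_nonneg_left b2 hε.le).trans_lt (hp'.trans_le b)
        rw [show (k + 1) * |z| = k * |z| + |z| by ring, Real.exp_add, Real.exp_neg] at b3
        have b4 : ε * (Real.exp (B * d.T))⁻¹ / 2 * Real.exp |z| < 2 * K := by
          refine lt_of_mul_lt_mul_right ?_ (Real.exp_pos (k * |z|)).le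
          linarith
        have b5 : |z| ≤ Real.exp |z| := by linarith [Real.add_one_le_exp |z|]
        refine b5.trans ?_
        rw [hR, le_div_iff₀ hε]
        have hE := Real.exp_pos (B * d.T)
        have := mul_lt_mul_of_pos_right b4 hE
        field_simp at this
        linarith
      have htau : τ ≤ t := by
        have b2 := mul_le_mul_of_nonneg_left (inv_le_barrier d.σ κ B t z) hε.le
        have b3 : Real.exp (k * |z|) ≤ Real.exp (k * R) :=
          Real.exp_le_exp.2 (mul_le_mul_of_nonneg_left hz hk0)
        have b4 : ε * t⁻¹ < 2 * K * Real.exp (k * R) + 1 := by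
          have := mul_le_mul_of_nonneg_left b3 (by positivity : 0 ≤ 2 * K)
          linarith
        rw [hτ, div_le_iff₀ (by positivity)]
        rw [← div_eq_mul_inv, div_lt_iff₀ ht.1] at b4
        linarith
      exact ⟨⟨htau, ht.2⟩, abs_le.1 hz, trivial⟩
    have hsub : Set.Icc τ d.T ×ˢ Set.Icc (-R) R ×ˢ (Set.univ : Set (Torus n))
        ⊆ Set.Icc 0 d.T ×ˢ Set.univ := fun p hp => ⟨⟨hτ0.le.trans hp.1.1, hp.1.2⟩, trivial⟩
    have hcont : ContinuousOn ψ (Set.Icc τ d.T ×ˢ Set.Icc (-R) R ×ˢ (Set.univ : Set (Torus n))) :=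
      ((h₁.continuousOn.mono hsub).sub (h₂.continuousOn.mono hsub)).sub
        (continuousOn_const.mul (continuousOn_barrier.mono fun p hp =>
          ⟨hτ0.trans_le hp.1.1, trivial⟩))
    obtain ⟨⟨t', z', x'⟩, hp, hmax⟩ := (isCompact_Icc.prod (isCompact_Icc.prod
      isCompact_univ)).exists_isMaxOn ⟨_, hloc (t, z, x) ht hψ⟩ hcont
    have hpos : 0 < ψ (t', z', x') := hψ.trans_le (hmax (hloc (t, z, x) ht hψ))
    have ht' : t' ∈ Set.Ioc 0 d.T := ⟨hτ0.trans_le hp.1.1, hp.1.2⟩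
    have hlt : t' < d.T := by
      refine lt_of_le_of_ne ht'.2 fun e => ?_
      subst e
      have b0 : (0 : ℝ) < d.T⁻¹ := by positivity
      have b1 := mul_pos hε (b0.trans_le (inv_le_barrier d.σ κ B d.T z'))
      simp only [ψ, h₁.terminal, h₂.terminal, hG] at hpos
      linarith
    refine h₁.not_isMax hd h₂ hF (κ := κ) (z := z') hε ⟨ht'.1, hlt⟩ x' fun r hr w y => ?_
    change ψ (r, w, y) ≤ ψ (t', z', x')
    by_cases hc : 0 < ψ (r, w, y)
    · exact hmax (hloc (r, w, y) ⟨hr.1, hr.2.le⟩ hc)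
    · exact (not_lt.1 hc).trans hpos.le
  have hpos : ∀ t ∈ Set.Ioc 0 d.T, u₁ t z x - u₂ t z x ≤ 0 := by
    intro t ht
    have h : Tendsto (fun ε : ℝ => ε * barrier d.σ κ B t z) (𝓝[>] 0) (𝓝 0) := by
      have : Continuous fun ε : ℝ => ε * barrier d.σ κ B t z := by fun_prop
      simpa using (this.tendsto 0).mono_left nhdsWithin_le_nhds
    refine ge_of_tendsto h ?_
    filter_upwards [self_mem_nhdsWithin] with ε hε using main t ht z x ε hε
  have hc : ContinuousOn (fun t => u₁ t z x - u₂ t z x) (Set.Icc 0 d.T) :=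
    ContinuousOn.sub
      (h₁.continuousOn.comp (f := fun t => (t, z, x)) (by fun_prop) fun t ht => ⟨ht, trivial⟩)
      (h₂.continuousOn.comp (f := fun t => (t, z, x)) (by fun_prop) fun t ht => ⟨ht, trivial⟩)
  rw [← sub_nonpos]
  -- The barrier is of no use at t = 0; the inequality there follows by continuity from positive
  -- times.
  have hcl : closure (Set.Ioc 0 d.T) = Set.Icc 0 d.T := closure_Ioc hT.ne
  have hn : NeBot (𝓝[Set.Ioc 0 d.T] t) := mem_closure_iff_nhdsWithin_neBot.1 (by rwa [hcl])
  refine le_of_tendsto ((hc t ht).mono_left (nhdsWithin_mono t Set.Ioc_subset_Icc_self)) ?_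
  filter_upwards [self_mem_nhdsWithin] with t ht using hpos t ht

end MFGData

end MaximumPrinciple

end

/-! ### Conclusion -/

theorem mainTheorem2 {n : ℕ} (d : MFGData n)
    (hd : d.Nondegenerate)
    (hC : MFGData.RegularRunningCost d.C)
    (hF : MFGData.RegularInteraction d.F)
    (hG : MFGData.RegularInteraction d.G)
    (hLip : MFGData.LipschitzGradient d.C)
    (hFmono : MFGData.StatewiseMonotone d.F)
    (hGmono : MFGData.StatewiseMonotone d.G)
    (u₁ u₂ : ℝ → ℝ → Torus n → ℝ) (m₁ m₂ : ℝ → ℝ → ℝ → Torus n → ℝ)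
    (h₁ : d.IsSolution u₁ m₁) (h₂ : d.IsSolution u₂ m₂) :
    (∀ t ∈ Set.Icc 0 d.T, ∀ z x, u₁ t z x = u₂ t z x) ∧
      ∀ᵐ p : ℝ × ℝ ∂((volume : Measure ℝ).prod (volume.restrict (Set.Icc 0 d.T))),
        ∀ z x, m₁ p.1 p.2 z x = m₂ p.1 p.2 z x := by
  have hm : ∀ s, ∀ t ∈ Set.Ioc 0 d.T, m₁ s t = m₂ s t := fun s t ht =>
    funext fun z => funext fun x =>
      MFGData.IsSolution.density_eq hd hC hF hG hFmono hGmono h₁ h₂ s ht z x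
  have hlaw : ∀ s, ∀ t ∈ Set.Ioc 0 d.T, posLaw m₁ s t = posLaw m₂ s t := fun s t ht => by
    unfold posLaw
    rw [hm s t ht]
  have eF : ∀ t ∈ Set.Ioo 0 d.T, ∀ z x, d.avgF t z x (posLaw m₁) = d.avgF t z x (posLaw m₂) :=
    fun t ht z x => by simp only [MFGData.avgF, hlaw _ t ⟨ht.1, ht.2.le⟩]
  have eG : ∀ z x, d.avgG z x (posLaw m₁) = d.avgG z x (posLaw m₂) := fun z x => by
    simp only [MFGData.avgG, hlaw _ d.T ⟨hd.T_pos, le_rfl⟩]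
  refine ⟨fun t ht z x => le_antisymm (h₁.hjb.le hd h₂.hjb eF eG ht z x)
    (h₂.hjb.le hd h₁.hjb (fun t ht z x => (eF t ht z x).symm) (fun z x => (eG z x).symm) ht z x), ?_⟩
  -- The densities are compared at positive times only; time 0 is negligible.
  have h0 : ∀ᵐ t ∂(volume : Measure ℝ).restrict (Set.Icc 0 d.T), t ∈ Set.Ioc 0 d.T := by
    rw [← restrict_Ioc_eq_restrict_Icc]
    exact ae_restrict_mem measurableSet_Ioc
  filter_upwards [Measure.quasiMeasurePreserving_snd.ae h0] with p hp z x
  rw [hm p.1 p.2 hp]
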